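/- **Theorem.** Let $\mathsf{k}$ be a field of characteristic $0$ with algebraic closure $K$, let $V_1,\dots,V_r$ be $\mathsf{k}$-vector spaces, $\dim V_i=n_i+1$, $n_i\ge 1$, $\sum_i n_i\ge 2$, and let $Y=\mathbb{P}(V_1)\times\dots\times\mathbb{P}(V_r)$ (points of $\mathbb P(V)$ are lines in $V$). Let $y=([v_1],\dots,[v_r])\in Y$ be a $\mathsf{k}$-point, $\sigma\colon\tilde Y=\mathrm{Bl}_y(Y)\to Y$ the blowup, $E$ its exceptional divisor, and $G=\prod_i \mathrm{PGL}(V_i)_{v_i}$, where $\mathrm{PGL}(V_i)_{v_i}$ is the stabilizer of $[v_i]$. Let $\tilde Y_i\subset\tilde Y$ be the strict transform of $\{u\in Y: u_i=[v_i]\}$. Put $\bar V_i=V_i/\mathsf{k}v_i$, $Y^+=\prod_i\mathbb{P}(\bar V_i)$, let $h_i$ be the hyperplane class of $\mathbb{P}(\bar V_i)$, $h_I=\sum_{i\in I}h_i$, and $$\mathscr{E}=\bigoplus_{I\subset\{1,\dots,r\},\ |I|\ge r-1}\mathscr{O}(-h_I),\qquad \hat Y^+=\mathbb{P}_{Y^+}(\mathscr{E})\xrightarrow{\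 \hat\sigma_+\ }Y^+ .$$ Let $s_i$ be the section of $\hat\sigma_+$ given by the summand with $I=\{1,\dots,r\}\setminus\{i\}$, let $\tilde\sigma_+\colon\tilde Y^+\to\hat Y^+$ be the blowup of the disjoint union of the sections $s_i(Y^+)$ over all $i$ with $n_i=1$, let $E_i$ be its exceptional divisors, and $\sigma_+=\hat\sigma_+\circ\tilde\sigma_+$. For $J\subset\{1,\dots,r\}$ let $\tilde Y^+_J\subset\tilde Y^+$ be the strict transform of $\mathbb{P}_{Y^+}\big(\bigoplus_{J\subset I,\,|I|=r-1}\mathscr{O}(-h_I)\big)$, where $\tilde Y^+_J=\varnothing$ if this sum is zero or the strict transform is empty. Choose splittings $V_i=\mathsf{k}v_i\oplus\bar V_i$; they define the action of $G$ on $\hat Y^+$ and $\tilde Y^+$ through the identification of $\bigoplus_{|I|\ge r-1}\bigotimes_{i\in I}\bar V_i$ with the quotient of $\bigotimes_i V_i$ by the $G$-invariant subspace $\bigoplus_{|I|\le r-2}\bigotimes_{i\in I}\bar V_i$. Let $\psi_0\colon Y\dashrightarrow Y^+$, $(u_i)\mapsto(\bar u_i)$, be the product of the linear projections from $[v_i]$,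 and let $\hat\psi_0\colon Y\dashrightarrow\hat Y^+$ be the map $$(u_1,\dots,u_r)\mapsto\Big((\bar u_1,\dots,\bar u_r),\ \sum_{|I|\ge r-1}\Big(\prod_{i\notin I}t_i\Big)\bigotimes_{i\in I}\bar u_i\Big),\qquad u_i=t_iv_i+\bar u_i .$$ Then there is a $G$-equivariant birational isomorphism $\psi\colon\tilde Y\dashrightarrow\tilde Y^+$ over $\mathsf{k}$ that is small (an isomorphism between open subsets whose complements have codimension at least $2$), such that $$\tilde\sigma_+\circ\psi=\hat\psi_0\circ\sigma,\qquad \sigma_+\circ\psi=\psi_0\circ\sigma$$ as rational maps, and $\psi$ induces isomorphisms of $G$-orbits $$\tilde Y\setminus\Big(E\cup\bigcup_i\tilde Y_i\Big)\cong\tilde Y^+\setminus\Big(\tilde Y^+_\varnothing\cup\bigcup_{n_j=1}E_j\Big)$$ of codimension $0$, and $$E\setminus\bigcup_i\tilde Y_i\cong\tilde Y^+_\varnothing\setminus\Big(\bigcup_i\tilde Y^+_{\{i\}}\cup\bigcup_{n_j=1}E_j\Big),\qquad \tilde Y_i\setminus\Big(E\cup\bigcup_{j\ne i}\tilde Y_j\Big)\cong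 E_i\setminus\tilde Y^+_\varnothing\quad(n_i=1)$$ of codimension $1$; moreover, $\psi$ is already small as an isomorphism between the unions of these orbits. Let $H_i$ be the pullback to $\tilde Y$ of the hyperplane class of $\mathbb{P}(V_i)$, $H=\sum_iH_i$, let $h$ be the relative hyperplane class of $\hat\sigma_+$ (the class of $\mathscr{O}(1)$, dual to the tautological line subbundle of $\mathscr E$) and $e_i$ the class of $E_i$. Then, under the isomorphism $\mathrm{Pic}(\tilde Y)=\mathrm{Pic}(\tilde Y^+)$ compatible with $\psi$, $$h_i=H_i-E\ \ (n_i\ge 2),\qquad e_i=H_i-E\ \ (n_i=1),\qquad h=H-(r-1)E,$$ and conversely $$E=h-\sum_{n_i\ge 2}h_i-\sum_{n_j=1}e_j,\qquad H_i=\begin{cases}h_i+E,& n_i\ge 2,\\ e_i+E,& n_i=1.\end{cases}$$ -/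

import Mathlib

open scoped Topology MatrixGroups

noncomputable section

namespace ToricLink

/-! ## Quasi-projective varieties over `k`, through their geometric points

`k` is a field and `K` an algebraic closure of `k`. A variety over `k` is described by the set `X`
of its `K`-points inside a product of projective spaces; topology, regular functions, regular maps
and line bundles are all defined over `k`, that is, by multihomogeneous polynomials with
coefficients in `k`. -/

section Ambient

/-- The `K`-points of the product `∏ j, ℙ(m j → K)` of projective spaces over `k`; the points of a
projective space are the lines in the vector space. The field `k` is recorded because topology and
regularity refer to it. -/
@[nolint unusedArguments]
def MPt (k K : Type*) [Field k] [Field K] {ι : Type} (m : ι → Type) : Type _ :=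
  ∀ j, Projectivization K (m j → K)

variable {k K : Type*} [Field k] [Field K] [Algebra k K]
variable {ι : Type} {m : ι → Type}

/-- Value of a polynomial in the coordinates of the factors at the chosen representatives of the
coordinates of `x`. It is used only for multihomogeneous polynomials, for their vanishing and for
ratios of polynomials of the same multidegree, which do not depend on the representatives. -/
def hval (F : MvPolynomial (Σ j, m j) k) (x : MPt k K m) : K :=
  MvPolynomial.aeval (fun s : Σ j, m j => (x s.1).rep s.2) F

/-- `F` is multihomogeneous of multidegree `d`. -/
def IsMultiHom (F : MvPolynomial (Σ j, m j) k) (d : ι →₀ ℕ) : Prop :=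
  F.IsWeightedHomogeneous (fun s : Σ j, m j => Finsupp.single s.1 1) d

/-- The Zariski topology (over `k`): the basic open sets are the nonvanishing loci of
multihomogeneous polynomials with coefficients in `k`. -/
instance : TopologicalSpace (MPt k K m) :=
  TopologicalSpace.generateFrom
    {D | ∃ (F : MvPolynomial (Σ j, m j) k) (d : ι →₀ ℕ), IsMultiHom F d ∧ D = {x | hval F x ≠ 0}}

/-- The nonzero vector `w` is a homogeneous coordinate vector of the point `p`, i.e. `[w] = p`. -/
def Represents {c : Type} (w : c → K) (p : Projectivization K (c → K)) : Prop :=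
  ∃ t : K, t ≠ 0 ∧ w = t • p.rep

variable {X : Set (MPt k K m)}

/-- The function `φ` on `X` is regular at `x`: near `x` it is a ratio of multihomogeneous
polynomials over `k` of the same multidegree. -/
def RegAt (φ : X → K) (x : X) : Prop :=
  ∃ (d : ι →₀ ℕ) (F G : MvPolynomial (Σ j, m j) k), IsMultiHom F d ∧ IsMultiHom G d ∧
    hval G x.1 ≠ 0 ∧ ∀ᶠ z in 𝓝 x, φ z = hval F z.1 / hval G z.1

/-- A map between varieties is regular (a morphism over `k`): near each point, each of its
components is given by multihomogeneous polynomials over `k` of the same multidegree without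
common zero at the point. -/
def IsRegularMap {ι' : Type} {m' : ι' → Type} {X' : Set (MPt k K m')} (f : X → X') : Prop :=
  ∀ (x : X) (j : ι'), ∃ (d : ι →₀ ℕ) (F : m' j → MvPolynomial (Σ j, m j) k),
    (∀ a, IsMultiHom (F a) d) ∧ (∃ a, hval (F a) x.1 ≠ 0) ∧
    ∀ᶠ z in 𝓝 x, Represents (fun a => hval (F a) z.1) ((f z).1 j)

/-- An isomorphism of varieties over `k`. -/
structure VarIso {ι' : Type} {m' : ι' → Type} (X : Set (MPt k K m)) (X' : Set (MPt k K m'))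
    extends X ≃ X' where
  regular : IsRegularMap toEquiv
  regular_symm : IsRegularMap toEquiv.symm

/-- The complement of `U` has codimension at least `2` in `X`: every irreducible closed subset of
`X` that does not meet `U` has codimension at least `2`. -/
def CodimComplGeTwo (X U : Set (MPt k K m)) : Prop :=
  ∀ W : TopologicalSpace.IrreducibleCloseds X, (∀ x ∈ W, (x : MPt k K m) ∉ U) → 2 ≤ Order.coheight W

/-- The closure of `O` in `X` is irreducible of codimension `c`. -/
def HasCodim (X O : Set (MPt k K m)) (c : ℕ∞) : Prop :=
  ∃ W : TopologicalSpace.IrreducibleCloseds X,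
    (W : Set X) = closure ((↑) ⁻¹' O : Set X) ∧ Order.coheight W = c

/-- A small birational isomorphism `X ⇢ X'`: an isomorphism between open subsets whose complements
have codimension at least `2`. -/
structure SmallBirIso {ι' : Type} {m' : ι' → Type} (X : Set (MPt k K m)) (X' : Set (MPt k K m'))
    where
  dom : Set (MPt k K m)
  cod : Set (MPt k K m')
  dom_subset : dom ⊆ X
  cod_subset : cod ⊆ X'
  isOpen_dom : IsOpen ((↑) ⁻¹' dom : Set X)
  isOpen_cod : IsOpen ((↑) ⁻¹' cod : Set X')
  codim_dom : CodimComplGeTwo X dom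
  codim_cod : CodimComplGeTwo X' cod
  iso : VarIso dom cod

/-- `ψ` is defined on `O` and restricts to an isomorphism of `O` with the subvariety `O'`. -/
def SmallBirIso.InducesIso {ι' : Type} {m' : ι' → Type} {X' : Set (MPt k K m')}
    (ψ : SmallBirIso X X') (O : Set (MPt k K m)) (O' : Set (MPt k K m')) : Prop :=
  ∃ hO : O ⊆ ψ.dom, ∃ e : VarIso O O',
    ∀ x : O, (e.toEquiv x : MPt k K m') = ψ.iso.toEquiv ⟨x, hO x.2⟩

end Ambient

/-! ## The Picard group -/

section Picard

/-- A homogeneous coordinate of the factor `j` that does not vanish at `x`. -/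
def coordAt {k K : Type*} [Field k] [Field K] {ι : Type} {m : ι → Type}
    (x : MPt k K m) (j : ι) : m j :=
  Classical.choose (Function.ne_iff.mp (x j).rep_nonzero)

lemma coordAt_ne {k K : Type*} [Field k] [Field K] {ι : Type} {m : ι → Type}
    (x : MPt k K m) (j : ι) : (x j).rep (coordAt x j) ≠ 0 :=
  Classical.choose_spec (Function.ne_iff.mp (x j).rep_nonzero)

variable {k K : Type*} [Field k] [Field K] [Algebra k K] {ι : Type} {m : ι → Type}

/-- Nowhere vanishing functions on `X` that are regular near `x` together with their inverse. -/
def unitsAt {X : Set (MPt k K m)} (x : X) : Subgroup (X → Kˣ) where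
  carrier := {φ | ∃ (d : ι →₀ ℕ) (F G : MvPolynomial (Σ j, m j) k), IsMultiHom F d ∧
    IsMultiHom G d ∧ hval F x.1 ≠ 0 ∧ hval G x.1 ≠ 0 ∧
    ∀ᶠ z in 𝓝 x, (φ z : K) = hval F z.1 / hval G z.1}
  mul_mem' := by
    rintro φ φ' ⟨d, F, G, hF, hG, hFx, hGx, h⟩ ⟨d', F', G', hF', hG', hFx', hGx', h'⟩
    refine ⟨d + d', F * F', G * G', hF.mul hF', hG.mul hG', ?_, ?_, ?_⟩
    · simpa [hval] using ⟨hFx, hFx'⟩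
    · simpa [hval] using ⟨hGx, hGx'⟩
    · filter_upwards [h, h'] with z hz hz'
      simp only [Pi.mul_apply, Units.val_mul, hz, hz', hval, map_mul]
      exact div_mul_div_comm _ _ _ _
  one_mem' := by
    refine ⟨0, 1, 1, MvPolynomial.isWeightedHomogeneous_one _ _,
      MvPolynomial.isWeightedHomogeneous_one _ _, ?_, ?_, ?_⟩ <;> simp [hval]
  inv_mem' := by
    rintro φ ⟨d, F, G, hF, hG, hFx, hGx, h⟩
    refine ⟨d, G, F, hG, hF, hGx, hFx, ?_⟩
    filter_upwards [h] with z hz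
    simp [hz]

/-- Line bundles on `X`. All fibres are identified with `K` (as lines, one point at a time), and
`L x` is a local frame near `x`, written through these identifications as a function; only its
germ at `x` matters. The local frames at `x` and at all nearby points `y` have to differ by an
invertible regular function near `y`. The group law is the tensor product. -/
def LineBundles (X : Set (MPt k K m)) : Subgroup (X → X → Kˣ) where
  carrier := {L | ∀ x, ∀ᶠ y in 𝓝 x, L x / L y ∈ unitsAt y}
  mul_mem' := by
    intro L L' h h' x
    filter_upwards [h x, h' x] with y hy hy'
    have := mul_mem hy hy'
    rwa [div_mul_div_comm] at this
  one_mem' := fun x => Filter.Eventually.of_forall fun y => by simp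
  inv_mem' := by
    intro L h x
    filter_upwards [h x] with y hy
    have := inv_mem hy
    rw [inv_div] at this
    simpa only [Pi.inv_apply, inv_div_inv] using this

/-- Trivial line bundles: after multiplication by a scalar `f z` in the fibre at each point `z`,
all local frames become invertible regular functions. -/
def TrivialBundles (X : Set (MPt k K m)) : Subgroup (X → X → Kˣ) where
  carrier := {L | ∃ f : X → Kˣ, ∀ x, f * L x ∈ unitsAt x}
  mul_mem' := by
    rintro L L' ⟨f, h⟩ ⟨f', h'⟩
    refine ⟨f * f', fun x => ?_⟩
    have := mul_mem (h x) (h' x)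
    rwa [mul_mul_mul_comm] at this
  one_mem' := ⟨1, fun x => by simp⟩
  inv_mem' := by
    rintro L ⟨f, h⟩
    refine ⟨f⁻¹, fun x => ?_⟩
    have := inv_mem (h x)
    rwa [mul_inv] at this

/-- The Picard group of `X`, written additively: line bundles modulo isomorphism. (In terms of
sheaves: if `ℱ` is the flasque sheaf of all functions with values in `Kˣ`, this is the group
`H⁰(ℱ / 𝒪ˣ) / H⁰(ℱ) = H¹(X, 𝒪ˣ)`.) -/
abbrev Pic (X : Set (MPt k K m)) : Type _ :=
  Additive (LineBundles X ⧸ (TrivialBundles X).subgroupOf (LineBundles X))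

/-- The class of a line bundle. -/
def cls {X : Set (MPt k K m)} (L : LineBundles X) : Pic X :=
  Additive.ofMul (QuotientGroup.mk L)

lemma isMultiHom_X (s : Σ j, m j) :
    IsMultiHom (MvPolynomial.X s : MvPolynomial (Σ j, m j) k) (Finsupp.single s.1 1) :=
  MvPolynomial.isWeightedHomogeneous_X _ _ _

lemma eventually_hval_ne {X : Set (MPt k K m)} {F : MvPolynomial (Σ j, m j) k} {d : ι →₀ ℕ}
    (hF : IsMultiHom F d) {x : X} (hx : hval F x.1 ≠ 0) : ∀ᶠ z : X in 𝓝 x, hval F z.1 ≠ 0 := by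
  have : IsOpen {z : MPt k K m | hval F z ≠ 0} :=
    TopologicalSpace.isOpen_generateFrom_of_mem ⟨F, d, hF, rfl⟩
  exact (this.preimage continuous_subtype_val).mem_nhds hx

open Classical in
/-- The line bundle `𝒪(1)` of the factor `j`, pulled back to `X`: the fibre at `z` is the dual of
the line `z j`, with the basis dual to the representative of `z j`; the local frame near `x` is a
homogeneous coordinate that does not vanish at `x`. -/
def hyperplaneBundle (X : Set (MPt k K m)) (j : ι) : LineBundles X where
  val x z := if h : (z.1 j).rep (coordAt x.1 j) ≠ 0 then Units.mk0 _ h else 1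
  property x := by
    have key : ∀ a : m j, ∀ y : X, (y.1 j).rep a ≠ 0 → ∀ᶠ z : X in 𝓝 y, (z.1 j).rep a ≠ 0 := by
      intro a y hy
      simpa [hval] using eventually_hval_ne (X := X) (isMultiHom_X (k := k) (⟨j, a⟩ : Σ j, m j))
        (x := y) (by simpa [hval] using hy)
    filter_upwards [key _ x (coordAt_ne x.1 j)] with y hy
    refine ⟨Finsupp.single j 1, MvPolynomial.X ⟨j, coordAt x.1 j⟩,
      MvPolynomial.X ⟨j, coordAt y.1 j⟩, isMultiHom_X _, isMultiHom_X _, ?_, ?_, ?_⟩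
    · simpa [hval] using hy
    · simpa [hval] using coordAt_ne y.1 j
    · filter_upwards [key _ y hy, key _ y (coordAt_ne y.1 j)] with z hz hz'
      simp [hval, hz, hz', Units.val_div_eq_div_val]

/-- The pullback to `X` of the hyperplane class of the factor `j`. -/
def hyperplaneClass (X : Set (MPt k K m)) (j : ι) : Pic X := cls (hyperplaneBundle X j)

/-- `c` is the class of the line bundle `𝒪_X(Z)`: this line bundle has a section `s` that, written
in the local frames, generates the ideal of `Z` at every point of `X`. -/
def IsDivisorClass (X Z : Set (MPt k K m)) (c : Pic X) : Prop :=
  ∃ (L : LineBundles X) (s : X → K), cls L = c ∧ ∀ x : X,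
    RegAt (fun z => s z / (L.1 x z : K)) x ∧
    (∀ᶠ z : X in 𝓝 x, (z : MPt k K m) ∈ Z → s z = 0) ∧
    ∀ φ : X → K, RegAt φ x → (∀ᶠ z : X in 𝓝 x, (z : MPt k K m) ∈ Z → φ z = 0) →
      ∃ χ : X → K, RegAt χ x ∧ ∀ᶠ z : X in 𝓝 x, φ z = χ z * (s z / (L.1 x z : K))

/-- The line bundle classes `c` on `X` and `c'` on `X'` correspond to each other under `ψ`: over
the open sets identified by `ψ` there is an isomorphism `f` of line bundles between the pullback
of `c'` and `c`. -/
def SmallBirIso.PicCompat {ι' : Type} {m' : ι' → Type} {X : Set (MPt k K m)}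
    {X' : Set (MPt k K m')} (ψ : SmallBirIso X X') (c : Pic X) (c' : Pic X') : Prop :=
  ∃ (L : LineBundles X) (L' : LineBundles X'), cls L = c ∧ cls L' = c' ∧
    ∃ f : ψ.dom → Kˣ, ∀ x : ψ.dom,
      (fun z : ψ.dom => f z *
        L.1 ⟨x, ψ.dom_subset x.2⟩ ⟨z, ψ.dom_subset z.2⟩ /
          L'.1 ⟨ψ.iso.toEquiv x, ψ.cod_subset (ψ.iso.toEquiv x).2⟩
            ⟨ψ.iso.toEquiv z, ψ.cod_subset (ψ.iso.toEquiv z).2⟩) ∈ unitsAt x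

end Picard

/-! ## Blowups -/

section Blowup

variable {k K : Type*} [Field k] [Field K] [Algebra k K] {ι J : Type} {m : ι → Type} {c : J → Type}

/-- Projection of `∏ ℙ(m i) × ∏ ℙ(c j)` to `∏ ℙ(m i)`. -/
def fst (p : MPt k K (Sum.elim m c)) : MPt k K m := fun i => p (Sum.inl i)

/-- The blowup of `X`. For each `j ∈ J` the polynomials `F j a`, `a ∈ c j`, are multihomogeneous of
the same multidegree, and they generate the ideal sheaf of a closed subvariety `Z j` of `X`. Then
the closure of the graph of the map `X ⇢ ∏ j, ℙ(c j)`, `x ↦ ([F j a (x)]_a)_j`, is the blowup of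
`X` in the product of these ideal sheaves, that is, in the union of the `Z j` when the `Z j` are
pairwise disjoint. The blowup morphism is `fst`. -/
def blowup (X : Set (MPt k K m)) (F : ∀ j, c j → MvPolynomial (Σ i, m i) k) :
    Set (MPt k K (Sum.elim m c)) :=
  {p | fst p ∈ X} ∩
    closure {p | fst p ∈ X ∧ ∀ j, Represents (fun a => hval (F j a) (fst p)) (p (Sum.inr j))}

/-- Strict transform in `X̃ ⊆ ∏ ℙ(m i) × ∏ ℙ(c j)`, a blowup with centre `Z`, of a subvariety `S`
of the blown up variety. -/
def strictTransform (X' : Set (MPt k K (Sum.elim m c))) (S Z : Set (MPt k K m)) :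
    Set (MPt k K (Sum.elim m c)) :=
  {p ∈ X' | p ∈ closure {q ∈ X' | fst q ∈ S \ Z}}

end Blowup

/-! ## The blowup of the product of projective spaces -/

section Source

variable {k : Type*} (K : Type*) [Field k] [Field K] [Algebra k K] {r : ℕ} {n : Fin r → ℕ}

/-- Coordinates of `Y = ∏ i, ℙ(V i)`, `V i = k ^ (n i + 1)`. -/
abbrev ySpace (n : Fin r → ℕ) : Fin r → Type := fun i => Fin (n i + 1)

variable (v : ∀ i, Fin (n i + 1) → k)

/-- The point `y = ([v 1], …, [v r])` of `Y`. -/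
def basePt (hv : ∀ i, v i ≠ 0) : MPt k K (ySpace n) := fun i =>
  Projectivization.mk K (fun a => algebraMap k K (v i a)) (fun h => hv i (funext fun a => by
    simpa using congrFun h a))

/-- Multi-indices: coordinates of the tensor product of the `V i`. -/
abbrev TensIdx (n : Fin r → ℕ) : Type := ∀ i, Fin (n i + 1)

/-- The forms of multidegree `(1, …, 1)` vanishing at `y`: they are spanned by the `2 × 2` minors
of the pair of tensors `⊗ u i`, `⊗ v i`, and generate the ideal sheaf of the point `y`. -/
def baseForms (_ : Unit) (ab : TensIdx n × TensIdx n) :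
    MvPolynomial (Σ i, ySpace n i) k :=
  MvPolynomial.C (∏ i, v i (ab.2 i)) * ∏ i, MvPolynomial.X ⟨i, ab.1 i⟩ -
    MvPolynomial.C (∏ i, v i (ab.1 i)) * ∏ i, MvPolynomial.X ⟨i, ab.2 i⟩

/-- Coordinates of `Y × ℙ(⊗²(⊗ V i))`, which contains the blowup of `Y` at `y`. -/
abbrev ytSpace (n : Fin r → ℕ) : Fin r ⊕ Unit → Type :=
  Sum.elim (ySpace n) (fun _ : Unit => TensIdx n × TensIdx n)

/-- `Ỹ = Bl_y(Y)`. -/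
def Yt : Set (MPt k K (ytSpace n)) := blowup Set.univ (baseForms v)

variable (hv : ∀ i, v i ≠ 0)

/-- The exceptional divisor `E ⊆ Ỹ`. -/
def Exc : Set (MPt k K (ytSpace n)) := {p ∈ Yt K v | fst p = basePt K v hv}

/-- `Ỹ_i`, the blowup at `y` of the subvariety of `Y` where the `i`-th component is `[v i]`. -/
def Yti (i : Fin r) : Set (MPt k K (ytSpace n)) :=
  strictTransform (Yt K v) {p | p i = basePt K v hv i} {basePt K v hv}

/-- `Ỹ_∅° ⊆ Ỹ`. -/
def YtOpen : Set (MPt k K (ytSpace n)) := Yt K v \ (Exc K v hv ∪ ⋃ i, Yti K v hv i)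

/-- `E_∅° ⊆ E`. -/
def ExcOpen : Set (MPt k K (ytSpace n)) := Exc K v hv \ ⋃ i, Yti K v hv i

/-- `Ỹ_i° ⊆ Ỹ_i`. -/
def YtiOpen (i : Fin r) : Set (MPt k K (ytSpace n)) :=
  Yti K v hv i \ (Exc K v hv ∪ ⋃ j ∈ {j | j ≠ i}, Yti K v hv j)

end Source

/-! ## The blowup of the projective bundle -/

section Target

variable (k K : Type*) [Field k] [Field K] [Algebra k K] {r : ℕ} (n : Fin r → ℕ)

/-- Multi-indices `a` of basis vectors of `⨁ V̄_I`, the sum over the subsets `I` of `{1, …, r}` with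
`|I| ≥ r - 1`. Here `V̄_I = ⊗_{i ∈ I} V̄ i`, `V̄ i = k ^ (n i)`, and `a i` is `none` for `i ∉ I`. -/
abbrev PlusIdx : Type :=
  {a : ∀ i, Option (Fin (n i)) // r ≤ (Finset.univ.filter fun i => (a i).isSome).card + 1}

variable {n} in
/-- The subset `I` to which a multi-index belongs. -/
def PlusIdx.supp (a : PlusIdx n) : Finset (Fin r) := Finset.univ.filter fun i => (a.1 i).isSome

/-- Coordinates of `Y⁺ × ℙ(⨁_{|I| ≥ r - 1} V̄_I)`, where `Y⁺ = ∏ i, ℙ(V̄ i)`. -/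
abbrev yhSpace : Fin r ⊕ Unit → Type :=
  Sum.elim (fun i => Fin (n i)) (fun _ : Unit => PlusIdx n)

/-- `Ŷ⁺ = ℙ_{Y⁺}(ℰ)`, the bundle of lines in `ℰ = ⨁_{|I| ≥ r - 1} 𝒪(-h_I) ⊆ ⨁_{|I| ≥ r - 1} V̄_I ⊗ 𝒪`.
The fibre of `𝒪(-h_I)` at `(ū i)_i` is the line spanned by `⊗_{i ∈ I} ū i` in `V̄_I`; so a vector
is in the fibre of `ℰ` if and only if, for some scalars `c I`, its component in each `V̄_I` is
`c I • ⊗_{i ∈ I} ū i`. -/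
def Yh : Set (MPt k K (yhSpace n)) :=
  {p | ∃ c : Finset (Fin r) → K, ∀ a : PlusIdx n,
    (p (Sum.inr ())).rep a = c a.supp * ∏ i, (a.1 i).elim 1 (p (Sum.inl i)).rep}

/-- The image of the section `s_i`, given by the summand `𝒪(-h_I)` with `I = {1, …, r} \ {i}`. -/
def Sec (i : Fin r) : Set (MPt k K (yhSpace n)) :=
  {p ∈ Yh k K n | ∀ a : PlusIdx n, i ∈ a.supp → (p (Sum.inr ())).rep a = 0}

/-- `ℙ_{Y⁺}(ℰ̄_J)`, where `ℰ̄_J` is the sum of the summands with `J ⊆ I` and `|I| = r - 1`. -/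
def PE (J : Finset (Fin r)) : Set (MPt k K (yhSpace n)) :=
  {p ∈ Yh k K n | ∀ a : PlusIdx n, ¬ (J ⊆ a.supp ∧ a.supp.card + 1 = r) →
    (p (Sum.inr ())).rep a = 0}

/-- The factors of `Y` of dimension `1`. -/
abbrev Lines : Type := {i : Fin r // n i = 1}

/-- Linear forms generating the ideal of the section `s_j`. -/
def secForms (j : Lines n) (a : {a : PlusIdx n // j.1 ∈ a.supp}) :
    MvPolynomial (Σ i, yhSpace n i) k :=
  MvPolynomial.X ⟨Sum.inr (), a.1⟩

/-- Coordinates of the product of projective spaces which contains `Ỹ⁺`. -/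
abbrev ypSpace : (Fin r ⊕ Unit) ⊕ Lines n → Type :=
  Sum.elim (yhSpace n) (fun j : Lines n => {a : PlusIdx n // j.1 ∈ a.supp})

/-- `Ỹ⁺`, the blowup of `Ŷ⁺` in the disjoint union of the sections `s_j`, `j ∈ Lines n`. -/
def Yp : Set (MPt k K (ypSpace n)) := blowup (Yh k K n) (secForms k n)

/-- The exceptional divisor over the section `s_j`. -/
def ExcP (j : Lines n) : Set (MPt k K (ypSpace n)) := {p ∈ Yp k K n | fst p ∈ Sec k K n j}

/-- `Ỹ⁺_J`, the strict transform of `ℙ_{Y⁺}(ℰ̄_J)`. -/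
def YpJ (J : Finset (Fin r)) : Set (MPt k K (ypSpace n)) :=
  strictTransform (Yp k K n) (PE k K n J) (⋃ j : Lines n, Sec k K n j)

/-- `(Ỹ⁺)°`. -/
def YpOpen : Set (MPt k K (ypSpace n)) :=
  Yp k K n \ (YpJ k K n ∅ ∪ ⋃ j, ExcP k K n j)

/-- `(Ỹ⁺_∅)°`. -/
def YpEmptyOpen : Set (MPt k K (ypSpace n)) :=
  YpJ k K n ∅ \ ((⋃ i, YpJ k K n {i}) ∪ ⋃ j, ExcP k K n j)

/-- `E_j° ⊆ E_j`. -/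
def ExcPOpen (j : Lines n) : Set (MPt k K (ypSpace n)) := ExcP k K n j \ YpJ k K n ∅

end Target

/-! ## The group action and the explicit rational maps -/

section Action

variable {k K : Type*} [Field k] [Field K] [Algebra k K] {r : ℕ} {n : Fin r → ℕ}

/-- The point of a projective space obtained from `p` by a linear map that is injective on `p`
(the value for other linear maps is irrelevant). -/
def pmap {c : Type} (A : (c → K) →ₗ[K] (c → K)) (p : Projectivization K (c → K)) :
    Projectivization K (c → K) :=
  open Classical in if h : A p.rep ≠ 0 then Projectivization.mk K _ h else p

variable (K) in
/-- The group (of `K`-points of) `G = ∏ i, PGL(V i)_{v i}`. -/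
def G (v : ∀ i, Fin (n i + 1) → k) (hv : ∀ i, v i ≠ 0) :
    Subgroup (∀ i, PGL(Fin (n i + 1), K)) :=
  Subgroup.pi Set.univ fun i => MulAction.stabilizer _ (basePt K v hv i)

/-- A matrix representing an element of `PGL`. -/
def lift {c : Type} [Fintype c] [DecidableEq c] (g : PGL(c, K)) : Matrix c c K :=
  (Function.surjInv Matrix.ProjGenLinGroup.mk_surjective g : GL c K)

/-- The action on `Y × ℙ(⊗²(⊗ V i))`, hence on `Ỹ`. -/
def actYt (g : ∀ i, PGL(Fin (n i + 1), K)) (p : MPt k K (ytSpace n)) : MPt k K (ytSpace n)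
  | Sum.inl i => HSMul.hSMul (β := Projectivization K (Fin (n i + 1) → K)) (g i) (p (Sum.inl i))
  | Sum.inr u => pmap (c := TensIdx n × TensIdx n)
      (Matrix.mulVecLin (Matrix.of fun a b =>
        (∏ i, lift (g i) (a.1 i) (b.1 i)) * ∏ i, lift (g i) (a.2 i) (b.2 i))) (p (Sum.inr u))

/-- `B i` is a splitting `V i = k v_i ⊕ V̄ i` together with a basis of `V̄ i`: the coordinate
`none` is the one along `v i`, the coordinates `some _` are those of the projection to `V̄ i`. -/
abbrev Splitting (k : Type*) [Field k] {r : ℕ} (n : Fin r → ℕ) : Type _ :=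
  ∀ i, (Fin (n i + 1) → k) ≃ₗ[k] (Option (Fin (n i)) → k)

variable (B : Splitting k n)

variable (K) in
/-- The matrix of `B i`, as a matrix over `K`. -/
def splitMat (i : Fin r) : Matrix (Option (Fin (n i))) (Fin (n i + 1)) K :=
  (LinearMap.toMatrix' (B i).toLinearMap).map (algebraMap k K)

variable (K) in
/-- The matrix of the inverse of `B i`, as a matrix over `K`. -/
def splitInv (i : Fin r) : Matrix (Fin (n i + 1)) (Option (Fin (n i))) K :=
  (LinearMap.toMatrix' (B i).symm.toLinearMap).map (algebraMap k K)

/-- The matrix of an element of `PGL(V i)` with respect to the decomposition `k v_i ⊕ V̄ i`. -/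
def adapted (g : ∀ i, PGL(Fin (n i + 1), K)) (i : Fin r) :
    Matrix (Option (Fin (n i))) (Option (Fin (n i))) K :=
  splitMat K B i * lift (g i) * splitInv K B i

/-- The action of `G` on `⨁_{|I| ≥ r - 1} V̄_I` (up to scalars), which is the quotient of `⊗ V i` by
the invariant subspace `⨁_{|I| ≤ r - 2} V̄_I`. -/
def actPlusMat (g : ∀ i, PGL(Fin (n i + 1), K)) : Matrix (PlusIdx n) (PlusIdx n) K :=
  Matrix.of fun a b => ∏ i, adapted B g i (a.1 i) (b.1 i)

/-- The action of `G` on `Ỹ⁺`: it acts on `ℙ(V̄ i)` as `PGL(V i)_{v i}` acts on the quotient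
`V̄ i = V i / k v_i`, on `ℙ(⨁ V̄_I)` as above, and on the remaining factors as on the quotient of
`⨁ V̄_I` by the invariant summand with `I = {1, …, r} \ {j}`. -/
def actYp (g : ∀ i, PGL(Fin (n i + 1), K)) (p : MPt k K (ypSpace n)) : MPt k K (ypSpace n)
  | Sum.inl (Sum.inl i) => pmap (c := Fin (n i))
      (Matrix.mulVecLin ((adapted B g i).submatrix some some)) (p (Sum.inl (Sum.inl i)))
  | Sum.inl (Sum.inr u) => pmap (c := PlusIdx n)
      (Matrix.mulVecLin (actPlusMat B g)) (p (Sum.inl (Sum.inr u)))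
  | Sum.inr j => pmap (c := {a : PlusIdx n // j.1 ∈ a.supp})
      (Matrix.mulVecLin ((actPlusMat B g).submatrix Subtype.val Subtype.val)) (p (Sum.inr j))

/-- `O` is an orbit of the action `act` of a group `H`. -/
def IsOrbit {P Γ : Type*} [Group Γ] (H : Subgroup Γ) (act : Γ → P → P) (O : Set P) : Prop :=
  ∃ x, O = {x' | ∃ g ∈ H, x' = act g x}

/-- `ψ` is equivariant: its domain is invariant, and it commutes with the action. -/
def SmallBirIso.IsEquivariant {ι ι' : Type} {m : ι → Type} {m' : ι' → Type}
    {X : Set (MPt k K m)} {X' : Set (MPt k K m')} (ψ : SmallBirIso X X') {Γ : Type*} [Group Γ]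
    (H : Subgroup Γ) (act : Γ → MPt k K m → MPt k K m) (act' : Γ → MPt k K m' → MPt k K m') :
    Prop :=
  ∀ g ∈ H, ∀ x : ψ.dom, ∃ h : act g x ∈ ψ.dom,
    (ψ.iso.toEquiv ⟨act g x, h⟩ : MPt k K m') = act' g (ψ.iso.toEquiv x)

/-- The coordinates of a representative `u i` of the `i`-th component of a point of `Y` with
respect to `V i = k v_i ⊕ V̄ i`. -/
def splitCoord (p : MPt k K (ySpace n)) (i : Fin r) : Option (Fin (n i)) → K :=
  (splitMat K B i).mulVec (p i).rep

/-- The image `ū i ∈ V̄ i` of `u i`; the linear projection from `[v i]` is `[u i] ↦ [ū i]`, and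
`ψ₀ : Y ⇢ Y⁺` is the product of these maps. -/
def psi0 (p : MPt k K (ySpace n)) (i : Fin r) : Fin (n i) → K := fun j => splitCoord B p i (some j)

/-- The component `∑_{|I| ≥ r - 1} ⊗_{i ∈ I} ū i` of the rational map `ψ̂₀ : Y ⇢ Ŷ⁺`; here
`u i = t i • v i + ū i`, and in the homogeneous form the summand of `I` has the coefficient
`∏_{i ∉ I} t i`. -/
def psiHat0 (p : MPt k K (ySpace n)) (a : PlusIdx n) : K := ∏ i, splitCoord B p i (a.1 i)

end Action

end ToricLink

end

open scoped Topology MatrixGroups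

noncomputable section

namespace ToricLink

set_option linter.unusedSectionVars false

/-! ## Regular functions -/

section Regular

variable {k K : Type*} [Field k] [Field K] [Algebra k K] {ι : Type} {m : ι → Type}

/-! Both varieties are quotients of open subsets of one affine space by one torus. The coordinates
are `e`, `t i`, `x i b` (`CoxVar`), of degrees `degE`, `degX i + degE`, `degX i`. On the blowup of
Y, `e` is the equation of the exceptional divisor, and the point of the factor ℙ(V i) is spanned by
`t i • v i + e • x i`. On the other side `x i` spans a line in V̄ i, while `e` and `t i` are the
coefficients of the summands of ℰ with I = {1, …, r} and I = {1, …, r} \ {i}. If `n i = 1`, then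
ℙ(V̄ i) is a point, and the only coordinate `x i` becomes the equation of the exceptional divisor
over s_i. In these coordinates ψ is the identity. The two open subsets of the affine space differ,
but both contain the open set `bigStratum`, and in each quotient the rest lies over points where two
of the coordinates vanish (`codimComplGeTwo_Yt`, `codimComplGeTwo_Yp`). Hence ψ is small.

`CoxPres` collects what is needed of such a quotient: local sections, invertible functions of every
degree near every point, and a zero of every prime polynomial in the open set. Three facts follow.
Regular functions are locally ratios of homogeneous polynomials in the Cox coordinates
(`CoxPres.regAt_iff`). A homogeneous prime cuts out an irreducible closed subset of codimension one
(`CoxPres.coheight_divisor`). Since the polynomial ring is factorial, the Picard group is the group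
of degrees (`CoxPres.picHom_bijective`). As the degrees are the same for both quotients, the
relations between E, H_i, h, h_i and e_i are identities between degrees.

Most of the work is in the two presentations `coxYt` and `coxYp`. The blowups are closures of
graphs. A point with Cox coordinates lies in the closure because vanishing coordinates can be
deformed to nonzero ones (`mem_closure_of_deform`). Conversely, Cox coordinates of a point of the
closure are read off from equations that hold on the graph (`exists_lift_Yt`, `exists_lift_Yp`).

The group acts on Cox coordinates through block triangular matrices (`coxAct`), compatibly with both
quotients (`lifts_actYt`, `lifts_actYp`). The polynomial identities behind this are checked only
where `e` or some `x j` does not vanish. The orbits are described by which coordinates vanish, and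
transitivity on them is linear algebra (`exists_coxAct_eq`). -/

lemma hval_mul (F G : MvPolynomial (Σ j, m j) k) (x : MPt k K m) :
    hval (F * G) x = hval F x * hval G x := by simp [hval]

lemma hval_add (F G : MvPolynomial (Σ j, m j) k) (x : MPt k K m) :
    hval (F + G) x = hval F x + hval G x := by simp [hval]

/-- A product of two forms is a form, so the generating open sets are already closed under finite
intersections. -/
lemma isTopologicalBasis_hval : TopologicalSpace.IsTopologicalBasis
    {D : Set (MPt k K m) | ∃ (F : MvPolynomial (Σ j, m j) k) (d : ι →₀ ℕ),
      IsMultiHom F d ∧ D = {x | hval F x ≠ 0}} where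
  exists_subset_inter := by
    rintro _ ⟨F, d, hF, rfl⟩ _ ⟨G, e, hG, rfl⟩ x ⟨hx, hx'⟩
    refine ⟨_, ⟨F * G, d + e, hF.mul hG, rfl⟩, ?_, ?_⟩
    · simpa [hval_mul] using ⟨hx, hx'⟩
    · intro z hz
      simpa [hval_mul] using hz
  sUnion_eq := by
    refine Set.eq_univ_of_forall fun x => Set.mem_sUnion.2 ⟨Set.univ, ⟨1, 0,
      MvPolynomial.isWeightedHomogeneous_one _ _, ?_⟩, trivial⟩
    simp [hval]
  eq_generateFrom := rfl

variable {X : Set (MPt k K m)}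

lemma eventually_iff_hval {x : X} {P : X → Prop} :
    (∀ᶠ z in 𝓝 x, P z) ↔ ∃ (F : MvPolynomial (Σ j, m j) k) (d : ι →₀ ℕ),
      IsMultiHom F d ∧ hval F x.1 ≠ 0 ∧ ∀ z : X, hval F z.1 ≠ 0 → P z := by
  constructor
  · intro h
    rw [nhds_subtype, Filter.eventually_comap, isTopologicalBasis_hval.nhds_hasBasis.eventually_iff]
      at h
    obtain ⟨_, ⟨⟨F, d, hF, rfl⟩, hx⟩, h⟩ := h
    exact ⟨F, d, hF, hx, fun z hz => h hz z rfl⟩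
  · rintro ⟨F, d, hF, hx, h⟩
    exact (eventually_hval_ne hF hx).mono h

lemma isClosed_hval_eq_zero {F : MvPolynomial (Σ j, m j) k} {d : ι →₀ ℕ} (hF : IsMultiHom F d) :
    IsClosed {x : MPt k K m | hval F x = 0} := by
  rw [← isOpen_compl_iff]
  exact isTopologicalBasis_hval.isOpen ⟨F, d, hF, rfl⟩

lemma isMultiHom_C (c : k) : IsMultiHom (MvPolynomial.C c : MvPolynomial (Σ j, m j) k) 0 :=
  MvPolynomial.isWeightedHomogeneous_C _ _

lemma IsMultiHom.C_mul {F : MvPolynomial (Σ j, m j) k} {d : ι →₀ ℕ} (hF : IsMultiHom F d) (c : k) :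
    IsMultiHom (MvPolynomial.C c * F) d := by
  have h := (isMultiHom_C c).mul hF
  rwa [zero_add] at h

lemma RegAt.congr {φ ψ : X → K} {x : X} (h : RegAt φ x) (h' : ∀ᶠ z in 𝓝 x, ψ z = φ z) :
    RegAt ψ x := by
  obtain ⟨d, F, G, hF, hG, hx, h⟩ := h
  refine ⟨d, F, G, hF, hG, hx, ?_⟩
  filter_upwards [h, h'] with z hz hz'
  rw [hz', hz]

lemma regAt_const (c : k) (x : X) : RegAt (fun _ => algebraMap k K c) x :=
  ⟨0, MvPolynomial.C c, 1, isMultiHom_C c, MvPolynomial.isWeightedHomogeneous_one _ _,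
    by simp [hval], Filter.Eventually.of_forall fun z => by simp [hval]⟩

lemma RegAt.add {φ ψ : X → K} {x : X} (h : RegAt φ x) (h' : RegAt ψ x) :
    RegAt (fun z => φ z + ψ z) x := by
  obtain ⟨d, F, G, hF, hG, hx, h⟩ := h
  obtain ⟨d', F', G', hF', hG', hx', h'⟩ := h'
  refine ⟨d + d', F * G' + G * F', G * G', (hF.mul hG').add (hG.mul hF'), hG.mul hG', ?_, ?_⟩
  · simpa [hval_mul] using ⟨hx, hx'⟩
  · filter_upwards [h, h', eventually_hval_ne hG hx, eventually_hval_ne hG' hx'] with z h1 h2 h3 h4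
    rw [h1, h2, div_add_div _ _ h3 h4, hval_add, hval_mul, hval_mul, hval_mul]

lemma RegAt.mul {φ ψ : X → K} {x : X} (h : RegAt φ x) (h' : RegAt ψ x) :
    RegAt (fun z => φ z * ψ z) x := by
  obtain ⟨d, F, G, hF, hG, hx, h⟩ := h
  obtain ⟨d', F', G', hF', hG', hx', h'⟩ := h'
  refine ⟨d + d', F * F', G * G', hF.mul hF', hG.mul hG', ?_, ?_⟩
  · simpa [hval_mul] using ⟨hx, hx'⟩
  · filter_upwards [h, h'] with z h1 h2
    rw [h1, h2, div_mul_div_comm, hval_mul, hval_mul]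

lemma RegAt.eventually_ne {φ : X → K} {x : X} (h : RegAt φ x) (hx : φ x ≠ 0) :
    ∀ᶠ z in 𝓝 x, φ z ≠ 0 := by
  obtain ⟨d, F, G, hF, hG, hGx, h⟩ := h
  have hFx : hval F x.1 ≠ 0 := by
    intro h0
    apply hx
    rw [h.self_of_nhds, h0, zero_div]
  filter_upwards [h, eventually_hval_ne hF hFx, eventually_hval_ne hG hGx] with z h1 h2 h3
  rw [h1]
  exact div_ne_zero h2 h3

lemma RegAt.inv {φ : X → K} {x : X} (h : RegAt φ x) (hx : φ x ≠ 0) :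
    RegAt (fun z => (φ z)⁻¹) x := by
  obtain ⟨d, F, G, hF, hG, hGx, h⟩ := h
  have hFx : hval F x.1 ≠ 0 := by
    intro h0
    apply hx
    rw [h.self_of_nhds, h0, zero_div]
  refine ⟨d, G, F, hG, hF, hFx, h.mono fun z hz => ?_⟩
  simp only [hz, inv_div]

lemma RegAt.div {φ ψ : X → K} {x : X} (h : RegAt φ x) (h' : RegAt ψ x) (hx : ψ x ≠ 0) :
    RegAt (fun z => φ z / ψ z) x := by
  simpa only [div_eq_mul_inv] using h.mul (h'.inv hx)

/-- Regular functions at a point form a `k`-algebra. This makes it possible to evaluate polynomials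
over `k` on local sections of a quotient. -/
lemma RegAt.aeval {τ : Type} {σ : X → τ → K} {x : X} (h : ∀ s, RegAt (fun z => σ z s) x)
    (F : MvPolynomial τ k) : RegAt (fun z => MvPolynomial.aeval (σ z) F) x := by
  induction F using MvPolynomial.induction_on with
  | C c => simpa using regAt_const c x
  | add F G hF hG => simpa using hF.add hG
  | mul_X F s hF => simpa using hF.mul (h s)

lemma RegAt.restrict {X' : Set (MPt k K m)} (hX : X' ⊆ X) {φ : X → K} {x : X'} {φ' : X' → K}
    (h : RegAt φ ⟨x, hX x.2⟩) (h' : ∀ᶠ z : X' in 𝓝 x, φ' z = φ ⟨z, hX z.2⟩) : RegAt φ' x := by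
  obtain ⟨d, F, G, hF, hG, hx, h⟩ := h
  refine ⟨d, F, G, hF, hG, hx, ?_⟩
  have hc : Continuous (fun z : X' => (⟨z, hX z.2⟩ : X)) :=
    Continuous.subtype_mk continuous_subtype_val _
  filter_upwards [h', hc.continuousAt.eventually h] with z h1 h2
  rw [h1, h2]

/-- The values are units, so the numerator of a local expression cannot vanish at `x`, and
invertibility is automatic. -/
lemma mem_unitsAt_iff {x : X} {φ : X → Kˣ} : φ ∈ unitsAt x ↔ RegAt (fun z => (φ z : K)) x := by
  constructor
  · rintro ⟨d, F, G, hF, hG, hFx, hGx, h⟩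
    exact ⟨d, F, G, hF, hG, hGx, h⟩
  · rintro ⟨d, F, G, hF, hG, hGx, h⟩
    refine ⟨d, F, G, hF, hG, fun h0 => (φ x).ne_zero ?_, hGx, h⟩
    have h1 := h.self_of_nhds
    rwa [h0, zero_div] at h1

/-- Finitely many regular functions have a common denominator. -/
lemma RegAt.exists_common_denominator {c : Type} [Finite c] {φ : c → X → K} {x : X}
    (h : ∀ a, RegAt (φ a) x) : ∃ (d : ι →₀ ℕ) (F : c → MvPolynomial (Σ j, m j) k)
      (G : MvPolynomial (Σ j, m j) k), (∀ a, IsMultiHom (F a) d) ∧ IsMultiHom G d ∧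
      hval G x.1 ≠ 0 ∧ ∀ᶠ z in 𝓝 x, ∀ a, φ a z = hval (F a) z.1 / hval G z.1 := by
  classical
  have := Fintype.ofFinite c
  choose d F G hF hG hx h using h
  refine ⟨∑ a, d a, fun a => F a * ∏ b ∈ Finset.univ.erase a, G b, ∏ b, G b, fun a => ?_,
    MvPolynomial.IsWeightedHomogeneous.prod _ _ _ fun b _ => hG b, ?_, ?_⟩
  · rw [← Finset.add_sum_erase _ _ (Finset.mem_univ a)]
    exact (hF a).mul (MvPolynomial.IsWeightedHomogeneous.prod _ _ _ fun b _ => hG b)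
  · simp only [hval, map_prod]
    exact Finset.prod_ne_zero_iff.2 fun b _ => hx b
  · rw [Filter.eventually_all]
    intro a
    filter_upwards [h a, Filter.eventually_all.2 fun b => eventually_hval_ne (hG b) (hx b)]
      with z h1 h2
    rw [h1, ← Finset.mul_prod_erase _ _ (Finset.mem_univ a), hval_mul, hval_mul]
    refine (mul_div_mul_right _ _ ?_).symm
    simp only [hval, map_prod]
    exact Finset.prod_ne_zero_iff.2 fun b _ => h2 b

lemma represents_mk {c : Type} {w : c → K} (hw : w ≠ 0) :
    Represents w (Projectivization.mk K w hw) := by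
  obtain ⟨a, ha⟩ := Projectivization.exists_smul_eq_mk_rep K w hw
  refine ⟨(a⁻¹ : Kˣ), Units.ne_zero _, ?_⟩
  rw [← ha]
  simp [Units.smul_def, smul_smul]

lemma Represents.ne_zero {c : Type} {w : c → K} {p : Projectivization K (c → K)}
    (h : Represents w p) : w ≠ 0 := by
  obtain ⟨t, ht, rfl⟩ := h
  exact smul_ne_zero ht p.rep_nonzero

lemma represents_iff {c : Type} {w : c → K} {p : Projectivization K (c → K)} :
    Represents w p ↔ ∃ h : w ≠ 0, p = Projectivization.mk K w h := by
  constructor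
  · intro h
    refine ⟨h.ne_zero, ?_⟩
    obtain ⟨t, ht, rfl⟩ := h
    conv_lhs => rw [← p.mk_rep]
    rw [Projectivization.mk_eq_mk_iff']
    exact ⟨t⁻¹, by rw [smul_smul, inv_mul_cancel₀ ht, one_smul]⟩
  · rintro ⟨h, rfl⟩
    exact represents_mk h

lemma represents_rep {c : Type} (p : Projectivization K (c → K)) : Represents p.rep p :=
  ⟨1, one_ne_zero, by simp⟩

lemma Represents.smul {c : Type} {w : c → K} {p : Projectivization K (c → K)}
    (h : Represents w p) {s : K} (hs : s ≠ 0) : Represents (s • w) p := by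
  obtain ⟨t, ht, rfl⟩ := h
  exact ⟨s * t, mul_ne_zero hs ht, by rw [smul_smul]⟩

lemma Represents.exists_smul {c : Type} {w w' : c → K} {p : Projectivization K (c → K)}
    (h : Represents w p) (h' : Represents w' p) : ∃ s : K, s ≠ 0 ∧ w' = s • w := by
  obtain ⟨t, ht, rfl⟩ := h
  obtain ⟨t', ht', rfl⟩ := h'
  exact ⟨t' / t, div_ne_zero ht' ht, by rw [smul_smul, div_mul_cancel₀ _ ht]⟩

lemma Represents.unique {c : Type} {w : c → K} {p p' : Projectivization K (c → K)}
    (h : Represents w p) (h' : Represents w p') : p = p' := by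
  rw [represents_iff] at h h'
  rw [h.2, h'.2]

end Regular

/-! ## Multigraded polynomial rings and the action of the torus -/

section Graded

variable {k K : Type*} [Field k] [Field K] [Algebra k K] {τ ρ : Type} [Fintype ρ]

/-- The value at `u` of the character `d` of the torus. -/
def chi (u : ρ → Kˣ) (d : ρ → ℤ) : Kˣ := ∏ i, u i ^ d i

lemma chi_zero (u : ρ → Kˣ) : chi u 0 = 1 := by simp [chi]

lemma chi_add (u : ρ → Kˣ) (d e : ρ → ℤ) : chi u (d + e) = chi u d * chi u e := by
  simp [chi, zpow_add, Finset.prod_mul_distrib]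

lemma chi_nsmul (u : ρ → Kˣ) (n : ℕ) (d : ρ → ℤ) : chi u (n • d) = chi u d ^ n := by
  induction n with
  | zero => simp [chi_zero]
  | succ n ih => rw [succ_nsmul, chi_add, ih, pow_succ]

lemma chi_sum {α : Type*} (u : ρ → Kˣ) (s : Finset α) (d : α → ρ → ℤ) :
    chi u (∑ a ∈ s, d a) = ∏ a ∈ s, chi u (d a) := by
  classical
  induction s using Finset.induction_on with
  | empty => simp [chi_zero]
  | insert a s ha ih => rw [Finset.sum_insert ha, Finset.prod_insert ha, chi_add, ih]

lemma chi_single [DecidableEq ρ] (u : ρ → Kˣ) (i : ρ) : chi u (Pi.single i 1) = u i := by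
  rw [chi, Finset.prod_eq_single i]
  · simp
  · intro j _ hj
    simp [Pi.single_eq_of_ne hj]
  · simp

lemma chi_mul (u u' : ρ → Kˣ) (d : ρ → ℤ) : chi (u * u') d = chi u d * chi u' d := by
  simp [chi, mul_zpow, Finset.prod_mul_distrib]

variable (w : τ → ρ → ℤ)

/-- The action of the torus on the affine space. -/
def tact (u : ρ → Kˣ) (q : τ → K) : τ → K := fun s => chi u (w s) * q s

lemma tact_mul (u u' : ρ → Kˣ) (q : τ → K) : tact w (u * u') q = tact w u (tact w u' q) := by
  funext s
  simp [tact, chi_mul, mul_assoc]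

lemma tact_one (q : τ → K) : tact w 1 q = q := by
  funext s
  simp [tact, chi]

lemma tact_inv_tact (u : ρ → Kˣ) (q : τ → K) : tact w u⁻¹ (tact w u q) = q := by
  rw [← tact_mul, inv_mul_cancel, tact_one]

/-- `F` is homogeneous of degree `d` for the grading with weights `w`. -/
def Hom (F : MvPolynomial τ k) (d : ρ → ℤ) : Prop := F.IsWeightedHomogeneous w d

variable {w}

lemma Hom.mul {F G : MvPolynomial τ k} {d e : ρ → ℤ} (hF : Hom w F d) (hG : Hom w G e) :
    Hom w (F * G) (d + e) := MvPolynomial.IsWeightedHomogeneous.mul hF hG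

lemma Hom.sub {F G : MvPolynomial τ k} {d : ρ → ℤ} (hF : Hom w F d) (hG : Hom w G d) :
    Hom w (F - G) d :=
  Submodule.sub_mem (MvPolynomial.weightedHomogeneousSubmodule k _ d) hF hG

lemma Hom.sum {α : Type*} (s : Finset α) {F : α → MvPolynomial τ k} {d : ρ → ℤ}
    (hF : ∀ a ∈ s, Hom w (F a) d) : Hom w (∑ a ∈ s, F a) d :=
  Submodule.sum_mem (MvPolynomial.weightedHomogeneousSubmodule k _ d) hF

lemma hom_C (c : k) : Hom w (MvPolynomial.C c) 0 := MvPolynomial.isWeightedHomogeneous_C _ _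

lemma hom_one : Hom w (1 : MvPolynomial τ k) 0 := MvPolynomial.isWeightedHomogeneous_one _ _

lemma hom_X (s : τ) : Hom w (MvPolynomial.X s : MvPolynomial τ k) (w s) :=
  MvPolynomial.isWeightedHomogeneous_X _ _ _

lemma hom_zero (d : ρ → ℤ) : Hom w (0 : MvPolynomial τ k) d :=
  Submodule.zero_mem (MvPolynomial.weightedHomogeneousSubmodule k _ d)

lemma Hom.C_mul {F : MvPolynomial τ k} {d : ρ → ℤ} (hF : Hom w F d) (c : k) :
    Hom w (MvPolynomial.C c * F) d := by
  have h := (hom_C c).mul hF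
  rwa [zero_add] at h

lemma Hom.pow {F : MvPolynomial τ k} {d : ρ → ℤ} (hF : Hom w F d) (n : ℕ) :
    Hom w (F ^ n) (n • d) := MvPolynomial.IsWeightedHomogeneous.pow hF n

lemma Hom.prod {α : Type*} (s : Finset α) {F : α → MvPolynomial τ k} {d : α → ρ → ℤ}
    (hF : ∀ a ∈ s, Hom w (F a) (d a)) : Hom w (∏ a ∈ s, F a) (∑ a ∈ s, d a) :=
  MvPolynomial.IsWeightedHomogeneous.prod _ _ _ hF

lemma Hom.degree_unique {F : MvPolynomial τ k} {d e : ρ → ℤ} (hF : Hom w F d) (hF' : Hom w F e)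
    (h0 : F ≠ 0) : d = e := MvPolynomial.IsWeightedHomogeneous.inj_right h0 hF hF'

lemma weight_comp_apply (a : τ →₀ ℕ) (i : ρ) :
    Finsupp.weight w a i = Finsupp.weight (fun s => w s i) a := by
  simp [Finsupp.weight_apply, Finsupp.sum, Finset.sum_apply]

lemma Hom.aeval_tact {F : MvPolynomial τ k} {d : ρ → ℤ} (hF : Hom w F d) (u : ρ → Kˣ)
    (q : τ → K) : MvPolynomial.aeval (tact w u q) F = chi u d * MvPolynomial.aeval q F := by
  rw [MvPolynomial.aeval_def, MvPolynomial.aeval_def, MvPolynomial.eval₂_eq, MvPolynomial.eval₂_eq,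
    Finset.mul_sum]
  refine Finset.sum_congr rfl fun a ha => ?_
  have h := hF (MvPolynomial.mem_support_iff.1 ha)
  have h2 : ((chi u d : Kˣ) : K) = ∏ s ∈ a.support, (chi u (w s) : K) ^ a s := by
    rw [← h, Finsupp.weight_apply, Finsupp.sum, chi_sum, Units.coe_prod]
    simp only [chi_nsmul, Units.val_pow_eq_pow_val]
  rw [h2]
  simp only [tact, mul_pow, Finset.prod_mul_distrib]
  ring

lemma Hom.aeval_tact_ne {F : MvPolynomial τ k} {d : ρ → ℤ} (hF : Hom w F d) (u : ρ → Kˣ)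
    (q : τ → K) : MvPolynomial.aeval (tact w u q) F ≠ 0 ↔ MvPolynomial.aeval q F ≠ 0 := by
  rw [hF.aeval_tact]
  simp

lemma Hom.ratio_tact {F G : MvPolynomial τ k} {d : ρ → ℤ} (hF : Hom w F d) (hG : Hom w G d)
    (u : ρ → Kˣ) (q : τ → K) :
    MvPolynomial.aeval (tact w u q) F / MvPolynomial.aeval (tact w u q) G =
      MvPolynomial.aeval q F / MvPolynomial.aeval q G := by
  rw [hF.aeval_tact, hG.aeval_tact, mul_div_mul_left _ _ (Units.ne_zero _)]

/-- For a grading by the integers, a factor of a nonzero homogeneous polynomial is homogeneous. -/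
lemma isWeightedHomogeneous_of_mul {w : τ → ℤ} {F G : MvPolynomial τ k} {d : ℤ}
    (h : (F * G).IsWeightedHomogeneous w d) (hF : F ≠ 0) (hG : G ≠ 0) :
    ∃ e, F.IsWeightedHomogeneous w e := by
  classical
  have aux : ∀ F : MvPolynomial τ k, ∀ i, MvPolynomial.weightedHomogeneousComponent w i F ≠ 0 ↔
      ∃ a ∈ F.support, Finsupp.weight w a = i := by
    intro F i
    constructor
    · intro h
      obtain ⟨a, ha⟩ := MvPolynomial.ne_zero_iff.1 h
      rw [MvPolynomial.coeff_weightedHomogeneousComponent] at ha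
      split_ifs at ha with hi
      · exact ⟨a, MvPolynomial.mem_support_iff.2 ha, hi⟩
      · exact absurd rfl ha
    · rintro ⟨a, ha, rfl⟩
      refine MvPolynomial.ne_zero_iff.2 ⟨a, ?_⟩
      rw [MvPolynomial.coeff_weightedHomogeneousComponent, if_pos rfl]
      exact MvPolynomial.mem_support_iff.1 ha
  -- extreme degrees
  have main : ∀ (F G : MvPolynomial τ k) (i j : ℤ),
      MvPolynomial.weightedHomogeneousComponent w i F ≠ 0 →
      MvPolynomial.weightedHomogeneousComponent w j G ≠ 0 →
      (∀ a ∈ F.support, ∀ b ∈ G.support, Finsupp.weight w a + Finsupp.weight w b = i + j →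
        Finsupp.weight w a = i ∧ Finsupp.weight w b = j) →
      MvPolynomial.weightedHomogeneousComponent w (i + j) (F * G) ≠ 0 := by
    intro F G i j hi hj hij
    have : MvPolynomial.weightedHomogeneousComponent w (i + j) (F * G) =
        MvPolynomial.weightedHomogeneousComponent w i F *
          MvPolynomial.weightedHomogeneousComponent w j G := by
      ext c
      rw [MvPolynomial.coeff_weightedHomogeneousComponent, MvPolynomial.coeff_mul,
        MvPolynomial.coeff_mul]
      split_ifs with hc
      · refine Finset.sum_congr rfl fun ab hab => ?_
        rw [MvPolynomial.coeff_weightedHomogeneousComponent,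
          MvPolynomial.coeff_weightedHomogeneousComponent]
        replace hab := Finset.HasAntidiagonal.mem_antidiagonal.1 hab
        by_cases ha : MvPolynomial.coeff ab.1 F = 0
        · simp [ha]
        by_cases hb : MvPolynomial.coeff ab.2 G = 0
        · simp [hb]
        have := hij ab.1 (MvPolynomial.mem_support_iff.2 ha) ab.2
          (MvPolynomial.mem_support_iff.2 hb) (by rw [← hc, ← hab, map_add])
        rw [if_pos this.1, if_pos this.2]
      · refine (Finset.sum_eq_zero fun ab hab => ?_).symm
        rw [MvPolynomial.coeff_weightedHomogeneousComponent,
          MvPolynomial.coeff_weightedHomogeneousComponent]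
        replace hab := Finset.HasAntidiagonal.mem_antidiagonal.1 hab
        split_ifs with h1 h2
        · exact absurd (by rw [← hab, map_add, h1, h2]) hc
        all_goals simp
    rw [this]
    exact mul_ne_zero hi hj
  have eqd : ∀ i, MvPolynomial.weightedHomogeneousComponent w i (F * G) ≠ 0 → i = d := by
    intro i hi
    obtain ⟨a, ha, rfl⟩ := (aux _ _).1 hi
    exact h (MvPolynomial.mem_support_iff.1 ha)
  have hFs : F.support.Nonempty := MvPolynomial.support_nonempty.2 hF
  have hGs : G.support.Nonempty := MvPolynomial.support_nonempty.2 hG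
  obtain ⟨a, ha, haM⟩ := F.support.exists_max_image (Finsupp.weight w) hFs
  obtain ⟨a', ha', ham⟩ := F.support.exists_min_image (Finsupp.weight w) hFs
  obtain ⟨b, hb, hbM⟩ := G.support.exists_max_image (Finsupp.weight w) hGs
  obtain ⟨b', hb', hbm⟩ := G.support.exists_min_image (Finsupp.weight w) hGs
  -- The maximal degrees of the two factors add up to a degree of the product, and so do the minimal
  -- ones. Both sums equal `d`, which forces maximum and minimum to agree.
  have h1 := eqd _ (main F G (Finsupp.weight w a) (Finsupp.weight w b) ((aux _ _).2 ⟨a, ha, rfl⟩)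
    ((aux _ _).2 ⟨b, hb, rfl⟩) fun c hc c' hc' h => by
      have := haM c hc; have := hbM c' hc'; omega)
  have h2 := eqd _ (main F G (Finsupp.weight w a') (Finsupp.weight w b')
    ((aux _ _).2 ⟨a', ha', rfl⟩) ((aux _ _).2 ⟨b', hb', rfl⟩) fun c hc c' hc' h => by
      have := ham c hc; have := hbm c' hc'; omega)
  refine ⟨Finsupp.weight w a, fun c hc => ?_⟩
  have hc := MvPolynomial.mem_support_iff.2 hc
  have := haM c hc
  have := ham c hc
  have := hbM b' hb'
  have := haM a' ha'
  omega

/-- The comparison of extreme degrees needs an ordered group, so each integer coordinate of the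
grading is treated separately. -/
lemma Hom.of_mul {F G : MvPolynomial τ k} {d : ρ → ℤ} (h : Hom w (F * G) d) (hF : F ≠ 0)
    (hG : G ≠ 0) : ∃ e, Hom w F e := by
  have : ∀ i, ∃ e, F.IsWeightedHomogeneous (fun s => w s i) e := fun i =>
    isWeightedHomogeneous_of_mul (G := G) (d := d i) (fun a ha => by
      rw [← weight_comp_apply, h ha]) hF hG
  choose e he using this
  refine ⟨e, fun a ha => funext fun i => ?_⟩
  rw [weight_comp_apply, he i ha]

lemma Hom.of_dvd {F G : MvPolynomial τ k} {d : ρ → ℤ} (h : Hom w G d) (hG : G ≠ 0)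
    (hd : F ∣ G) : ∃ e, Hom w F e := by
  obtain ⟨H, rfl⟩ := hd
  exact h.of_mul (left_ne_zero_of_mul hG) (right_ne_zero_of_mul hG)

lemma Hom.of_dvd_of_degree {F G : MvPolynomial τ k} {d e : ρ → ℤ} (h : Hom w (F * G) d)
    (hF : Hom w F e) (h0 : F * G ≠ 0) : Hom w G (d - e) := by
  obtain ⟨e', he'⟩ := h.of_dvd h0 (Dvd.intro_left F rfl)
  have := (hF.mul he').degree_unique h h0
  rw [← this, add_sub_cancel_left]
  exact he'

/-! ### Zeros of polynomials -/

/-- The Nullstellensatz for an ideal over `k` and zeros in `K`. The value `Z = 0` is allowed; then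
it gives a point where a nonzero polynomial does not vanish. -/
lemma exists_aeval_ne_zero_of_not_dvd [IsAlgClosed K] [Finite τ] {Z : MvPolynomial τ k}
    (hZ : (Ideal.span {Z}).IsPrime) {f : MvPolynomial τ k} (hf : ¬ Z ∣ f) :
    ∃ q : τ → K, MvPolynomial.aeval q Z = 0 ∧ MvPolynomial.aeval q f ≠ 0 := by
  by_contra! h
  apply hf
  rw [← Ideal.mem_span_singleton,
    ← MvPolynomial.IsPrime.vanishingIdeal_zeroLocus (K := K) (Ideal.span {Z}),
    MvPolynomial.mem_vanishingIdeal_iff]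
  intro q hq
  exact h q (hq Z (Ideal.mem_span_singleton_self Z))

end Graded

/-! ## Cox presentations -/

section Cox

variable {k K : Type*} [Field k] [Field K] [Algebra k K] {ι : Type} {m : ι → Type}
variable {τ ρ : Type} [Fintype ρ]

/-- The values at `q` of the polynomials `Θ j` are homogeneous coordinates of `p`. -/
def Lifts (Θ : ∀ j, m j → MvPolynomial τ k) (q : τ → K) (p : MPt k K m) : Prop :=
  ∀ j, Represents (fun a => MvPolynomial.aeval q (Θ j a)) (p j)

/-- A presentation of `X` as the quotient of an open subset `Q` of an affine space by the torus
with weights `w`, with local sections. -/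
structure CoxPres (w : τ → ρ → ℤ) (X : Set (MPt k K m)) where
  Q : Set (τ → K)
  Θ : ∀ j, m j → MvPolynomial τ k
  δ : ι → ρ → ℤ
  hom : ∀ j a, Hom w (Θ j a) (δ j)
  isOpen : ∀ q ∈ Q, ∃ (f : MvPolynomial τ k) (d : ρ → ℤ), Hom w f d ∧ MvPolynomial.aeval q f ≠ 0 ∧
    ∀ q' : τ → K, MvPolynomial.aeval q' f ≠ 0 → q' ∈ Q
  exists_point : ∀ q ∈ Q, ∃ p ∈ X, Lifts Θ q p
  exists_lift : ∀ p ∈ X, ∃ q ∈ Q, Lifts Θ q p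
  -- The section agrees with every lift of `z` only up to the torus. Taken at `z = x`, this says
  -- that the fibres of the quotient are single torus orbits.
  exists_section : ∀ (x : X), ∀ q₀ ∈ Q, Lifts Θ q₀ x.1 → ∃ σ : X → τ → K,
    (∀ s, RegAt (fun z => σ z s) x) ∧
    ∀ᶠ z : X in 𝓝 x, ∀ q ∈ Q, Lifts Θ q z.1 → ∃ u : ρ → Kˣ, σ z = tact w u q
  -- An invertible homogeneous function of degree `d` near `q`; it makes the functions of degree `d`
  -- a line bundle on the quotient.
  exists_frame : ∀ q ∈ Q, ∀ d : ρ → ℤ, ∃ (F G : MvPolynomial τ k) (e : ρ → ℤ),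
    Hom w F (e + d) ∧ Hom w G e ∧ MvPolynomial.aeval q F ≠ 0 ∧ MvPolynomial.aeval q G ≠ 0
  -- The complement of `Q` contains no hypersurface. Hence no prime divisor is lost, and a
  -- polynomial without zeros on `Q` is constant.
  exists_zero : ∀ π : MvPolynomial τ k, Prime π → ∃ q ∈ Q, MvPolynomial.aeval q π = 0

variable {w : τ → ρ → ℤ} {X : Set (MPt k K m)}

lemma Lifts.unique {Θ : ∀ j, m j → MvPolynomial τ k} {q : τ → K} {p p' : MPt k K m}
    (h : Lifts Θ q p) (h' : Lifts Θ q p') : p = p' :=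
  funext fun j => (h j).unique (h' j)

lemma aeval_scale {F : MvPolynomial (Σ j, m j) k} {d : ι →₀ ℕ} (hF : IsMultiHom F d)
    (μ : ι → K) (y : ∀ j, m j → K) :
    MvPolynomial.aeval (fun s : Σ j, m j => μ s.1 * y s.1 s.2) F =
      (d.prod fun j e => μ j ^ e) * MvPolynomial.aeval (fun s : Σ j, m j => y s.1 s.2) F := by
  classical
  rw [MvPolynomial.aeval_def, MvPolynomial.aeval_def, MvPolynomial.eval₂_eq, MvPolynomial.eval₂_eq,
    Finset.mul_sum]
  refine Finset.sum_congr rfl fun a ha => ?_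
  have h := hF (MvPolynomial.mem_support_iff.1 ha)
  have h2 : (d.prod fun j e => μ j ^ e) = ∏ s ∈ a.support, μ s.1 ^ a s := by
    rw [← h, Finsupp.weight_apply]
    rw [Finsupp.prod_sum_index (fun _ => pow_zero _) (fun _ _ _ => pow_add _ _ _)]
    rw [Finsupp.prod]
    refine Finset.prod_congr rfl fun s _ => ?_
    simp
  rw [h2]
  simp only [mul_pow, Finset.prod_mul_distrib]
  ring

/-- The pullback of a form to the polynomial ring with variables `τ`. -/
def pull (Θ : ∀ j, m j → MvPolynomial τ k) (F : MvPolynomial (Σ j, m j) k) : MvPolynomial τ k :=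
  MvPolynomial.aeval (fun s : Σ j, m j => Θ s.1 s.2) F

lemma aeval_pull (Θ : ∀ j, m j → MvPolynomial τ k) (F : MvPolynomial (Σ j, m j) k) (q : τ → K) :
    MvPolynomial.aeval q (pull Θ F) =
      MvPolynomial.aeval (fun s : Σ j, m j => MvPolynomial.aeval q (Θ s.1 s.2)) F := by
  rw [pull, ← AlgHom.comp_apply, MvPolynomial.comp_aeval]

/-- In each factor the values of `Θ` differ from the chosen representative by a scalar, so all forms
of one multidegree are rescaled by the same constant. Vanishing and ratios of forms can therefore be
computed in Cox coordinates. -/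
lemma Lifts.exists_factor {Θ : ∀ j, m j → MvPolynomial τ k} {q : τ → K} {p : MPt k K m}
    (h : Lifts Θ q p) (d : ι →₀ ℕ) : ∃ c : K, c ≠ 0 ∧ ∀ F, IsMultiHom F d →
      MvPolynomial.aeval q (pull Θ F) = c * hval F p := by
  choose μ hμ h using h
  refine ⟨d.prod fun j e => μ j ^ e, Finset.prod_ne_zero_iff.2 fun j _ => pow_ne_zero _ (hμ j),
    fun F hF => ?_⟩
  refine Eq.trans ?_ (aeval_scale hF μ fun j => (p j).rep)
  rw [aeval_pull]
  congr 2
  funext s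
  exact congrFun (h s.1) s.2

lemma Lifts.hval_ne_iff {Θ : ∀ j, m j → MvPolynomial τ k} {q : τ → K} {p : MPt k K m}
    (h : Lifts Θ q p) {d : ι →₀ ℕ} {F} (hF : IsMultiHom F d) :
    MvPolynomial.aeval q (pull Θ F) ≠ 0 ↔ hval F p ≠ 0 := by
  obtain ⟨c, hc, h⟩ := h.exists_factor d
  rw [h F hF]
  simp [hc]

lemma Lifts.ratio {Θ : ∀ j, m j → MvPolynomial τ k} {q : τ → K} {p : MPt k K m}
    (h : Lifts Θ q p) {d : ι →₀ ℕ} {F G} (hF : IsMultiHom F d) (hG : IsMultiHom G d) :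
    MvPolynomial.aeval q (pull Θ F) / MvPolynomial.aeval q (pull Θ G) = hval F p / hval G p := by
  obtain ⟨c, hc, h⟩ := h.exists_factor d
  rw [h F hF, h G hG, mul_div_mul_left _ _ hc]

lemma hom_pull {Θ : ∀ j, m j → MvPolynomial τ k} {δ : ι → ρ → ℤ} (hom : ∀ j a, Hom w (Θ j a) (δ j))
    {F : MvPolynomial (Σ j, m j) k} {d : ι →₀ ℕ} (hF : IsMultiHom F d) :
    Hom w (pull Θ F) (d.sum fun j e => e • δ j) := by
  rw [pull, MvPolynomial.aeval_def, MvPolynomial.eval₂_eq]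
  refine Hom.sum _ fun a ha => ?_
  have h := hF (MvPolynomial.mem_support_iff.1 ha)
  have h2 : (d.sum fun j e => e • δ j) = ∑ s ∈ a.support, a s • δ s.1 := by
    rw [← h, Finsupp.weight_apply]
    rw [Finsupp.sum_sum_index (h := fun j e => e • δ j) (fun _ => zero_nsmul _)
      (fun _ _ _ => add_nsmul _ _ _)]
    rw [Finsupp.sum]
    refine Finset.sum_congr rfl fun s _ => ?_
    simp
  rw [h2]
  exact Hom.C_mul (Hom.prod _ fun s _ => (hom _ _).pow _) _

namespace CoxPres

variable (C : CoxPres w X)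

/-- The point of `X` with Cox coordinates `q`. -/
def pt (q : τ → K) (hq : q ∈ C.Q) : X :=
  ⟨Classical.choose (C.exists_point q hq), (Classical.choose_spec (C.exists_point q hq)).1⟩

lemma lifts_pt (q : τ → K) (hq : q ∈ C.Q) : Lifts C.Θ q (C.pt q hq).1 :=
  (Classical.choose_spec (C.exists_point q hq)).2

/-- Cox coordinates of a point. -/
def lift (x : X) : τ → K := Classical.choose (C.exists_lift x.1 x.2)

lemma lift_mem (x : X) : C.lift x ∈ C.Q := (Classical.choose_spec (C.exists_lift x.1 x.2)).1

lemma lifts_lift (x : X) : Lifts C.Θ (C.lift x) x.1 :=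
  (Classical.choose_spec (C.exists_lift x.1 x.2)).2

lemma eq_pt {q : τ → K} (hq : q ∈ C.Q) {x : X} (h : Lifts C.Θ q x.1) : x = C.pt q hq :=
  Subtype.ext (h.unique (C.lifts_pt q hq))

lemma tact_mem {q : τ → K} (hq : q ∈ C.Q) (u : ρ → Kˣ) : tact w u q ∈ C.Q := by
  obtain ⟨f, d, hf, hfq, h⟩ := C.isOpen q hq
  exact h _ ((hf.aeval_tact_ne u q).2 hfq)

lemma lifts_tact {q : τ → K} {p : MPt k K m} (h : Lifts C.Θ q p) (u : ρ → Kˣ) :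
    Lifts C.Θ (tact w u q) p := by
  intro j
  have := (h j).smul (Units.ne_zero (chi u (C.δ j)))
  convert this using 1
  funext a
  exact (C.hom j a).aeval_tact u q

/-- Both lifts are compared with the value of a local section at `x` itself. -/
lemma exists_tact {x : X} {q q' : τ → K} (hq : q ∈ C.Q) (hq' : q' ∈ C.Q) (h : Lifts C.Θ q x.1)
    (h' : Lifts C.Θ q' x.1) : ∃ u : ρ → Kˣ, q' = tact w u q := by
  obtain ⟨σ, -, hσ⟩ := C.exists_section x q hq h
  obtain ⟨u, hu⟩ := hσ.self_of_nhds q hq h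
  obtain ⟨u', hu'⟩ := hσ.self_of_nhds q' hq' h'
  refine ⟨u'⁻¹ * u, ?_⟩
  rw [tact_mul, ← hu, hu', tact_inv_tact]

lemma exists_tact_lift {x : X} {q : τ → K} (hq : q ∈ C.Q) (h : Lifts C.Θ q x.1) :
    ∃ u : ρ → Kˣ, q = tact w u (C.lift x) :=
  C.exists_tact (C.lift_mem x) hq (C.lifts_lift x) h

/-- The open sets upstairs. -/
lemma exists_hom_of_eventually {x : X} {P : X → Prop} (h : ∀ᶠ z in 𝓝 x, P z) :
    ∃ (f : MvPolynomial τ k) (d : ρ → ℤ), Hom w f d ∧ MvPolynomial.aeval (C.lift x) f ≠ 0 ∧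
      ∀ q : τ → K, MvPolynomial.aeval q f ≠ 0 → ∃ hq : q ∈ C.Q, P (C.pt q hq) := by
  obtain ⟨F, d, hF, hx, h⟩ := eventually_iff_hval.1 h
  obtain ⟨f, e, hf, hfx, hfQ⟩ := C.isOpen _ (C.lift_mem x)
  refine ⟨f * pull C.Θ F, _, hf.mul (hom_pull C.hom hF), ?_, fun q hq => ?_⟩
  · rw [map_mul]
    exact mul_ne_zero hfx (((C.lifts_lift x).hval_ne_iff hF).2 hx)
  · rw [map_mul] at hq
    have hqQ := hfQ q (left_ne_zero_of_mul hq)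
    exact ⟨hqQ, h _ (((C.lifts_pt q hqQ).hval_ne_iff hF).1 (right_ne_zero_of_mul hq))⟩

lemma hom_ne_of_lifts {F : MvPolynomial τ k} {d : ρ → ℤ} (hF : Hom w F d) {x : X} {q : τ → K}
    (hq : q ∈ C.Q) (h : Lifts C.Θ q x.1) :
    MvPolynomial.aeval q F ≠ 0 ↔ MvPolynomial.aeval (C.lift x) F ≠ 0 := by
  obtain ⟨u, rfl⟩ := C.exists_tact_lift hq h
  exact hF.aeval_tact_ne u _

/-- The chosen lift need not vary regularly. But the ratio is invariant under the torus, so near `x`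
the lift may be replaced by a regular local section. -/
lemma regAt_ratio {F G : MvPolynomial τ k} {d : ρ → ℤ} (hF : Hom w F d) (hG : Hom w G d) {x : X}
    (hx : MvPolynomial.aeval (C.lift x) G ≠ 0) :
    RegAt (fun z => MvPolynomial.aeval (C.lift z) F / MvPolynomial.aeval (C.lift z) G) x := by
  obtain ⟨σ, hσ, h⟩ := C.exists_section x _ (C.lift_mem x) (C.lifts_lift x)
  have hG0 : MvPolynomial.aeval (σ x) G ≠ 0 := by
    obtain ⟨u, hu⟩ := h.self_of_nhds _ (C.lift_mem x) (C.lifts_lift x)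
    rw [hu]
    exact (hG.aeval_tact_ne u _).2 hx
  refine ((RegAt.aeval hσ F).div (RegAt.aeval hσ G) hG0).congr ?_
  filter_upwards [h] with z hz
  obtain ⟨u, hu⟩ := hz _ (C.lift_mem z) (C.lifts_lift z)
  rw [hu, hF.ratio_tact hG]

lemma eventually_ne {F : MvPolynomial τ k} {d : ρ → ℤ} (hF : Hom w F d) {x : X}
    (hx : MvPolynomial.aeval (C.lift x) F ≠ 0) :
    ∀ᶠ z in 𝓝 x, MvPolynomial.aeval (C.lift z) F ≠ 0 := by
  obtain ⟨σ, hσ, h⟩ := C.exists_section x _ (C.lift_mem x) (C.lifts_lift x)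
  have hG0 : MvPolynomial.aeval (σ x) F ≠ 0 := by
    obtain ⟨u, hu⟩ := h.self_of_nhds _ (C.lift_mem x) (C.lifts_lift x)
    rw [hu]
    exact (hF.aeval_tact_ne u _).2 hx
  filter_upwards [h, (RegAt.aeval hσ F).eventually_ne hG0] with z hz hz'
  obtain ⟨u, hu⟩ := hz _ (C.lift_mem z) (C.lifts_lift z)
  rw [hu] at hz'
  exact (hF.aeval_tact_ne u _).1 hz'

/-- Regular functions are locally ratios of homogeneous polynomials in the Cox coordinates. -/
lemma regAt_iff {φ : X → K} {x : X} : RegAt φ x ↔ ∃ (F G : MvPolynomial τ k) (d : ρ → ℤ),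
    Hom w F d ∧ Hom w G d ∧ MvPolynomial.aeval (C.lift x) G ≠ 0 ∧
    ∀ᶠ z in 𝓝 x, φ z = MvPolynomial.aeval (C.lift z) F / MvPolynomial.aeval (C.lift z) G := by
  constructor
  · rintro ⟨d, F, G, hF, hG, hx, h⟩
    refine ⟨_, _, _, hom_pull C.hom hF, hom_pull C.hom hG, ((C.lifts_lift x).hval_ne_iff hG).2 hx,
      h.mono fun z hz => ?_⟩
    rw [hz, (C.lifts_lift z).ratio hF hG]
  · rintro ⟨F, G, d, hF, hG, hx, h⟩
    exact (C.regAt_ratio hF hG hx).congr h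

lemma mem_unitsAt_iff {φ : X → Kˣ} {x : X} : φ ∈ unitsAt x ↔
    ∃ (F G : MvPolynomial τ k) (d : ρ → ℤ), Hom w F d ∧ Hom w G d ∧
    MvPolynomial.aeval (C.lift x) F ≠ 0 ∧ MvPolynomial.aeval (C.lift x) G ≠ 0 ∧
    ∀ᶠ z in 𝓝 x, (φ z : K) = MvPolynomial.aeval (C.lift z) F / MvPolynomial.aeval (C.lift z) G := by
  rw [ToricLink.mem_unitsAt_iff, C.regAt_iff]
  constructor
  · rintro ⟨F, G, d, hF, hG, hx, h⟩
    refine ⟨F, G, d, hF, hG, fun h0 => (φ x).ne_zero ?_, hx, h⟩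
    have := h.self_of_nhds
    rwa [h0, zero_div] at this
  · rintro ⟨F, G, d, hF, hG, hx, hx', h⟩
    exact ⟨F, G, d, hF, hG, hx', h⟩

/-- Neighbourhoods of two points on the divisor `Z = 0` (or on `X`, if `Z = 0`) meet in the
complement of another hypersurface. -/
lemma exists_common [IsAlgClosed K] [Finite τ] {Z : MvPolynomial τ k} {e : ρ → ℤ} (hZ : Hom w Z e)
    (hp : (Ideal.span {Z}).IsPrime) {x y : X} (hx : MvPolynomial.aeval (C.lift x) Z = 0)
    (hy : MvPolynomial.aeval (C.lift y) Z = 0) {P P' : X → Prop} (h : ∀ᶠ z in 𝓝 x, P z)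
    (h' : ∀ᶠ z in 𝓝 y, P' z) {f : MvPolynomial τ k} {d : ρ → ℤ} (hf : Hom w f d) (hfZ : ¬ Z ∣ f) :
    ∃ z, P z ∧ P' z ∧ MvPolynomial.aeval (C.lift z) Z = 0 ∧ MvPolynomial.aeval (C.lift z) f ≠ 0 := by
  obtain ⟨g, _, -, hgx, hg⟩ := C.exists_hom_of_eventually h
  obtain ⟨g', _, -, hgx', hg'⟩ := C.exists_hom_of_eventually h'
  have h1 : ¬ Z ∣ g := by
    rintro ⟨c, rfl⟩
    simp [hx] at hgx
  have h2 : ¬ Z ∣ g' := by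
    rintro ⟨c, rfl⟩
    simp [hy] at hgx'
  have h3 : ¬ Z ∣ g * g' * f := by
    intro h
    rw [← Ideal.mem_span_singleton] at h h1 h2 hfZ
    rcases hp.mem_or_mem h with h | h
    · exact (hp.mem_or_mem h).elim h1 h2
    · exact hfZ h
  -- The nonvanishing of `g` and `g'` puts the point into the two neighbourhoods. None of `g`, `g'`,
  -- `f` is divisible by the prime `Z`, so one point of `Z = 0` serves for all three.
  obtain ⟨q, hqZ, hq⟩ := exists_aeval_ne_zero_of_not_dvd (K := K) hp h3
  rw [map_mul, map_mul] at hq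
  obtain ⟨hqQ, hP⟩ := hg q (left_ne_zero_of_mul (left_ne_zero_of_mul hq))
  obtain ⟨_, hP'⟩ := hg' q (right_ne_zero_of_mul (left_ne_zero_of_mul hq))
  refine ⟨C.pt q hqQ, hP, hP', ?_, ?_⟩
  · by_contra h0
    exact ((C.hom_ne_of_lifts hZ hqQ (C.lifts_pt q hqQ)).2 h0) hqZ
  · exact (C.hom_ne_of_lifts hf hqQ (C.lifts_pt q hqQ)).1 (right_ne_zero_of_mul hq)

/-- The case `Z = 0`: nonempty open subsets of the quotient always meet, even outside a
hypersurface. -/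
lemma exists_common_bot [IsAlgClosed K] [Finite τ] {x y : X} {P P' : X → Prop}
    (h : ∀ᶠ z in 𝓝 x, P z) (h' : ∀ᶠ z in 𝓝 y, P' z) {f : MvPolynomial τ k} {d : ρ → ℤ}
    (hf : Hom w f d) (hf0 : f ≠ 0) :
    ∃ z, P z ∧ P' z ∧ MvPolynomial.aeval (C.lift z) f ≠ 0 := by
  obtain ⟨z, h1, h2, -, h3⟩ := C.exists_common (Z := 0) (hom_zero 0)
    (by rw [Ideal.span_singleton_zero]; exact Ideal.isPrime_bot) (map_zero _) (map_zero _)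
    h h' hf (by simpa using hf0)
  exact ⟨z, h1, h2, h3⟩

/-- Ratios of homogeneous polynomials that agree on a nonempty open set are equal. -/
lemma mul_eq_mul_of_eventually [IsAlgClosed K] [Finite τ] {x : X} {F G F' G' : MvPolynomial τ k}
    {d d' : ρ → ℤ} (hF : Hom w F d) (hG : Hom w G d) (hF' : Hom w F' d') (hG' : Hom w G' d')
    (hx : MvPolynomial.aeval (C.lift x) G ≠ 0) (hx' : MvPolynomial.aeval (C.lift x) G' ≠ 0)
    (h : ∀ᶠ z in 𝓝 x, MvPolynomial.aeval (C.lift z) F / MvPolynomial.aeval (C.lift z) G =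
      MvPolynomial.aeval (C.lift z) F' / MvPolynomial.aeval (C.lift z) G') :
    F * G' = F' * G := by
  by_contra h0
  obtain ⟨z, ⟨h1, h2⟩, h3, h4⟩ := C.exists_common_bot (h.and (C.eventually_ne hG hx))
    (C.eventually_ne hG' hx') ((hF.mul hG').sub (by
      have := hF'.mul hG
      rwa [add_comm] at this)) (sub_ne_zero.2 h0)
  apply h4
  rw [map_sub, map_mul, map_mul, sub_eq_zero]
  exact (div_eq_div_iff h2 h3).1 h1

end CoxPres

end Cox

section Cox

variable {k K : Type*} [Field k] [Field K] [Algebra k K] {ι : Type} {m : ι → Type}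
variable {τ ρ : Type} [Fintype ρ] {w : τ → ρ → ℤ} {X : Set (MPt k K m)}

/-! ### Codimension -/

namespace CoxPres

variable (C : CoxPres w X)

/-- The zero locus of `Z`. -/
def zero (Z : MvPolynomial τ k) : Set X := {z | MvPolynomial.aeval (C.lift z) Z = 0}

lemma isClosed_zero {Z : MvPolynomial τ k} {e : ρ → ℤ} (hZ : Hom w Z e) :
    IsClosed (C.zero Z) := by
  rw [← isOpen_compl_iff, isOpen_iff_mem_nhds]
  exact fun x hx => C.eventually_ne hZ hx

/-- A hypersurface contains the closure of its subsets. -/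
lemma mem_zero_of_mem_closure {Z : MvPolynomial τ k} {e : ρ → ℤ} (hZ : Hom w Z e)
    {S : Set (MPt k K m)} (hSX : S ⊆ X) (hS : ∀ x : X, x.1 ∈ S → x ∈ C.zero Z) {x : X}
    (hx : x.1 ∈ closure S) : x ∈ C.zero Z := by
  have h : closure ((↑) ⁻¹' S : Set X) ⊆ C.zero Z := closure_minimal hS (C.isClosed_zero hZ)
  refine h (closure_subtype.2 ?_)
  rwa [Subtype.image_preimage_coe, Set.inter_eq_right.2 hSX]

lemma exists_mem_zero {Z : MvPolynomial τ k} {e : ρ → ℤ} (hZ : Hom w Z e) (hp : Prime Z) :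
    ∃ x, x ∈ C.zero Z := by
  obtain ⟨q, hq, h⟩ := C.exists_zero Z hp
  refine ⟨C.pt q hq, ?_⟩
  by_contra h0
  exact (C.hom_ne_of_lifts hZ hq (C.lifts_pt q hq)).2 h0 h

variable [IsAlgClosed K] [Finite τ]

lemma isIrreducible_zero {Z : MvPolynomial τ k} {e : ρ → ℤ} (hZ : Hom w Z e)
    (hp : (Ideal.span {Z}).IsPrime) (hne : (C.zero Z).Nonempty) : IsIrreducible (C.zero Z) := by
  refine ⟨hne, ?_⟩
  rintro u v hu hv ⟨x, hx, hxu⟩ ⟨y, hy, hyv⟩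
  obtain ⟨z, h1, h2, h3, -⟩ := C.exists_common hZ hp hx hy (hu.mem_nhds hxu) (hv.mem_nhds hyv)
    hom_one (fun h => hp.ne_top (Ideal.span_singleton_eq_top.2 (isUnit_of_dvd_one h)))
  exact ⟨z, h3, h1, h2⟩

/-- A prime divisor. -/
def divisor {Z : MvPolynomial τ k} {e : ρ → ℤ} (hZ : Hom w Z e) (hp : Prime Z) :
    TopologicalSpace.IrreducibleCloseds X where
  carrier := C.zero Z
  isIrreducible' := C.isIrreducible_zero hZ ((Ideal.span_singleton_prime hp.ne_zero).2 hp)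
    (C.exists_mem_zero hZ hp)
  isClosed' := C.isClosed_zero hZ

lemma isIrreducible_univ (C : CoxPres w X) [Nonempty X] : IsIrreducible (Set.univ : Set X) := by
  have h := C.isIrreducible_zero (Z := 0) (hom_zero 0)
    (by rw [Ideal.span_singleton_zero]; exact Ideal.isPrime_bot)
    ⟨Classical.arbitrary X, map_zero _⟩
  convert h using 1
  exact (Set.eq_univ_of_forall fun x => map_zero _).symm

/-- The whole space. -/
def whole (C : CoxPres w X) [Nonempty X] : TopologicalSpace.IrreducibleCloseds X where
  carrier := Set.univ
  isIrreducible' := C.isIrreducible_univ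
  isClosed' := isClosed_univ

lemma coheight_whole [Nonempty X] : Order.coheight C.whole = 0 := by
  rw [Order.coheight_eq_zero]
  intro W _ x _
  exact Set.mem_univ x

/-- The divisor minus a hypersurface not containing it is dense in the divisor, hence so is every
set lying in between. -/
lemma closure_eq_zero {Z f : MvPolynomial τ k} {e d : ρ → ℤ} (hZ : Hom w Z e)
    (hp : (Ideal.span {Z}).IsPrime) (hf : Hom w f d) (hfZ : ¬ Z ∣ f) {O : Set (MPt k K m)}
    (hO : ∀ x : X, x.1 ∈ O → x ∈ C.zero Z)
    (hO' : ∀ x ∈ C.zero Z, MvPolynomial.aeval (C.lift x) f ≠ 0 → x.1 ∈ O) :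
    closure ((↑) ⁻¹' O : Set X) = C.zero Z := by
  apply subset_antisymm
  · exact closure_minimal (hO) (C.isClosed_zero hZ)
  · intro x hx
    rw [mem_closure_iff_nhds]
    intro t ht
    obtain ⟨z, h1, -, h3, h4⟩ := C.exists_common hZ hp hx hx ht ht hf hfZ
    exact ⟨z, h1, hO' z h3 h4⟩

lemma divisor_lt_whole [Nonempty X] {Z : MvPolynomial τ k} {e : ρ → ℤ} (hZ : Hom w Z e)
    (hp : Prime Z) : C.divisor hZ hp < C.whole := by
  refine lt_of_le_of_ne (fun x _ => Set.mem_univ x) fun h => ?_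
  obtain ⟨z, -, -, hz⟩ := C.exists_common_bot (x := Classical.arbitrary X)
    (y := Classical.arbitrary X) (P := fun _ => True) (P' := fun _ => True) (by simp) (by simp)
    hZ hp.ne_zero
  have : z ∈ C.divisor hZ hp := by
    rw [h]
    exact Set.mem_univ z
  exact hz this

/-- If `W` were proper, some nonzero homogeneous `f` would vanish on it. Write `f = Z ^ m * g` with
`g` prime to `Z`. By irreducibility `W` lies in `Z = 0`, against strictness, or in `g = 0`; but `g`
does not vanish on the whole divisor contained in `W`. -/
lemma eq_whole_of_divisor_lt [Nonempty X] {Z : MvPolynomial τ k} {e : ρ → ℤ} (hZ : Hom w Z e)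
    (hp : Prime Z) {W : TopologicalSpace.IrreducibleCloseds X} (h : C.divisor hZ hp < W) :
    W = C.whole := by
  by_contra hW
  have : ∃ x, x ∉ W := by
    by_contra! h'
    exact hW (SetLike.ext fun x => ⟨fun _ => Set.mem_univ x, fun _ => h' x⟩)
  obtain ⟨x, hx⟩ := this
  obtain ⟨f, d, hf, hfx, hfW⟩ := C.exists_hom_of_eventually (W.isClosed.isOpen_compl.mem_nhds hx)
  have hf0 : f ≠ 0 := by
    rintro rfl
    simp at hfx
  have hWf : ∀ z ∈ W, MvPolynomial.aeval (C.lift z) f = 0 := by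
    intro z hz
    by_contra h0
    obtain ⟨hq, h1⟩ := hfW _ h0
    rw [← C.eq_pt hq (C.lifts_lift z)] at h1
    exact h1 hz
  obtain ⟨g, hfg, hg⟩ := (FiniteMultiplicity.of_prime_left hp hf0).exists_eq_pow_mul_and_not_dvd
  obtain ⟨d', hg'⟩ := hf.of_dvd hf0 (Dvd.intro_left _ hfg.symm)
  have hsub := isPreirreducible_iff_isClosed_union_isClosed.1 W.isIrreducible.isPreirreducible
    _ _ (C.isClosed_zero hZ) (C.isClosed_zero hg') (by
      intro z hz
      have := hWf z hz
      rw [hfg, map_mul, map_pow, mul_eq_zero] at this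
      exact this.imp eq_zero_of_pow_eq_zero id)
  rcases hsub with h1 | h1
  · exact absurd (show W ≤ C.divisor hZ hp from h1) h.not_ge
  · obtain ⟨y, hy⟩ := C.exists_mem_zero hZ hp
    obtain ⟨z, -, -, hz, hz'⟩ := C.exists_common hZ ((Ideal.span_singleton_prime hp.ne_zero).2 hp)
      hy hy (P := fun _ => True) (P' := fun _ => True) (by simp) (by simp) hg' hg
    exact hz' (h1 (h.le hz))

lemma coheight_divisor [Nonempty X] {Z : MvPolynomial τ k} {e : ρ → ℤ} (hZ : Hom w Z e)
    (hp : Prime Z) : Order.coheight (C.divisor hZ hp) = 1 := by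
  apply le_antisymm
  · have := (Order.coheight_le_coe_iff (x := C.divisor hZ hp) (n := 1)).2 fun y hy => by
      rw [C.eq_whole_of_divisor_lt hZ hp hy, C.coheight_whole]
      exact Nat.cast_pos.2 one_pos
    simpa using this
  · have := Order.coheight_add_one_le (C.divisor_lt_whole hZ hp)
    rwa [C.coheight_whole, zero_add] at this

lemma hasCodim_one {Z f : MvPolynomial τ k} {e d : ρ → ℤ} (hZ : Hom w Z e) (hp : Prime Z)
    (hf : Hom w f d) (hfZ : ¬ Z ∣ f) {O : Set (MPt k K m)}
    (hO : ∀ x : X, x.1 ∈ O → x ∈ C.zero Z)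
    (hO' : ∀ x ∈ C.zero Z, MvPolynomial.aeval (C.lift x) f ≠ 0 → x.1 ∈ O) :
    HasCodim X O 1 := by
  have : Nonempty X := ⟨(C.exists_mem_zero hZ hp).choose⟩
  exact ⟨C.divisor hZ hp, (C.closure_eq_zero hZ
    ((Ideal.span_singleton_prime hp.ne_zero).2 hp) hf hfZ hO hO').symm, C.coheight_divisor hZ hp⟩

lemma hasCodim_zero [Nonempty X] {f : MvPolynomial τ k} {d : ρ → ℤ} (hf : Hom w f d) (hf0 : f ≠ 0)
    {O : Set (MPt k K m)} (hO : ∀ x : X, MvPolynomial.aeval (C.lift x) f ≠ 0 → x.1 ∈ O) :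
    HasCodim X O 0 := by
  refine ⟨C.whole, ?_, C.coheight_whole⟩
  rw [C.closure_eq_zero (Z := 0) (hom_zero 0)
    (by rw [Ideal.span_singleton_zero]; exact Ideal.isPrime_bot) hf (by simpa using hf0)
    (fun x _ => map_zero _) fun x _ => hO x]
  exact (Set.eq_univ_of_forall fun x => map_zero _).symm

/-- A subset has codimension at least two if it is covered by finitely many intersections of a
prime divisor with a hypersurface that does not contain it. -/
lemma codimComplGeTwo [Nonempty X] {α : Type} [Finite α] {Z Z' : α → MvPolynomial τ k}
    {e e' : α → ρ → ℤ} (hZ : ∀ a, Hom w (Z a) (e a)) (hZ' : ∀ a, Hom w (Z' a) (e' a))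
    (hp : ∀ a, Prime (Z a)) (hd : ∀ a, ¬ Z a ∣ Z' a) {U : Set (MPt k K m)}
    (hU : ∀ x : X, x.1 ∉ U → ∃ a, x ∈ C.zero (Z a) ∧ x ∈ C.zero (Z' a)) :
    CodimComplGeTwo X U := by
  intro W hW
  have := Fintype.ofFinite α
  classical
  obtain ⟨t, ht, hWt⟩ := isIrreducible_iff_sUnion_isClosed.1 W.isIrreducible
    (Finset.univ.image fun a => C.zero (Z a) ∩ C.zero (Z' a)) (by
      intro t ht
      obtain ⟨a, -, rfl⟩ := Finset.mem_image.1 ht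
      exact (C.isClosed_zero (hZ a)).inter (C.isClosed_zero (hZ' a))) (by
      intro x hx
      obtain ⟨a, ha⟩ := hU x (hW x hx)
      exact ⟨_, Finset.mem_coe.2 (Finset.mem_image_of_mem _ (Finset.mem_univ a)), ha⟩)
  obtain ⟨a, -, rfl⟩ := Finset.mem_image.1 ht
  -- The divisor is not contained in the hypersurface `Z' a = 0`, while `W` is, so the inclusion is
  -- strict and the coheight exceeds that of the divisor.
  have h1 : W < C.divisor (hZ a) (hp a) := by
    refine lt_of_le_of_ne (fun x hx => (hWt hx).1) ?_
    rintro rfl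
    obtain ⟨y, hy⟩ := C.exists_mem_zero (hZ a) (hp a)
    obtain ⟨z, -, -, hz, hz'⟩ := C.exists_common (hZ a)
      ((Ideal.span_singleton_prime (hp a).ne_zero).2 (hp a))
      hy hy (P := fun _ => True) (P' := fun _ => True) (by simp) (by simp) (hZ' a) (hd a)
    exact hz' (hWt hz).2
  have h2 := Order.coheight_add_one_le h1
  rw [C.coheight_divisor] at h2
  exact le_trans (by norm_num) h2

end CoxPres

end Cox

section Comparison

variable {k K : Type*} [Field k] [Field K] [Algebra k K]
variable {ι ι' : Type} {m : ι → Type} {m' : ι' → Type}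
variable {τ ρ : Type} [Fintype ρ] {w : τ → ρ → ℤ} {X : Set (MPt k K m)} {X' : Set (MPt k K m')}

/-! ### Comparison of two quotients by the same torus -/

/-- `V` is invariant under the torus. -/
def TorusInvariant (w : τ → ρ → ℤ) (V : Set (τ → K)) : Prop :=
  ∀ q ∈ V, ∀ u : ρ → Kˣ, tact w u q ∈ V

variable (k) in
/-- `V` is a union of nonvanishing loci of homogeneous polynomials. -/
def HomOpen (w : τ → ρ → ℤ) (V : Set (τ → K)) : Prop :=
  ∀ q ∈ V, ∃ (f : MvPolynomial τ k) (d : ρ → ℤ), Hom w f d ∧ MvPolynomial.aeval q f ≠ 0 ∧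
    ∀ q' : τ → K, MvPolynomial.aeval q' f ≠ 0 → q' ∈ V

lemma HomOpen.torusInvariant {V : Set (τ → K)} (h : HomOpen k w V) : TorusInvariant w V := by
  intro q hq u
  obtain ⟨f, d, hf, hfq, h⟩ := h q hq
  exact h _ ((hf.aeval_tact_ne u q).2 hfq)

lemma HomOpen.inter {V W : Set (τ → K)} (hV : HomOpen k w V) (hW : HomOpen k w W) :
    HomOpen k w (V ∩ W) := by
  rintro q ⟨h1, h2⟩
  obtain ⟨f, d, hf, hfq, h⟩ := hV q h1
  obtain ⟨f', d', hf', hfq', h'⟩ := hW q h2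
  refine ⟨f * f', _, hf.mul hf', by rw [map_mul]; exact mul_ne_zero hfq hfq', fun q' hq' => ?_⟩
  rw [map_mul] at hq'
  exact ⟨h q' (left_ne_zero_of_mul hq'), h' q' (right_ne_zero_of_mul hq')⟩

lemma HomOpen.union {V W : Set (τ → K)} (hV : HomOpen k w V) (hW : HomOpen k w W) :
    HomOpen k w (V ∪ W) := by
  rintro q (h | h)
  · obtain ⟨f, d, hf, hfq, h⟩ := hV q h
    exact ⟨f, d, hf, hfq, fun q' hq' => Or.inl (h q' hq')⟩
  · obtain ⟨f, d, hf, hfq, h⟩ := hW q h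
    exact ⟨f, d, hf, hfq, fun q' hq' => Or.inr (h q' hq')⟩

lemma HomOpen.iUnion {α : Type*} {V : α → Set (τ → K)} (hV : ∀ a, HomOpen k w (V a)) :
    HomOpen k w (⋃ a, V a) := by
  intro q hq
  obtain ⟨a, ha⟩ := Set.mem_iUnion.1 hq
  obtain ⟨f, d, hf, hfq, h⟩ := hV a q ha
  exact ⟨f, d, hf, hfq, fun q' hq' => Set.mem_iUnion.2 ⟨a, h q' hq'⟩⟩

lemma HomOpen.iInter {α : Type*} [Finite α] {V : α → Set (τ → K)} (hV : ∀ a, HomOpen k w (V a)) :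
    HomOpen k w (⋂ a, V a) := by
  have := Fintype.ofFinite α
  intro q hq
  rw [Set.mem_iInter] at hq
  choose f d hf hfq h using fun a => hV a q (hq a)
  refine ⟨∏ a, f a, _, Hom.prod _ fun a _ => hf a, ?_, fun q' hq' => Set.mem_iInter.2 fun a => ?_⟩
  · rw [map_prod]
    exact Finset.prod_ne_zero_iff.2 fun a _ => hfq a
  · rw [map_prod] at hq'
    exact h a q' (Finset.prod_ne_zero_iff.1 hq' a (Finset.mem_univ a))

lemma homOpen_ne {f : MvPolynomial τ k} {d : ρ → ℤ} (hf : Hom w f d) :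
    HomOpen k w {q : τ → K | MvPolynomial.aeval q f ≠ 0} :=
  fun _ hq => ⟨f, d, hf, hq, fun _ h => h⟩

lemma homOpen_X_ne (s : τ) : HomOpen k w {q : τ → K | q s ≠ 0} := by
  simpa using homOpen_ne (k := k) (K := K) (hom_X (w := w) (k := k) s)

namespace CoxPres

variable (C : CoxPres w X) (C' : CoxPres w X')

/-- The image of `V` in the quotient. -/
def img (V : Set (τ → K)) : Set (MPt k K m) := {p | ∃ q ∈ V, q ∈ C.Q ∧ Lifts C.Θ q p}

lemma img_subset (V : Set (τ → K)) : C.img V ⊆ X := by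
  rintro p ⟨q, -, hq, h⟩
  obtain ⟨p', hp', h'⟩ := C.exists_point q hq
  rwa [h.unique h']

variable {C} in
lemma mem_img_iff {V : Set (τ → K)} (hV : TorusInvariant w V) {x : X} :
    x.1 ∈ C.img V ↔ C.lift x ∈ V := by
  constructor
  · rintro ⟨q, hqV, hq, h⟩
    obtain ⟨u, hu⟩ := C.exists_tact hq (C.lift_mem x) h (C.lifts_lift x)
    rw [hu]
    exact hV q hqV u
  · exact fun h => ⟨_, h, C.lift_mem x, C.lifts_lift x⟩

lemma mem_of_mem_img {V : Set (τ → K)} (hV : TorusInvariant w V) {x : MPt k K m}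
    (hx : x ∈ C.img V) {q : τ → K} (hq : q ∈ C.Q) (h : Lifts C.Θ q x) : q ∈ V := by
  obtain ⟨q', hqV, hq', h'⟩ := hx
  obtain ⟨u, hu⟩ := C.exists_tact (x := ⟨x, C.img_subset V ⟨q', hqV, hq', h'⟩⟩) hq' hq h' h
  rw [hu]
  exact hV q' hqV u

lemma isOpen_img {V : Set (τ → K)} (hV : HomOpen k w V) :
    IsOpen ((↑) ⁻¹' C.img V : Set X) := by
  rw [isOpen_iff_mem_nhds]
  intro x hx
  obtain ⟨f, d, hf, hfq, h⟩ := hV _ ((mem_img_iff hV.torusInvariant).1 hx)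
  exact (C.eventually_ne hf hfq).mono fun z hz => (mem_img_iff hV.torusInvariant).2 (h _ hz)

variable {C C'} in
-- Near a point the map is a regular local section of the first quotient followed by the homogeneous
-- coordinates of the second; a common denominator turns the components into forms.
lemma isRegularMap_of_lifts [∀ j, Finite (m' j)] {V : Set (τ → K)} (hV : TorusInvariant w V)
    (f : C.img V → C'.img V)
    (hf : ∀ (z : C.img V), ∀ q ∈ V, q ∈ C.Q → Lifts C.Θ q z.1 → Lifts C'.Θ q (f z).1) :
    IsRegularMap f := by
  intro x j
  set y : X := ⟨x.1, C.img_subset V x.2⟩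
  obtain ⟨σ, hσ, h⟩ := C.exists_section y _ (C.lift_mem y) (C.lifts_lift y)
  obtain ⟨d, F, G, hF, hG, hGx, hφ⟩ := RegAt.exists_common_denominator
    (φ := fun a z => MvPolynomial.aeval (σ z) (C'.Θ j a)) (x := y) fun a => RegAt.aeval hσ _
  have hc : Continuous (fun z : C.img V => (⟨z.1, C.img_subset V z.2⟩ : X)) :=
    Continuous.subtype_mk continuous_subtype_val _
  have key : ∀ᶠ z : C.img V in 𝓝 x, Represents (fun a => hval (F a) z.1) ((f z).1 j) := by
    have h1 := (hc.continuousAt (x := x)).eventually (h.and (hφ.and (eventually_hval_ne hG hGx)))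
    filter_upwards [h1] with z ⟨hz1, hz2, hz3⟩
    set y' : X := ⟨z.1, C.img_subset V z.2⟩
    obtain ⟨u, hu⟩ := hz1 _ (C.lift_mem y') (C.lifts_lift y')
    have h2 : Lifts C.Θ (σ y') z.1 := by
      rw [hu]
      exact C.lifts_tact (C.lifts_lift y') u
    have h3 : σ y' ∈ C.Q := by
      rw [hu]
      exact C.tact_mem (C.lift_mem y') u
    have h4 := hf z _ (C.mem_of_mem_img hV z.2 h3 h2) h3 h2 j
    convert h4.smul hz3 using 1
    funext a
    simp only [Pi.smul_apply, smul_eq_mul]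
    rw [hz2 a, mul_div_cancel₀ _ hz3]
  refine ⟨d, F, hF, ?_, key⟩
  obtain ⟨a, ha⟩ := Function.ne_iff.1 key.self_of_nhds.ne_zero
  exact ⟨a, ha⟩

variable {V : Set (τ → K)} (hV : TorusInvariant w V) (h : V ⊆ C.Q) (h' : V ⊆ C'.Q)

/-- The map between the images of `V` in two quotients. -/
def trans (z : C.img V) : C'.img V :=
  let y : X := ⟨z.1, C.img_subset V z.2⟩
  have hy : C.lift y ∈ V := (mem_img_iff hV).1 z.2
  ⟨(C'.pt (C.lift y) (h' hy)).1, C.lift y, hy, h' hy, C'.lifts_pt _ _⟩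

lemma lifts_trans (z : C.img V) {q : τ → K} (hqV : q ∈ V) (hq : q ∈ C.Q)
    (hz : Lifts C.Θ q z.1) : Lifts C'.Θ q (C.trans C' hV h' z).1 := by
  let y : X := ⟨z.1, C.img_subset V z.2⟩
  have hy : C.lift y ∈ V := (mem_img_iff hV).1 z.2
  obtain ⟨u, rfl⟩ := C.exists_tact_lift (x := y) hq hz
  exact C'.lifts_tact (C'.lifts_pt _ (h' hy)) u

lemma trans_trans (z : C.img V) : C'.trans C hV h (C.trans C' hV h' z) = z := by
  obtain ⟨q, hqV, hq, hz⟩ := z.2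
  have h1 := C.lifts_trans C' hV h' z hqV hq hz
  have h2 := C'.lifts_trans C hV h _ hqV (h' hqV) h1
  exact Subtype.ext (h2.unique hz)

variable [∀ j, Finite (m j)] [∀ j, Finite (m' j)]

/-- The isomorphism between the images of `V` in two quotients. -/
def isoOf : VarIso (C.img V) (C'.img V) where
  toFun := C.trans C' hV h'
  invFun := C'.trans C hV h
  left_inv := C.trans_trans C' hV h h'
  right_inv := C'.trans_trans C hV h' h
  regular := isRegularMap_of_lifts hV _ fun z _ hqV hq hz => C.lifts_trans C' hV h' z hqV hq hz
  regular_symm := isRegularMap_of_lifts hV _ fun z _ hqV hq hz =>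
    C'.lifts_trans C hV h z hqV hq hz

/-- The small birational isomorphism between two quotients by the same torus. -/
def smallBirIso (hVo : HomOpen k w V) (h : V ⊆ C.Q) (h' : V ⊆ C'.Q)
    (hc : CodimComplGeTwo X (C.img V)) (hc' : CodimComplGeTwo X' (C'.img V)) :
    SmallBirIso X X' where
  dom := C.img V
  cod := C'.img V
  dom_subset := C.img_subset V
  cod_subset := C'.img_subset V
  isOpen_dom := C.isOpen_img hVo
  isOpen_cod := C'.isOpen_img hVo
  codim_dom := hc
  codim_cod := hc'
  iso := C.isoOf C' hVo.torusInvariant h h'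

lemma lifts_smallBirIso (hVo : HomOpen k w V) (h : V ⊆ C.Q) (h' : V ⊆ C'.Q)
    (hc : CodimComplGeTwo X (C.img V)) (hc' : CodimComplGeTwo X' (C'.img V))
    (z : (C.smallBirIso C' hVo h h' hc hc').dom) {q : τ → K} (hqV : q ∈ V)
    (hz : Lifts C.Θ q z.1) :
    Lifts C'.Θ q ((C.smallBirIso C' hVo h h' hc hc').iso.toEquiv z).1 :=
  C.lifts_trans C' hVo.torusInvariant h' z hqV (h hqV) hz

lemma smallBirIso_inducesIso (hVo : HomOpen k w V) (h : V ⊆ C.Q) (h' : V ⊆ C'.Q)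
    (hc : CodimComplGeTwo X (C.img V)) (hc' : CodimComplGeTwo X' (C'.img V)) {V₁ : Set (τ → K)}
    (hV₁ : TorusInvariant w V₁) (hsub : V₁ ⊆ V) :
    (C.smallBirIso C' hVo h h' hc hc').InducesIso (C.img V₁) (C'.img V₁) := by
  refine ⟨fun p ⟨q, hq, hq'⟩ => ⟨q, hsub hq, hq'⟩,
    C.isoOf C' hV₁ (hsub.trans h) (hsub.trans h'), fun x => ?_⟩
  obtain ⟨q, hqV, hq, hz⟩ := x.2
  exact (C.lifts_trans C' hV₁ (hsub.trans h') x hqV hq hz).unique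
    (C.lifts_trans C' hVo.torusInvariant h' ⟨x.1, q, hsub hqV, hq, hz⟩ (hsub hqV) hq hz)

end CoxPres

end Comparison

/-! ### Factoriality -/

section Factorial

variable {k K : Type*} [Field k] [Field K] [Algebra k K] {τ ρ : Type} [Fintype ρ]
variable {w : τ → ρ → ℤ}

/-- The factors `c` and `d` are invertible at the generic point of `π`, so `b / a` and `b' / a'`
have the same order along `π`. -/
lemma multiplicity_eq_of_mul_eq {a b a' b' c d π : MvPolynomial τ k} (hπ : Prime π) (ha : a ≠ 0)
    (hb : b ≠ 0) (ha' : a' ≠ 0) (hb' : b' ≠ 0) (hc : ¬ π ∣ c) (hd : ¬ π ∣ d)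
    (h : c * b * a' = d * a * b') :
    multiplicity π b + multiplicity π a' = multiplicity π a + multiplicity π b' := by
  have hc0 : c ≠ 0 := fun h => hc (h ▸ dvd_zero _)
  have hd0 : d ≠ 0 := fun h => hd (h ▸ dvd_zero _)
  have h1 := congrArg (multiplicity π) h
  have fin : ∀ x : MvPolynomial τ k, x ≠ 0 → FiniteMultiplicity π x := fun x hx =>
    FiniteMultiplicity.of_prime_left hπ hx
  rw [multiplicity_mul hπ (fin _ (by simp [hc0, hb, ha'])), multiplicity_mul hπ (fin _ (by simp [hc0, hb])),
    multiplicity_mul hπ (fin _ (by simp [hd0, ha, hb'])), multiplicity_mul hπ (fin _ (by simp [hd0, ha])),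
    multiplicity_eq_zero.2 hc, multiplicity_eq_zero.2 hd] at h1
  omega

lemma exists_prime_factor_of_aeval_eq_zero {A : MvPolynomial τ k} (hA : A ≠ 0) {q : τ → K}
    (hq : MvPolynomial.aeval q A = 0) :
    ∃ π, Prime π ∧ π ∣ A ∧ MvPolynomial.aeval q π = 0 := by
  have h := UniqueFactorizationMonoid.factors_prod hA
  have h0 : MvPolynomial.aeval q (UniqueFactorizationMonoid.factors A).prod = 0 := by
    obtain ⟨u, hu⟩ := h
    have : MvPolynomial.aeval q (UniqueFactorizationMonoid.factors A).prod *
        MvPolynomial.aeval q (u : MvPolynomial τ k) = 0 := by rw [← map_mul, hu, hq]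
    refine (mul_eq_zero.1 this).resolve_right ?_
    exact (u.isUnit.map (MvPolynomial.aeval q)).ne_zero
  rw [map_multiset_prod, Multiset.prod_eq_zero_iff, Multiset.mem_map] at h0
  obtain ⟨π, hπ, hπq⟩ := h0
  exact ⟨π, UniqueFactorizationMonoid.prime_of_factor π hπ,
    UniqueFactorizationMonoid.dvd_of_mem_factors hπ, hπq⟩

/-- Two polynomials with the same multiplicities along all primes through `q` differ by a local
unit at `q`. -/
lemma exists_local_unit {A B : MvPolynomial τ k} {d d' : ρ → ℤ} (hA : Hom w A d) (hB : Hom w B d')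
    (hA0 : A ≠ 0) (hB0 : B ≠ 0) {q : τ → K}
    (h : ∀ (π : MvPolynomial τ k) (e : ρ → ℤ), Hom w π e → Prime π → MvPolynomial.aeval q π = 0 →
      multiplicity π A = multiplicity π B) :
    ∃ (C D : MvPolynomial τ k) (e e' : ρ → ℤ), Hom w C e ∧ Hom w D e' ∧
      MvPolynomial.aeval q C ≠ 0 ∧ MvPolynomial.aeval q D ≠ 0 ∧ C * A = D * B := by
  -- After cancelling the common factor, `A'` and `B'` are coprime and still have equal
  -- multiplicities along the homogeneous primes through `q`. So no prime factor of either vanishes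
  -- at `q`, and they are themselves the local units sought.
  obtain ⟨A', B', c, hrel, rfl, rfl⟩ := UniqueFactorizationMonoid.exists_reduced_factors A hA0 B
  have hc0 := left_ne_zero_of_mul hA0
  have hA'0 := right_ne_zero_of_mul hA0
  have hB'0 := right_ne_zero_of_mul hB0
  obtain ⟨e', he'⟩ := hA.of_dvd hA0 (Dvd.intro_left c rfl)
  obtain ⟨e, he⟩ := hB.of_dvd hB0 (Dvd.intro_left c rfl)
  have key : ∀ (π : MvPolynomial τ k) (e : ρ → ℤ), Hom w π e → Prime π →
      MvPolynomial.aeval q π = 0 → multiplicity π A' = multiplicity π B' := by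
    intro π e hπ hp hq
    have := h π e hπ hp hq
    rw [multiplicity_mul hp (FiniteMultiplicity.of_prime_left hp hA0),
      multiplicity_mul hp (FiniteMultiplicity.of_prime_left hp hB0)] at this
    omega
  refine ⟨B', A', e, e', he, he', fun h0 => ?_, fun h0 => ?_, by ring⟩
  · obtain ⟨π, hp, hd, hq⟩ := exists_prime_factor_of_aeval_eq_zero hB'0 h0
    obtain ⟨g, hg⟩ := he.of_dvd hB'0 hd
    refine hp.not_isUnit (hrel ?_ hd)
    by_contra hd'
    have := key π g hg hp hq
    rw [multiplicity_eq_zero.2 hd'] at this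
    exact multiplicity_ne_zero.2 hd this.symm
  · obtain ⟨π, hp, hd, hq⟩ := exists_prime_factor_of_aeval_eq_zero hA'0 h0
    obtain ⟨g, hg⟩ := he'.of_dvd hA'0 hd
    refine hp.not_isUnit (hrel hd ?_)
    by_contra hd'
    have := key π g hg hp hq
    rw [multiplicity_eq_zero.2 hd'] at this
    exact multiplicity_ne_zero.2 hd this

/-- The last hypothesis covers two uses at once: `π` is a member of a set of pairwise non-associated
primes, or `π` divides no member. -/
lemma multiplicity_prod_pow {s : Finset (MvPolynomial τ k)} (hs : ∀ p ∈ s, Prime p)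
    (n : MvPolynomial τ k → ℕ) {π : MvPolynomial τ k} (hπ : Prime π)
    (hdis : ∀ p ∈ s, π ∣ p → p = π) :
    multiplicity π (∏ p ∈ s, p ^ n p) = open Classical in if π ∈ s then n π else 0 := by
  classical
  induction s using Finset.induction_on with
  | empty =>
    simp only [Finset.prod_empty, Finset.notMem_empty, if_false]
    exact multiplicity_eq_zero.2 fun h => hπ.not_isUnit (isUnit_of_dvd_one h)
  | insert p s hps ih =>
    have h0 : p ^ n p * ∏ p ∈ s, p ^ n p ≠ 0 :=
      mul_ne_zero (pow_ne_zero _ (hs p (Finset.mem_insert_self p s)).ne_zero)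
        (Finset.prod_ne_zero_iff.2 fun q hq =>
          pow_ne_zero _ (hs q (Finset.mem_insert_of_mem hq)).ne_zero)
    rw [Finset.prod_insert hps, multiplicity_mul hπ (FiniteMultiplicity.of_prime_left hπ h0),
      ih (fun q hq => hs q (Finset.mem_insert_of_mem hq))
        (fun q hq => hdis q (Finset.mem_insert_of_mem hq))]
    by_cases hp : p = π
    · subst hp
      rw [if_neg hps, if_pos (Finset.mem_insert_self _ _), add_zero,
        multiplicity_pow_self hπ.ne_zero hπ.not_isUnit]
    · rw [multiplicity_eq_zero.2 fun h => hp (hdis p (Finset.mem_insert_self p s)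
        (hπ.dvd_of_dvd_pow h)), zero_add]
      simp [Finset.mem_insert, Ne.symm hp]

end Factorial

/-! ### A global homogeneous equation for a locally principal divisor. -/

section Cox

variable {k K : Type*} [Field k] [Field K] [Algebra k K] {ι : Type} {m : ι → Type}
variable {τ ρ : Type} [Fintype ρ] {w : τ → ρ → ℤ} {X : Set (MPt k K m)}

namespace CoxPres

variable (C : CoxPres w X) [IsAlgClosed K] [Finite τ]

/-- A Cartier divisor on a quotient of a factorial affine space is given by one homogeneous
rational function. -/
lemma exists_homogeneous_equation [Nonempty X] {a b : X → MvPolynomial τ k} {e : X → ρ → ℤ}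
    (ha : ∀ x, Hom w (a x) (e x)) (hb : ∀ x, Hom w (b x) (e x)) (ha0 : ∀ x, a x ≠ 0)
    (hb0 : ∀ x, b x ≠ 0)
    (h : ∀ x, ∀ᶠ y in 𝓝 x, ∃ c d : MvPolynomial τ k, MvPolynomial.aeval (C.lift y) c ≠ 0 ∧
      MvPolynomial.aeval (C.lift y) d ≠ 0 ∧ c * b x * a y = d * a x * b y) :
    ∃ (P R : MvPolynomial τ k) (p r : ρ → ℤ), Hom w P p ∧ Hom w R r ∧ P ≠ 0 ∧ R ≠ 0 ∧
      ∀ x, ∃ (c d : MvPolynomial τ k) (g g' : ρ → ℤ), Hom w c g ∧ Hom w d g' ∧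
        MvPolynomial.aeval (C.lift x) c ≠ 0 ∧
        MvPolynomial.aeval (C.lift x) d ≠ 0 ∧ c * (a x * R) = d * (b x * P) := by
  classical
  have hvan : ∀ {y : X} {π c : MvPolynomial τ k}, MvPolynomial.aeval (C.lift y) π = 0 →
      MvPolynomial.aeval (C.lift y) c ≠ 0 → ¬ π ∣ c := by
    rintro y π _ h1 h2 ⟨c, rfl⟩
    rw [map_mul, h1, zero_mul] at h2
    exact h2 rfl
  have hval : ∀ {x y : X} {π : MvPolynomial τ k}, Prime π →
      MvPolynomial.aeval (C.lift y) π = 0 →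
      (∃ c d : MvPolynomial τ k, MvPolynomial.aeval (C.lift y) c ≠ 0 ∧
        MvPolynomial.aeval (C.lift y) d ≠ 0 ∧ c * b x * a y = d * a x * b y) →
      multiplicity π (b x) + multiplicity π (a y) = multiplicity π (a x) + multiplicity π (b y) := by
    rintro x y π hπ hy ⟨c, d, hc, hd, h⟩
    exact multiplicity_eq_of_mul_eq hπ (ha0 x) (hb0 x) (ha0 y) (hb0 y) (hvan hy hc) (hvan hy hd) h
  -- multiplicities do not depend on the point
  have hconst : ∀ {x x' : X} {π : MvPolynomial τ k} {g : ρ → ℤ}, Hom w π g → Prime π →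
      MvPolynomial.aeval (C.lift x) π = 0 → MvPolynomial.aeval (C.lift x') π = 0 →
      multiplicity π (b x) + multiplicity π (a x') =
        multiplicity π (a x) + multiplicity π (b x') := by
    intro x x' π g hg hπ hx hx'
    obtain ⟨z, h1, h2, h3, -⟩ := C.exists_common hg
      ((Ideal.span_singleton_prime hπ.ne_zero).2 hπ) hx hx' (h x) (h x') hom_one
      (fun h => hπ.not_isUnit (isUnit_of_dvd_one h))
    have := hval hπ h3 h1
    have := hval hπ h3 h2
    omega
  let x₀ : X := Classical.arbitrary X
  obtain ⟨f, df, hf, hfx, hfQ⟩ := C.exists_hom_of_eventually (h x₀)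
  -- Only primes dividing `F` can occur in the divisor. Any other prime that vanishes somewhere on
  -- `X` has a zero in the neighbourhood `f ≠ 0` of `x₀`, where the divisor is described by `a x₀ /
  -- b x₀`, and this has order zero along it.
  set F := f * a x₀ * b x₀ with hFdef
  have hF : Hom w F _ := (hf.mul (ha x₀)).mul (hb x₀)
  have hF0 : F ≠ 0 := by
    refine mul_ne_zero (mul_ne_zero ?_ (ha0 _)) (hb0 _)
    rintro rfl
    simp at hfx
  have htriv : ∀ {x : X} {π : MvPolynomial τ k} {g : ρ → ℤ}, Hom w π g → Prime π →
      MvPolynomial.aeval (C.lift x) π = 0 → ¬ π ∣ F →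
      multiplicity π (b x) = multiplicity π (a x) := by
    intro x π g hg hπ hx hπF
    obtain ⟨z, h1, -, h3, h4⟩ := C.exists_common hg
      ((Ideal.span_singleton_prime hπ.ne_zero).2 hπ) hx hx (h x) (h x) hF hπF
    have hz : MvPolynomial.aeval (C.lift z) f ≠ 0 := by
      rw [hFdef, map_mul, map_mul] at h4
      exact left_ne_zero_of_mul (left_ne_zero_of_mul h4)
    obtain ⟨hq, h5⟩ := hfQ _ hz
    rw [← C.eq_pt hq (C.lifts_lift z)] at h5
    have e1 := hval hπ h3 h1
    have e2 := hval hπ h3 h5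
    rw [multiplicity_eq_zero.2 fun hd => hπF (Dvd.dvd.mul_left hd _),
      multiplicity_eq_zero.2 fun hd => hπF (Dvd.dvd.mul_right (Dvd.dvd.mul_left hd _) _)] at e2
    omega
  let _ : StrongNormalizationMonoid (MvPolynomial τ k) :=
    UniqueFactorizationMonoid.strongNormalizationMonoid
  set s : Finset (MvPolynomial τ k) := (UniqueFactorizationMonoid.normalizedFactors F).toFinset
    with hs
  have hsp : ∀ p ∈ s, Prime p := fun p hp =>
    UniqueFactorizationMonoid.prime_of_normalized_factor p (Multiset.mem_toFinset.1 hp)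
  have hsd : ∀ p ∈ s, p ∣ F := fun p hp =>
    UniqueFactorizationMonoid.dvd_of_mem_normalizedFactors (Multiset.mem_toFinset.1 hp)
  have hsu : ∀ p ∈ s, ∀ p' ∈ s, p ∣ p' → p' = p := by
    intro p hp p' hp' hd
    have h1 := (hsp p hp).associated_of_dvd (hsp p' hp') hd
    have h2 := UniqueFactorizationMonoid.normalize_normalized_factor p (Multiset.mem_toFinset.1 hp)
    have h3 := UniqueFactorizationMonoid.normalize_normalized_factor p'
      (Multiset.mem_toFinset.1 hp')
    rw [← h2, ← h3]
    exact (normalize_eq_normalize_iff_associated.2 h1).symm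
  have hsh : ∀ p ∈ s, ∃ g, Hom w p g := fun p hp => hF.of_dvd hF0 (hsd p hp)
  choose! g hg using hsh
  -- A point of the divisor `π = 0` at which the order along `π` is measured. The default `x₀` plays
  -- no role, since every comparison starts from a point on the divisor.
  let pnt : MvPolynomial τ k → X := fun π =>
    if hx : ∃ x : X, MvPolynomial.aeval (C.lift x) π = 0 then hx.choose else x₀
  have hpnt : ∀ {π : MvPolynomial τ k} {x : X}, MvPolynomial.aeval (C.lift x) π = 0 →
      MvPolynomial.aeval (C.lift (pnt π)) π = 0 := by
    intro π x hx
    have hx' : ∃ x : X, MvPolynomial.aeval (C.lift x) π = 0 := ⟨x, hx⟩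
    simp only [pnt, dif_pos hx']
    exact hx'.choose_spec
  -- `P / R` has along each prime of `s` the same order as the local equation `a / b` at the chosen
  -- point of that prime.
  set P := ∏ p ∈ s, p ^ multiplicity p (a (pnt p)) with hP
  set R := ∏ p ∈ s, p ^ multiplicity p (b (pnt p)) with hR
  have hP0 : P ≠ 0 := Finset.prod_ne_zero_iff.2 fun p hp => pow_ne_zero _ (hsp p hp).ne_zero
  have hR0 : R ≠ 0 := Finset.prod_ne_zero_iff.2 fun p hp => pow_ne_zero _ (hsp p hp).ne_zero
  have hPh : Hom w P _ := Hom.prod _ fun p hp => (hg p hp).pow _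
  have hRh : Hom w R _ := Hom.prod _ fun p hp => (hg p hp).pow _
  refine ⟨P, R, _, _, hPh, hRh, hP0, hR0, fun x => ?_⟩
  refine exists_local_unit ((ha x).mul hRh) ((hb x).mul hPh) (mul_ne_zero (ha0 x) hR0)
    (mul_ne_zero (hb0 x) hP0) fun π d hπh hπ hx => ?_
  rw [multiplicity_mul hπ (FiniteMultiplicity.of_prime_left hπ (mul_ne_zero (ha0 x) hR0)),
    multiplicity_mul hπ (FiniteMultiplicity.of_prime_left hπ (mul_ne_zero (hb0 x) hP0))]
  by_cases hd : π ∣ F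
  · obtain ⟨π', hπ', hass⟩ := UniqueFactorizationMonoid.exists_mem_normalizedFactors_of_dvd hF0
      hπ.irreducible hd
    replace hπ' : π' ∈ s := Multiset.mem_toFinset.2 hπ'
    have hm : ∀ A : MvPolynomial τ k, multiplicity π A = multiplicity π' A := fun A =>
      multiplicity_eq_of_associated_left hass.symm
    have hx' : MvPolynomial.aeval (C.lift x) π' = 0 := by
      obtain ⟨u, rfl⟩ := hass
      rw [map_mul, hx, zero_mul]
    rw [hm, hm, hm, hm, hP, hR, multiplicity_prod_pow hsp _ (hsp π' hπ') (hsu π' hπ'),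
      multiplicity_prod_pow hsp _ (hsp π' hπ') (hsu π' hπ'), if_pos hπ', if_pos hπ']
    have := hconst (hg π' hπ') (hsp π' hπ') hx' (hpnt hx')
    omega
  · have hdis : ∀ p ∈ s, π ∣ p → p = π := fun p hp h => absurd (h.trans (hsd p hp)) hd
    have hns : π ∉ s := fun h => hd (hsd π h)
    rw [hP, hR, multiplicity_prod_pow hsp _ hπ hdis, multiplicity_prod_pow hsp _ hπ hdis,
      if_neg hns, if_neg hns, htriv hπh hπ hx hd]

end CoxPres

end Cox

section Cox

variable {k K : Type*} [Field k] [Field K] [Algebra k K] {ι : Type} {m : ι → Type}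
variable {τ ρ : Type} [Fintype ρ] {w : τ → ρ → ℤ} {X : Set (MPt k K m)}

lemma cls_eq_iff {L L' : LineBundles X} : cls L = cls L' ↔ L.1⁻¹ * L'.1 ∈ TrivialBundles X := by
  rw [cls, cls, Additive.ofMul.apply_eq_iff_eq, QuotientGroup.eq, Subgroup.mem_subgroupOf]
  rfl

lemma cls_mul (L L' : LineBundles X) : cls (L * L') = cls L + cls L' := rfl

lemma exists_cls (c : Pic X) : ∃ L : LineBundles X, cls L = c := by
  obtain ⟨L, hL⟩ := QuotientGroup.mk_surjective (Additive.toMul c)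
  exact ⟨L, by rw [cls, hL]; rfl⟩

namespace CoxPres

/-! ### The Picard group of a quotient -/

variable (C : CoxPres w X)

/-- The line bundle `L` is isomorphic to the line bundle of functions of degree `d` on the affine
space. -/
def HasDegree (L : X → X → Kˣ) (d : ρ → ℤ) : Prop :=
  ∃ f : X → Kˣ, ∀ x, ∃ (F G : MvPolynomial τ k) (e : ρ → ℤ), Hom w F (e + d) ∧ Hom w G e ∧
    MvPolynomial.aeval (C.lift x) F ≠ 0 ∧ MvPolynomial.aeval (C.lift x) G ≠ 0 ∧
    ∀ᶠ z in 𝓝 x, (f z * L x z : K) =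
      MvPolynomial.aeval (C.lift z) F / MvPolynomial.aeval (C.lift z) G

variable {C}

lemma HasDegree.mul {L L' : X → X → Kˣ} {d d' : ρ → ℤ} (h : C.HasDegree L d)
    (h' : C.HasDegree L' d') : C.HasDegree (L * L') (d + d') := by
  obtain ⟨f, hf⟩ := h
  obtain ⟨f', hf'⟩ := h'
  refine ⟨f * f', fun x => ?_⟩
  obtain ⟨F, G, e, hF, hG, hFx, hGx, h⟩ := hf x
  obtain ⟨F', G', e', hF', hG', hFx', hGx', h'⟩ := hf' x
  refine ⟨F * F', G * G', e + e', ?_, hG.mul hG', ?_, ?_, ?_⟩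
  · rw [add_add_add_comm]
    exact hF.mul hF'
  · rw [map_mul]
    exact mul_ne_zero hFx hFx'
  · rw [map_mul]
    exact mul_ne_zero hGx hGx'
  · filter_upwards [h, h'] with z hz hz'
    rw [map_mul, map_mul, ← div_mul_div_comm, ← hz, ← hz']
    simp only [Pi.mul_apply, Units.val_mul]
    ring

lemma HasDegree.inv {L : X → X → Kˣ} {d : ρ → ℤ} (h : C.HasDegree L d) :
    C.HasDegree L⁻¹ (-d) := by
  obtain ⟨f, hf⟩ := h
  refine ⟨f⁻¹, fun x => ?_⟩
  obtain ⟨F, G, e, hF, hG, hFx, hGx, h⟩ := hf x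
  refine ⟨G, F, e + d, by rwa [add_neg_cancel_right], hF, hGx, hFx, ?_⟩
  filter_upwards [h] with z hz
  rw [← inv_div, ← hz]
  simp [mul_comm]

lemma hasDegree_zero_iff {L : X → X → Kˣ} : C.HasDegree L 0 ↔ L ∈ TrivialBundles X := by
  refine exists_congr fun f => forall_congr' fun x => ?_
  rw [C.mem_unitsAt_iff]
  constructor
  · rintro ⟨F, G, e, hF, hG, hFx, hGx, h⟩
    rw [add_zero] at hF
    exact ⟨F, G, e, hF, hG, hFx, hGx, by simpa using h⟩
  · rintro ⟨F, G, e, hF, hG, hFx, hGx, h⟩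
    exact ⟨F, G, e, by rwa [add_zero], hG, hFx, hGx, by simpa using h⟩

lemma HasDegree.cls_eq {L L' : LineBundles X} {d : ρ → ℤ} (h : C.HasDegree L.1 d)
    (h' : C.HasDegree L'.1 d) : cls L = cls L' := by
  rw [cls_eq_iff, ← hasDegree_zero_iff (C := C)]
  simpa using h.inv.mul h'

variable (C) in
lemma exists_frame_at (x : X) (d : ρ → ℤ) : ∃ p : MvPolynomial τ k × MvPolynomial τ k,
    ∃ e : ρ → ℤ, Hom w p.1 (e + d) ∧ Hom w p.2 e ∧ MvPolynomial.aeval (C.lift x) p.1 ≠ 0 ∧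
      MvPolynomial.aeval (C.lift x) p.2 ≠ 0 := by
  obtain ⟨F, G, e, h⟩ := C.exists_frame _ (C.lift_mem x) d
  exact ⟨(F, G), e, h⟩

variable (C) in
/-- A homogeneous rational function of degree `d` that generates the functions of degree `d`
near `x`. -/
def frame (d : ρ → ℤ) (x : X) : MvPolynomial τ k × MvPolynomial τ k :=
  Classical.choose (C.exists_frame_at x d)

variable (C) in
lemma frame_spec (d : ρ → ℤ) (x : X) : ∃ e : ρ → ℤ, Hom w (C.frame d x).1 (e + d) ∧
    Hom w (C.frame d x).2 e ∧ MvPolynomial.aeval (C.lift x) (C.frame d x).1 ≠ 0 ∧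
    MvPolynomial.aeval (C.lift x) (C.frame d x).2 ≠ 0 :=
  Classical.choose_spec (C.exists_frame_at x d)

open Classical in
variable (C) in
/-- The values of the local frames. -/
def frameVal (d : ρ → ℤ) (x z : X) : Kˣ :=
  if h : MvPolynomial.aeval (C.lift z) (C.frame d x).1 /
      MvPolynomial.aeval (C.lift z) (C.frame d x).2 ≠ 0 then Units.mk0 _ h else 1

lemma eventually_frameVal (d : ρ → ℤ) (x : X) : ∀ᶠ z in 𝓝 x, (C.frameVal d x z : K) =
    MvPolynomial.aeval (C.lift z) (C.frame d x).1 /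
      MvPolynomial.aeval (C.lift z) (C.frame d x).2 := by
  obtain ⟨e, h1, h2, h3, h4⟩ := C.frame_spec d x
  filter_upwards [C.eventually_ne h1 h3, C.eventually_ne h2 h4] with z hz hz'
  rw [frameVal, dif_pos (div_ne_zero hz hz')]
  rfl

variable (C) in
/-- The line bundle of functions of degree `d`. -/
def bundle (d : ρ → ℤ) : LineBundles X where
  val := C.frameVal d
  property x := by
    obtain ⟨e, h1, h2, h3, h4⟩ := C.frame_spec d x
    filter_upwards [C.eventually_ne h1 h3, C.eventually_ne h2 h4,
      (C.eventually_frameVal d x).eventually_nhds] with y hy hy' hxy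
    obtain ⟨e', h1', h2', h3', h4'⟩ := C.frame_spec d y
    rw [C.mem_unitsAt_iff]
    refine ⟨(C.frame d x).1 * (C.frame d y).2, (C.frame d x).2 * (C.frame d y).1, e + d + e',
      h1.mul h2', ?_, ?_, ?_, ?_⟩
    · have := h2.mul h1'
      convert this using 1
      abel
    · rw [map_mul]
      exact mul_ne_zero hy h4'
    · rw [map_mul]
      exact mul_ne_zero hy' h3'
    · filter_upwards [hxy, C.eventually_frameVal d y] with z hz hz'
      rw [Pi.div_apply, Units.val_div_eq_div_val, hz, hz', map_mul, map_mul, div_div_div_eq]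

variable (C) in
lemma hasDegree_bundle (d : ρ → ℤ) : C.HasDegree (C.bundle d).1 d := by
  refine ⟨1, fun x => ?_⟩
  obtain ⟨e, h1, h2, h3, h4⟩ := C.frame_spec d x
  refine ⟨_, _, e, h1, h2, h3, h4, ?_⟩
  filter_upwards [C.eventually_frameVal d x] with z hz
  rw [← hz]
  simp [bundle]

variable (C) in
/-- The class of the hyperplane bundle is the degree of the homogeneous coordinates. -/
lemma hasDegree_hyperplaneBundle (j : ι) : C.HasDegree (hyperplaneBundle X j).1 (C.δ j) := by
  -- The scalar `μ x` carries the chosen representative of the `j`-th component to the value of `Θ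
  -- j` at the chosen lift. It provides the isomorphism of line bundles.
  choose μ hμ h using fun x : X => C.lifts_lift x j
  refine ⟨fun x => Units.mk0 (μ x) (hμ x), fun x => ?_⟩
  have key : ∀ z, MvPolynomial.aeval (C.lift z) (C.Θ j (coordAt x.1 j)) =
      μ z * (z.1 j).rep (coordAt x.1 j) := fun z => congrFun (h z) _
  have hx : MvPolynomial.aeval (C.lift x) (C.Θ j (coordAt x.1 j)) ≠ 0 := by
    rw [key]
    exact mul_ne_zero (hμ x) (coordAt_ne x.1 j)
  refine ⟨C.Θ j (coordAt x.1 j), 1, 0, by rw [zero_add]; exact C.hom _ _, hom_one, hx, by simp, ?_⟩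
  filter_upwards [C.eventually_ne (C.hom _ _) hx] with z hz
  rw [key] at hz ⊢
  simp [hyperplaneBundle, right_ne_zero_of_mul hz]

/-- The line bundle of a divisor given by one homogeneous equation. -/
lemma isDivisorClass_bundle [IsAlgClosed K] [Finite τ] {Z : MvPolynomial τ k} {d : ρ → ℤ}
    (hZ : Hom w Z d) (hp : Prime Z) {O : Set (MPt k K m)}
    (hO : ∀ x : X, x.1 ∈ O ↔ MvPolynomial.aeval (C.lift x) Z = 0) :
    IsDivisorClass X O (cls (C.bundle d)) := by
  refine ⟨C.bundle d, fun z => MvPolynomial.aeval (C.lift z) Z, rfl, fun x => ?_⟩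
  obtain ⟨e, h1, h2, h3, h4⟩ := C.frame_spec d x
  set F := (C.frame d x).1
  set G := (C.frame d x).2
  have hs : ∀ᶠ z in 𝓝 x, MvPolynomial.aeval (C.lift z) Z / ((C.bundle d).1 x z : K) =
      MvPolynomial.aeval (C.lift z) (Z * G) / MvPolynomial.aeval (C.lift z) F := by
    filter_upwards [C.eventually_frameVal d x] with z hz
    rw [map_mul, ← div_div_eq_mul_div, ← hz]
    rfl
  have hreg : RegAt (fun z => MvPolynomial.aeval (C.lift z) Z / ((C.bundle d).1 x z : K)) x :=
    C.regAt_iff.2 ⟨Z * G, F, e + d, by rw [add_comm]; exact hZ.mul h2, h1, h3, hs⟩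
  refine ⟨hreg, Filter.Eventually.of_forall fun z hz => (hO z).1 hz, fun φ hφ hv => ?_⟩
  by_cases hx : MvPolynomial.aeval (C.lift x) Z = 0
  · obtain ⟨A, B, g, hA, hB, hBx, hAB⟩ := C.regAt_iff.1 hφ
    -- Otherwise the divisor would contain, arbitrarily near `x`, points where the numerator `A` of
    -- `φ` does not vanish.
    have hdvd : Z ∣ A := by
      by_contra hd
      obtain ⟨z, ⟨hz1, hz2, hz3⟩, -, hz, hzA⟩ := C.exists_common hZ
        ((Ideal.span_singleton_prime hp.ne_zero).2 hp) hx hx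
        ((hAB.and (hv.and (C.eventually_ne hB hBx)))) (P' := fun _ => True) (by simp) hA hd
      have := hz2 ((hO z).2 hz)
      rw [hz1] at this
      exact (div_ne_zero hzA hz3) this
    rcases eq_or_ne A 0 with rfl | hA0
    · refine ⟨fun _ => algebraMap k K 0, regAt_const 0 x, ?_⟩
      filter_upwards [hAB] with z hz
      simp [hz]
    obtain ⟨A', rfl⟩ := hdvd
    have hA' := hA.of_dvd_of_degree hZ hA0
    refine ⟨fun z => MvPolynomial.aeval (C.lift z) (A' * F) /
      MvPolynomial.aeval (C.lift z) (B * G), C.regAt_ratio (d := g + e) ?_ (hB.mul h2) ?_, ?_⟩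
    · convert hA'.mul h1 using 1
      abel
    · rw [map_mul]
      exact mul_ne_zero hBx h4
    · filter_upwards [hAB, hs, C.eventually_ne h1 h3, C.eventually_ne h2 h4, C.eventually_ne hB hBx]
        with z hz1 hz2 hz3 hz4 hz5
      rw [hz1, hz2]
      simp only [map_mul]
      field_simp
  -- Away from the divisor its equation is invertible, and division by it is harmless.
  · have hne : MvPolynomial.aeval (C.lift x) Z / ((C.bundle d).1 x x : K) ≠ 0 :=
      div_ne_zero hx (Units.ne_zero _)
    refine ⟨_, hφ.div hreg hne, ?_⟩
    filter_upwards [C.eventually_ne hZ hx] with z hz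
    rw [div_mul_cancel₀ _ (div_ne_zero hz (Units.ne_zero _))]

/-- Trivial line bundles have degree zero. -/
lemma HasDegree.eq_zero [IsAlgClosed K] [Finite τ] [Nonempty X] {d : ρ → ℤ}
    (h : C.HasDegree 1 d) : d = 0 := by
  obtain ⟨f, hf⟩ := h
  choose F G e hF hG hFx hGx h using hf
  let x₀ : X := Classical.arbitrary X
  have hne : ∀ {A : MvPolynomial τ k} {x : X}, MvPolynomial.aeval (C.lift x) A ≠ 0 → A ≠ 0 := by
    rintro A x h rfl
    simp at h
  -- The local expressions `F x / G x` all represent the same scalar function `f`. Any two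
  -- neighbourhoods meet, so they are one rational function.
  have key : ∀ x, F x₀ * G x = F x * G x₀ := by
    intro x
    by_contra h0
    have hsub : Hom w (F x₀ * G x - F x * G x₀) (e x₀ + d + e x) := by
      refine ((hF x₀).mul (hG x)).sub ?_
      convert (hF x).mul (hG x₀) using 1
      abel
    obtain ⟨z, ⟨h1, h2⟩, ⟨h3, h4⟩, h5⟩ := C.exists_common_bot
      ((h x₀).and (C.eventually_ne (hG x₀) (hGx x₀))) ((h x).and (C.eventually_ne (hG x) (hGx x)))
      hsub (sub_ne_zero.2 h0)
    apply h5
    rw [map_sub, map_mul, map_mul, sub_eq_zero]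
    exact (div_eq_div_iff h2 h4).1 (h1.symm.trans h3)
  obtain ⟨P, R, c, hrel, hPc, hRc⟩ :=
    UniqueFactorizationMonoid.exists_reduced_factors (F x₀) (hne (hFx x₀)) (G x₀)
  have hF0 : c * P ≠ 0 := hPc ▸ hne (hFx x₀)
  have hG0 : c * R ≠ 0 := hRc ▸ hne (hGx x₀)
  have hcF : Hom w (c * P) (e x₀ + d) := hPc ▸ hF x₀
  have hcG : Hom w (c * R) (e x₀) := hRc ▸ hG x₀
  obtain ⟨p, hp⟩ := hcF.of_dvd hF0 (Dvd.intro_left c rfl)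
  obtain ⟨r, hr⟩ := hcG.of_dvd hG0 (Dvd.intro_left c rfl)
  obtain ⟨ec, hc⟩ := hcF.of_dvd hF0 (Dvd.intro _ rfl)
  have hPR : ∀ x, P * G x = F x * R := by
    intro x
    have := key x
    rw [← hPc, ← hRc] at this
    have hc0 : c ≠ 0 := left_ne_zero_of_mul hF0
    apply mul_left_cancel₀ hc0
    linear_combination this
  -- A homogeneous polynomial without zeros on `X` has no prime factor, by `exists_zero`; it is a
  -- constant and has degree zero. This will be applied to numerator and denominator of the reduced
  -- form.
  have unit_of : ∀ (A : MvPolynomial τ k) (a : ρ → ℤ), Hom w A a → A ≠ 0 →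
      (∀ x, MvPolynomial.aeval (C.lift x) A ≠ 0) → a = 0 := by
    intro A a hAh hA hAx
    have hu : IsUnit A := by
      by_contra hu
      obtain ⟨π, hπ, hd⟩ := WfDvdMonoid.exists_irreducible_factor hu hA
      obtain ⟨q, hq, hq0⟩ := C.exists_zero π hπ.prime
      refine (C.hom_ne_of_lifts hAh hq (C.lifts_pt q hq)).2 (hAx _) ?_
      obtain ⟨B, rfl⟩ := hd
      rw [map_mul, hq0, zero_mul]
    obtain ⟨t, -, rfl⟩ := MvPolynomial.isUnit_iff_eq_C_of_isReduced.1 hu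
    exact hAh.degree_unique (hom_C t) hA
  have hPx : ∀ x, MvPolynomial.aeval (C.lift x) P ≠ 0 := by
    intro x h0
    have hd : P ∣ F x := hrel.dvd_of_dvd_mul_right (Dvd.intro _ (hPR x))
    obtain ⟨B, hB⟩ := hd
    apply hFx x
    rw [hB, map_mul, h0, zero_mul]
  have hRx : ∀ x, MvPolynomial.aeval (C.lift x) R ≠ 0 := by
    intro x h0
    have hd : R ∣ G x := hrel.symm.dvd_of_dvd_mul_left (Dvd.intro_left _ (hPR x).symm)
    obtain ⟨B, hB⟩ := hd
    apply hGx x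
    rw [hB, map_mul, h0, zero_mul]
  have hp0 := unit_of P p hp (right_ne_zero_of_mul hF0) hPx
  have hr0 := unit_of R r hr (right_ne_zero_of_mul hG0) hRx
  have e1 := hcF.degree_unique (hc.mul hp) hF0
  have e2 := hcG.degree_unique (hc.mul hr) hG0
  rw [hp0, add_zero] at e1
  rw [hr0, add_zero] at e2
  rw [← e2] at e1
  simpa using e1

lemma exists_hasDegree [IsAlgClosed K] [Finite τ] [Nonempty X] (L : LineBundles X) :
    ∃ d, C.HasDegree L.1 d := by
  let x₀ : X := Classical.arbitrary X
  have hne : ∀ {A : MvPolynomial τ k} {x : X}, MvPolynomial.aeval (C.lift x) A ≠ 0 → A ≠ 0 := by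
    rintro A x h rfl
    simp at h
  -- rational transition functions
  have h1 : ∀ x, ∃ (y : X) (a b : MvPolynomial τ k) (e : ρ → ℤ), Hom w a e ∧ Hom w b e ∧
      MvPolynomial.aeval (C.lift y) a ≠ 0 ∧ MvPolynomial.aeval (C.lift y) b ≠ 0 ∧
      ∀ᶠ z in 𝓝 y, (L.1 x z / L.1 x₀ z : K) =
        MvPolynomial.aeval (C.lift z) a / MvPolynomial.aeval (C.lift z) b := by
    intro x
    obtain ⟨y, hy, hy', -⟩ := C.exists_common_bot (L.2 x) (L.2 x₀) hom_one one_ne_zero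
    have := div_mem hy hy'
    rw [div_div_div_cancel_right] at this
    obtain ⟨a, b, e, ha, hb, hay, hby, h⟩ := C.mem_unitsAt_iff.1 this
    refine ⟨y, a, b, e, ha, hb, hay, hby, h.mono fun z hz => ?_⟩
    rw [← hz]
    simp [Units.val_div_eq_div_val]
  choose pt a b e ha hb hax hbx hab using h1
  -- The transition function near `y` is the quotient of the rational functions `a x / b x` and `a
  -- x' / b x'`. Three germs given at different points have to be compared, which takes two
  -- applications of irreducibility.
  have h2 : ∀ x x' y, L.1 x / L.1 x' ∈ unitsAt y → ∃ (c d : MvPolynomial τ k),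
      MvPolynomial.aeval (C.lift y) c ≠ 0 ∧ MvPolynomial.aeval (C.lift y) d ≠ 0 ∧
      (L.1 x y / L.1 x' y : K) =
        MvPolynomial.aeval (C.lift y) c / MvPolynomial.aeval (C.lift y) d ∧
      c * b x * a x' = d * a x * b x' := by
    intro x x' y h
    obtain ⟨c, d, g, hc, hd, hcy, hdy, h⟩ := C.mem_unitsAt_iff.1 h
    refine ⟨c, d, hcy, hdy, ?_, ?_⟩
    · rw [← h.self_of_nhds]
      simp [Units.val_div_eq_div_val]
    · obtain ⟨z, h3, h4, -⟩ := C.exists_common_bot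
        (h.and (C.eventually_ne hd hdy)).eventually_nhds
        ((hab x).and (C.eventually_ne (hb x) (hbx x))).eventually_nhds hom_one one_ne_zero
      obtain ⟨z', h5, h6, -⟩ := C.exists_common_bot (h3.and h4).eventually_nhds
        ((hab x').and (C.eventually_ne (hb x') (hbx x'))).eventually_nhds hom_one one_ne_zero
      have h7 := h5.self_of_nhds
      have h8 := h6.self_of_nhds
      have := C.mul_eq_mul_of_eventually (hc.mul (ha x')) (hd.mul (hb x')) (ha x) (hb x)
        (by rw [map_mul]; exact mul_ne_zero h7.1.2 h8.2) h7.2.2 (by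
          filter_upwards [h5, h6] with t ht ht'
          rw [map_mul, map_mul, ← div_mul_div_comm, ← ht.1.1, ← ht'.1, ← ht.2.1, Pi.div_apply,
            Units.val_div_eq_div_val]
          exact div_mul_div_cancel₀ (Units.ne_zero _))
      linear_combination this
  obtain ⟨P, R, p, r, hP, hR, hP0, hR0, hx⟩ := C.exists_homogeneous_equation ha hb
    (fun x => hne (hax x)) (fun x => hne (hbx x)) fun x => (L.2 x).mono fun y hy => by
      obtain ⟨c, d, hc, hd, -, h⟩ := h2 x y y hy
      exact ⟨c, d, hc, hd, h⟩
  choose c d g g' hc hd hcx hdx hcd using hx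
  -- The degree of `d x / c x` is that of `R / P`, because `a x` and `b x` have the same degree.
  have hdeg : ∀ x, g' x = g x + (r - p) := by
    intro x
    have e1 := ((hc x).mul ((ha x).mul hR))
    rw [hcd x] at e1
    have := ((hd x).mul ((hb x).mul hP)).degree_unique e1
      (mul_ne_zero (hne (hdx x)) (mul_ne_zero (hne (hbx x)) hP0))
    have h3 : g' x + p = g x + r := by
      apply add_left_cancel (a := e x)
      calc e x + (g' x + p) = g' x + (e x + p) := by abel
        _ = g x + (e x + r) := this
        _ = e x + (g x + r) := by abel
    rw [eq_sub_of_add_eq h3]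
    abel
  -- By `hcd` the ratio `d z / c z` is the transition function `a z / b z` from `L x₀` times the
  -- global function `R / P`. The scalar at `z` makes the frame `L z` take this value there.
  refine ⟨r - p, fun z => Units.mk0 _ (hdx z) / Units.mk0 _ (hcx z) / L.1 z z, fun x =>
    ⟨d x, c x, g x, hdeg x ▸ hd x, hc x, hdx x, hcx x, ?_⟩⟩
  filter_upwards [L.2 x, C.eventually_ne (hc x) (hcx x), C.eventually_ne (hd x) (hdx x)]
    with z hz hcz hdz
  obtain ⟨c', d', hc', hd', hval, h⟩ := h2 x z z hz
  have key : d z * c' * c x = c z * d' * d x := by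
    have h0 : b z * P * (b x * a z) * (a x * R) ≠ 0 :=
      mul_ne_zero (mul_ne_zero (mul_ne_zero (hne (hbx z)) hP0)
        (mul_ne_zero (hne (hbx x)) (hne (hax z)))) (mul_ne_zero (hne (hax x)) hR0)
    apply mul_right_cancel₀ h0
    calc d z * c' * c x * (b z * P * (b x * a z) * (a x * R))
        = (d z * (b z * P)) * (c' * b x * a z) * (c x * (a x * R)) := by ring
      _ = (c z * (a z * R)) * (d' * a x * b z) * (d x * (b x * P)) := by
        rw [← hcd z, h, hcd x]
      _ = _ := by ring
  have key' := congrArg (MvPolynomial.aeval (C.lift z)) key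
  simp only [map_mul] at key'
  have h3 : (L.1 x z : K) = MvPolynomial.aeval (C.lift z) c' / MvPolynomial.aeval (C.lift z) d' *
      L.1 z z := by
    rw [← hval, div_mul_cancel₀ _ (Units.ne_zero _)]
  rw [Units.val_div_eq_div_val, Units.val_div_eq_div_val, h3, Units.val_mk0, Units.val_mk0]
  have h4 := hcx z
  have h5 := (L.1 z z).ne_zero
  field_simp
  linear_combination key'

variable (C) in
/-- The class of the line bundle of functions of degree `d`. -/
def picHom : (ρ → ℤ) →+ Pic X where
  toFun d := cls (C.bundle d)
  map_zero' := by
    have h : cls (1 : LineBundles X) = 0 := rfl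
    rw [← h]
    exact HasDegree.cls_eq (C.hasDegree_bundle 0) (hasDegree_zero_iff.2 (one_mem _))
  map_add' d d' := by
    rw [← cls_mul]
    exact HasDegree.cls_eq (C.hasDegree_bundle _)
      ((C.hasDegree_bundle d).mul (C.hasDegree_bundle d'))

variable (C) in
-- Injectivity uses that units on the quotient are constants, surjectivity that a locally principal
-- divisor has one homogeneous equation. Both rest on unique factorisation.
lemma picHom_bijective [IsAlgClosed K] [Finite τ] [Nonempty X] :
    Function.Bijective C.picHom := by
  constructor
  · rw [injective_iff_map_eq_zero]
    intro d hd
    have h : cls (C.bundle d) = cls (1 : LineBundles X) := hd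
    rw [cls_eq_iff, ← hasDegree_zero_iff (C := C)] at h
    have h' := (C.hasDegree_bundle d).mul h
    rw [add_zero] at h'
    apply HasDegree.eq_zero (C := C)
    convert h' using 1
    simp
  · intro c
    obtain ⟨L, rfl⟩ := exists_cls c
    obtain ⟨d, hd⟩ := exists_hasDegree (C := C) L
    exact ⟨d, HasDegree.cls_eq (C.hasDegree_bundle d) hd⟩

variable (C) in
/-- The Picard group is the group of degrees. -/
def picEquiv [IsAlgClosed K] [Finite τ] [Nonempty X] : (ρ → ℤ) ≃+ Pic X :=
  AddEquiv.ofBijective C.picHom C.picHom_bijective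

lemma picEquiv_apply [IsAlgClosed K] [Finite τ] [Nonempty X] (d : ρ → ℤ) :
    C.picEquiv d = cls (C.bundle d) := rfl

lemma hyperplaneClass_eq [IsAlgClosed K] [Finite τ] [Nonempty X] (j : ι) :
    hyperplaneClass X j = C.picEquiv (C.δ j) :=
  HasDegree.cls_eq (C.hasDegree_hyperplaneBundle j) (C.hasDegree_bundle _)

/-! ### Line bundles of equal degree on two quotients. -/

section Comparison

variable {ι' : Type} {m' : ι' → Type} {X' : Set (MPt k K m')}

/-- Line bundles of the same degree on two quotients by the same torus correspond to each other. -/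
lemma picCompat_bundle [∀ j, Finite (m j)] [∀ j, Finite (m' j)] (C : CoxPres w X)
    (C' : CoxPres w X') {V : Set (τ → K)} (hVo : HomOpen k w V) (h : V ⊆ C.Q) (h' : V ⊆ C'.Q)
    (hc : CodimComplGeTwo X (C.img V)) (hc' : CodimComplGeTwo X' (C'.img V)) (d : ρ → ℤ) :
    (C.smallBirIso C' hVo h h' hc hc').PicCompat (cls (C.bundle d)) (cls (C'.bundle d)) := by
  set ψ := C.smallBirIso C' hVo h h' hc hc' with hψ
  refine ⟨_, _, rfl, rfl, ?_⟩
  let i : ψ.dom → X := fun z => ⟨z, ψ.dom_subset z.2⟩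
  let i' : ψ.dom → X' := fun z => ⟨ψ.iso.toEquiv z, ψ.cod_subset (ψ.iso.toEquiv z).2⟩
  have hi : Continuous i := Continuous.subtype_mk continuous_subtype_val _
  have hV : ∀ z, C.lift (i z) ∈ V := fun z => (mem_img_iff hVo.torusInvariant).1 z.2
  have hl : ∀ z, ∃ u : ρ → Kˣ, C'.lift (i' z) = tact w u (C.lift (i z)) := fun z => by
    have h1 := C.lifts_smallBirIso C' hVo h h' hc hc' z (hV z) (C.lifts_lift (i z))
    exact C'.exists_tact (h' (hV z)) (C'.lift_mem _) h1 (C'.lifts_lift (i' z))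
  choose u hu using hl
  -- The chosen lifts of corresponding points differ by the torus element `u z`; its character of
  -- degree `d` compensates for this in functions of degree `d`.
  refine ⟨fun z => chi (u z) d, fun x => ?_⟩
  obtain ⟨e, h1, h2, h3, h4⟩ := C.frame_spec d (i x)
  obtain ⟨e', h1', h2', h3', h4'⟩ := C'.frame_spec d (i' x)
  rw [hu] at h3' h4'
  rw [ToricLink.mem_unitsAt_iff]
  set F := (C.frame d (i x)).1
  set G := (C.frame d (i x)).2
  set F' := (C'.frame d (i' x)).1
  set G' := (C'.frame d (i' x)).2
  refine RegAt.restrict ψ.dom_subset (φ := fun z => MvPolynomial.aeval (C.lift z) (F * G') /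
    MvPolynomial.aeval (C.lift z) (G * F'))
    (C.regAt_ratio (h1.mul h2') (d := e + d + e') ?_ ?_) ?_
  · convert h2.mul h1' using 1
    abel
  · rw [map_mul]
    exact mul_ne_zero h4 ((h1'.aeval_tact_ne _ _).1 h3')
  · have hE : ∀ᶠ z in 𝓝 x, MvPolynomial.aeval (C.lift (i z)) F ≠ 0 ∧
        MvPolynomial.aeval (C.lift (i z)) G ≠ 0 ∧ MvPolynomial.aeval (C.lift (i z)) F' ≠ 0 ∧
        MvPolynomial.aeval (C.lift (i z)) G' ≠ 0 ∧ ((C.bundle d).1 (i x) (i z) : K) =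
          MvPolynomial.aeval (C.lift (i z)) F / MvPolynomial.aeval (C.lift (i z)) G :=
      (hi.continuousAt (x := x)).eventually
        ((C.eventually_ne h1 h3).and ((C.eventually_ne h2 h4).and
          ((C.eventually_ne h1' ((h1'.aeval_tact_ne _ _).1 h3')).and
            ((C.eventually_ne h2' ((h2'.aeval_tact_ne _ _).1 h4')).and
              (C.eventually_frameVal d (i x))))))
    filter_upwards [hE] with z ⟨z1, z2, z3, z4, z5⟩
    have z6 : ((C'.bundle d).1 (i' x) (i' z) : K) = chi (u z) d *
        (MvPolynomial.aeval (C.lift (i z)) F' / MvPolynomial.aeval (C.lift (i z)) G') := by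
      have hF' : MvPolynomial.aeval (C'.lift (i' z)) F' = chi (u z) (e' + d) *
          MvPolynomial.aeval (C.lift (i z)) F' := by rw [hu, h1'.aeval_tact]
      have hG' : MvPolynomial.aeval (C'.lift (i' z)) G' = chi (u z) e' *
          MvPolynomial.aeval (C.lift (i z)) G' := by rw [hu, h2'.aeval_tact]
      have hr : MvPolynomial.aeval (C'.lift (i' z)) F' / MvPolynomial.aeval (C'.lift (i' z)) G' =
          chi (u z) d * (MvPolynomial.aeval (C.lift (i z)) F' /
            MvPolynomial.aeval (C.lift (i z)) G') := by
        rw [hF', hG', chi_add, Units.val_mul]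
        have := (chi (u z) e').ne_zero
        field_simp
      rw [← hr]
      change (C'.frameVal d (i' x) (i' z) : K) = _
      rw [frameVal, dif_pos]
      · rfl
      · change MvPolynomial.aeval (C'.lift (i' z)) F' / MvPolynomial.aeval (C'.lift (i' z)) G' ≠ 0
        rw [hr]
        exact mul_ne_zero (Units.ne_zero _) (div_ne_zero z3 z4)
    change ((chi (u z) d * (C.bundle d).1 (i x) (i z) / (C'.bundle d).1 (i' x) (i' z) : Kˣ) : K) = _
    rw [Units.val_div_eq_div_val, Units.val_mul, z5, z6]
    change _ = MvPolynomial.aeval (C.lift (i z)) (F * G') / MvPolynomial.aeval (C.lift (i z)) (G * F')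
    rw [map_mul, map_mul]
    have := (chi (u z) d).ne_zero
    field_simp

end Comparison

end CoxPres

end Cox

section General

variable {k K : Type*} [Field k] [Field K] [Algebra k K] {ι : Type} {m : ι → Type}
variable {τ ρ : Type} [Fintype ρ] {w : τ → ρ → ℤ}

/-! ### Construction of Cox presentations -/

/-- The locus where the polynomials `Θ j` define a point. -/
def regLocus (K : Type*) [Field K] [Algebra k K] (Θ : ∀ j, m j → MvPolynomial τ k) :
    Set (τ → K) :=
  {q | ∀ j, ∃ a, MvPolynomial.aeval q (Θ j a) ≠ 0}

lemma homOpen_regLocus [Finite ι] {Θ : ∀ j, m j → MvPolynomial τ k} {δ : ι → ρ → ℤ}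
    (hom : ∀ j a, Hom w (Θ j a) (δ j)) : HomOpen k w (regLocus K Θ) := by
  have : regLocus K Θ = ⋂ j, ⋃ a, {q | MvPolynomial.aeval q (Θ j a) ≠ 0} := by
    ext q
    simp [regLocus]
  rw [this]
  exact HomOpen.iInter fun j => HomOpen.iUnion fun a => homOpen_ne (hom j a)

lemma exists_lifts {Θ : ∀ j, m j → MvPolynomial τ k} {q : τ → K} (hq : q ∈ regLocus K Θ) :
    ∃ p : MPt k K m, Lifts Θ q p := by
  have h : ∀ j, (fun a => MvPolynomial.aeval q (Θ j a)) ≠ 0 := fun j h => by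
    obtain ⟨a, ha⟩ := hq j
    exact ha (congrFun h a)
  exact ⟨fun j => Projectivization.mk K _ (h j), fun j => represents_mk (h j)⟩

lemma Lifts.mem_regLocus {Θ : ∀ j, m j → MvPolynomial τ k} {q : τ → K} {p : MPt k K m}
    (h : Lifts Θ q p) : q ∈ regLocus K Θ :=
  fun j => Function.ne_iff.1 (h j).ne_zero

open Classical in
/-- Replace the vanishing coordinates in `T` by `ε`. -/
def deform (T : Set τ) (ε : K) (q : τ → K) : τ → K := fun s => if s ∈ T ∧ q s = 0 then ε else q s

lemma deform_ne {T : Set τ} {ε : K} (hε : ε ≠ 0) (q : τ → K) {s : τ} (hs : s ∈ T) :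
    deform T ε q s ≠ 0 := by
  rw [deform]
  split_ifs with h
  · exact hε
  · exact fun h0 => h ⟨hs, h0⟩

lemma deform_of_notMem {T : Set τ} (ε : K) (q : τ → K) {s : τ} (hs : s ∉ T) :
    deform T ε q s = q s := by
  rw [deform, if_neg fun h => hs h.1]

/-- Along the deformation `f` is a polynomial in one variable `ε` whose value at `0` is `f` at the
undeformed point; hence it has only finitely many zeros. -/
lemma exists_deform [Infinite K] (T : Set τ) {f : MvPolynomial τ k} {q : τ → K}
    (hq : MvPolynomial.aeval q f ≠ 0) :
    ∃ ε : K, ε ≠ 0 ∧ MvPolynomial.aeval (deform T ε q) f ≠ 0 := by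
  classical
  set P : Polynomial K := MvPolynomial.aeval
    (fun s => if s ∈ T ∧ q s = 0 then Polynomial.X else Polynomial.C (q s)) f
  have hP : ∀ ε, P.eval ε = MvPolynomial.aeval (deform T ε q) f := by
    intro ε
    have : (Polynomial.aeval ε) P = MvPolynomial.aeval (deform T ε q) f := by
      rw [show P = _ from rfl, ← AlgHom.restrictScalars_apply k, ← AlgHom.comp_apply,
        MvPolynomial.comp_aeval]
      congr 2
      funext s
      simp only [deform, AlgHom.restrictScalars_apply]
      split_ifs <;> simp
    rw [← this, Polynomial.coe_aeval_eq_eval]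
  have h0 : P ≠ 0 := by
    intro h
    apply hq
    have := hP 0
    rw [h, Polynomial.eval_zero] at this
    rw [this]
    congr 2
    funext s
    rw [deform]
    split_ifs with hs
    · exact hs.2
    · rfl
  -- The additional factor `X` excludes `ε = 0`.
  obtain ⟨ε, hε⟩ := Infinite.exists_notMem_finset (Polynomial.X * P).roots.toFinset
  rw [Multiset.mem_toFinset, Polynomial.mem_roots (mul_ne_zero Polynomial.X_ne_zero h0),
    Polynomial.IsRoot, Polynomial.eval_mul, Polynomial.eval_X, mul_eq_zero, not_or] at hε
  exact ⟨ε, hε.1, by rw [← hP]; exact hε.2⟩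

/-- Points obtained by deforming the coordinates in `T` are dense. -/
lemma mem_closure_of_deform [Infinite K] [Finite ι] {Θ : ∀ j, m j → MvPolynomial τ k}
    {δ : ι → ρ → ℤ} (hom : ∀ j a, Hom w (Θ j a) (δ j)) (T : Set τ) {S : Set (MPt k K m)}
    {q : τ → K} {p : MPt k K m} (hq : Lifts Θ q p)
    (hS : ∀ ε : K, ε ≠ 0 → ∀ p', Lifts Θ (deform T ε q) p' → p' ∈ S) : p ∈ closure S := by
  rw [isTopologicalBasis_hval.mem_closure_iff]
  rintro _ ⟨F, d, hF, rfl⟩ hp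
  obtain ⟨f, e, hf, hfq, h⟩ := homOpen_regLocus hom q hq.mem_regLocus
  obtain ⟨ε, hε, hε'⟩ := exists_deform T (f := f * pull Θ F) (q := q) (by
    rw [map_mul]
    exact mul_ne_zero hfq ((hq.hval_ne_iff hF).2 hp))
  rw [map_mul] at hε'
  obtain ⟨p', hp'⟩ := exists_lifts (h _ (left_ne_zero_of_mul hε'))
  exact ⟨p', (hp'.hval_ne_iff hF).1 (right_ne_zero_of_mul hε'), hS ε hε p' hp'⟩

/-- The point `q` has a nonvanishing homogeneous rational function of degree `d`. -/
def HasFrame (k : Type*) [Field k] [Algebra k K] (w : τ → ρ → ℤ) (q : τ → K) (d : ρ → ℤ) : Prop :=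
  ∃ (F G : MvPolynomial τ k) (e : ρ → ℤ), Hom w F (e + d) ∧ Hom w G e ∧
    MvPolynomial.aeval q F ≠ 0 ∧ MvPolynomial.aeval q G ≠ 0

lemma HasFrame.add {q : τ → K} {d d' : ρ → ℤ} (h : HasFrame k w q d) (h' : HasFrame k w q d') :
    HasFrame k w q (d + d') := by
  obtain ⟨F, G, e, hF, hG, hFx, hGx⟩ := h
  obtain ⟨F', G', e', hF', hG', hFx', hGx'⟩ := h'
  refine ⟨F * F', G * G', e + e', ?_, hG.mul hG', ?_, ?_⟩
  · rw [add_add_add_comm]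
    exact hF.mul hF'
  · rw [map_mul]
    exact mul_ne_zero hFx hFx'
  · rw [map_mul]
    exact mul_ne_zero hGx hGx'

lemma HasFrame.neg {q : τ → K} {d : ρ → ℤ} (h : HasFrame k w q d) : HasFrame k w q (-d) := by
  obtain ⟨F, G, e, hF, hG, hFx, hGx⟩ := h
  exact ⟨G, F, e + d, by rwa [add_neg_cancel_right], hF, hGx, hFx⟩

lemma HasFrame.sub {q : τ → K} {d d' : ρ → ℤ} (h : HasFrame k w q d) (h' : HasFrame k w q d') :
    HasFrame k w q (d - d') := by
  rw [sub_eq_add_neg]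
  exact h.add h'.neg

lemma hasFrame_zero (q : τ → K) : HasFrame k w q 0 :=
  ⟨1, 1, 0, by rw [add_zero]; exact hom_one, hom_one, by simp, by simp⟩

lemma hasFrame_of_ne {q : τ → K} {s : τ} (hs : q s ≠ 0) : HasFrame k w q (w s) :=
  ⟨MvPolynomial.X s, 1, 0, by rw [zero_add]; exact hom_X s, hom_one, by simpa, by simp⟩

/-- The degrees with an invertible function at `q` form a subgroup, so generators suffice. -/
lemma hasFrame_of_single [DecidableEq ρ] {q : τ → K}
    (h : ∀ i : ρ, HasFrame k w q (Pi.single i 1)) (d : ρ → ℤ) : HasFrame k w q d := by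
  let S : AddSubgroup (ρ → ℤ) :=
    { carrier := {d | HasFrame k w q d}
      add_mem' := HasFrame.add
      zero_mem' := hasFrame_zero q
      neg_mem' := HasFrame.neg }
  have : d = ∑ i, d i • (Pi.single i 1 : ρ → ℤ) := by
    ext j
    simp [Finset.sum_apply, Pi.single_apply]
  rw [this]
  exact S.sum_mem fun i _ => S.zsmul_mem (h i) _

lemma eq_of_prime_dvd_X {π : MvPolynomial τ k} (hπ : Prime π) {s s' : τ}
    (h : π ∣ MvPolynomial.X s) (h' : π ∣ MvPolynomial.X s') : s = s' := by
  have h1 := hπ.associated_of_dvd (MvPolynomial.X_prime (R := k) (i := s)) h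
  have h2 := (h1.symm.dvd.trans h')
  by_contra hne
  classical
  have := map_dvd (MvPolynomial.aeval (R := k) (fun x : τ => if x = s then (0 : k) else 1)) h2
  simp [Ne.symm hne] at this

/-- If `π` has no zero in `Q`, then `f` vanishes wherever `π` does. Applied to monomials without a
common prime factor, this gives the axiom `exists_zero`. -/
lemma prime_dvd_of_forall [IsAlgClosed K] [Finite τ] {Q : Set (τ → K)} {π : MvPolynomial τ k}
    (hπ : Prime π) (h : ¬ ∃ q ∈ Q, MvPolynomial.aeval q π = 0) {f : MvPolynomial τ k}
    (hf : ∀ q : τ → K, MvPolynomial.aeval q f ≠ 0 → q ∈ Q) : π ∣ f := by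
  by_contra hd
  obtain ⟨q, h1, h2⟩ := exists_aeval_ne_zero_of_not_dvd (K := K)
    ((Ideal.span_singleton_prime hπ.ne_zero).2 hπ) hd
  exact h ⟨q, hf q h2, h1⟩

end General

/-! ### Cox coordinates -/

/-- The Cox coordinates of the blowup of a product of projective spaces at a point. -/
inductive CoxVar {r : ℕ} (n : Fin r → ℕ) : Type
  | e : CoxVar n
  | t (i : Fin r) : CoxVar n
  | x (i : Fin r) (b : Fin (n i)) : CoxVar n

section CoxVar

variable {r : ℕ} {n : Fin r → ℕ}

instance : Finite (CoxVar n) := by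
  refine Finite.of_surjective
    (fun s : Unit ⊕ Fin r ⊕ (Σ i, Fin (n i)) => match s with
      | Sum.inl _ => CoxVar.e
      | Sum.inr (Sum.inl i) => CoxVar.t i
      | Sum.inr (Sum.inr ⟨i, b⟩) => CoxVar.x i b) ?_
  rintro (_ | i | ⟨i, b⟩)
  · exact ⟨Sum.inl (), rfl⟩
  · exact ⟨Sum.inr (Sum.inl i), rfl⟩
  · exact ⟨Sum.inr (Sum.inr ⟨i, b⟩), rfl⟩

/-- The degree of the exceptional divisor. -/
def degE (r : ℕ) : Option (Fin r) → ℤ := Pi.single none 1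

/-- The degree of the coordinates of the quotient of the factor `i`. -/
def degX (i : Fin r) : Option (Fin r) → ℤ := Pi.single (some i) 1

/-- The degrees of the Cox coordinates. -/
def wt : CoxVar n → Option (Fin r) → ℤ
  | CoxVar.e => degE r
  | CoxVar.t i => degX i + degE r
  | CoxVar.x i _ => degX i

variable {K : Type*} [Field K]

/-- The element of the torus with given coordinates. -/
def torusPt (ε : Kˣ) (α : Fin r → Kˣ) : Option (Fin r) → Kˣ := fun o => o.elim ε α

lemma chi_degE (u : Option (Fin r) → Kˣ) : chi u (degE r) = u none := chi_single u none

lemma chi_degX (u : Option (Fin r) → Kˣ) (i : Fin r) : chi u (degX i) = u (some i) :=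
  chi_single u (some i)

lemma tact_e (u : Option (Fin r) → Kˣ) (q : CoxVar n → K) :
    tact wt u q CoxVar.e = u none * q CoxVar.e := by
  rw [tact, wt, chi_degE]

lemma tact_t (u : Option (Fin r) → Kˣ) (q : CoxVar n → K) (i : Fin r) :
    tact wt u q (CoxVar.t i) = u (some i) * u none * q (CoxVar.t i) := by
  rw [tact, wt, chi_add, chi_degE, chi_degX, Units.val_mul]

lemma tact_x (u : Option (Fin r) → Kˣ) (q : CoxVar n → K) (i : Fin r) (b : Fin (n i)) :
    tact wt u q (CoxVar.x i b) = u (some i) * q (CoxVar.x i b) := by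
  rw [tact, wt, chi_degX]

lemma eq_tact {u : Option (Fin r) → Kˣ} {q q' : CoxVar n → K}
    (he : q' CoxVar.e = u none * q CoxVar.e)
    (ht : ∀ i, q' (CoxVar.t i) = u (some i) * u none * q (CoxVar.t i))
    (hx : ∀ i b, q' (CoxVar.x i b) = u (some i) * q (CoxVar.x i b)) : q' = tact wt u q := by
  funext s
  rcases s with _ | i | ⟨i, b⟩
  · rw [he, tact_e]
  · rw [ht, tact_t]
  · rw [hx, tact_x]

variable {k : Type*} [Field k] [Algebra k K]

lemma hasFrame_of_degX {q : CoxVar n → K} (hE : HasFrame k wt q (degE r))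
    (hX : ∀ i, HasFrame k wt q (degX i)) (d : Option (Fin r) → ℤ) : HasFrame k wt q d := by
  refine hasFrame_of_single (fun o => ?_) d
  rcases o with _ | i
  · exact hE
  · exact hX i

end CoxVar

/-! ### Tensors -/

section Tensor

variable {r : ℕ} {R S : Type*} [CommRing R] [CommRing S] {c c' : Fin r → Type}

/-- The divided difference of the pure tensors `⊗ f l` and `⊗ g l` in the direction of the `x l`:
if `f l = g l + s • x l` for all `l` then `⊗ f l - ⊗ g l = s • divDiff f g x`. -/
def divDiff (f g x : ∀ l, c l → R) (a : ∀ l, c l) : R :=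
  ∑ i, ∏ l, if l < i then f l (a l) else if l = i then x l (a l) else g l (a l)

/-- Brings a summand of `divDiff` into the shape of `Finset.prod_add_ordered`. -/
lemma prod_ite_lt (i : Fin r) (A B C : Fin r → R) :
    (∏ l, if l < i then A l else if l = i then B l else C l) =
      B i * (∏ l ∈ Finset.univ.filter fun l => l < i, A l) *
        ∏ l ∈ Finset.univ.filter fun l => i < l, C l := by
  have h : (Finset.univ.filter fun l : Fin r => ¬ l < i) =
      insert i (Finset.univ.filter fun l => i < l) := by
    ext l
    simp only [Finset.mem_filter, Finset.mem_univ, true_and, Finset.mem_insert, not_lt]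
    rw [le_iff_eq_or_lt, eq_comm]
  rw [Finset.prod_ite, h, Finset.prod_insert (by simp), if_pos rfl]
  have h2 : (∏ l ∈ Finset.univ.filter fun l => i < l, if l = i then B l else C l) =
      ∏ l ∈ Finset.univ.filter fun l => i < l, C l := by
    refine Finset.prod_congr rfl fun l hl => ?_
    rw [if_neg (Finset.mem_filter.1 hl).2.ne']
  rw [h2]
  ring

/-- A telescoping sum: the factors `g l` are replaced by `f l` one at a time. -/
lemma mul_divDiff {f g x : ∀ l, c l → R} {s : R} (h : ∀ l b, f l b = g l b + s * x l b)
    (a : ∀ l, c l) : s * divDiff f g x a = (∏ l, f l (a l)) - ∏ l, g l (a l) := by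
  have h1 := Finset.prod_add_ordered Finset.univ (fun l => g l (a l)) (fun l => s * x l (a l))
  simp only [← h] at h1
  rw [h1, add_sub_cancel_left, divDiff, Finset.mul_sum]
  refine Finset.sum_congr rfl fun i _ => ?_
  rw [prod_ite_lt]
  ring

lemma map_divDiff (φ : R →+* S) (f g x : ∀ l, c l → R) (a : ∀ l, c l) :
    φ (divDiff f g x a) = divDiff (fun l b => φ (f l b)) (fun l b => φ (g l b))
      (fun l b => φ (x l b)) a := by
  rw [divDiff, divDiff, map_sum]
  refine Finset.sum_congr rfl fun i _ => ?_
  rw [map_prod]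
  refine Finset.prod_congr rfl fun l _ => ?_
  split_ifs <;> rfl

variable [∀ l, Fintype (c l)]

lemma sum_tensor_prod (M : ∀ l, c' l → c l → R) (f : ∀ l, c l → R) (a : ∀ l, c' l) :
    ∑ b : ∀ l, c l, (∏ l, M l (a l) (b l)) * ∏ l, f l (b l) =
      ∏ l, ∑ b, M l (a l) b * f l b := by
  rw [Finset.prod_univ_sum, Fintype.piFinset_univ]
  exact Finset.sum_congr rfl fun b _ => Finset.prod_mul_distrib.symm

lemma sum_tensor_divDiff (M : ∀ l, c' l → c l → R) (f g x : ∀ l, c l → R) (a : ∀ l, c' l) :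
    ∑ b : ∀ l, c l, (∏ l, M l (a l) (b l)) * divDiff f g x b =
      divDiff (fun l a => ∑ b, M l a b * f l b) (fun l a => ∑ b, M l a b * g l b)
        (fun l a => ∑ b, M l a b * x l b) a := by
  simp only [divDiff, Finset.mul_sum]
  rw [Finset.sum_comm]
  refine Finset.sum_congr rfl fun i _ => ?_
  rw [sum_tensor_prod M (fun l b => if l < i then f l b else if l = i then x l b else g l b)]
  refine Finset.prod_congr rfl fun l _ => ?_
  split_ifs <;> rfl

end Tensor

/-! ### The Cox presentation of the blowup of the product of projective spaces -/

section Source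

variable {k K : Type*} [Field k] [Field K] [Algebra k K] {r : ℕ} {n : Fin r → ℕ}

section Vectors

variable {R : Type*} [CommRing R] (q : CoxVar n → R)

/-- The vector `t i • v i + e • x i` in coordinates of `k v i ⊕ V̄ i`. -/
def uVec (i : Fin r) (o : Option (Fin (n i))) : R :=
  o.elim (q (CoxVar.t i)) fun b => q CoxVar.e * q (CoxVar.x i b)

/-- The vector `t i • v i` in coordinates of `k v i ⊕ V̄ i`. -/
def tVec (i : Fin r) (o : Option (Fin (n i))) : R := o.elim (q (CoxVar.t i)) fun _ => 0

/-- The vector `x i` in coordinates of `k v i ⊕ V̄ i`. -/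
def xVec (i : Fin r) (o : Option (Fin (n i))) : R := o.elim 0 fun b => q (CoxVar.x i b)

lemma uVec_eq (i : Fin r) (o : Option (Fin (n i))) :
    uVec q i o = tVec q i o + q CoxVar.e * xVec q i o := by
  rcases o with _ | b <;> simp [uVec, tVec, xVec]

/-- The tensor `(⊗ u i - ⊗ t i v i) / e` in coordinates of `k v i ⊕ V̄ i`. -/
def tensQ (o : ∀ i, Option (Fin (n i))) : R := divDiff (uVec q) (tVec q) (xVec q) o

lemma mul_tensQ (o : ∀ i, Option (Fin (n i))) :
    q CoxVar.e * tensQ q o = (∏ i, uVec q i (o i)) - ∏ i, tVec q i (o i) :=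
  mul_divDiff (uVec_eq q) o

lemma mul_tensQ_of_ne {o : ∀ i, Option (Fin (n i))} (ho : ∃ i, o i ≠ none) :
    q CoxVar.e * tensQ q o = ∏ i, uVec q i (o i) := by
  obtain ⟨i, hi⟩ := ho
  rw [mul_tensQ, Finset.prod_eq_zero (f := fun i => tVec q i (o i)) (Finset.mem_univ i), sub_zero]
  obtain ⟨b, hb⟩ := Option.ne_none_iff_exists'.1 hi
  simp [tVec, hb]

lemma tensQ_none : tensQ q (fun _ => none) = 0 := by
  rw [tensQ, divDiff]
  refine Finset.sum_eq_zero fun i _ => Finset.prod_eq_zero (Finset.mem_univ i) ?_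
  simp [xVec]

/-- The multi-index with one entry different from `none`. -/
def oneIdx (i : Fin r) (b : Fin (n i)) : ∀ i, Option (Fin (n i)) :=
  Function.update (fun _ => none) i (some b)

/-- Only the summand `i` survives, as `xVec` vanishes at `none`. These components do not involve
`e`, and on the exceptional divisor they recover the `x i b`. -/
lemma tensQ_oneIdx (i : Fin r) (b : Fin (n i)) : tensQ q (oneIdx i b) =
    q (CoxVar.x i b) * ∏ l ∈ Finset.univ.erase i, q (CoxVar.t l) := by
  have hne : ∀ l, l ≠ i → oneIdx i b l = none := fun l hl => by
    rw [oneIdx, Function.update_of_ne hl]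
  have heq : oneIdx i b i = some b := by rw [oneIdx, Function.update_self]
  rw [tensQ, divDiff, Finset.sum_eq_single i]
  · rw [← Finset.mul_prod_erase _ _ (Finset.mem_univ i)]
    congr 1
    · rw [if_neg (lt_irrefl i), if_pos rfl, heq]
      rfl
    · refine Finset.prod_congr rfl fun l hl => ?_
      have hl := Finset.ne_of_mem_erase hl
      rw [if_neg hl, hne l hl]
      split_ifs <;> rfl
  · intro j _ hj
    refine Finset.prod_eq_zero (Finset.mem_univ j) ?_
    rw [if_neg (lt_irrefl j), if_pos rfl, hne j hj]
    rfl
  · simp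

lemma tensQ_of_x_eq_zero (h : ∀ i b, q (CoxVar.x i b) = 0) (o : ∀ i, Option (Fin (n i))) :
    tensQ q o = 0 := by
  rw [tensQ, divDiff]
  refine Finset.sum_eq_zero fun i _ => Finset.prod_eq_zero (Finset.mem_univ i) ?_
  rw [if_neg (lt_irrefl i), if_pos rfl]
  rcases o i with _ | b <;> simp [xVec, h]

end Vectors

variable (B : Splitting k n)

/-- The matrix of the inverse of `B i`. -/
def invMat (i : Fin r) : Matrix (Fin (n i + 1)) (Option (Fin (n i))) k :=
  LinearMap.toMatrix' (B i).symm.toLinearMap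

/-- The matrix of `B i`. -/
def dirMat (i : Fin r) : Matrix (Option (Fin (n i))) (Fin (n i + 1)) k :=
  LinearMap.toMatrix' (B i).toLinearMap

lemma dirMat_mul_invMat (i : Fin r) : dirMat B i * invMat B i = 1 := by
  rw [dirMat, invMat, ← LinearMap.toMatrix'_comp]
  simp

lemma invMat_mul_dirMat (i : Fin r) : invMat B i * dirMat B i = 1 := by
  rw [dirMat, invMat, ← LinearMap.toMatrix'_comp]
  simp

variable {B} {v : ∀ i, Fin (n i + 1) → k}

lemma invMat_none (hB : ∀ i, B i (v i) = Pi.single none 1) (i : Fin r) (a : Fin (n i + 1)) :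
    invMat B i a none = v i a := by
  rw [invMat, LinearMap.toMatrix'_apply]
  have : (B i).symm (Pi.single none 1) = v i := by rw [← hB i, LinearEquiv.symm_apply_apply]
  exact congrFun this a

variable (B)

lemma sum_dirMat_invMat (i : Fin r) (o o' : Option (Fin (n i))) :
    ∑ a, algebraMap k K (dirMat B i o a) * algebraMap k K (invMat B i a o') =
      if o = o' then 1 else 0 := by
  simp only [← map_mul, ← map_sum]
  have := congrFun (congrFun (dirMat_mul_invMat B i) o) o'
  rw [Matrix.mul_apply, Matrix.one_apply] at this
  rw [this]
  split_ifs <;> simp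

lemma sum_invMat_dirMat (i : Fin r) (a a' : Fin (n i + 1)) :
    ∑ o, algebraMap k K (invMat B i a o) * algebraMap k K (dirMat B i o a') =
      if a = a' then 1 else 0 := by
  simp only [← map_mul, ← map_sum]
  have := congrFun (congrFun (invMat_mul_dirMat B i) a) a'
  rw [Matrix.mul_apply, Matrix.one_apply] at this
  rw [this]
  split_ifs <;> simp

/-- The vector of `V i ⊗ K` with coordinates `f` with respect to the splitting. -/
def unsplit (i : Fin r) (f : Option (Fin (n i)) → K) (a : Fin (n i + 1)) : K :=
  ∑ o, algebraMap k K (invMat B i a o) * f o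

/-- The coordinates of a vector with respect to the splitting. -/
def split (i : Fin r) (f : Fin (n i + 1) → K) (o : Option (Fin (n i))) : K :=
  ∑ a, algebraMap k K (dirMat B i o a) * f a

lemma split_unsplit (i : Fin r) (f : Option (Fin (n i)) → K) : split B i (unsplit B i f) = f := by
  funext o
  simp only [split, unsplit, Finset.mul_sum]
  rw [Finset.sum_comm]
  simp only [← mul_assoc, ← Finset.sum_mul, sum_dirMat_invMat]
  simp

lemma unsplit_split (i : Fin r) (f : Fin (n i + 1) → K) : unsplit B i (split B i f) = f := by
  funext o
  simp only [split, unsplit, Finset.mul_sum]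
  rw [Finset.sum_comm]
  simp only [← mul_assoc, ← Finset.sum_mul, sum_invMat_dirMat]
  simp

lemma split_smul (i : Fin r) (c : K) (f : Fin (n i + 1) → K) :
    split B i (c • f) = c • split B i f := by
  funext o
  simp only [split, Pi.smul_apply, smul_eq_mul, Finset.mul_sum]
  exact Finset.sum_congr rfl fun _ _ => by ring

lemma splitCoord_eq (p : MPt k K (ySpace n)) (i : Fin r) :
    splitCoord B p i = split B i (p i).rep := rfl

variable {B} in
lemma unsplit_single (hB : ∀ i, B i (v i) = Pi.single none 1) (i : Fin r) (c : K) :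
    unsplit B i (Pi.single none c) = fun a => c * algebraMap k K (v i a) := by
  funext a
  rw [unsplit, Finset.sum_eq_single none]
  · rw [Pi.single_eq_same, invMat_none hB, mul_comm]
  · intro o _ ho
    rw [Pi.single_eq_of_ne ho, mul_zero]
  · simp

/-! #### The polynomials -/

variable (v)

/-- The Cox coordinates as elements of the polynomial ring. -/
def genericPt (k : Type*) [Field k] (n : Fin r → ℕ) : CoxVar n → MvPolynomial (CoxVar n) k :=
  MvPolynomial.X

/-- A vector in coordinates of `V i`, from its coordinates with respect to the splitting. -/
def unsplitPoly (i : Fin r) (f : Option (Fin (n i)) → MvPolynomial (CoxVar n) k)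
    (a : Fin (n i + 1)) : MvPolynomial (CoxVar n) k :=
  ∑ o, MvPolynomial.C (invMat B i a o) * f o

/-- The tensor `(⊗ u i - ⊗ t i v i) / e`. -/
def tensPoly (a : TensIdx n) : MvPolynomial (CoxVar n) k :=
  divDiff (fun i => unsplitPoly B i (uVec (genericPt k n) i))
    (fun i => unsplitPoly B i (tVec (genericPt k n) i))
    (fun i => unsplitPoly B i (xVec (genericPt k n) i)) a

/-- The homogeneous coordinates on the blowup, as polynomials in the Cox coordinates. -/
def thetaYt : ∀ j : Fin r ⊕ Unit, ytSpace n j → MvPolynomial (CoxVar n) k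
  | Sum.inl i => fun a => unsplitPoly B i (uVec (genericPt k n) i) a
  | Sum.inr _ => fun ab => MvPolynomial.C (∏ i, v i (ab.2 i)) * tensPoly B ab.1 -
      MvPolynomial.C (∏ i, v i (ab.1 i)) * tensPoly B ab.2

/-- The degrees of the homogeneous coordinates on the blowup. -/
def degYt : Fin r ⊕ Unit → Option (Fin r) → ℤ
  | Sum.inl i => degX i + degE r
  | Sum.inr _ => ∑ i : Fin r, (degX i + degE r) - degE r

lemma hom_uVec (i : Fin r) (o : Option (Fin (n i))) :
    Hom wt (uVec (genericPt k n) i o) (degX i + degE r) := by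
  rcases o with _ | b
  · exact hom_X (w := wt) (CoxVar.t i)
  · have := (hom_X (k := k) (w := wt) (CoxVar.e : CoxVar n)).mul (hom_X (k := k) (CoxVar.x i b))
    rwa [add_comm] at this

lemma hom_tVec (i : Fin r) (o : Option (Fin (n i))) :
    Hom wt (tVec (genericPt k n) i o) (degX i + degE r) := by
  rcases o with _ | b
  · exact hom_X (w := wt) (CoxVar.t i)
  · exact hom_zero _

lemma hom_xVec (i : Fin r) (o : Option (Fin (n i))) :
    Hom wt (xVec (genericPt k n) i o) (degX i) := by
  rcases o with _ | b
  · exact hom_zero _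
  · exact hom_X (w := wt) (CoxVar.x i b)

lemma hom_unsplitPoly {i : Fin r} {f : Option (Fin (n i)) → MvPolynomial (CoxVar n) k}
    {d : Option (Fin r) → ℤ} (hf : ∀ o, Hom wt (f o) d) (a : Fin (n i + 1)) :
    Hom wt (unsplitPoly B i f a) d :=
  Hom.sum _ fun o _ => (hf o).C_mul _

lemma hom_tensPoly (a : TensIdx n) :
    Hom wt (tensPoly B a) (∑ i : Fin r, (degX i + degE r) - degE r) := by
  refine Hom.sum _ fun i _ => ?_
  -- In the `i`-th summand one factor `u i` is replaced by `x i`, which lowers the degree by `degE`.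
  have h : ∑ l : Fin r, (degX l + degE r) - degE r =
      ∑ l : Fin r, if l = i then degX l else degX l + degE r := by
    rw [← Finset.add_sum_erase _ _ (Finset.mem_univ i),
      ← Finset.add_sum_erase (a := i) _ (fun l => if l = i then degX l else degX l + degE r)
        (Finset.mem_univ i), if_pos rfl]
    rw [Finset.sum_congr rfl fun l hl => if_neg (Finset.ne_of_mem_erase hl)]
    abel
  rw [h]
  refine Hom.prod _ fun l _ => ?_
  split_ifs with h1 h2 h3
  · exact absurd h2 h1.ne
  · exact hom_unsplitPoly B (hom_uVec l) _
  · exact hom_unsplitPoly B (hom_xVec l) _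
  · exact hom_unsplitPoly B (hom_tVec l) _

lemma hom_thetaYt (j : Fin r ⊕ Unit) (a : ytSpace n j) :
    Hom wt (thetaYt B v j a) (degYt j) := by
  rcases j with i | _
  · exact hom_unsplitPoly B (hom_uVec i) _
  · exact ((hom_tensPoly B _).C_mul _).sub ((hom_tensPoly B _).C_mul _)

/-! #### Values of the polynomials -/

lemma aeval_unsplitPoly (q : CoxVar n → K) (i : Fin r)
    (f : Option (Fin (n i)) → MvPolynomial (CoxVar n) k) (a : Fin (n i + 1)) :
    MvPolynomial.aeval q (unsplitPoly B i f a) =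
      unsplit B i (fun o => MvPolynomial.aeval q (f o)) a := by
  simp [unsplitPoly, unsplit]

lemma aeval_uVec (q : CoxVar n → K) (i : Fin r) :
    (fun o => MvPolynomial.aeval q (uVec (genericPt k n) i o)) = uVec q i := by
  funext o
  rcases o with _ | b <;> simp [uVec, genericPt]

lemma aeval_tVec (q : CoxVar n → K) (i : Fin r) :
    (fun o => MvPolynomial.aeval q (tVec (genericPt k n) i o)) = tVec q i := by
  funext o
  rcases o with _ | b <;> simp [tVec, genericPt]

lemma aeval_xVec (q : CoxVar n → K) (i : Fin r) :
    (fun o => MvPolynomial.aeval q (xVec (genericPt k n) i o)) = xVec q i := by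
  funext o
  rcases o with _ | b <;> simp [xVec, genericPt]

/-- The value of `tensPoly`. -/
def tensVal (q : CoxVar n → K) (a : TensIdx n) : K :=
  divDiff (fun i => unsplit B i (uVec q i)) (fun i => unsplit B i (tVec q i))
    (fun i => unsplit B i (xVec q i)) a

lemma aeval_tensPoly (q : CoxVar n → K) (a : TensIdx n) :
    MvPolynomial.aeval q (tensPoly B a) = tensVal B q a := by
  have := map_divDiff (MvPolynomial.aeval (R := k) q).toRingHom
    (fun i => unsplitPoly B i (uVec (genericPt k n) i))
    (fun i => unsplitPoly B i (tVec (genericPt k n) i))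
    (fun i => unsplitPoly B i (xVec (genericPt k n) i)) a
  refine this.trans ?_
  simp only [AlgHom.toRingHom_eq_coe, RingHom.coe_coe, aeval_unsplitPoly, aeval_uVec, aeval_tVec,
    aeval_xVec]
  rfl

lemma aeval_thetaYt_inl (q : CoxVar n → K) (i : Fin r) (a : Fin (n i + 1)) :
    MvPolynomial.aeval q (thetaYt B v (Sum.inl i) a) = unsplit B i (uVec q i) a := by
  rw [← aeval_uVec (k := k), ← aeval_unsplitPoly]
  rfl

/-- The tensor `⊗ v i`. -/
def vTens (a : TensIdx n) : K := ∏ i, algebraMap k K (v i (a i))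

/-- The value of the homogeneous coordinates of the last factor. -/
def wedgeVal (q : CoxVar n → K) (ab : TensIdx n × TensIdx n) : K :=
  vTens v ab.2 * tensVal B q ab.1 - vTens v ab.1 * tensVal B q ab.2

lemma aeval_thetaYt_inr (q : CoxVar n → K) (u : Unit) (ab : TensIdx n × TensIdx n) :
    MvPolynomial.aeval q (thetaYt B v (Sum.inr u) ab) =
      wedgeVal B v q ab := by
  rw [wedgeVal, ← aeval_tensPoly, ← aeval_tensPoly]
  simp [thetaYt, vTens, map_prod]

lemma tensVal_eq (q : CoxVar n → K) (a : TensIdx n) :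
    tensVal B q a = ∑ o : ∀ i, Option (Fin (n i)),
      (∏ i, algebraMap k K (invMat B i (a i) (o i))) * tensQ q o := by
  exact (sum_tensor_divDiff (fun i a o => algebraMap k K (invMat B i a o)) _ _ _ a).symm

lemma sum_dirMat_tensVal (q : CoxVar n → K) (o : ∀ i, Option (Fin (n i))) :
    ∑ a : TensIdx n, (∏ i, algebraMap k K (dirMat B i (o i) (a i))) * tensVal B q a =
      tensQ q o := by
  refine (sum_tensor_divDiff (fun i o a => algebraMap k K (dirMat B i o a)) _ _ _ o).trans ?_
  have h : ∀ (i : Fin r) (f : Option (Fin (n i)) → K) (o : Option (Fin (n i))),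
      ∑ a, algebraMap k K (dirMat B i o a) * unsplit B i f a = f o := fun i f o =>
    congrFun (split_unsplit B i f) o
  simp only [h]
  rfl

variable {B v} in
lemma sum_dirMat_vTens (hB : ∀ i, B i (v i) = Pi.single none 1) :
    ∑ a : TensIdx n, (∏ i, algebraMap k K (dirMat B i none (a i))) * vTens v a = 1 := by
  refine (sum_tensor_prod (fun i (o : Option (Fin (n i))) a => algebraMap k K (dirMat B i o a))
    (fun i a => algebraMap k K (v i a)) (fun _ => none)).trans ?_
  refine Finset.prod_eq_one fun i _ => ?_
  have := congrFun (split_unsplit B i (Pi.single none (1 : K))) none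
  rw [unsplit_single hB] at this
  simpa [split] using this

/-- The coefficients of the linear forms that recover `tensQ` from the homogeneous coordinates. -/
def lamCoeff (o : ∀ i, Option (Fin (n i))) (ab : TensIdx n × TensIdx n) : k :=
  (∏ i, dirMat B i (o i) (ab.1 i)) * ∏ i, dirMat B i none (ab.2 i)

/-- The linear form with coefficients `lamCoeff`. -/
def lamForm (o : ∀ i, Option (Fin (n i))) (W : TensIdx n × TensIdx n → K) : K :=
  ∑ ab, algebraMap k K (lamCoeff B o ab) * W ab

lemma lamForm_smul (o : ∀ i, Option (Fin (n i))) (c : K) (W : TensIdx n × TensIdx n → K) :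
    lamForm B o (c • W) = c * lamForm B o W := by
  simp only [lamForm, Pi.smul_apply, smul_eq_mul, Finset.mul_sum]
  exact Finset.sum_congr rfl fun _ _ => by ring

variable {B v} in
-- The second tensor factor is contracted with the coordinate dual to ⊗ v i. In the antisymmetrised
-- expression the first term gives the component `o`, and the second vanishes because the component
-- `none` of `tensQ` is zero.
lemma lamForm_wedgeVal (hB : ∀ i, B i (v i) = Pi.single none 1) (o : ∀ i, Option (Fin (n i)))
    (q : CoxVar n → K) : lamForm B o (wedgeVal B v q) = tensQ q o := by
  have h : lamForm B o (wedgeVal B v q) =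
      (∑ a : TensIdx n, (∏ i, algebraMap k K (dirMat B i (o i) (a i))) * tensVal B q a) *
        (∑ a : TensIdx n, (∏ i, algebraMap k K (dirMat B i none (a i))) * vTens v a) -
      (∑ a : TensIdx n, (∏ i, algebraMap k K (dirMat B i (o i) (a i))) * vTens v a) *
        (∑ a : TensIdx n, (∏ i, algebraMap k K (dirMat B i none (a i))) * tensVal B q a) := by
    rw [Finset.sum_mul_sum, Finset.sum_mul_sum, ← Finset.sum_sub_distrib, lamForm,
      Fintype.sum_prod_type]
    refine Finset.sum_congr rfl fun a _ => ?_
    rw [← Finset.sum_sub_distrib]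
    refine Finset.sum_congr rfl fun b _ => ?_
    rw [lamCoeff, wedgeVal, map_mul, map_prod, map_prod]
    ring
  rw [h, sum_dirMat_tensVal, sum_dirMat_tensVal B q (fun _ => none), tensQ_none,
    sum_dirMat_vTens hB]
  ring

variable {B v} in
-- Multiplied by `e`, the tensor is ⊗ u i minus a multiple of ⊗ v i, and the minors with ⊗ v i do
-- not see that multiple.
lemma mul_wedgeVal (hB : ∀ i, B i (v i) = Pi.single none 1) (q : CoxVar n → K)
    (ab : TensIdx n × TensIdx n) : q CoxVar.e * wedgeVal B v q ab =
      vTens v ab.2 * (∏ i, unsplit B i (uVec q i) (ab.1 i)) -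
        vTens v ab.1 * ∏ i, unsplit B i (uVec q i) (ab.2 i) := by
  have h : ∀ a : TensIdx n, q CoxVar.e * tensVal B q a = (∏ i, unsplit B i (uVec q i) (a i)) -
      (∏ i, q (CoxVar.t i)) * vTens v a := by
    intro a
    rw [tensVal, mul_divDiff (s := q CoxVar.e), vTens, ← Finset.prod_mul_distrib]
    · congr 1
      refine Finset.prod_congr rfl fun i _ => ?_
      have : tVec q i = Pi.single none (q (CoxVar.t i)) := by
        funext o
        rcases o with _ | b <;> simp [tVec]
      rw [this, unsplit_single hB]
    · intro l b
      simp only [unsplit, Finset.mul_sum, ← Finset.sum_add_distrib]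
      refine Finset.sum_congr rfl fun o _ => ?_
      rw [uVec_eq]
      ring
  rw [wedgeVal, mul_sub, mul_left_comm, h, mul_left_comm, h]
  ring

end Source

/-! ### Equations that hold on the closure of a graph. -/

section BlowupEquations

variable {k K : Type*} [Field k] [Field K] [Algebra k K] {ι J : Type} {m : ι → Type} {c : J → Type}

/-- A form on the blown up variety as a form on the blowup. -/
def extendForm (c : J → Type) (F : MvPolynomial (Σ i, m i) k) :
    MvPolynomial (Σ s, Sum.elim m c s) k :=
  MvPolynomial.rename (fun s : Σ i, m i => (⟨Sum.inl s.1, s.2⟩ : Σ s, Sum.elim m c s)) F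

lemma hval_extendForm (F : MvPolynomial (Σ i, m i) k) (p : MPt k K (Sum.elim m c)) :
    hval (extendForm c F) p = hval F (fst p) := by
  rw [extendForm, hval, MvPolynomial.aeval_rename]
  rfl

lemma isMultiHom_extendForm {F : MvPolynomial (Σ i, m i) k} {d : ι →₀ ℕ} (hF : IsMultiHom F d) :
    IsMultiHom (extendForm c F) (d.mapDomain Sum.inl) := by
  classical
  rw [extendForm, ← F.support_sum_monomial_coeff, map_sum]
  refine MvPolynomial.IsWeightedHomogeneous.sum _ _ _ fun a ha => ?_
  rw [MvPolynomial.rename_monomial]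
  refine MvPolynomial.isWeightedHomogeneous_monomial _ _ _ ?_
  rw [← hF (MvPolynomial.mem_support_iff.1 ha), Finsupp.weight_apply, Finsupp.weight_apply,
    Finsupp.sum_mapDomain_index (by simp) (by intros; rw [add_smul])]
  refine Eq.trans ?_ (Finsupp.mapDomain_finsetSum).symm
  refine Finset.sum_congr rfl fun s _ => ?_
  rw [Finsupp.mapDomain_smul, Finsupp.mapDomain_single]

lemma IsMultiHom.sub {F G : MvPolynomial (Σ j, m j) k} {d : ι →₀ ℕ} (hF : IsMultiHom F d)
    (hG : IsMultiHom G d) : IsMultiHom (F - G) d :=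
  Submodule.sub_mem (MvPolynomial.weightedHomogeneousSubmodule k _ d) hF hG

/-- The equations of the graph hold on its closure. -/
lemma blowup_mul_comm {X : Set (MPt k K m)} {F : ∀ j, c j → MvPolynomial (Σ i, m i) k}
    {d : J → ι →₀ ℕ} (hF : ∀ j a, IsMultiHom (F j a) (d j)) {p : MPt k K (Sum.elim m c)}
    (hp : p ∈ blowup X F) (j : J) (a b : c j) :
    hval (F j a) (fst p) * (p (Sum.inr j)).rep b = hval (F j b) (fst p) * (p (Sum.inr j)).rep a := by
  have h1 : IsMultiHom (extendForm c (F j a) * MvPolynomial.X (⟨Sum.inr j, b⟩ : Σ s, Sum.elim m c s)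
      - extendForm c (F j b) * MvPolynomial.X (⟨Sum.inr j, a⟩ : Σ s, Sum.elim m c s)) _ :=
    ((isMultiHom_extendForm (hF j a)).mul (isMultiHom_X _)).sub
      ((isMultiHom_extendForm (hF j b)).mul (isMultiHom_X _))
  have h2 : ∀ q : MPt k K (Sum.elim m c),
      hval (extendForm c (F j a) * MvPolynomial.X (⟨Sum.inr j, b⟩ : Σ s, Sum.elim m c s)
      - extendForm c (F j b) * MvPolynomial.X (⟨Sum.inr j, a⟩ : Σ s, Sum.elim m c s)) q =
      hval (F j a) (fst q) * (q (Sum.inr j)).rep b - hval (F j b) (fst q) * (q (Sum.inr j)).rep a := by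
    intro q
    rw [← hval_extendForm (c := c), ← hval_extendForm (c := c) (F j b)]
    simp [hval]
  have h3 := closure_minimal (s := {p | fst p ∈ X ∧ ∀ j, Represents (fun a => hval (F j a) (fst p))
    (p (Sum.inr j))}) (fun q hq => ?_) (isClosed_hval_eq_zero h1) hp.2
  · rw [Set.mem_ofPred_eq, h2, sub_eq_zero] at h3
    exact h3
  · obtain ⟨t, _, ht⟩ := hq.2 j
    rw [Set.mem_ofPred_eq, h2, sub_eq_zero]
    have ha := congrFun ht a
    have hb := congrFun ht b
    simp only [Pi.smul_apply, smul_eq_mul] at ha hb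
    rw [ha, hb]
    exact mul_right_comm _ _ _

/-- Where the forms do not vanish simultaneously, the blowup is the graph. -/
lemma represents_of_mem_blowup {X : Set (MPt k K m)} {F : ∀ j, c j → MvPolynomial (Σ i, m i) k}
    {d : J → ι →₀ ℕ} (hF : ∀ j a, IsMultiHom (F j a) (d j)) {p : MPt k K (Sum.elim m c)}
    (hp : p ∈ blowup X F) {j : J} (h0 : (fun a => hval (F j a) (fst p)) ≠ 0) :
    Represents (fun a => hval (F j a) (fst p)) (p (Sum.inr j)) := by
  obtain ⟨b, hb⟩ := Function.ne_iff.1 (p (Sum.inr j)).rep_nonzero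
  have hb : (p (Sum.inr j)).rep b ≠ 0 := hb
  have key : ∀ a, hval (F j a) (fst p) =
      hval (F j b) (fst p) / (p (Sum.inr j)).rep b * (p (Sum.inr j)).rep a := by
    intro a
    rw [div_mul_eq_mul_div, eq_div_iff hb]
    exact blowup_mul_comm hF hp j a b
  refine ⟨_, div_ne_zero (fun h => h0 (funext fun a => ?_)) hb, funext key⟩
  rw [key, h, zero_div, zero_mul, Pi.zero_apply]

lemma isMultiHom_sum {α : Type*} (s : Finset α) {F : α → MvPolynomial (Σ j, m j) k} {d : ι →₀ ℕ}
    (hF : ∀ a ∈ s, IsMultiHom (F a) d) : IsMultiHom (∑ a ∈ s, F a) d :=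
  MvPolynomial.IsWeightedHomogeneous.sum _ _ _ hF

end BlowupEquations

/-! ### Cox coordinates of the points of the blowup of the product. -/

section Source

variable {k K : Type*} [Field k] [Field K] [Algebra k K] {r : ℕ} {n : Fin r → ℕ}
variable (B : Splitting k n) {v : ∀ i, Fin (n i + 1) → k}

lemma unsplit_zero (i : Fin r) : unsplit B i (0 : Option (Fin (n i)) → K) = 0 := by
  funext a
  simp [unsplit]

lemma unsplit_smul (i : Fin r) (c : K) (f : Option (Fin (n i)) → K) :
    unsplit B i (c • f) = c • unsplit B i f := by
  funext o
  simp only [unsplit, Pi.smul_apply, smul_eq_mul, Finset.mul_sum]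
  exact Finset.sum_congr rfl fun _ _ => by ring

lemma unsplit_ne_zero_iff (i : Fin r) (f : Option (Fin (n i)) → K) :
    unsplit B i f ≠ 0 ↔ f ≠ 0 := by
  refine not_congr ⟨fun h => ?_, fun h => by rw [h, unsplit_zero]⟩
  have := congrArg (split B i) h
  rw [split_unsplit] at this
  rw [this]
  funext o
  simp [split]

variable {B}

lemma uVec_ne_zero_iff (q : CoxVar n → K) (i : Fin r) :
    uVec q i ≠ 0 ↔ q (CoxVar.t i) ≠ 0 ∨ ∃ b, q CoxVar.e * q (CoxVar.x i b) ≠ 0 := by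
  rw [Function.ne_iff]
  constructor
  · rintro ⟨_ | b, h⟩
    · exact Or.inl h
    · exact Or.inr ⟨b, h⟩
  · rintro (h | ⟨b, h⟩)
    · exact ⟨none, h⟩
    · exact ⟨some b, h⟩

lemma wedgeVal_eq (q : CoxVar n → K) (ab : TensIdx n × TensIdx n) :
    wedgeVal B v q ab = ∑ o : ∀ i, Option (Fin (n i)),
      ((vTens v ab.2 * ∏ i, algebraMap k K (invMat B i (ab.1 i) (o i))) -
        vTens v ab.1 * ∏ i, algebraMap k K (invMat B i (ab.2 i) (o i))) * tensQ q o := by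
  rw [wedgeVal, tensVal_eq, tensVal_eq, Finset.mul_sum, Finset.mul_sum, ← Finset.sum_sub_distrib]
  exact Finset.sum_congr rfl fun _ _ => by ring

lemma exists_c_of_regular {q : CoxVar n → K}
    (h1 : ∀ i, q (CoxVar.t i) ≠ 0 ∨ ∃ b, q CoxVar.e * q (CoxVar.x i b) ≠ 0) :
    ∃ o : ∀ i, Option (Fin (n i)), ∀ i, uVec q i (o i) ≠ 0 := by
  have : ∀ i, ∃ o, uVec q i o ≠ 0 := fun i => Function.ne_iff.1 ((uVec_ne_zero_iff q i).2 (h1 i))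
  choose o ho using this
  exact ⟨o, ho⟩

/-- The component in the last factor. -/
def wPt (p : MPt k K (ytSpace n)) : Projectivization K (TensIdx n × TensIdx n → K) := p (Sum.inr ())

lemma lifts_thetaYt_iff {q : CoxVar n → K} {p : MPt k K (ytSpace n)} :
    Lifts (thetaYt B v) q p ↔ (∀ i, Represents (unsplit B i (uVec q i)) (fst p i)) ∧
      Represents (wedgeVal B v q) (wPt p) := by
  have h1 : ∀ i, (fun a => MvPolynomial.aeval q (thetaYt B v (Sum.inl i) a)) =
      unsplit B i (uVec q i) := fun i => funext fun a => aeval_thetaYt_inl B v q i a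
  have h2 : (fun a => MvPolynomial.aeval q (thetaYt B v (Sum.inr ()) a)) =
      wedgeVal B v q := funext fun a => aeval_thetaYt_inr B v q () a
  constructor
  · intro h
    exact ⟨fun i => h1 i ▸ h (Sum.inl i), h2 ▸ h (Sum.inr ())⟩
  · rintro ⟨h, h'⟩ (i | u)
    · exact (h1 i).symm ▸ h i
    · exact h2.symm ▸ h'

lemma mem_regLocus_thetaYt_iff {q : CoxVar n → K} : q ∈ regLocus K (thetaYt B v) ↔
    (∀ i, uVec q i ≠ 0) ∧ wedgeVal B v q ≠ 0 := by
  have h1 : ∀ i, (∃ a, MvPolynomial.aeval q (thetaYt B v (Sum.inl i) a) ≠ 0) ↔ uVec q i ≠ 0 := by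
    intro i
    rw [← unsplit_ne_zero_iff B, Function.ne_iff]
    exact exists_congr fun a => not_congr (by rw [← aeval_thetaYt_inl B v q i a]; rfl)
  have h2 : (∃ a, MvPolynomial.aeval q (thetaYt B v (Sum.inr ()) a) ≠ 0) ↔ wedgeVal B v q ≠ 0 := by
    rw [Function.ne_iff]
    exact exists_congr fun a => not_congr (by rw [← aeval_thetaYt_inr B v q () a]; rfl)
  constructor
  · intro h
    exact ⟨fun i => (h1 i).1 (h (Sum.inl i)), h2.1 (h (Sum.inr ()))⟩
  · rintro ⟨h, h'⟩ (i | u)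
    · exact (h1 i).2 (h i)
    · exact h2.2 h'

/-- The last component vanishes only if all `x i b` do. Given `x i b ≠ 0`: if `e = 0`, all `t l` are
nonzero and the component `oneIdx i b` is nonzero. If `e ≠ 0`, put the entry `some b` at `i` into a
multi-index along which no `u l` vanishes. -/
lemma mem_regLocus_thetaYt (hB : ∀ i, B i (v i) = Pi.single none 1) {q : CoxVar n → K} :
    q ∈ regLocus K (thetaYt B v) ↔
      (∀ i, q (CoxVar.t i) ≠ 0 ∨ ∃ b, q CoxVar.e * q (CoxVar.x i b) ≠ 0) ∧
        ∃ i b, q (CoxVar.x i b) ≠ 0 := by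
  rw [mem_regLocus_thetaYt_iff, forall_congr' fun i => uVec_ne_zero_iff q i]
  refine and_congr_right fun h1 => ⟨fun h => ?_, ?_⟩
  · by_contra! h0
    refine h (funext fun ab => ?_)
    rw [wedgeVal_eq]
    exact Finset.sum_eq_zero fun o _ => by rw [tensQ_of_x_eq_zero q h0, mul_zero]
  · rintro ⟨i, b, hx⟩ h0
    have hQ : ∀ o, tensQ q o = 0 := by
      intro o
      rw [← lamForm_wedgeVal hB, h0]
      simp [lamForm]
    by_cases he : q CoxVar.e = 0
    · have ht : ∀ l, q (CoxVar.t l) ≠ 0 := fun l => (h1 l).resolve_right (by simp [he])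
      have := hQ (oneIdx i b)
      rw [tensQ_oneIdx] at this
      exact mul_ne_zero hx (Finset.prod_ne_zero_iff.2 fun l _ => ht l) this
    · obtain ⟨o, ho⟩ := exists_c_of_regular h1
      have h2 := mul_tensQ_of_ne q (o := Function.update o i (some b)) ⟨i, by simp⟩
      rw [hQ, mul_zero] at h2
      refine Finset.prod_ne_zero_iff.2 (fun l _ => ?_) h2.symm
      by_cases hl : l = i
      · subst hl
        rw [Function.update_self]
        exact mul_ne_zero he hx
      · rw [Function.update_of_ne hl]
        exact ho l

lemma isMultiHom_baseForms (u : Unit) (ab : TensIdx n × TensIdx n) :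
    IsMultiHom (baseForms v u ab) (∑ i : Fin r, Finsupp.single i 1) := by
  have h : ∀ a : TensIdx n, IsMultiHom
      (∏ i, MvPolynomial.X (⟨i, a i⟩ : Σ i, ySpace n i) : MvPolynomial (Σ i, ySpace n i) k)
      (∑ i : Fin r, Finsupp.single i 1) := fun a =>
    MvPolynomial.IsWeightedHomogeneous.prod _ _ _ fun i _ => isMultiHom_X _
  exact ((h _).C_mul _).sub ((h _).C_mul _)

lemma hval_baseForms (u : Unit) (ab : TensIdx n × TensIdx n) (p : MPt k K (ySpace n)) :
    hval (baseForms v u ab) p = vTens v ab.2 * ∏ i, (p i).rep (ab.1 i) -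
      vTens v ab.1 * ∏ i, (p i).rep (ab.2 i) := by
  simp [hval, baseForms, vTens, map_prod]

/-- The forms vanishing at the base point, at a point with given Cox coordinates. -/
lemma exists_hval_baseForms (hB : ∀ i, B i (v i) = Pi.single none 1) {q : CoxVar n → K}
    {p : MPt k K (ytSpace n)} (h : Lifts (thetaYt B v) q p) : ∃ s : K, s ≠ 0 ∧
      (fun ab => hval (baseForms v () ab) (fst p)) = (s * q CoxVar.e) • wedgeVal B v q := by
  choose s hs h1 using (lifts_thetaYt_iff.1 h).1
  have hs' : (∏ i, s i) ≠ 0 := Finset.prod_ne_zero_iff.2 fun i _ => hs i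
  have h2 : ∀ a : TensIdx n, (∏ i, s i) * ∏ i, (fst p i).rep (a i) =
      ∏ i, unsplit B i (uVec q i) (a i) := by
    intro a
    rw [← Finset.prod_mul_distrib]
    exact Finset.prod_congr rfl fun i _ => (congrFun (h1 i) (a i)).symm
  refine ⟨(∏ i, s i)⁻¹, inv_ne_zero hs', funext fun ab => ?_⟩
  rw [Pi.smul_apply, smul_eq_mul, mul_assoc, mul_wedgeVal hB, ← h2, ← h2, hval_baseForms,
    eq_inv_mul_iff_mul_eq₀ hs']
  ring

lemma represents_baseForms (hB : ∀ i, B i (v i) = Pi.single none 1) {q : CoxVar n → K}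
    {p : MPt k K (ytSpace n)} (h : Lifts (thetaYt B v) q p) (he : q CoxVar.e ≠ 0) :
    Represents (fun ab => hval (baseForms v () ab) (fst p)) (wPt p) := by
  obtain ⟨s, hs, h1⟩ := exists_hval_baseForms hB h
  rw [h1]
  exact (lifts_thetaYt_iff.1 h).2.smul (mul_ne_zero hs he)

/-- If `e = 0`, changing it to a nonzero `ε` gives points of the graph. -/
lemma mem_Yt_of_lifts [Infinite K] (hB : ∀ i, B i (v i) = Pi.single none 1) {q : CoxVar n → K}
    {p : MPt k K (ytSpace n)} (h : Lifts (thetaYt B v) q p) : p ∈ Yt K v := by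
  refine ⟨trivial, mem_closure_of_deform (hom_thetaYt B v) {CoxVar.e} h fun ε hε p' hp' => ?_⟩
  exact ⟨trivial, fun _ => represents_baseForms hB hp' (deform_ne hε q (Set.mem_singleton _))⟩

/-- The Cox coordinates with `e = 1` of a point of the product of projective spaces. -/
def affineLift (B : Splitting k n) (p : MPt k K (ySpace n)) : CoxVar n → K
  | CoxVar.e => 1
  | CoxVar.t i => splitCoord B p i none
  | CoxVar.x i b => splitCoord B p i (some b)

lemma uVec_affineLift (p : MPt k K (ySpace n)) (i : Fin r) :
    uVec (affineLift B p) i = splitCoord B p i := by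
  funext o
  rcases o with _ | b <;> simp [uVec, affineLift]

lemma wedgeVal_affineLift (hB : ∀ i, B i (v i) = Pi.single none 1) (p : MPt k K (ySpace n)) :
    wedgeVal B v (affineLift B p) = fun ab => hval (baseForms v () ab) p := by
  funext ab
  have := mul_wedgeVal hB (affineLift B p) ab
  simp only [uVec_affineLift, splitCoord_eq, unsplit_split] at this
  rw [hval_baseForms, ← this]
  simp [affineLift]

lemma lifts_affineLift (hB : ∀ i, B i (v i) = Pi.single none 1) {p : MPt k K (ytSpace n)}
    (h : Represents (fun ab => hval (baseForms v () ab) (fst p)) (wPt p)) :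
    Lifts (thetaYt B v) (affineLift B (fst p)) p := by
  rw [lifts_thetaYt_iff]
  refine ⟨fun i => ?_, (wedgeVal_affineLift hB (fst p)).symm ▸ h⟩
  rw [uVec_affineLift, splitCoord_eq, unsplit_split]
  exact represents_rep _

/-- A summand contains just one factor `x`. At the other entry different from `none` both `u` and
`t` vanish when `e = 0`. -/
lemma tensQ_of_two {q : CoxVar n → K} (he : q CoxVar.e = 0) {o : ∀ i, Option (Fin (n i))}
    {i j : Fin r} (hij : i ≠ j) (hi : o i ≠ none) (hj : o j ≠ none) : tensQ q o = 0 := by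
  obtain ⟨b, hb⟩ := Option.ne_none_iff_exists'.1 hi
  obtain ⟨c, hc⟩ := Option.ne_none_iff_exists'.1 hj
  rw [tensQ, divDiff]
  refine Finset.sum_eq_zero fun l _ => ?_
  by_cases hl : l = i
  · refine Finset.prod_eq_zero (Finset.mem_univ j) ?_
    rw [if_neg (show ¬ j = l by rw [hl]; exact hij.symm), hc]
    simp [uVec, tVec, he]
  · refine Finset.prod_eq_zero (Finset.mem_univ i) ?_
    rw [if_neg (show ¬ i = l from Ne.symm hl), hb]
    simp [uVec, tVec, he]

lemma exists_splitCoord {q : CoxVar n → K} {p : MPt k K (ytSpace n)}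
    (h : Lifts (thetaYt B v) q p) :
    ∃ s : Fin r → K, (∀ i, s i ≠ 0) ∧ ∀ i o, splitCoord B (fst p) i o = s i * uVec q i o := by
  choose s hs h using (lifts_thetaYt_iff.1 h).1
  refine ⟨fun i => (s i)⁻¹, fun i => inv_ne_zero (hs i), fun i o => ?_⟩
  have := congrArg (split B i) (h i)
  rw [split_unsplit, split_smul] at this
  rw [this, Pi.smul_apply, smul_eq_mul, inv_mul_cancel_left₀ (hs i), splitCoord_eq]

lemma exists_lamForm (hB : ∀ i, B i (v i) = Pi.single none 1) {q : CoxVar n → K}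
    {p : MPt k K (ytSpace n)} (h : Lifts (thetaYt B v) q p) :
    ∃ s : K, s ≠ 0 ∧ (wPt p).rep = s • wedgeVal B v q ∧
      ∀ o, lamForm B o (wPt p).rep = s * tensQ q o := by
  obtain ⟨s, hs, h⟩ := (lifts_thetaYt_iff.1 h).2
  have h2 : (wPt p).rep = s⁻¹ • wedgeVal B v q := by rw [h, smul_smul, inv_mul_cancel₀ hs, one_smul]
  refine ⟨s⁻¹, inv_ne_zero hs, h2, fun o => ?_⟩
  rw [h2, lamForm_smul, lamForm_wedgeVal hB]

/-- The linear form `lamForm` as a polynomial. -/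
def lamPoly (B : Splitting k n) (o : ∀ i, Option (Fin (n i))) :
    MvPolynomial (Σ j, ytSpace n j) k :=
  ∑ ab : TensIdx n × TensIdx n,
    MvPolynomial.C (lamCoeff B o ab) * MvPolynomial.X ⟨Sum.inr (), ab⟩

/-- A coordinate with respect to the splitting as a polynomial. -/
def splitPoly (B : Splitting k n) (i : Fin r) (o : Option (Fin (n i))) :
    MvPolynomial (Σ j, ytSpace n j) k :=
  ∑ a : Fin (n i + 1), MvPolynomial.C (dirMat B i o a) * MvPolynomial.X ⟨Sum.inl i, a⟩

lemma isMultiHom_lamPoly (o : ∀ i, Option (Fin (n i))) :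
    IsMultiHom (lamPoly B o) (Finsupp.single (Sum.inr ()) 1) :=
  isMultiHom_sum _ fun _ _ => (isMultiHom_X _).C_mul _

lemma isMultiHom_splitPoly (i : Fin r) (o : Option (Fin (n i))) :
    IsMultiHom (splitPoly B i o) (Finsupp.single (Sum.inl i) 1) :=
  isMultiHom_sum _ fun _ _ => (isMultiHom_X _).C_mul _

lemma hval_lamPoly (o : ∀ i, Option (Fin (n i))) (p : MPt k K (ytSpace n)) :
    hval (lamPoly B o) p = lamForm B o (wPt p).rep := by
  simp only [lamPoly, hval, map_sum, map_mul, MvPolynomial.aeval_C, MvPolynomial.aeval_X]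
  rfl

lemma hval_splitPoly (i : Fin r) (o : Option (Fin (n i))) (p : MPt k K (ytSpace n)) :
    hval (splitPoly B i o) p = splitCoord B (fst p) i o := by
  simp only [splitPoly, hval, map_sum, map_mul, MvPolynomial.aeval_C, MvPolynomial.aeval_X]
  rfl

/-- Equations are checked on the graph, where Cox coordinates with `e = 1` exist, and pass to the
closure. -/
lemma hval_eq_zero_of_mem_Yt (hB : ∀ i, B i (v i) = Pi.single none 1)
    {F : MvPolynomial (Σ j, ytSpace n j) k} {d : Fin r ⊕ Unit →₀ ℕ} (hF : IsMultiHom F d)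
    (h : ∀ (p : MPt k K (ytSpace n)) (q : CoxVar n → K), Lifts (thetaYt B v) q p →
      q CoxVar.e = 1 → hval F p = 0) {p : MPt k K (ytSpace n)} (hp : p ∈ Yt K v) :
    hval F p = 0 :=
  closure_minimal (fun p' hp' => h p' _ (lifts_affineLift hB (hp'.2 ())) rfl)
    (isClosed_hval_eq_zero hF) hp.2

/-- The relation `wedgeVal_eq` is linear in the last component, hence an equation of the blowup. So
the values of `lamForm` determine this component. -/
lemma wPt_eq_sum (hB : ∀ i, B i (v i) = Pi.single none 1) {p : MPt k K (ytSpace n)}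
    (hp : p ∈ Yt K v) (ab : TensIdx n × TensIdx n) :
    (wPt p).rep ab = ∑ o : ∀ i, Option (Fin (n i)),
      ((vTens v ab.2 * ∏ i, algebraMap k K (invMat B i (ab.1 i) (o i))) -
        vTens v ab.1 * ∏ i, algebraMap k K (invMat B i (ab.2 i) (o i))) *
          lamForm B o (wPt p).rep := by
  have hF : IsMultiHom (MvPolynomial.X ⟨Sum.inr (), ab⟩ - ∑ o : ∀ i, Option (Fin (n i)),
      MvPolynomial.C (((∏ i, v i (ab.2 i)) * ∏ i, invMat B i (ab.1 i) (o i)) -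
        (∏ i, v i (ab.1 i)) * ∏ i, invMat B i (ab.2 i) (o i)) * lamPoly B o :
        MvPolynomial (Σ j, ytSpace n j) k) (Finsupp.single (Sum.inr ()) 1) :=
    (isMultiHom_X (⟨Sum.inr (), ab⟩ : Σ j, ytSpace n j)).sub
      (isMultiHom_sum _ fun o _ => (isMultiHom_lamPoly o).C_mul _)
  have hv : ∀ p : MPt k K (ytSpace n), hval (MvPolynomial.X ⟨Sum.inr (), ab⟩ -
      ∑ o : ∀ i, Option (Fin (n i)),
      MvPolynomial.C (((∏ i, v i (ab.2 i)) * ∏ i, invMat B i (ab.1 i) (o i)) -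
        (∏ i, v i (ab.1 i)) * ∏ i, invMat B i (ab.2 i) (o i)) * lamPoly B o :
        MvPolynomial (Σ j, ytSpace n j) k) p = (wPt p).rep ab - ∑ o : ∀ i, Option (Fin (n i)),
      ((vTens v ab.2 * ∏ i, algebraMap k K (invMat B i (ab.1 i) (o i))) -
        vTens v ab.1 * ∏ i, algebraMap k K (invMat B i (ab.2 i) (o i))) *
          lamForm B o (wPt p).rep := by
    intro p
    simp only [← hval_lamPoly, hval, map_sub, map_sum, map_mul, MvPolynomial.aeval_X,
      MvPolynomial.aeval_C, vTens, map_prod]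
    rfl
  have := hval_eq_zero_of_mem_Yt hB hF (fun p q h _ => ?_) hp
  · rwa [hv, sub_eq_zero] at this
  · obtain ⟨s, _, h1, h2⟩ := exists_lamForm hB h
    rw [hv, sub_eq_zero, h1, Pi.smul_apply, wedgeVal_eq, smul_eq_mul, Finset.mul_sum, ← h1]
    refine Finset.sum_congr rfl fun o _ => ?_
    rw [h2]
    ring

/-- For `e = 1` the form `lamForm` at `o` is, up to a common scalar, the product of the `u j` along
`o`, and the two indices differ in one factor. The entry at `l` keeps both indices away from the one
where this product formula fails, the constant index `none`. -/
lemma lamForm_mul_splitCoord (hB : ∀ i, B i (v i) = Pi.single none 1) {p : MPt k K (ytSpace n)}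
    (hp : p ∈ Yt K v) {o : ∀ i, Option (Fin (n i))} {i l : Fin r} (hl : l ≠ i) (ho : o l ≠ none) :
    lamForm B o (wPt p).rep * splitCoord B (fst p) i none =
      lamForm B (Function.update o i none) (wPt p).rep * splitCoord B (fst p) i (o i) := by
  have hF := ((isMultiHom_lamPoly (B := B) o).mul (isMultiHom_splitPoly (B := B) i none)).sub
    ((isMultiHom_lamPoly (B := B) (Function.update o i none)).mul
      (isMultiHom_splitPoly (B := B) i (o i)))
  have hv : ∀ p : MPt k K (ytSpace n), hval (lamPoly B o * splitPoly B i none -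
      lamPoly B (Function.update o i none) * splitPoly B i (o i)) p =
      lamForm B o (wPt p).rep * splitCoord B (fst p) i none -
      lamForm B (Function.update o i none) (wPt p).rep * splitCoord B (fst p) i (o i) := by
    intro p
    simp only [← hval_lamPoly, ← hval_splitPoly, hval, map_sub, map_mul]
  have := hval_eq_zero_of_mem_Yt hB hF (fun p q h he => ?_) hp
  · rwa [hv, sub_eq_zero] at this
  · obtain ⟨s, _, -, h2⟩ := exists_lamForm hB h
    obtain ⟨s', _, h3⟩ := exists_splitCoord h
    have h4 := mul_tensQ_of_ne q (o := o) ⟨l, ho⟩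
    have h5 := mul_tensQ_of_ne q (o := Function.update o i none)
      ⟨l, by rwa [Function.update_of_ne hl]⟩
    rw [he, one_mul, ← Finset.mul_prod_erase _ _ (Finset.mem_univ i)] at h4 h5
    have h6 : ∏ j ∈ Finset.univ.erase i, uVec q j (Function.update o i none j) =
        ∏ j ∈ Finset.univ.erase i, uVec q j (o j) :=
      Finset.prod_congr rfl fun j hj => by rw [Function.update_of_ne (Finset.ne_of_mem_erase hj)]
    rw [Function.update_self, h6] at h5
    rw [hv, sub_eq_zero, h2, h2, h3, h3, h4, h5]
    ring

lemma lamForm_none (hB : ∀ i, B i (v i) = Pi.single none 1) {p : MPt k K (ytSpace n)}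
    (hp : p ∈ Yt K v) : lamForm B (fun _ => none) (wPt p).rep = 0 := by
  rw [← hval_lamPoly]
  refine hval_eq_zero_of_mem_Yt hB (isMultiHom_lamPoly _) (fun p q h _ => ?_) hp
  obtain ⟨s, _, -, h2⟩ := exists_lamForm hB h
  rw [hval_lamPoly, h2, tensQ_none, mul_zero]

/-- The Cox coordinates with `e = 0` of a point of the exceptional divisor. -/
def excLift (B : Splitting k n) (p : MPt k K (ytSpace n)) : CoxVar n → K
  | CoxVar.e => 0
  | CoxVar.t i => splitCoord B (fst p) i none
  | CoxVar.x i b => lamForm B (oneIdx i b) (wPt p).rep /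
      ∏ l ∈ Finset.univ.erase i, splitCoord B (fst p) l none

lemma splitCoord_ne_zero (p : MPt k K (ySpace n)) (i : Fin r) : ∃ o, splitCoord B p i o ≠ 0 := by
  by_contra! h
  have h1 : split B i (p i).rep = 0 := funext h
  have := unsplit_split B i (p i).rep
  rw [h1, unsplit_zero] at this
  exact (p i).rep_nonzero this.symm

/-- The forms vanish only at the base point, so each `u i` is a nonzero multiple of `v i`. On the
blowup the components of the last factor with two entries different from `none` are then zero, and
those with one such entry define the `x i b`. -/
lemma lifts_excLift (hB : ∀ i, B i (v i) = Pi.single none 1) {p : MPt k K (ytSpace n)}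
    (hp : p ∈ Yt K v) (h0 : (fun ab => hval (baseForms v () ab) (fst p)) = 0) :
    Lifts (thetaYt B v) (excLift B p) p := by
  -- The tensor of the affine coordinates vanishes. In a multi-index of nonzero coordinates replace
  -- the entry at `i` by `some b`: the resulting product is zero, and only the replaced factor can
  -- be responsible.
  have hx : ∀ i b, splitCoord B (fst p) i (some b) = 0 := by
    intro i b
    have hQ : ∀ o, tensQ (affineLift B (fst p)) o = 0 := by
      intro o
      rw [← lamForm_wedgeVal hB, wedgeVal_affineLift hB, h0]
      simp [lamForm]
    choose o ho using splitCoord_ne_zero (B := B) (fst p)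
    have h2 := mul_tensQ_of_ne (affineLift B (fst p)) (o := Function.update o i (some b))
      ⟨i, by simp⟩
    rw [hQ, mul_zero] at h2
    obtain ⟨l, _, hl⟩ := Finset.prod_eq_zero_iff.1 h2.symm
    rw [uVec_affineLift] at hl
    by_cases hli : l = i
    · subst hli
      rwa [Function.update_self] at hl
    · rw [Function.update_of_ne hli] at hl
      exact absurd hl (ho l)
  have ht : ∀ i, splitCoord B (fst p) i none ≠ 0 := by
    intro i
    obtain ⟨_ | b, ho⟩ := splitCoord_ne_zero (B := B) (fst p) i
    · exact ho
    · exact absurd (hx i b) ho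
  have hu : ∀ i, uVec (excLift B p) i = splitCoord B (fst p) i := by
    intro i
    funext o
    rcases o with _ | b
    · rfl
    · rw [hx]
      exact zero_mul _
  have hQ : ∀ o, tensQ (excLift B p) o = lamForm B o (wPt p).rep := by
    intro o
    by_cases h1 : ∃ i, o i ≠ none
    · obtain ⟨i, hi⟩ := h1
      by_cases h2 : ∃ l, l ≠ i ∧ o l ≠ none
      · obtain ⟨l, hl, hol⟩ := h2
        rw [tensQ_of_two rfl hl.symm hi hol]
        have := lamForm_mul_splitCoord hB hp hl hol
        obtain ⟨b, hb⟩ := Option.ne_none_iff_exists'.1 hi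
        rw [hb, hx, mul_zero] at this
        exact ((mul_eq_zero.1 this).resolve_right (ht i)).symm
      · push Not at h2
        obtain ⟨b, hb⟩ := Option.ne_none_iff_exists'.1 hi
        have ho : o = oneIdx i b := by
          funext l
          by_cases hl : l = i
          · subst hl
            rw [oneIdx, Function.update_self, hb]
          · rw [oneIdx, Function.update_of_ne hl, h2 l hl]
        rw [ho, tensQ_oneIdx]
        exact div_mul_cancel₀ _ (Finset.prod_ne_zero_iff.2 fun l _ => ht l)
    · push Not at h1
      rw [show o = fun _ => none from funext h1, tensQ_none, lamForm_none hB hp]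
  rw [lifts_thetaYt_iff]
  refine ⟨fun i => ?_, ?_⟩
  · rw [hu, splitCoord_eq, unsplit_split]
    exact represents_rep _
  · have : wedgeVal B v (excLift B p) = (wPt p).rep := by
      funext ab
      rw [wedgeVal_eq, wPt_eq_sum hB hp]
      exact Finset.sum_congr rfl fun o _ => by rw [hQ]
    rw [this]
    exact represents_rep _

lemma exists_lift_Yt (hB : ∀ i, B i (v i) = Pi.single none 1) {p : MPt k K (ytSpace n)}
    (hp : p ∈ Yt K v) : ∃ q ∈ regLocus K (thetaYt B v), Lifts (thetaYt B v) q p := by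
  suffices h : ∃ q, Lifts (thetaYt B v) q p from h.imp fun q hq => ⟨hq.mem_regLocus, hq⟩
  by_cases h0 : (fun ab => hval (baseForms v () ab) (fst p)) = 0
  · exact ⟨_, lifts_excLift hB hp h0⟩
  · exact ⟨_, lifts_affineLift hB (represents_of_mem_blowup (F := baseForms v)
      (d := fun _ => _) (fun _ ab => isMultiHom_baseForms () ab) (j := ()) hp h0)⟩

end Source

/-! ### Prime divisors, frames and local sections on the blowup of the product. -/

section Source

variable {k K : Type*} [Field k] [Field K] [Algebra k K] {r : ℕ} {n : Fin r → ℕ}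
variable {B : Splitting k n} {v : ∀ i, Fin (n i + 1) → k}

/-- Here the dimension enters: with a single variable `x` the hypersurface `x = 0` would be missing
from the regular locus. -/
lemma exists_ne_idx (hdim : 2 ≤ ∑ i, n i) (i : Fin r) (b : Fin (n i)) :
    ∃ (i' : Fin r) (b' : Fin (n i')), CoxVar.x i' b' ≠ CoxVar.x i b := by
  have : Nontrivial (Σ i, Fin (n i)) := by
    rw [← Fintype.one_lt_card_iff_nontrivial, Fintype.card_sigma]
    simp only [Fintype.card_fin]
    exact hdim
  obtain ⟨⟨i', b'⟩, h⟩ := exists_ne (⟨i, b⟩ : Σ i, Fin (n i))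
  refine ⟨i', b', fun h' => h ?_⟩
  rw [CoxVar.x.injEq] at h'
  exact Sigma.ext h'.1 h'.2

/-- A prime without zero in the regular locus would divide every `(∏ t l) * x i b` and also `e * ∏ x
l ⟨0, _⟩`. It would be associated to a variable common to all these monomials, and there is none. -/
lemma exists_zero_Yt [IsAlgClosed K] (hB : ∀ i, B i (v i) = Pi.single none 1)
    (hn : ∀ i, 1 ≤ n i) (hdim : 2 ≤ ∑ i, n i) {π : MvPolynomial (CoxVar n) k} (hπ : Prime π) :
    ∃ q ∈ regLocus K (thetaYt B v), MvPolynomial.aeval q π = 0 := by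
  by_contra h
  have h1 : ∀ i b, (∃ l, π ∣ MvPolynomial.X (CoxVar.t l)) ∨ π ∣ MvPolynomial.X (CoxVar.x i b) := by
    intro i b
    have := prime_dvd_of_forall hπ h
      (f := (∏ l, MvPolynomial.X (CoxVar.t l)) * MvPolynomial.X (CoxVar.x i b)) (fun q hq => by
        simp only [map_mul, map_prod, MvPolynomial.aeval_X, mul_ne_zero_iff,
          Finset.prod_ne_zero_iff] at hq
        exact (mem_regLocus_thetaYt hB).2 ⟨fun l => Or.inl (hq.1 l (Finset.mem_univ _)), i, b, hq.2⟩)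
    refine (hπ.dvd_or_dvd this).imp (fun h => ?_) id
    exact ((Prime.dvd_finsetProd_iff hπ _).1 h).imp fun l hl => hl.2
  have h2 : π ∣ MvPolynomial.X CoxVar.e ∨ ∃ i, π ∣ MvPolynomial.X (CoxVar.x i ⟨0, hn i⟩) := by
    have hr : Nonempty (Fin r) := by
      by_contra hr
      rw [not_nonempty_iff] at hr
      simp at hdim
    have := prime_dvd_of_forall hπ h
      (f := MvPolynomial.X CoxVar.e * ∏ l, MvPolynomial.X (CoxVar.x l ⟨0, hn l⟩)) (fun q hq => by
        simp only [map_mul, map_prod, MvPolynomial.aeval_X, mul_ne_zero_iff,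
          Finset.prod_ne_zero_iff] at hq
        exact (mem_regLocus_thetaYt hB).2 ⟨fun l => Or.inr ⟨_, mul_ne_zero hq.1
          (hq.2 l (Finset.mem_univ _))⟩, hr.some, _, hq.2 _ (Finset.mem_univ _)⟩)
    refine (hπ.dvd_or_dvd this).imp id fun h => ?_
    exact ((Prime.dvd_finsetProd_iff hπ _).1 h).imp fun l hl => hl.2
  have hr : ∃ i : Fin r, True := by
    by_contra! hr
    have : IsEmpty (Fin r) := ⟨fun i => hr i⟩
    simp at hdim
  obtain ⟨i0, -⟩ := hr
  rcases h2 with h2 | ⟨i, h2⟩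
  · rcases h1 i0 ⟨0, hn i0⟩ with ⟨l, h3⟩ | h3
    · exact absurd (eq_of_prime_dvd_X hπ h2 h3) (by simp)
    · exact absurd (eq_of_prime_dvd_X hπ h2 h3) (by simp)
  · obtain ⟨i', b', hne⟩ := exists_ne_idx hdim i ⟨0, hn i⟩
    rcases h1 i' b' with ⟨l, h3⟩ | h3
    · exact absurd (eq_of_prime_dvd_X hπ h2 h3) (by simp)
    · exact hne (eq_of_prime_dvd_X hπ h3 h2)

/-- For each `i` either `t i` or some product `e * x i b` is invertible, both of degree `degX i +
degE`; one nonvanishing `x i b` separates the two summands. -/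
lemma exists_frame_Yt (hB : ∀ i, B i (v i) = Pi.single none 1) {q : CoxVar n → K}
    (hq : q ∈ regLocus K (thetaYt B v)) (d : Option (Fin r) → ℤ) : HasFrame k wt q d := by
  obtain ⟨h1, i, b, hx⟩ := (mem_regLocus_thetaYt hB).1 hq
  have hH : ∀ i : Fin r, HasFrame k wt q (degX i + degE r) := by
    intro i
    rcases h1 i with h | ⟨b, h⟩
    · exact hasFrame_of_ne (w := wt) h
    · rw [add_comm]
      exact (hasFrame_of_ne (w := wt) (left_ne_zero_of_mul h)).add
        (hasFrame_of_ne (w := wt) (right_ne_zero_of_mul h))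
  have hE : HasFrame k wt q (degE r) := by
    have h2 : HasFrame k wt q (degX i) := hasFrame_of_ne (w := wt) hx
    have := (hH i).sub h2
    rwa [add_sub_cancel_left] at this
  refine hasFrame_of_degX hE (fun i => ?_) d
  have := (hH i).sub hE
  rwa [add_sub_cancel_right] at this

lemma regAt_splitCoord_div {X : Set (MPt k K (ytSpace n))} (i : Fin r)
    (o o' : Option (Fin (n i))) (x : X) (hx : splitCoord B (fst x.1) i o' ≠ 0) :
    RegAt (fun z : X => splitCoord B (fst z.1) i o / splitCoord B (fst z.1) i o') x := by
  refine ⟨_, _, _, isMultiHom_splitPoly (B := B) i o, isMultiHom_splitPoly (B := B) i o', ?_,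
    Filter.Eventually.of_forall fun z => ?_⟩
  · rwa [hval_splitPoly]
  · rw [hval_splitPoly, hval_splitPoly]

lemma regAt_lamForm_div {X : Set (MPt k K (ytSpace n))} (o o' : ∀ i, Option (Fin (n i))) (x : X)
    (hx : lamForm B o' (wPt x.1).rep ≠ 0) :
    RegAt (fun z : X => lamForm B o (wPt z.1).rep / lamForm B o' (wPt z.1).rep) x := by
  refine ⟨_, _, _, isMultiHom_lamPoly (B := B) o, isMultiHom_lamPoly (B := B) o', ?_,
    Filter.Eventually.of_forall fun z => ?_⟩
  · rwa [hval_lamPoly]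
  · rw [hval_lamPoly, hval_lamPoly]

lemma eventually_splitCoord_ne {X : Set (MPt k K (ytSpace n))} {i : Fin r}
    {o : Option (Fin (n i))} {x : X} (hx : splitCoord B (fst x.1) i o ≠ 0) :
    ∀ᶠ z : X in 𝓝 x, splitCoord B (fst z.1) i o ≠ 0 := by
  have := eventually_hval_ne (isMultiHom_splitPoly (B := B) i o) (x := x) (by rwa [hval_splitPoly])
  simpa only [hval_splitPoly] using this

lemma eventually_lamForm_ne {X : Set (MPt k K (ytSpace n))} {o : ∀ i, Option (Fin (n i))} {x : X}
    (hx : lamForm B o (wPt x.1).rep ≠ 0) : ∀ᶠ z : X in 𝓝 x, lamForm B o (wPt z.1).rep ≠ 0 := by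
  have := eventually_hval_ne (isMultiHom_lamPoly (B := B) o) (x := x) (by rwa [hval_lamPoly])
  simpa only [hval_lamPoly] using this

/-- The section is normalised by `e = 1` and by making one chosen nonzero coordinate of each `u i`
equal to `1`. -/
lemma exists_section_Yt_of_e_ne {q₀ : CoxVar n → K} (x : Yt K v)
    (h1 : ∀ i, uVec q₀ i ≠ 0) {i₀ : Fin r} {b₀ : Fin (n i₀)}
    (hx₀ : q₀ (CoxVar.x i₀ b₀) ≠ 0) (he : q₀ CoxVar.e ≠ 0)
    (hq₀ : Lifts (thetaYt B v) q₀ x.1) : ∃ σ : Yt K v → CoxVar n → K,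
    (∀ s, RegAt (fun z => σ z s) x) ∧ ∀ᶠ z : Yt K v in 𝓝 x, ∀ q ∈ regLocus K (thetaYt B v),
      Lifts (thetaYt B v) q z.1 → ∃ u : Option (Fin r) → Kˣ, σ z = tact wt u q := by
  choose c hc using fun i => Function.ne_iff.1 (h1 i)
  obtain ⟨s, hs, hs'⟩ := exists_splitCoord hq₀
  have hcx : ∀ i, splitCoord B (fst x.1) i (c i) ≠ 0 := fun i => by
    rw [hs']
    exact mul_ne_zero (hs i) (hc i)
  have hbx : splitCoord B (fst x.1) i₀ (some b₀) ≠ 0 := by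
    rw [hs']
    exact mul_ne_zero (hs i₀) (mul_ne_zero he hx₀)
  refine ⟨fun z s => match s with
    | CoxVar.e => 1
    | CoxVar.t i => splitCoord B (fst z.1) i none / splitCoord B (fst z.1) i (c i)
    | CoxVar.x i b => splitCoord B (fst z.1) i (some b) / splitCoord B (fst z.1) i (c i), ?_, ?_⟩
  · rintro (_ | i | ⟨i, b⟩)
    · simpa using regAt_const (k := k) (1 : k) x
    · exact regAt_splitCoord_div i _ _ x (hcx i)
    · exact regAt_splitCoord_div i _ _ x (hcx i)
  · filter_upwards [Filter.eventually_all.2 fun i => eventually_splitCoord_ne (hcx i),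
      eventually_splitCoord_ne hbx] with z h2 h3 q _ hqz
    obtain ⟨s, hs, hs'⟩ := exists_splitCoord hqz
    have hu : ∀ i, uVec q i (c i) ≠ 0 := fun i => by
      have := h2 i
      rw [hs'] at this
      exact right_ne_zero_of_mul this
    have he : q CoxVar.e ≠ 0 := by
      rw [hs'] at h3
      exact left_ne_zero_of_mul (right_ne_zero_of_mul h3)
    have hdiv : ∀ i o, splitCoord B (fst z.1) i o / splitCoord B (fst z.1) i (c i) =
        uVec q i o / uVec q i (c i) := fun i o => by
      rw [hs', hs', mul_div_mul_left _ _ (hs i)]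
    refine ⟨torusPt (Units.mk0 _ he)⁻¹ fun i => Units.mk0 _ (div_ne_zero he (hu i)),
      eq_tact ?_ (fun i => ?_) fun i b => ?_⟩
    · simp [torusPt, he]
    · simp only [torusPt, Option.elim, Units.val_mk0, Units.val_inv_eq_inv_val, hdiv]
      rw [div_eq_mul_inv, div_eq_mul_inv]
      change q (CoxVar.t i) * _ = _
      field_simp
    · simp only [torusPt, Option.elim, Units.val_mk0, hdiv]
      change q CoxVar.e * q (CoxVar.x i b) / _ = _
      rw [mul_div_right_comm]

/-- A chart that reaches the exceptional divisor: all `t i` and one `x i₀ b₀` are normalised to `1`,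
so that `e` is a ratio of coordinates of `u i₀`. -/
lemma exists_section_Yt_of_t_ne (hB : ∀ i, B i (v i) = Pi.single none 1) {q₀ : CoxVar n → K}
    (x : Yt K v) {i₀ : Fin r} {b₀ : Fin (n i₀)}
    (hx₀ : q₀ (CoxVar.x i₀ b₀) ≠ 0) (ht : ∀ i, q₀ (CoxVar.t i) ≠ 0)
    (hq₀ : Lifts (thetaYt B v) q₀ x.1) : ∃ σ : Yt K v → CoxVar n → K,
    (∀ s, RegAt (fun z => σ z s) x) ∧ ∀ᶠ z : Yt K v in 𝓝 x, ∀ q ∈ regLocus K (thetaYt B v),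
      Lifts (thetaYt B v) q z.1 → ∃ u : Option (Fin r) → Kˣ, σ z = tact wt u q := by
  obtain ⟨s, hs, hs'⟩ := exists_splitCoord hq₀
  obtain ⟨s₁, hs₁, -, hs₁'⟩ := exists_lamForm hB hq₀
  have hcx : ∀ i, splitCoord B (fst x.1) i none ≠ 0 := fun i => by
    rw [hs']
    exact mul_ne_zero (hs i) (ht i)
  have hbx : lamForm B (oneIdx i₀ b₀) (wPt x.1).rep ≠ 0 := by
    rw [hs₁', tensQ_oneIdx]
    exact mul_ne_zero hs₁ (mul_ne_zero hx₀ (Finset.prod_ne_zero_iff.2 fun l _ => ht l))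
  refine ⟨fun z s => match s with
    | CoxVar.e => splitCoord B (fst z.1) i₀ (some b₀) / splitCoord B (fst z.1) i₀ none
    | CoxVar.t i => 1
    | CoxVar.x i b => lamForm B (oneIdx i b) (wPt z.1).rep /
        lamForm B (oneIdx i₀ b₀) (wPt z.1).rep, ?_, ?_⟩
  · rintro (_ | i | ⟨i, b⟩)
    · exact regAt_splitCoord_div i₀ _ _ x (hcx i₀)
    · simpa using regAt_const (k := k) (1 : k) x
    · exact regAt_lamForm_div _ _ x hbx
  · filter_upwards [Filter.eventually_all.2 fun i => eventually_splitCoord_ne (hcx i),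
      eventually_lamForm_ne hbx] with z h2 h3 q _ hqz
    obtain ⟨s, hs, hs'⟩ := exists_splitCoord hqz
    obtain ⟨s₁, hs₁, -, hs₁'⟩ := exists_lamForm hB hqz
    have ht : ∀ i, q (CoxVar.t i) ≠ 0 := fun i => by
      have := h2 i
      rw [hs'] at this
      exact right_ne_zero_of_mul this
    have hP : ∀ i, q (CoxVar.t i) * ∏ l ∈ Finset.univ.erase i, q (CoxVar.t l) =
        ∏ l, q (CoxVar.t l) := fun i =>
      Finset.mul_prod_erase _ (fun l => q (CoxVar.t l)) (Finset.mem_univ i)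
    have hP0 : ∏ l, q (CoxVar.t l) ≠ 0 := Finset.prod_ne_zero_iff.2 fun l _ => ht l
    have hPe : ∀ i, ∏ l ∈ Finset.univ.erase i, q (CoxVar.t l) =
        (∏ l, q (CoxVar.t l)) / q (CoxVar.t i) := fun i => by
      rw [eq_div_iff (ht i), mul_comm, hP]
    have hx : q (CoxVar.x i₀ b₀) ≠ 0 := by
      rw [hs₁', tensQ_oneIdx] at h3
      exact left_ne_zero_of_mul (right_ne_zero_of_mul h3)
    refine ⟨torusPt (Units.mk0 _ (div_ne_zero hx (ht i₀))) fun i =>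
      Units.mk0 _ (div_ne_zero (ht i₀) (mul_ne_zero hx (ht i))),
      eq_tact ?_ (fun i => ?_) fun i b => ?_⟩
    · simp only [torusPt, Option.elim, Units.val_mk0, hs']
      rw [mul_div_mul_left _ _ (hs i₀)]
      change q CoxVar.e * q (CoxVar.x i₀ b₀) / q (CoxVar.t i₀) = _
      rw [mul_comm, mul_div_right_comm]
    · simp only [torusPt, Option.elim, Units.val_mk0]
      have := ht i
      have := ht i₀
      field_simp
    · simp only [torusPt, Option.elim, Units.val_mk0, hs₁', tensQ_oneIdx, hPe]
      rw [mul_div_mul_left _ _ hs₁]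
      have := ht i
      have := ht i₀
      field_simp

/-- The Cox presentation of the blowup of the product of projective spaces at a point. -/
def coxYt [IsAlgClosed K] (B : Splitting k n) (v : ∀ i, Fin (n i + 1) → k)
    (hB : ∀ i, B i (v i) = Pi.single none 1) (hn : ∀ i, 1 ≤ n i) (hdim : 2 ≤ ∑ i, n i) :
    CoxPres (wt (n := n)) (Yt K v) where
  Q := regLocus K (thetaYt B v)
  Θ := thetaYt B v
  δ := degYt
  hom := hom_thetaYt B v
  isOpen := homOpen_regLocus (hom_thetaYt B v)
  exists_point q hq := by
    have : Infinite K := IsAlgClosed.instInfinite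
    obtain ⟨p, hp⟩ := exists_lifts hq
    exact ⟨p, mem_Yt_of_lifts hB hp, hp⟩
  exists_lift p hp := exists_lift_Yt hB hp
  exists_section x q₀ hq₀ h := by
    obtain ⟨h1, i, b, hx⟩ := (mem_regLocus_thetaYt hB).1 hq₀
    by_cases he : q₀ CoxVar.e = 0
    · exact exists_section_Yt_of_t_ne hB x hx (fun i => (h1 i).resolve_right (by simp [he])) h
    · exact exists_section_Yt_of_e_ne x (mem_regLocus_thetaYt_iff.1 hq₀).1 hx he h
  exists_frame q hq d := exists_frame_Yt hB hq d
  exists_zero π hπ := exists_zero_Yt hB hn hdim hπ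

end Source

/-! ### The Cox presentation of the blowup of the projective bundle -/

/-! ### Multi-indices of the summands of the projective bundle. -/

section Indices

variable {r : ℕ} {n : Fin r → ℕ}

lemma PlusIdx.mem_supp {a : PlusIdx n} {i : Fin r} : i ∈ a.supp ↔ ∃ b, a.1 i = some b := by
  rw [PlusIdx.supp, Finset.mem_filter, Option.isSome_iff_exists]
  simp

lemma PlusIdx.notMem_supp {a : PlusIdx n} {i : Fin r} : i ∉ a.supp ↔ a.1 i = none := by
  rw [PlusIdx.supp, Finset.mem_filter, Option.isSome_iff_ne_none]
  simp

lemma PlusIdx.supp_cases (a : PlusIdx n) :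
    a.supp = Finset.univ ∨ ∃ i, a.supp = Finset.univ.erase i := by
  have h : r ≤ a.supp.card + 1 := a.2
  by_cases h1 : a.supp = Finset.univ
  · exact Or.inl h1
  · right
    obtain ⟨i, hi⟩ : ∃ i, i ∉ a.supp := by
      by_contra! h2
      exact h1 (Finset.eq_univ_of_forall h2)
    refine ⟨i, Finset.eq_of_subset_of_card_le (fun l hl => Finset.mem_erase.2
      ⟨fun h => hi (h ▸ hl), Finset.mem_univ l⟩) ?_⟩
    rw [Finset.card_erase_of_mem (Finset.mem_univ i), Finset.card_univ, Fintype.card_fin]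
    omega

/-- The multi-index with entries `b l`, except for the entry missing according to `o`. -/
def bIdx (b : ∀ l, Fin (n l)) (o : Option (Fin r)) : PlusIdx n :=
  ⟨fun l => if o = some l then none else some (b l), by
    have h : (Finset.univ : Finset (Fin r)) ⊆ (Finset.univ.filter fun l =>
        (if o = some l then none else some (b l)).isSome) ∪ o.toFinset := by
      intro l _
      rw [Finset.mem_union, Finset.mem_filter]
      by_cases h : o = some l
      · right
        simp [h]
      · left
        simp [h]
    have h1 := (Finset.card_le_card h).trans (Finset.card_union_le _ _)
    rw [Finset.card_univ, Fintype.card_fin] at h1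
    refine h1.trans (Nat.add_le_add_left ?_ _)
    rcases o with _ | i <;> simp⟩

lemma bIdx_apply (b : ∀ l, Fin (n l)) (o : Option (Fin r)) (l : Fin r) :
    (bIdx b o).1 l = if o = some l then none else some (b l) := rfl

lemma mem_supp_bIdx {b : ∀ l, Fin (n l)} {o : Option (Fin r)} {l : Fin r} :
    l ∈ (bIdx b o).supp ↔ o ≠ some l := by
  rw [PlusIdx.mem_supp, bIdx_apply]
  split_ifs with h <;> simp [h]

lemma supp_bIdx_eq_univ_iff {b : ∀ l, Fin (n l)} {o : Option (Fin r)} :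
    (bIdx b o).supp = Finset.univ ↔ o = none := by
  constructor
  · intro h
    rcases o with _ | i
    · rfl
    · have : i ∈ (bIdx b (some i)).supp := h ▸ Finset.mem_univ i
      exact absurd rfl (mem_supp_bIdx.1 this)
  · rintro rfl
    exact Finset.eq_univ_of_forall fun l => mem_supp_bIdx.2 (by simp)

lemma fin_eq_of_line {i : Fin r} (hi : n i = 1) (b b' : Fin (n i)) : b = b' := by
  have h1 := b.2
  have h2 := b'.2
  exact Fin.ext (by omega)

end Indices

/-! ### Homogeneous coordinates of the bundle and of its blowup as monomials. -/

section Values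

variable {r : ℕ} {n : Fin r → ℕ} {R : Type*} [CommRing R] (q : CoxVar n → R)

/-- The coordinates on the quotient of the factor `i`; a projective space of dimension zero has a
constant coordinate. -/
def yVal (i : Fin r) (b : Fin (n i)) : R := if n i = 1 then 1 else q (CoxVar.x i b)

/-- A factor of the coordinates on the projective bundle. -/
def fac (a : PlusIdx n) (l : Fin r) : R := (a.1 l).elim (q (CoxVar.t l)) fun b => q (CoxVar.x l b)

/-- The first factor of the coordinates on the projective bundle. -/
def facE (a : PlusIdx n) : R := if a.supp = Finset.univ then q CoxVar.e else 1

/-- The coordinates on the projective bundle. -/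
def sVal (a : PlusIdx n) : R := facE q a * ∏ l, fac q a l

/-- The coordinates on the projective bundle, divided by those of the factor `j`. -/
def zVal (j : Fin r) (a : PlusIdx n) : R := facE q a * ∏ l ∈ Finset.univ.erase j, fac q a l

lemma sVal_eq (j : Fin r) (a : PlusIdx n) : sVal q a = fac q a j * zVal q j a := by
  rw [sVal, zVal, ← Finset.mul_prod_erase _ _ (Finset.mem_univ j)]
  ring

variable {q}

lemma fac_of_eq_some {a : PlusIdx n} {l : Fin r} {b : Fin (n l)} (h : a.1 l = some b) :
    fac q a l = q (CoxVar.x l b) := by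
  rw [fac, h]
  rfl

lemma fac_of_eq_none {a : PlusIdx n} {l : Fin r} (h : a.1 l = none) :
    fac q a l = q (CoxVar.t l) := by
  rw [fac, h]
  rfl

lemma facE_bIdx_none (b : ∀ l, Fin (n l)) : facE q (bIdx b none) = q CoxVar.e :=
  if_pos (supp_bIdx_eq_univ_iff.2 rfl)

lemma facE_bIdx_some (b : ∀ l, Fin (n l)) (i : Fin r) : facE q (bIdx b (some i)) = 1 :=
  if_neg (fun h => by simpa using supp_bIdx_eq_univ_iff.1 h)

lemma fac_bIdx_self (b : ∀ l, Fin (n l)) (i : Fin r) :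
    fac q (bIdx b (some i)) i = q (CoxVar.t i) :=
  fac_of_eq_none (by rw [bIdx_apply, if_pos rfl])

lemma fac_bIdx_of_ne (b : ∀ l, Fin (n l)) {o : Option (Fin r)} {l : Fin r} (h : o ≠ some l) :
    fac q (bIdx b o) l = q (CoxVar.x l (b l)) :=
  fac_of_eq_some (by rw [bIdx_apply, if_neg h])

lemma sVal_bIdx_none (b : ∀ l, Fin (n l)) :
    sVal q (bIdx b none) = q CoxVar.e * ∏ l, q (CoxVar.x l (b l)) := by
  rw [sVal, facE_bIdx_none]
  congr 1

lemma sVal_bIdx_some (b : ∀ l, Fin (n l)) (i : Fin r) :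
    sVal q (bIdx b (some i)) =
      q (CoxVar.t i) * ∏ l ∈ Finset.univ.erase i, q (CoxVar.x l (b l)) := by
  rw [sVal_eq q i, zVal, facE_bIdx_some, one_mul, fac_bIdx_self]
  congr 1
  exact Finset.prod_congr rfl fun l hl => fac_bIdx_of_ne b
    (by simpa using (Finset.ne_of_mem_erase hl).symm)

lemma zVal_bIdx_none (b : ∀ l, Fin (n l)) (j : Fin r) :
    zVal q j (bIdx b none) = q CoxVar.e * ∏ l ∈ Finset.univ.erase j, q (CoxVar.x l (b l)) := by
  rw [zVal, facE_bIdx_none]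
  congr 1

lemma zVal_bIdx_some (b : ∀ l, Fin (n l)) {i j : Fin r} (hij : i ≠ j) :
    zVal q j (bIdx b (some i)) =
      q (CoxVar.t i) * ∏ l ∈ (Finset.univ.erase j).erase i, q (CoxVar.x l (b l)) := by
  rw [zVal, facE_bIdx_some, one_mul, ← Finset.mul_prod_erase _ _
    (Finset.mem_erase.2 ⟨hij, Finset.mem_univ i⟩), fac_bIdx_self]
  congr 1
  exact Finset.prod_congr rfl fun l hl => fac_bIdx_of_ne b
    (by simpa using (Finset.ne_of_mem_erase hl).symm)

end Values

/-! ### Degrees and the regular locus for the blowup of the bundle. -/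

section Target

variable {k K : Type*} [Field k] [Field K] [Algebra k K] {r : ℕ} {n : Fin r → ℕ}

/-- The homogeneous coordinates on the blowup of the projective bundle, as polynomials in the Cox
coordinates. -/
def thetaYp (k : Type*) [Field k] (n : Fin r → ℕ) :
    ∀ j : (Fin r ⊕ Unit) ⊕ Lines n, ypSpace n j → MvPolynomial (CoxVar n) k
  | Sum.inl (Sum.inl i) => fun b => yVal (genericPt k n) i b
  | Sum.inl (Sum.inr _) => fun a => sVal (genericPt k n) a
  | Sum.inr j => fun a => zVal (genericPt k n) j.1 a.1

/-- The degrees of the homogeneous coordinates on the blowup of the projective bundle. -/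
def degYp : (Fin r ⊕ Unit) ⊕ Lines n → Option (Fin r) → ℤ
  | Sum.inl (Sum.inl i) => if n i = 1 then 0 else degX i
  | Sum.inl (Sum.inr _) => degE r + ∑ l : Fin r, degX l
  | Sum.inr j => degE r + ∑ l ∈ Finset.univ.erase j.1, degX l

lemma hom_fac (a : PlusIdx n) (l : Fin r) :
    Hom wt (fac (genericPt k n) a l) (degX l + if l ∈ a.supp then 0 else degE r) := by
  by_cases h : l ∈ a.supp
  · obtain ⟨b, hb⟩ := PlusIdx.mem_supp.1 h
    rw [fac_of_eq_some hb, if_pos h, add_zero]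
    exact hom_X (w := wt) (CoxVar.x l b)
  · rw [fac_of_eq_none (PlusIdx.notMem_supp.1 h), if_neg h]
    exact hom_X (w := wt) (CoxVar.t l)

lemma hom_facE (a : PlusIdx n) :
    Hom wt (facE (genericPt k n) a) (if a.supp = Finset.univ then degE r else 0) := by
  rw [facE]
  split_ifs with h
  · exact hom_X (w := wt) (CoxVar.e)
  · exact hom_one

/-- The summand `degE` occurs exactly once for every multi-index: it comes from `e` if the support
is everything, and otherwise from `t i` for the one missing `i`, which has to belong to `s`. -/
lemma hom_prod_fac (a : PlusIdx n) (s : Finset (Fin r)) (hs : ∀ l, l ∉ a.supp → l ∈ s) :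
    Hom wt (facE (genericPt k n) a * ∏ l ∈ s, fac (genericPt k n) a l)
      (degE r + ∑ l ∈ s, degX l) := by
  have h := (hom_facE (k := k) a).mul (Hom.prod s fun l _ => hom_fac (k := k) a l)
  convert h using 1
  rw [Finset.sum_add_distrib, add_left_comm, add_comm (degE r)]
  congr 1
  rcases a.supp_cases with h1 | ⟨i, h1⟩
  · rw [if_pos h1, Finset.sum_eq_zero, add_zero]
    intro l _
    rw [if_pos (by rw [h1]; exact Finset.mem_univ l)]
  · have hi : i ∉ a.supp := by simp [h1]
    rw [if_neg (fun h2 : a.supp = Finset.univ => hi (h2 ▸ Finset.mem_univ i)), Finset.sum_eq_single i, if_neg hi, zero_add]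
    · intro l _ hl
      rw [if_pos (by rw [h1]; exact Finset.mem_erase.2 ⟨hl, Finset.mem_univ l⟩)]
    · exact fun h2 => absurd (hs i hi) h2

lemma hom_thetaYp (j : (Fin r ⊕ Unit) ⊕ Lines n) (a : ypSpace n j) :
    Hom wt (thetaYp k n j a) (degYp j) := by
  rcases j with (i | u) | j
  · change Hom wt (if n i = 1 then 1 else _) (if n i = 1 then 0 else _)
    split_ifs
    · exact hom_one
    · exact hom_X (w := wt) (CoxVar.x i a)
  · exact hom_prod_fac _ _ fun l _ => Finset.mem_univ l
  · exact hom_prod_fac _ _ fun l hl => Finset.mem_erase.2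
      ⟨fun h => hl (h ▸ a.2), Finset.mem_univ l⟩

lemma aeval_fac (q : CoxVar n → K) (a : PlusIdx n) (l : Fin r) :
    MvPolynomial.aeval q (fac (genericPt k n) a l) = fac q a l := by
  rw [fac, fac]
  rcases a.1 l with _ | b <;> simp [genericPt]

lemma aeval_facE (q : CoxVar n → K) (a : PlusIdx n) :
    MvPolynomial.aeval q (facE (genericPt k n) a) = facE q a := by
  rw [facE, facE]
  split_ifs <;> simp [genericPt]

lemma aeval_yVal (q : CoxVar n → K) (i : Fin r) (b : Fin (n i)) :
    MvPolynomial.aeval q (yVal (genericPt k n) i b) = yVal q i b := by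
  rw [yVal, yVal]
  split_ifs <;> simp [genericPt]

lemma aeval_sVal (q : CoxVar n → K) (a : PlusIdx n) :
    MvPolynomial.aeval q (sVal (genericPt k n) a) = sVal q a := by
  rw [sVal, sVal, map_mul, map_prod, aeval_facE]
  simp only [aeval_fac]

lemma aeval_zVal (q : CoxVar n → K) (j : Fin r) (a : PlusIdx n) :
    MvPolynomial.aeval q (zVal (genericPt k n) j a) = zVal q j a := by
  rw [zVal, zVal, map_mul, map_prod, aeval_facE]
  simp only [aeval_fac]

/-- The components in the quotients of the factors. -/
def yPt (p : MPt k K (ypSpace n)) (i : Fin r) : Projectivization K (Fin (n i) → K) :=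
  p (Sum.inl (Sum.inl i))

/-- The component in the projective bundle. -/
def sPt (p : MPt k K (ypSpace n)) : Projectivization K (PlusIdx n → K) := p (Sum.inl (Sum.inr ()))

/-- The components in the factors of the blowup. -/
def zPt (p : MPt k K (ypSpace n)) (j : Lines n) :
    Projectivization K ({a : PlusIdx n // j.1 ∈ a.supp} → K) := p (Sum.inr j)

lemma lifts_thetaYp_iff {q : CoxVar n → K} {p : MPt k K (ypSpace n)} :
    Lifts (thetaYp k n) q p ↔ (∀ i, Represents (yVal q i) (yPt p i)) ∧
      Represents (sVal q) (sPt p) ∧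
      ∀ j : Lines n, Represents (fun a : {a : PlusIdx n // j.1 ∈ a.supp} => zVal q j.1 a.1)
        (zPt p j) := by
  have h1 : ∀ i, (fun a => MvPolynomial.aeval q (thetaYp k n (Sum.inl (Sum.inl i)) a)) =
      yVal q i := fun i => funext fun a => aeval_yVal q i a
  have h2 : (fun a => MvPolynomial.aeval q (thetaYp k n (Sum.inl (Sum.inr ())) a)) =
      sVal q := funext fun a => aeval_sVal q a
  have h3 : ∀ j : Lines n, (fun a => MvPolynomial.aeval q (thetaYp k n (Sum.inr j) a)) =
      fun a : {a : PlusIdx n // j.1 ∈ a.supp} => zVal q j.1 a.1 :=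
    fun j => funext fun a => aeval_zVal q j a.1
  constructor
  · intro h
    exact ⟨fun i => h1 i ▸ h _, h2 ▸ h _, fun j => h3 j ▸ h _⟩
  · rintro ⟨h, h', h''⟩ ((i | u) | j)
    · exact (h1 i).symm ▸ h i
    · exact h2.symm ▸ h'
    · exact (h3 j).symm ▸ h'' j

lemma mem_regLocus_thetaYp_iff {q : CoxVar n → K} : q ∈ regLocus K (thetaYp k n) ↔
    (∀ i, ∃ b, yVal q i b ≠ 0) ∧ (∃ a, sVal q a ≠ 0) ∧
      ∀ j : Lines n, ∃ a : PlusIdx n, j.1 ∈ a.supp ∧ zVal q j.1 a ≠ 0 := by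
  constructor
  · intro h
    refine ⟨fun i => ?_, ?_, fun j => ?_⟩
    · obtain ⟨b, hb⟩ := h (Sum.inl (Sum.inl i))
      exact ⟨b, fun h0 => hb ((aeval_yVal q i b).trans h0)⟩
    · obtain ⟨a, ha⟩ := h (Sum.inl (Sum.inr ()))
      exact ⟨a, fun h0 => ha ((aeval_sVal q a).trans h0)⟩
    · obtain ⟨a, ha⟩ := h (Sum.inr j)
      exact ⟨a.1, a.2, fun h0 => ha ((aeval_zVal q j a.1).trans h0)⟩
  · rintro ⟨h, ⟨a, ha⟩, h'⟩ ((i | u) | j)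
    · obtain ⟨b, hb⟩ := h i
      exact ⟨b, fun h0 => hb ((aeval_yVal q i b).symm.trans h0)⟩
    · exact ⟨a, fun h0 => ha ((aeval_sVal q a).symm.trans h0)⟩
    · obtain ⟨a, ha, ha'⟩ := h' j
      exact ⟨⟨a, ha⟩, fun h0 => ha' ((aeval_zVal q j a).symm.trans h0)⟩

lemma sVal_ne_zero_iff {q : CoxVar n → K} {a : PlusIdx n} :
    sVal q a ≠ 0 ↔ facE q a ≠ 0 ∧ ∀ l, fac q a l ≠ 0 := by
  rw [sVal, mul_ne_zero_iff, Finset.prod_ne_zero_iff]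
  simp

lemma zVal_ne_zero_iff {q : CoxVar n → K} {j : Fin r} {a : PlusIdx n} :
    zVal q j a ≠ 0 ↔ facE q a ≠ 0 ∧ ∀ l, l ≠ j → fac q a l ≠ 0 := by
  rw [zVal, mul_ne_zero_iff, Finset.prod_ne_zero_iff]
  simp

/-- The nonvanishing of the first Cox coordinates belonging to `o`. -/
def headNe (q : CoxVar n → K) (o : Option (Fin r)) : Prop :=
  o.elim (q CoxVar.e) (fun i => q (CoxVar.t i)) ≠ 0

lemma exists_headNe {q : CoxVar n → K} {j : Fin r} {a : PlusIdx n} (hj : j ∈ a.supp)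
    (h : zVal q j a ≠ 0) : ∃ o, o ≠ some j ∧ headNe q o := by
  rw [zVal_ne_zero_iff] at h
  rcases a.supp_cases with h1 | ⟨i, h1⟩
  · refine ⟨none, by simp, ?_⟩
    have := h.1
    rwa [facE, if_pos h1] at this
  · have hij : i ≠ j := by
      rintro rfl
      simp [h1] at hj
    refine ⟨some i, by simpa using hij, ?_⟩
    have := h.2 i hij
    rwa [fac_of_eq_none (PlusIdx.notMem_supp.1 (by simp [h1]))] at this

lemma sVal_bIdx_ne {q : CoxVar n → K} {b : ∀ l, Fin (n l)} {o : Option (Fin r)} :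
    sVal q (bIdx b o) ≠ 0 ↔ headNe q o ∧ ∀ l, o ≠ some l → q (CoxVar.x l (b l)) ≠ 0 := by
  rcases o with _ | i
  · rw [sVal_bIdx_none, mul_ne_zero_iff, Finset.prod_ne_zero_iff]
    simp [headNe]
  · rw [sVal_bIdx_some, mul_ne_zero_iff, Finset.prod_ne_zero_iff]
    simp [headNe, eq_comm]

lemma zVal_bIdx_ne {q : CoxVar n → K} {b : ∀ l, Fin (n l)} {o : Option (Fin r)} {j : Fin r}
    (ho : o ≠ some j) : zVal q j (bIdx b o) ≠ 0 ↔
      headNe q o ∧ ∀ l, l ≠ j → o ≠ some l → q (CoxVar.x l (b l)) ≠ 0 := by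
  rcases o with _ | i
  · rw [zVal_bIdx_none, mul_ne_zero_iff, Finset.prod_ne_zero_iff]
    simp [headNe]
  · rw [zVal_bIdx_some _ (by simpa using ho), mul_ne_zero_iff, Finset.prod_ne_zero_iff]
    simp only [Finset.mem_erase, Finset.mem_univ, and_true, headNe, Option.elim_some, ne_eq,
      Option.some.injEq]
    refine and_congr_right fun _ => forall_congr' fun l => ?_
    rw [eq_comm (a := i)]
    tauto

/-- The two kinds of points of the regular locus. -/
lemma regLocus_thetaYp_cases (hn : ∀ i, 1 ≤ n i) {q : CoxVar n → K}
    (hq : q ∈ regLocus K (thetaYp k n)) :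
    (∃ b : ∀ l, Fin (n l), (∀ l, q (CoxVar.x l (b l)) ≠ 0) ∧ ∃ o, headNe q o) ∨
    ∃ j : Lines n, (∀ b, q (CoxVar.x j.1 b) = 0) ∧ q (CoxVar.t j.1) ≠ 0 ∧
      ∃ b : ∀ l, Fin (n l), (∀ l, l ≠ j.1 → q (CoxVar.x l (b l)) ≠ 0) ∧
      ∃ o, o ≠ some j.1 ∧ headNe q o := by
  obtain ⟨h1, ⟨a, ha⟩, h3⟩ := mem_regLocus_thetaYp_iff.1 hq
  rw [sVal_ne_zero_iff] at ha
  by_cases hx : ∀ l, ∃ b, q (CoxVar.x l b) ≠ 0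
  · left
    choose b hb using hx
    refine ⟨b, hb, ?_⟩
    rcases a.supp_cases with h | ⟨i, h⟩
    · refine ⟨none, ?_⟩
      have := ha.1
      rwa [facE, if_pos h] at this
    · refine ⟨some i, ?_⟩
      have := ha.2 i
      rwa [fac_of_eq_none (PlusIdx.notMem_supp.1 (by simp [h]))] at this
  · right
    push Not at hx
    obtain ⟨j, hj⟩ := hx
    -- For `n j ≠ 1` the coordinates `x j` are those of the point of the `j`-th factor and cannot
    -- all vanish.
    have hj1 : n j = 1 := by
      by_contra h
      obtain ⟨b, hb⟩ := h1 j
      rw [yVal, if_neg h] at hb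
      exact hb (hj b)
    have hja : j ∉ a.supp := by
      intro h
      obtain ⟨b, hb⟩ := PlusIdx.mem_supp.1 h
      have := ha.2 j
      rw [fac_of_eq_some hb] at this
      exact this (hj b)
    have hsupp : a.supp = Finset.univ.erase j := by
      rcases a.supp_cases with h | ⟨i, h⟩
      · exact absurd (h ▸ Finset.mem_univ j) hja
      · have : j = i := by
          by_contra hne
          rw [h] at hja
          exact hja (Finset.mem_erase.2 ⟨hne, Finset.mem_univ j⟩)
        rw [h, this]
    have hb : ∀ l, ∃ b, l ≠ j → q (CoxVar.x l b) ≠ 0 := by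
      intro l
      by_cases hl : l = j
      · exact ⟨⟨0, hn l⟩, fun h => absurd hl h⟩
      · obtain ⟨b, hb⟩ := (PlusIdx.mem_supp (a := a) (i := l)).1
          (by rw [hsupp]; exact Finset.mem_erase.2 ⟨hl, Finset.mem_univ l⟩)
        refine ⟨b, fun _ => ?_⟩
        have := ha.2 l
        rwa [fac_of_eq_some hb] at this
    choose b hb using hb
    obtain ⟨a', ha', h4⟩ := h3 ⟨j, hj1⟩
    refine ⟨⟨j, hj1⟩, hj, ?_, b, hb, exists_headNe ha' h4⟩
    have := ha.2 j
    rwa [fac_of_eq_none (PlusIdx.notMem_supp.1 hja)] at this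

/-- If `t j` were the only nonzero one among `e` and the `t i`, the point would lie on the section
s_j although `x j ≠ 0`, and the factor of the blowup belonging to `j` would be undefined. The last
hypothesis excludes this. -/
lemma mem_regLocus_of_headNe {q : CoxVar n → K} {b : ∀ l, Fin (n l)} {o : Option (Fin r)}
    (hb : ∀ l, q (CoxVar.x l (b l)) ≠ 0) (ho : headNe q o)
    (h : ∀ j : Lines n, ∃ o, o ≠ some j.1 ∧ headNe q o) : q ∈ regLocus K (thetaYp k n) := by
  refine mem_regLocus_thetaYp_iff.2 ⟨fun i => ⟨b i, ?_⟩, ⟨bIdx b o, ?_⟩, fun j => ?_⟩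
  · rw [yVal]
    split_ifs
    · exact one_ne_zero
    · exact hb i
  · exact sVal_bIdx_ne.2 ⟨ho, fun l _ => hb l⟩
  · obtain ⟨o, ho, ho'⟩ := h j
    exact ⟨bIdx b o, mem_supp_bIdx.2 ho, (zVal_bIdx_ne ho).2 ⟨ho', fun l _ _ => hb l⟩⟩

lemma mem_regLocus_of_line {q : CoxVar n → K} {b : ∀ l, Fin (n l)} (j : Lines n)
    (hb : ∀ l, l ≠ j.1 → q (CoxVar.x l (b l)) ≠ 0) (ht : q (CoxVar.t j.1) ≠ 0)
    {o : Option (Fin r)} (ho : o ≠ some j.1) (ho' : headNe q o) :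
    q ∈ regLocus K (thetaYp k n) := by
  refine mem_regLocus_thetaYp_iff.2 ⟨fun i => ⟨b i, ?_⟩, ⟨bIdx b (some j.1), ?_⟩, fun j' => ?_⟩
  · rw [yVal]
    split_ifs with h
    · exact one_ne_zero
    · exact hb i fun h' => h (h' ▸ j.2)
  · exact sVal_bIdx_ne.2 ⟨ht, fun l hl => hb l fun h => hl (h ▸ rfl)⟩
  · by_cases hj : j' = j
    · subst hj
      exact ⟨bIdx b o, mem_supp_bIdx.2 ho, (zVal_bIdx_ne ho).2 ⟨ho', fun l hl _ => hb l hl⟩⟩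
    · have h1 : some j.1 ≠ some j'.1 := fun h => hj (Subtype.ext (Option.some.inj h).symm)
      exact ⟨bIdx b (some j.1), mem_supp_bIdx.2 h1, (zVal_bIdx_ne h1).2
        ⟨ht, fun l _ hl => hb l fun h => hl (h ▸ rfl)⟩⟩

end Target

/-! ### Points with Cox coordinates lie on the blowup of the bundle. -/

section Target

variable {k K : Type*} [Field k] [Field K] [Algebra k K] {r : ℕ} {n : Fin r → ℕ}

/-- The tensor product of the representatives of the components in the quotients of the factors. -/
def yProd (p : MPt k K (ypSpace n)) (a : PlusIdx n) : K :=
  ∏ i, (a.1 i).elim 1 (yPt p i).rep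

lemma fst_mem_Yh_iff {p : MPt k K (ypSpace n)} : fst p ∈ Yh k K n ↔
    ∃ c : Finset (Fin r) → K, ∀ a, (sPt p).rep a = c a.supp * yProd p a := Iff.rfl

open Classical in
-- For `n i = 1` the component in ℙ(V̄ i) does not see the size of `x i`. Hence `κ i` may vanish,
-- and only the one inclusion of lines is asserted.
lemma exists_scale {q : CoxVar n → K} {p : MPt k K (ypSpace n)}
    (h : ∀ i, Represents (yVal q i) (yPt p i)) :
    ∃ κ : Fin r → K, ∀ i b, q (CoxVar.x i b) = κ i * (yPt p i).rep b := by
  refine ⟨fun i => if hi : ∃ b, (yPt p i).rep b ≠ 0 then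
    q (CoxVar.x i hi.choose) / (yPt p i).rep hi.choose else 0, fun i b => ?_⟩
  have hi : ∃ b, (yPt p i).rep b ≠ 0 := Function.ne_iff.1 (yPt p i).rep_nonzero
  dsimp only
  rw [dif_pos hi, div_mul_eq_mul_div, eq_div_iff hi.choose_spec]
  by_cases h1 : n i = 1
  · rw [fin_eq_of_line h1 b hi.choose]
  · obtain ⟨t, _, ht⟩ := h i
    have h2 : ∀ b, q (CoxVar.x i b) = t * (yPt p i).rep b := fun b => by
      have := congrFun ht b
      rwa [yVal, if_neg h1] at this
    rw [h2, h2]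
    ring

lemma prod_fac_of_scale {q : CoxVar n → K} {p : MPt k K (ypSpace n)} {κ : Fin r → K}
    {a : PlusIdx n} {s : Finset (Fin r)}
    (h : ∀ i ∈ s, ∀ b, q (CoxVar.x i b) = κ i * (yPt p i).rep b) :
    ∏ l ∈ s, fac q a l = (∏ l ∈ s, if l ∈ a.supp then κ l else q (CoxVar.t l)) *
      ∏ l ∈ s, (a.1 l).elim 1 (yPt p l).rep := by
  rw [← Finset.prod_mul_distrib]
  refine Finset.prod_congr rfl fun l hl => ?_
  by_cases h1 : l ∈ a.supp
  · obtain ⟨b, hb⟩ := PlusIdx.mem_supp.1 h1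
    rw [fac_of_eq_some hb, if_pos h1, h l hl, hb]
    rfl
  · rw [fac_of_eq_none (PlusIdx.notMem_supp.1 h1), if_neg h1, PlusIdx.notMem_supp.1 h1]
    exact (mul_one _).symm

lemma mem_Yh_of_lifts {q : CoxVar n → K} {p : MPt k K (ypSpace n)}
    (h : Lifts (thetaYp k n) q p) : fst p ∈ Yh k K n := by
  obtain ⟨h1, ⟨t, ht, h2⟩, -⟩ := lifts_thetaYp_iff.1 h
  obtain ⟨κ, hκ⟩ := exists_scale h1
  rw [fst_mem_Yh_iff]
  refine ⟨fun I => t⁻¹ * ((if I = Finset.univ then q CoxVar.e else 1) *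
    ∏ l, if l ∈ I then κ l else q (CoxVar.t l)), fun a => ?_⟩
  rw [mul_assoc, eq_inv_mul_iff_mul_eq₀ ht, mul_assoc, yProd,
    ← prod_fac_of_scale fun i _ => hκ i]
  exact (congrFun h2 a).symm

lemma hval_secForms (j : Lines n) (a : {a : PlusIdx n // j.1 ∈ a.supp})
    (p : MPt k K (ypSpace n)) : hval (secForms k n j a) (fst p) = (sPt p).rep a.1 := by
  simp only [secForms, hval, MvPolynomial.aeval_X]
  rfl

lemma isMultiHom_secForms (j : Lines n) (a : {a : PlusIdx n // j.1 ∈ a.supp}) :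
    IsMultiHom (secForms k n j a) (Finsupp.single (Sum.inr ()) 1) := isMultiHom_X _

/-- Along the factor `j` of dimension one, `x j` divides all forms defining the section s_j. The
quotients `zVal` are the coordinates of the blowup. -/
lemma sVal_eq_of_line {q : CoxVar n → K} (j : Lines n) {a : PlusIdx n} (ha : j.1 ∈ a.supp)
    (b : Fin (n j.1)) : sVal q a = q (CoxVar.x j.1 b) * zVal q j.1 a := by
  obtain ⟨b', hb'⟩ := PlusIdx.mem_supp.1 ha
  rw [sVal_eq q j.1, fac_of_eq_some hb', fin_eq_of_line j.2 b b']

/-- The Cox coordinates that vanish on the exceptional divisors of the blowup of the projective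
bundle. -/
def lineVars (n : Fin r → ℕ) : Set (CoxVar n) := {s | ∃ (j : Lines n) (b : _), s = CoxVar.x j.1 b}

lemma represents_secForms {q : CoxVar n → K} {p : MPt k K (ypSpace n)}
    (h : Lifts (thetaYp k n) q p) {j : Lines n} {b : Fin (n j.1)} (hx : q (CoxVar.x j.1 b) ≠ 0) :
    Represents (fun a => hval (secForms k n j a) (fst p)) (zPt p j) := by
  obtain ⟨-, ⟨t, ht, h2⟩, h3⟩ := lifts_thetaYp_iff.1 h
  have : (fun a => hval (secForms k n j a) (fst p)) = (t⁻¹ * q (CoxVar.x j.1 b)) •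
      fun a : {a : PlusIdx n // j.1 ∈ a.supp} => zVal q j.1 a.1 := by
    funext a
    rw [Pi.smul_apply, smul_eq_mul, mul_assoc, ← sVal_eq_of_line j a.2, hval_secForms,
      eq_inv_mul_iff_mul_eq₀ ht, h2]
    rfl
  rw [this]
  exact (h3 j).smul (mul_ne_zero (inv_ne_zero ht) hx)

/-- Making the vanishing `x j` with `n j = 1` nonzero moves the point off all exceptional divisors
and into the graph. -/
lemma mem_Yp_of_lifts [Infinite K] (hn : ∀ i, 1 ≤ n i) {q : CoxVar n → K}
    {p : MPt k K (ypSpace n)} (h : Lifts (thetaYp k n) q p) : p ∈ Yp k K n := by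
  refine ⟨mem_Yh_of_lifts h, mem_closure_of_deform hom_thetaYp (lineVars n) h
    fun ε hε p' hp' => ⟨mem_Yh_of_lifts hp', fun j => ?_⟩⟩
  exact represents_secForms hp' (b := ⟨0, hn j.1⟩) (deform_ne hε q ⟨j, _, rfl⟩)

/-! #### Existence of Cox coordinates -/

/-- A pure tensor of coordinates as a polynomial. -/
def yPoly (a : PlusIdx n) : MvPolynomial (Σ j, ypSpace n j) k :=
  ∏ i, (a.1 i).elim 1 fun b => MvPolynomial.X ⟨Sum.inl (Sum.inl i), b⟩

lemma isMultiHom_yPoly {a a' : PlusIdx n} (h : a.supp = a'.supp) :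
    IsMultiHom (yPoly (k := k) a) (∑ i : Fin r, if i ∈ a'.supp then
      Finsupp.single (Sum.inl (Sum.inl i)) 1 else 0) := by
  refine MvPolynomial.IsWeightedHomogeneous.prod _ _ _ fun i _ => ?_
  rw [← h]
  by_cases h1 : i ∈ a.supp
  · obtain ⟨b, hb⟩ := PlusIdx.mem_supp.1 h1
    rw [if_pos h1, hb]
    exact isMultiHom_X (⟨Sum.inl (Sum.inl i), b⟩ : Σ j, ypSpace n j)
  · rw [if_neg h1, PlusIdx.notMem_supp.1 h1]
    exact MvPolynomial.isWeightedHomogeneous_one _ _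

lemma hval_yPoly (a : PlusIdx n) (p : MPt k K (ypSpace n)) : hval (yPoly a) p = yProd p a := by
  rw [yPoly, hval, map_prod, yProd]
  refine Finset.prod_congr rfl fun i _ => ?_
  rcases a.1 i with _ | b
  · simp
  · simp only [Option.elim_some, MvPolynomial.aeval_X]
    rfl

/-- On the graph this component is a projected point of ℰ, so in each summand it is a multiple of
the pure tensor. Such proportions are closed conditions. -/
lemma zPt_mul_yProd {p : MPt k K (ypSpace n)} (hp : p ∈ Yp k K n) (j : Lines n)
    {a a' : {a : PlusIdx n // j.1 ∈ a.supp}} (h : a.1.supp = a'.1.supp) :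
    (zPt p j).rep a * yProd p a'.1 = (zPt p j).rep a' * yProd p a.1 := by
  have h1 := ((isMultiHom_X (k := k) (⟨Sum.inr j, a⟩ : Σ j, ypSpace n j)).mul
    (isMultiHom_yPoly (k := k) h.symm)).sub
    ((isMultiHom_X (k := k) (⟨Sum.inr j, a'⟩ : Σ j, ypSpace n j)).mul
    (isMultiHom_yPoly (k := k) rfl))
  have hv : ∀ p : MPt k K (ypSpace n), hval (MvPolynomial.X (⟨Sum.inr j, a⟩ : Σ j, ypSpace n j) *
      yPoly a'.1 - MvPolynomial.X (⟨Sum.inr j, a'⟩ : Σ j, ypSpace n j) * yPoly a.1 :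
        MvPolynomial (Σ j, ypSpace n j) k) p =
      (zPt p j).rep a * yProd p a'.1 - (zPt p j).rep a' * yProd p a.1 := by
    intro p
    simp only [← hval_yPoly, hval, map_sub, map_mul, MvPolynomial.aeval_X]
    rfl
  have h3 := closure_minimal (fun p hp => ?_) (isClosed_hval_eq_zero h1) hp.2
  · rw [Set.mem_ofPred_eq, hv, sub_eq_zero] at h3
    exact h3
  · rw [Set.mem_ofPred_eq, hv, sub_eq_zero]
    obtain ⟨c, hc⟩ := fst_mem_Yh_iff.1 hp.1
    obtain ⟨t, ht, h4⟩ := hp.2 j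
    have h5 : ∀ a : {a : PlusIdx n // j.1 ∈ a.supp},
        c a.1.supp * yProd p a.1 = t * (zPt p j).rep a := fun a => by
      rw [← hc, ← hval_secForms]
      exact congrFun h4 a
    apply mul_left_cancel₀ ht
    rw [← mul_assoc, ← mul_assoc, ← h5, ← h5, h]
    ring

lemma exists_zPt_eq {p : MPt k K (ypSpace n)} (hp : p ∈ Yp k K n) (j : Lines n) :
    ∃ d : Finset (Fin r) → K, ∀ a : {a : PlusIdx n // j.1 ∈ a.supp},
      (zPt p j).rep a = d a.1.supp * yProd p a.1 := by
  choose b hb using fun i => Function.ne_iff.1 (yPt p i).rep_nonzero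
  have hb0 : ∀ o, yProd p (bIdx b o) ≠ 0 := fun o => Finset.prod_ne_zero_iff.2 fun i _ => by
    rw [bIdx_apply]
    split_ifs
    · exact one_ne_zero
    · exact hb i
  -- Each support is that of some `bIdx b o`, where the pure tensor has a nonzero entry. For a set
  -- that is no support the choice of `o` is irrelevant.
  have hO : ∀ I : Finset (Fin r), ∃ o : Option (Fin r), ∀ a : PlusIdx n, a.supp = I →
      (bIdx b o).supp = I := by
    intro I
    by_cases h : ∃ a : PlusIdx n, a.supp = I
    · obtain ⟨a, rfl⟩ := h
      rcases a.supp_cases with h1 | ⟨i, h1⟩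
      · exact ⟨none, fun _ _ => by rw [h1, supp_bIdx_eq_univ_iff]⟩
      · refine ⟨some i, fun _ _ => ?_⟩
        ext l
        rw [mem_supp_bIdx, h1]
        simp [eq_comm]
    · exact ⟨none, fun a ha => absurd ⟨a, ha⟩ h⟩
  choose o ho using hO
  refine ⟨fun I => if h : j.1 ∈ (bIdx b (o I)).supp then
    (zPt p j).rep ⟨bIdx b (o I), h⟩ / yProd p (bIdx b (o I)) else 0, fun a => ?_⟩
  have h1 := ho _ a.1 rfl
  have h2 : j.1 ∈ (bIdx b (o a.1.supp)).supp := by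
    rw [h1]
    exact a.2
  dsimp only
  rw [dif_pos h2, div_mul_eq_mul_div, eq_div_iff (hb0 _)]
  exact zPt_mul_yProd hp j (a := a) (a' := ⟨_, h2⟩) h1.symm

lemma represents_yVal {q : CoxVar n → K} {p : MPt k K (ypSpace n)} {i : Fin r}
    (h : n i ≠ 1 → ∀ b, q (CoxVar.x i b) = (yPt p i).rep b) : Represents (yVal q i) (yPt p i) := by
  by_cases hi : n i = 1
  · obtain ⟨b, hb⟩ := Function.ne_iff.1 (yPt p i).rep_nonzero
    refine ⟨((yPt p i).rep b)⁻¹, inv_ne_zero hb, funext fun b' => ?_⟩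
    rw [Pi.smul_apply, smul_eq_mul, fin_eq_of_line hi b' b, yVal, if_pos hi]
    exact (inv_mul_cancel₀ hb).symm
  · have : yVal q i = (yPt p i).rep := by
      funext b
      rw [yVal, if_neg hi, h hi]
    rw [this]
    exact represents_rep _

/-- Off the section s_j the blowup is the graph, and dividing by `x j` gives the coordinates `zVal`.
-/
lemma represents_zVal {q : CoxVar n → K} {p : MPt k K (ypSpace n)} (hp : p ∈ Yp k K n)
    (hS : sVal q = (sPt p).rep) {j : Lines n} {b : Fin (n j.1)} (hx : q (CoxVar.x j.1 b) ≠ 0)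
    {a : PlusIdx n} (ha : j.1 ∈ a.supp) (ha' : (sPt p).rep a ≠ 0) :
    Represents (fun a : {a : PlusIdx n // j.1 ∈ a.supp} => zVal q j.1 a.1) (zPt p j) := by
  have h1 := represents_of_mem_blowup (F := secForms k n) (d := fun _ => _) isMultiHom_secForms hp
    (j := j) (fun h => ha' (by rw [← hval_secForms j ⟨a, ha⟩]; exact congrFun h ⟨a, ha⟩))
  have h2 : (fun a : {a : PlusIdx n // j.1 ∈ a.supp} => zVal q j.1 a.1) =
      (q (CoxVar.x j.1 b))⁻¹ • fun a => hval (secForms k n j a) (fst p) := by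
    funext a
    rw [Pi.smul_apply, smul_eq_mul, hval_secForms, ← hS, sVal_eq_of_line j a.2 b,
      inv_mul_cancel_left₀ hx]
  rw [h2]
  exact h1.smul (inv_ne_zero hx)

/-- Exactly one of `e` and the `t i` enters each multi-index; it is the coefficient of the
corresponding summand, up to the common factor `μ`. -/
lemma facE_eq {q : CoxVar n → K} {c : Finset (Fin r) → K} {a : PlusIdx n}
    {s : Finset (Fin r)} (hs : ∀ l, l ∉ a.supp → l ∈ s) {μ : K}
    (he : a.supp = Finset.univ → q CoxVar.e = c Finset.univ * μ)
    (ht : ∀ i ∈ s, i ∉ a.supp → q (CoxVar.t i) = c (Finset.univ.erase i) * μ) :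
    facE q a * ∏ l ∈ s, (if l ∈ a.supp then 1 else q (CoxVar.t l)) = c a.supp * μ := by
  rcases a.supp_cases with h | ⟨i, h⟩
  · rw [facE, if_pos h, he h, h, Finset.prod_eq_one, mul_one]
    intro l _
    rw [if_pos (Finset.mem_univ l)]
  · have hi : i ∉ a.supp := by simp [h]
    have hne : a.supp ≠ Finset.univ := fun h2 => hi (h2 ▸ Finset.mem_univ i)
    rw [facE, if_neg hne, one_mul, Finset.prod_eq_single i, if_neg hi, ht i (hs i hi) hi, ← h]
    · intro l _ hl
      rw [if_pos (by rw [h]; exact Finset.mem_erase.2 ⟨hl, Finset.mem_univ l⟩)]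
    · exact fun h2 => absurd (hs i hi) h2

/-- Off all sections, `e` and `t i` are the coefficients of the point of ℰ and `x i` is a
representative in V̄ i. A point over s_j needs its normal direction as well, which is recorded in
the factor of the blowup. It lies over no other section, so there the remaining factors are graphs.
-/
lemma exists_lift_Yp {p : MPt k K (ypSpace n)} (hp : p ∈ Yp k K n) :
    ∃ q ∈ regLocus K (thetaYp k n), Lifts (thetaYp k n) q p := by
  suffices h : ∃ q, Lifts (thetaYp k n) q p from h.imp fun q hq => ⟨hq.mem_regLocus, hq⟩
  obtain ⟨c, hc⟩ := fst_mem_Yh_iff.1 hp.1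
  by_cases hsec : ∀ j : Lines n, ∃ a : PlusIdx n, j.1 ∈ a.supp ∧ (sPt p).rep a ≠ 0
  · let q : CoxVar n → K := fun s => match s with
      | CoxVar.e => c Finset.univ
      | CoxVar.t i => c (Finset.univ.erase i)
      | CoxVar.x i b => (yPt p i).rep b
    have hS : sVal q = (sPt p).rep := by
      funext a
      rw [sVal, prod_fac_of_scale (p := p) (κ := fun _ => 1) (fun i _ b => (one_mul _).symm), hc,
        ← mul_assoc, facE_eq (c := c) (μ := 1) (fun l _ => Finset.mem_univ l)
          (fun _ => (mul_one _).symm)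
          (fun i _ _ => (mul_one _).symm), mul_one, yProd]
    refine ⟨q, lifts_thetaYp_iff.2 ⟨fun i => represents_yVal fun _ _ => rfl,
      hS ▸ represents_rep _, fun j => ?_⟩⟩
    obtain ⟨b, hb⟩ := Function.ne_iff.1 (yPt p j.1).rep_nonzero
    obtain ⟨a, ha, ha'⟩ := hsec j
    exact represents_zVal hp hS (b := b) hb ha ha'
  · push Not at hsec
    obtain ⟨j, hj⟩ := hsec
    obtain ⟨d, hd⟩ := exists_zPt_eq hp j
    obtain ⟨b, hb⟩ := Function.ne_iff.1 (yPt p j.1).rep_nonzero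
    set μ := (yPt p j.1).rep b
    have hb : μ ≠ 0 := hb
    -- Over s_j: `x j = 0`, the coefficient `t j` comes from the point of the bundle, and `e` and
    -- the other `t i` come from the blowup factor. The scalar `μ` is the coordinate of the `j`-th
    -- component, which occurs in the pure tensor but not in `zVal`.
    let q : CoxVar n → K := fun s => match s with
      | CoxVar.e => d Finset.univ * μ
      | CoxVar.t i => if i = j.1 then c (Finset.univ.erase i) else d (Finset.univ.erase i) * μ
      | CoxVar.x i b => if i = j.1 then 0 else (yPt p i).rep b
    have hx : ∀ i, i ≠ j.1 → ∀ b, q (CoxVar.x i b) = (yPt p i).rep b := fun i hi b => if_neg hi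
    have hZ : ∀ a : {a : PlusIdx n // j.1 ∈ a.supp}, zVal q j.1 a.1 = (zPt p j).rep a := by
      intro a
      obtain ⟨b', hb'⟩ := PlusIdx.mem_supp.1 a.2
      rw [zVal, prod_fac_of_scale (p := p) (κ := fun _ => 1) (fun i hi b => by
        rw [one_mul, hx i (Finset.ne_of_mem_erase hi)]), ← mul_assoc,
        facE_eq (c := d) (μ := μ) (fun l hl => Finset.mem_erase.2
          ⟨fun h => hl (h ▸ a.2), Finset.mem_univ l⟩) (fun _ => rfl)
          (fun i hi _ => if_neg (Finset.ne_of_mem_erase hi)), hd, yProd,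
        ← Finset.mul_prod_erase _ _ (Finset.mem_univ j.1), hb', mul_assoc]
      congr 2
      rw [fin_eq_of_line j.2 b' b]
      rfl
    have hS : sVal q = (sPt p).rep := by
      funext a
      by_cases ha : j.1 ∈ a.supp
      · obtain ⟨b', hb'⟩ := PlusIdx.mem_supp.1 ha
        rw [hj a ha, sVal_eq q j.1, fac_of_eq_some hb']
        simp [q]
      · have hsupp : ∀ l, l ∉ a.supp → l = j.1 := by
          intro l hl
          rcases a.supp_cases with h | ⟨i, h⟩
          · exact absurd (h ▸ Finset.mem_univ l) hl
          · have h1 : l = i := by simpa [h] using hl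
            have h2 : j.1 = i := by simpa [h] using ha
            rw [h1, h2]
        have hne : a.supp ≠ Finset.univ := fun h2 => ha (h2 ▸ Finset.mem_univ _)
        have hprod : ∏ l, fac q a l = (∏ l, if l ∈ a.supp then 1 else q (CoxVar.t l)) *
            yProd p a := by
          rw [yProd, ← Finset.prod_mul_distrib]
          refine Finset.prod_congr rfl fun l _ => ?_
          by_cases h1 : l ∈ a.supp
          · obtain ⟨b', hb'⟩ := PlusIdx.mem_supp.1 h1
            rw [fac_of_eq_some hb', if_pos h1, hx l (fun h => ha (h ▸ h1)), hb']
            exact (one_mul _).symm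
          · rw [fac_of_eq_none (PlusIdx.notMem_supp.1 h1), if_neg h1, PlusIdx.notMem_supp.1 h1]
            exact (mul_one _).symm
        have h3 := facE_eq (q := q) (c := c) (a := a) (s := Finset.univ) (μ := 1)
          (fun l _ => Finset.mem_univ l) (fun h => absurd h hne) (fun i _ hi => by
            rw [mul_one]
            exact if_pos (hsupp i hi))
        rw [mul_one] at h3
        rw [sVal, hprod, hc, ← h3, mul_assoc]
    refine ⟨q, lifts_thetaYp_iff.2 ⟨fun i => represents_yVal fun hi _ => hx i (fun h =>
      hi (h ▸ j.2)) _, hS ▸ represents_rep _, fun j' => ?_⟩⟩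
    by_cases hjj : j' = j
    · subst hjj
      rw [funext hZ]
      exact represents_rep _
    · have hne : j'.1 ≠ j.1 := fun h => hjj (Subtype.ext h)
      obtain ⟨b', hb'⟩ := Function.ne_iff.1 (yPt p j'.1).rep_nonzero
      obtain ⟨a, ha⟩ := Function.ne_iff.1 (sPt p).rep_nonzero
      have ha : (sPt p).rep a ≠ 0 := ha
      have hja : j.1 ∉ a.supp := fun h => ha (hj a h)
      have hja' : j'.1 ∈ a.supp := by
        rcases a.supp_cases with h | ⟨i, h⟩
        · rw [h]
          exact Finset.mem_univ _
        · have h2 : j.1 = i := by simpa [h] using hja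
          rw [h, ← h2]
          exact Finset.mem_erase.2 ⟨hne, Finset.mem_univ _⟩
      exact represents_zVal hp hS (b := b') (by rw [hx _ hne]; exact hb') hja' ha

end Target

/-! ### Ratios of homogeneous coordinates. -/

section General

variable {k K : Type*} [Field k] [Field K] [Algebra k K] {ι : Type} {m : ι → Type}
variable {X : Set (MPt k K m)}

lemma regAt_coord_div {j : ι} (a a' : m j) {x : X} (hx : (x.1 j).rep a' ≠ 0) :
    RegAt (fun z : X => (z.1 j).rep a / (z.1 j).rep a') x := by
  refine ⟨_, _, _, isMultiHom_X (⟨j, a⟩ : Σ j, m j), isMultiHom_X (⟨j, a'⟩ : Σ j, m j), ?_,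
    Filter.Eventually.of_forall fun z => ?_⟩
  · simpa [hval] using hx
  · simp [hval]

lemma eventually_coord_ne {j : ι} {a : m j} {x : X} (hx : (x.1 j).rep a ≠ 0) :
    ∀ᶠ z : X in 𝓝 x, (z.1 j).rep a ≠ 0 := by
  have := eventually_hval_ne (isMultiHom_X (k := k) (⟨j, a⟩ : Σ j, m j)) (x := x)
    (by simpa [hval] using hx)
  simpa [hval] using this

end General

/-! ### Local sections, frames and prime divisors on the blowup of the bundle. -/

section Target

variable {k K : Type*} [Field k] [Field K] [Algebra k K] {r : ℕ} {n : Fin r → ℕ}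

lemma yPt_div {q : CoxVar n → K} {p : MPt k K (ypSpace n)} (h : Lifts (thetaYp k n) q p)
    {i : Fin r} (b : Fin (n i)) {b' : Fin (n i)} (hb : q (CoxVar.x i b') ≠ 0) :
    (yPt p i).rep b / (yPt p i).rep b' = q (CoxVar.x i b) / q (CoxVar.x i b') := by
  obtain ⟨κ, hκ⟩ := exists_scale (lifts_thetaYp_iff.1 h).1
  rw [hκ] at hb
  rw [hκ, hκ, mul_div_mul_left _ _ (left_ne_zero_of_mul hb)]

lemma yPt_ne {q : CoxVar n → K} {p : MPt k K (ypSpace n)} (h : Lifts (thetaYp k n) q p)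
    {i : Fin r} {b : Fin (n i)} (hb : q (CoxVar.x i b) ≠ 0) : (yPt p i).rep b ≠ 0 := by
  obtain ⟨κ, hκ⟩ := exists_scale (lifts_thetaYp_iff.1 h).1
  rw [hκ] at hb
  exact right_ne_zero_of_mul hb

lemma x_ne_of_yPt_ne {q : CoxVar n → K} {p : MPt k K (ypSpace n)} (h : Lifts (thetaYp k n) q p)
    {i : Fin r} (hi : n i ≠ 1) {b : Fin (n i)} (hb : (yPt p i).rep b ≠ 0) :
    q (CoxVar.x i b) ≠ 0 := by
  obtain ⟨t, ht, h1⟩ := (lifts_thetaYp_iff.1 h).1 i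
  have := congrFun h1 b
  rw [yVal, if_neg hi] at this
  rw [this]
  exact mul_ne_zero ht hb

lemma exists_sPt {q : CoxVar n → K} {p : MPt k K (ypSpace n)} (h : Lifts (thetaYp k n) q p) :
    ∃ s : K, s ≠ 0 ∧ ∀ a, (sPt p).rep a = s * sVal q a := by
  obtain ⟨t, ht, h1⟩ := (lifts_thetaYp_iff.1 h).2.1
  refine ⟨t⁻¹, inv_ne_zero ht, fun a => ?_⟩
  rw [h1, Pi.smul_apply, smul_eq_mul, inv_mul_cancel_left₀ ht]

lemma exists_zPt {q : CoxVar n → K} {p : MPt k K (ypSpace n)} (h : Lifts (thetaYp k n) q p)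
    (j : Lines n) : ∃ s : K, s ≠ 0 ∧ ∀ a, (zPt p j).rep a = s * zVal q j.1 a.1 := by
  obtain ⟨t, ht, h1⟩ := (lifts_thetaYp_iff.1 h).2.2 j
  refine ⟨t⁻¹, inv_ne_zero ht, fun a => ?_⟩
  have : zVal q j.1 a.1 = _ := congrFun h1 a
  rw [this, Pi.smul_apply, smul_eq_mul, inv_mul_cancel_left₀ ht]

/-- The section is normalised by `x i (b i) = 1` for all `i` and by making equal to `1` that one of
`e` and the `t i` which belongs to `o`. -/
lemma exists_section_Yp_of_x_ne {q₀ : CoxVar n → K} (x : Yp k K n) {b : ∀ l, Fin (n l)}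
    (hb : ∀ l, q₀ (CoxVar.x l (b l)) ≠ 0) {o : Option (Fin r)} (ho : headNe q₀ o)
    (hQ : q₀ ∈ regLocus K (thetaYp k n))
    (hq₀ : Lifts (thetaYp k n) q₀ x.1) : ∃ σ : Yp k K n → CoxVar n → K,
    (∀ s, RegAt (fun z => σ z s) x) ∧ ∀ᶠ z : Yp k K n in 𝓝 x, ∀ q ∈ regLocus K (thetaYp k n),
      Lifts (thetaYp k n) q z.1 → ∃ u : Option (Fin r) → Kˣ, σ z = tact wt u q := by
  -- For `n j = 1` the component in ℙ(V̄ j) cannot detect `x j ≠ 0`. The coordinates `a j` of the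
  -- bundle, divisible by `x j`, ensure it at nearby points.
  choose a ha ha' using (mem_regLocus_thetaYp_iff.1 hQ).2.2
  obtain ⟨s, hs, hs'⟩ := exists_sPt hq₀
  have h1 : ∀ i, (yPt x.1 i).rep (b i) ≠ 0 := fun i => yPt_ne hq₀ (hb i)
  have h2 : (sPt x.1).rep (bIdx b o) ≠ 0 := by
    rw [hs']
    exact mul_ne_zero hs (sVal_bIdx_ne.2 ⟨ho, fun l _ => hb l⟩)
  have h3 : ∀ j, (sPt x.1).rep (a j) ≠ 0 := fun j => by
    rw [hs', sVal_eq_of_line j (ha j) (b j.1)]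
    exact mul_ne_zero hs (mul_ne_zero (hb _) (ha' j))
  refine ⟨fun z s => match s with
    | CoxVar.e => (sPt z.1).rep (bIdx b none) / (sPt z.1).rep (bIdx b o)
    | CoxVar.t i => (sPt z.1).rep (bIdx b (some i)) / (sPt z.1).rep (bIdx b o)
    | CoxVar.x i c => (yPt z.1 i).rep c / (yPt z.1 i).rep (b i), ?_, ?_⟩
  · rintro (_ | i | ⟨i, c⟩)
    · exact regAt_coord_div (m := ypSpace n) (x := x)
          (j := Sum.inl (Sum.inr ())) (bIdx b none) (bIdx b o) h2
    · exact regAt_coord_div (m := ypSpace n) (x := x)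
          (j := Sum.inl (Sum.inr ())) (bIdx b (some i)) (bIdx b o) h2
    · exact regAt_coord_div (m := ypSpace n) (x := x)
          (j := Sum.inl (Sum.inl i)) c (b i) (h1 i)
  · filter_upwards [Filter.eventually_all.2 fun i => eventually_coord_ne (j := Sum.inl (Sum.inl i))
      (h1 i), eventually_coord_ne (j := Sum.inl (Sum.inr ())) h2, Filter.eventually_all.2 fun j =>
      eventually_coord_ne (j := Sum.inl (Sum.inr ())) (h3 j)] with z h1 h2 h3 q _ hqz
    change ∀ i, (yPt z.1 i).rep (b i) ≠ 0 at h1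
    change (sPt z.1).rep (bIdx b o) ≠ 0 at h2
    change ∀ j, (sPt z.1).rep (a j) ≠ 0 at h3
    obtain ⟨s, hs, hs'⟩ := exists_sPt hqz
    have hx : ∀ i, q (CoxVar.x i (b i)) ≠ 0 := by
      intro i
      by_cases hi : n i = 1
      · have := h3 ⟨i, hi⟩
        rw [hs', sVal_eq_of_line ⟨i, hi⟩ (ha _) (b i)] at this
        exact left_ne_zero_of_mul (right_ne_zero_of_mul this)
      · exact x_ne_of_yPt_ne hqz hi (h1 i)
    have hS : ∀ o', (sPt z.1).rep (bIdx b o') / (sPt z.1).rep (bIdx b o) =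
        sVal q (bIdx b o') / sVal q (bIdx b o) := fun o' => by
      rw [hs', hs', mul_div_mul_left _ _ hs]
    have h0 : sVal q (bIdx b o) ≠ 0 := by
      rw [hs'] at h2
      exact right_ne_zero_of_mul h2
    refine ⟨torusPt (Units.mk0 _ (div_ne_zero (Finset.prod_ne_zero_iff.2 fun l (_ : l ∈
      Finset.univ) => hx l) h0)) fun i => Units.mk0 _ (inv_ne_zero (hx i)),
      eq_tact ?_ (fun i => ?_) fun i c => ?_⟩
    · simp only [torusPt, Option.elim, Units.val_mk0, hS, sVal_bIdx_none]
      ring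
    · simp only [torusPt, Option.elim, Units.val_mk0, hS, sVal_bIdx_some]
      rw [← Finset.mul_prod_erase _ _ (Finset.mem_univ i)]
      have := hx i
      field_simp
    · simp only [torusPt, Option.elim, Units.val_mk0]
      rw [yPt_div hqz _ (hx i), div_eq_inv_mul]

/-- A chart around a point over s_j. Besides `x i (b i)` for `i ≠ j` and the coordinate belonging to
`o`, also `t j` is normalised to `1`. Then `x j` is the ratio of two bundle coordinates, a local
equation of the exceptional divisor. -/
lemma exists_section_Yp_of_line {q₀ : CoxVar n → K} (x : Yp k K n) (j : Lines n)
    {b : ∀ l, Fin (n l)} (hb : ∀ l, l ≠ j.1 → q₀ (CoxVar.x l (b l)) ≠ 0)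
    (ht : q₀ (CoxVar.t j.1) ≠ 0) {o : Option (Fin r)} (hoj : o ≠ some j.1) (ho : headNe q₀ o)
    (hq₀ : Lifts (thetaYp k n) q₀ x.1) : ∃ σ : Yp k K n → CoxVar n → K,
    (∀ s, RegAt (fun z => σ z s) x) ∧ ∀ᶠ z : Yp k K n in 𝓝 x, ∀ q ∈ regLocus K (thetaYp k n),
      Lifts (thetaYp k n) q z.1 → ∃ u : Option (Fin r) → Kˣ, σ z = tact wt u q := by
  obtain ⟨s, hs, hs'⟩ := exists_sPt hq₀
  obtain ⟨s₁, hs₁, hs₁'⟩ := exists_zPt hq₀ j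
  have h1 : ∀ i, i ≠ j.1 → (yPt x.1 i).rep (b i) ≠ 0 := fun i hi => yPt_ne hq₀ (hb i hi)
  have h2 : (sPt x.1).rep (bIdx b (some j.1)) ≠ 0 := by
    rw [hs']
    exact mul_ne_zero hs (sVal_bIdx_ne.2 ⟨ht, fun l hl => hb l fun h => hl (h ▸ rfl)⟩)
  have h3 : (zPt x.1 j).rep ⟨bIdx b o, mem_supp_bIdx.2 hoj⟩ ≠ 0 := by
    rw [hs₁']
    exact mul_ne_zero hs₁ ((zVal_bIdx_ne hoj).2 ⟨ho, fun l hl _ => hb l hl⟩)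
  refine ⟨fun z s => match s with
    | CoxVar.e => (zPt z.1 j).rep ⟨bIdx b none, mem_supp_bIdx.2 (by simp)⟩ /
        (zPt z.1 j).rep ⟨bIdx b o, mem_supp_bIdx.2 hoj⟩
    | CoxVar.t i => if hi : i = j.1 then 1 else
        (zPt z.1 j).rep ⟨bIdx b (some i), mem_supp_bIdx.2 (by simpa using hi)⟩ /
        (zPt z.1 j).rep ⟨bIdx b o, mem_supp_bIdx.2 hoj⟩
    | CoxVar.x i c => if i = j.1 then (sPt z.1).rep (bIdx b o) / (sPt z.1).rep (bIdx b (some j.1))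
        else (yPt z.1 i).rep c / (yPt z.1 i).rep (b i), ?_, ?_⟩
  · rintro (_ | i | ⟨i, c⟩)
    · exact regAt_coord_div (m := ypSpace n) (x := x) (j := Sum.inr j) ⟨bIdx b none, mem_supp_bIdx.2 (by simp)⟩
        ⟨bIdx b o, mem_supp_bIdx.2 hoj⟩ h3
    · by_cases hi : i = j.1
      · simpa [hi] using regAt_const (k := k) (1 : k) x
      · simp only [hi, dite_false]
        exact regAt_coord_div (m := ypSpace n) (x := x) (j := Sum.inr j)
          ⟨bIdx b (some i), mem_supp_bIdx.2 (by simpa using hi)⟩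
          ⟨bIdx b o, mem_supp_bIdx.2 hoj⟩ h3
    · by_cases hi : i = j.1
      · simp only [hi, if_true]
        exact regAt_coord_div (m := ypSpace n) (x := x)
          (j := Sum.inl (Sum.inr ())) (bIdx b o) (bIdx b (some j.1)) h2
      · simp only [hi, if_false]
        exact regAt_coord_div (m := ypSpace n) (x := x)
          (j := Sum.inl (Sum.inl i)) c (b i) (h1 i hi)
  · filter_upwards [eventually_coord_ne (j := Sum.inl (Sum.inr ())) h2,
      eventually_coord_ne (j := Sum.inr j) h3] with z h2 h3 q _ hqz
    change (sPt z.1).rep (bIdx b (some j.1)) ≠ 0 at h2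
    change (zPt z.1 j).rep ⟨bIdx b o, mem_supp_bIdx.2 hoj⟩ ≠ 0 at h3
    obtain ⟨s, hs, hs'⟩ := exists_sPt hqz
    obtain ⟨s₁, hs₁, hs₁'⟩ := exists_zPt hqz j
    have h0 : sVal q (bIdx b (some j.1)) ≠ 0 := by
      rw [hs'] at h2
      exact right_ne_zero_of_mul h2
    have ht : q (CoxVar.t j.1) ≠ 0 := (sVal_bIdx_ne.1 h0).1
    have hx : ∀ i, i ≠ j.1 → q (CoxVar.x i (b i)) ≠ 0 := fun i hi => (sVal_bIdx_ne.1 h0).2 i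
      fun h => hi (Option.some.inj h).symm
    have hw : zVal q j.1 (bIdx b o) ≠ 0 := by
      rw [hs₁'] at h3
      exact right_ne_zero_of_mul h3
    have hP : ∏ l ∈ Finset.univ.erase j.1, q (CoxVar.x l (b l)) ≠ 0 :=
      Finset.prod_ne_zero_iff.2 fun l hl => hx l (Finset.ne_of_mem_erase hl)
    refine ⟨torusPt (Units.mk0 _ (div_ne_zero hP hw)) fun i => if hi : i = j.1 then
      Units.mk0 _ (div_ne_zero hw (mul_ne_zero ht hP)) else Units.mk0 _ (inv_ne_zero (hx i hi)),
      eq_tact ?_ (fun i => ?_) fun i c => ?_⟩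
    · simp only [torusPt, Option.elim, Units.val_mk0, hs₁']
      rw [mul_div_mul_left _ _ hs₁, zVal_bIdx_none]
      ring
    · by_cases hi : i = j.1
      · subst hi
        simp only [torusPt, Option.elim, Units.val_mk0, dite_true]
        field_simp
      · simp only [torusPt, Option.elim, Units.val_mk0, hi, dite_false, hs₁']
        rw [mul_div_mul_left _ _ hs₁, zVal_bIdx_some _ hi,
          ← Finset.mul_prod_erase (Finset.univ.erase j.1) _
            (Finset.mem_erase.2 ⟨hi, Finset.mem_univ i⟩)]
        have := hx i hi
        field_simp
    · by_cases hi : i = j.1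
      · subst hi
        simp only [torusPt, Option.elim, Units.val_mk0, dite_true, if_true, hs']
        rw [mul_div_mul_left _ _ hs, sVal_bIdx_some,
          sVal_eq_of_line j (mem_supp_bIdx.2 hoj) c]
        ring
      · simp only [torusPt, Option.elim, Units.val_mk0, hi, dite_false, if_false]
        rw [yPt_div hqz _ (hx i hi), div_eq_inv_mul]

lemma HasFrame.degE_of_headNe {q : CoxVar n → K} {o : Option (Fin r)} (ho : headNe q o)
    (hX : ∀ i, o = some i → HasFrame k wt q (degX i)) : HasFrame k wt q (degE r) := by
  rcases o with _ | i
  · exact hasFrame_of_ne (w := wt) ho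
  · have h : HasFrame k wt q (degX i + degE r) := hasFrame_of_ne (w := wt) ho
    have := h.sub (hX i rfl)
    rwa [add_sub_cancel_left] at this

lemma exists_frame_Yp (hn : ∀ i, 1 ≤ n i) {q : CoxVar n → K}
    (hq : q ∈ regLocus K (thetaYp k n)) (d : Option (Fin r) → ℤ) : HasFrame k wt q d := by
  rcases regLocus_thetaYp_cases hn hq with ⟨b, hb, o, ho⟩ | ⟨j, -, ht, b, hb, o, hoj, ho⟩
  · have hX : ∀ i, HasFrame k wt q (degX i) := fun i => hasFrame_of_ne (w := wt) (hb i)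
    exact hasFrame_of_degX (HasFrame.degE_of_headNe ho fun i _ => hX i) hX d
  · have hX : ∀ i, i ≠ j.1 → HasFrame k wt q (degX i) := fun i hi =>
      hasFrame_of_ne (w := wt) (hb i hi)
    have hE : HasFrame k wt q (degE r) := HasFrame.degE_of_headNe ho fun i hi => hX i
      fun h => hoj (h ▸ hi)
    refine hasFrame_of_degX hE (fun i => ?_) d
    by_cases hi : i = j.1
    · have h : HasFrame k wt q (degX j.1 + degE r) := hasFrame_of_ne (w := wt) ht
      have := h.sub hE
      rw [add_sub_cancel_right] at this
      rwa [hi]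
    · exact hX i hi

/-- A factor of dimension one is never the only factor, since the total dimension is at least two.
-/
lemma exists_ne_of_line (hdim : 2 ≤ ∑ i, n i) (j : Lines n) : ∃ i, i ≠ j.1 := by
  by_contra! h
  have h1 : ∑ i, n i = n j.1 := by
    rw [Finset.sum_eq_single j.1]
    · exact fun i _ hi => absurd (h i) hi
    · simp
  rw [h1, j.2] at hdim
  omega

/-- As for the other blowup, monomials whose nonvanishing loci are regular have no common prime
factor. The monomials in `h3`, without `x j`, belong to neighbourhoods of points of the exceptional
divisors. -/
lemma exists_zero_Yp [IsAlgClosed K] (hn : ∀ i, 1 ≤ n i) (hdim : 2 ≤ ∑ i, n i)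
    {π : MvPolynomial (CoxVar n) k} (hπ : Prime π) :
    ∃ q ∈ regLocus K (thetaYp k n), MvPolynomial.aeval q π = 0 := by
  by_contra h
  have hr : Nonempty (Fin r) := by
    by_contra hr
    rw [not_nonempty_iff] at hr
    simp at hdim
  have h1 : ∀ c : ∀ l, Fin (n l), π ∣ MvPolynomial.X CoxVar.e ∨
      ∃ i, π ∣ MvPolynomial.X (CoxVar.x i (c i)) := by
    intro c
    have := prime_dvd_of_forall hπ h
      (f := MvPolynomial.X CoxVar.e * ∏ l, MvPolynomial.X (CoxVar.x l (c l))) (fun q hq => by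
        simp only [map_mul, map_prod, MvPolynomial.aeval_X, mul_ne_zero_iff,
          Finset.prod_ne_zero_iff] at hq
        exact mem_regLocus_of_headNe (b := c) (o := none) (fun l => hq.2 l (Finset.mem_univ _)) hq.1
          fun j => ⟨none, by simp, hq.1⟩)
    refine (hπ.dvd_or_dvd this).imp id fun h => ?_
    exact ((Prime.dvd_finsetProd_iff hπ _).1 h).imp fun l hl => hl.2
  have h2 : (∃ i, π ∣ MvPolynomial.X (CoxVar.t i)) ∨
      ∃ i, π ∣ MvPolynomial.X (CoxVar.x i ⟨0, hn i⟩) := by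
    have := prime_dvd_of_forall hπ h
      (f := (∏ l, MvPolynomial.X (CoxVar.t l)) * ∏ l, MvPolynomial.X (CoxVar.x l ⟨0, hn l⟩))
      (fun q hq => by
        simp only [map_mul, map_prod, MvPolynomial.aeval_X, mul_ne_zero_iff,
          Finset.prod_ne_zero_iff] at hq
        refine mem_regLocus_of_headNe (b := fun l => ⟨0, hn l⟩) (o := some hr.some)
          (fun l => hq.2 l (Finset.mem_univ _)) (hq.1 _ (Finset.mem_univ _)) fun j => ?_
        obtain ⟨i, hi⟩ := exists_ne_of_line hdim j
        exact ⟨some i, by simpa using hi, hq.1 _ (Finset.mem_univ _)⟩)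
    refine (hπ.dvd_or_dvd this).imp (fun h => ?_) fun h => ?_
    · exact ((Prime.dvd_finsetProd_iff hπ _).1 h).imp fun l hl => hl.2
    · exact ((Prime.dvd_finsetProd_iff hπ _).1 h).imp fun l hl => hl.2
  have h3 : ∀ j : Lines n, π ∣ MvPolynomial.X CoxVar.e ∨ (∃ i, π ∣ MvPolynomial.X (CoxVar.t i)) ∨
      ∃ i, i ≠ j.1 ∧ π ∣ MvPolynomial.X (CoxVar.x i ⟨0, hn i⟩) := by
    intro j
    have := prime_dvd_of_forall hπ h
      (f := MvPolynomial.X CoxVar.e * (MvPolynomial.X (CoxVar.t j.1) *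
        ∏ l ∈ Finset.univ.erase j.1, MvPolynomial.X (CoxVar.x l ⟨0, hn l⟩)))
      (fun q hq => by
        simp only [map_mul, map_prod, MvPolynomial.aeval_X, mul_ne_zero_iff,
          Finset.prod_ne_zero_iff] at hq
        exact mem_regLocus_of_line (b := fun l => ⟨0, hn l⟩) (o := none) j
          (fun l hl => hq.2.2 l (Finset.mem_erase.2 ⟨hl, Finset.mem_univ _⟩)) hq.2.1
          (by simp) hq.1)
    refine (hπ.dvd_or_dvd this).imp id fun h => ?_
    refine (hπ.dvd_or_dvd h).imp (fun h => ⟨_, h⟩) fun h => ?_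
    exact ((Prime.dvd_finsetProd_iff hπ _).1 h).imp fun l hl =>
      ⟨Finset.ne_of_mem_erase hl.1, hl.2⟩
  rcases h1 fun l => ⟨0, hn l⟩ with he | ⟨i, hi⟩
  · rcases h2 with ⟨i, h4⟩ | ⟨i, h4⟩
    · exact absurd (eq_of_prime_dvd_X hπ he h4) (by simp)
    · exact absurd (eq_of_prime_dvd_X hπ he h4) (by simp)
  -- Now `π` is associated to `x i ⟨0, _⟩`. If `n i = 1`, the monomial in `h3` avoids this variable;
  -- otherwise another variable of the same factor takes its place in `h1`.
  · by_cases h4 : n i = 1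
    · rcases h3 ⟨i, h4⟩ with h5 | ⟨l, h5⟩ | ⟨l, hl, h5⟩
      · exact absurd (eq_of_prime_dvd_X hπ hi h5) (by simp)
      · exact absurd (eq_of_prime_dvd_X hπ hi h5) (by simp)
      · have := eq_of_prime_dvd_X hπ h5 hi
        rw [CoxVar.x.injEq] at this
        exact hl this.1
    · have h5 : 1 < n i := lt_of_le_of_ne (hn i) (Ne.symm h4)
      rcases h1 (Function.update (fun l => ⟨0, hn l⟩) i ⟨1, h5⟩) with h6 | ⟨l, h6⟩
      · exact absurd (eq_of_prime_dvd_X hπ hi h6) (by simp)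
      · have := eq_of_prime_dvd_X hπ hi h6
        rw [CoxVar.x.injEq] at this
        obtain ⟨rfl, h7⟩ := this
        rw [Function.update_self, heq_eq_eq, Fin.ext_iff] at h7
        simp at h7

/-- The Cox presentation of the blowup of the projective bundle. -/
def coxYp [IsAlgClosed K] (k : Type*) [Field k] [Algebra k K] (hn : ∀ i, 1 ≤ n i)
    (hdim : 2 ≤ ∑ i, n i) : CoxPres (wt (n := n)) (Yp k K n) where
  Q := regLocus K (thetaYp k n)
  Θ := thetaYp k n
  δ := degYp
  hom := hom_thetaYp
  isOpen := homOpen_regLocus hom_thetaYp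
  exists_point q hq := by
    have : Infinite K := IsAlgClosed.instInfinite
    obtain ⟨p, hp⟩ := exists_lifts hq
    exact ⟨p, mem_Yp_of_lifts hn hp, hp⟩
  exists_lift p hp := exists_lift_Yp hp
  exists_section x q₀ hq₀ h := by
    rcases regLocus_thetaYp_cases hn hq₀ with ⟨b, hb, o, ho⟩ | ⟨j, -, ht, b, hb, o, hoj, ho⟩
    · exact exists_section_Yp_of_x_ne x hb ho hq₀ h
    · exact exists_section_Yp_of_line x j hb ht hoj ho h
  exists_frame q hq d := exists_frame_Yp hn hq d
  exists_zero π hπ := exists_zero_Yp hn hdim hπ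

end Target

/-! ### The strata in Cox coordinates -/

section Source

variable {k K : Type*} [Field k] [Field K] [Algebra k K] {r : ℕ} {n : Fin r → ℕ}
variable {B : Splitting k n} {v : ∀ i, Fin (n i + 1) → k}

lemma split_basis (hB : ∀ i, B i (v i) = Pi.single none 1) (i : Fin r) :
    split B i (fun a => algebraMap k K (v i a)) = Pi.single none 1 := by
  have := split_unsplit B i (Pi.single none (1 : K))
  rw [unsplit_single hB] at this
  simpa using this

lemma represents_basePt (hv : ∀ i, v i ≠ 0) (i : Fin r) :
    Represents (fun a => algebraMap k K (v i a)) (basePt K v hv i) := represents_mk _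

lemma fst_eq_basePt_iff (hB : ∀ i, B i (v i) = Pi.single none 1) (hv : ∀ i, v i ≠ 0)
    {q : CoxVar n → K} {p : MPt k K (ytSpace n)} (h : Lifts (thetaYt B v) q p) (i : Fin r) :
    fst p i = basePt K v hv i ↔ ∀ b, q CoxVar.e * q (CoxVar.x i b) = 0 := by
  have h1 := (lifts_thetaYt_iff.1 h).1 i
  constructor
  · intro h2 b
    rw [h2] at h1
    obtain ⟨s, _, h3⟩ := (represents_basePt hv i).exists_smul h1
    have h4 := congrArg (split B i) h3
    rw [split_unsplit, split_smul, split_basis hB] at h4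
    have := congrFun h4 (some b)
    simpa [uVec] using this
  · intro h2
    have h3 : uVec q i = Pi.single none (q (CoxVar.t i)) := by
      funext o
      rcases o with _ | b
      · simp [uVec]
      · simpa [uVec] using h2 b
    rw [h3, unsplit_single hB] at h1
    have ht : q (CoxVar.t i) ≠ 0 := fun h0 => h1.ne_zero (by
      funext a
      simp [h0])
    exact h1.unique ((represents_basePt hv i).smul ht)

/-- The base point is given by `e * x i b = 0` for all `i`, `b`, and some `x i b` does not vanish.
-/
lemma mem_Exc_iff [Infinite K] (hB : ∀ i, B i (v i) = Pi.single none 1) (hv : ∀ i, v i ≠ 0)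
    {q : CoxVar n → K} {p : MPt k K (ytSpace n)} (h : Lifts (thetaYt B v) q p) :
    p ∈ Exc K v hv ↔ q CoxVar.e = 0 := by
  obtain ⟨-, i, b, hx⟩ := (mem_regLocus_thetaYt hB).1 h.mem_regLocus
  constructor
  · intro h1
    have := (fst_eq_basePt_iff hB hv h i).1 (congrFun h1.2 i) b
    exact (mul_eq_zero.1 this).resolve_right hx
  · intro h1
    exact ⟨mem_Yt_of_lifts hB h, funext fun i => (fst_eq_basePt_iff hB hv h i).2 fun b => by
      rw [h1, zero_mul]⟩

variable [IsAlgClosed K]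

/-- Off the exceptional divisor `e` is invertible, so `u i` is proportional to `v i` only if `x i =
0`, which is a closed condition. Conversely, changing `e = 0` to `ε` leaves the exceptional divisor
and keeps `x i = 0`. -/
lemma mem_Yti_iff (hB : ∀ i, B i (v i) = Pi.single none 1) (hv : ∀ i, v i ≠ 0)
    (hn : ∀ i, 1 ≤ n i) (hdim : 2 ≤ ∑ i, n i)
    {q : CoxVar n → K} {p : MPt k K (ytSpace n)} (h : Lifts (thetaYt B v) q p) (i : Fin r) :
    p ∈ Yti K v hv i ↔ ∀ b, q (CoxVar.x i b) = 0 := by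
  have : Infinite K := IsAlgClosed.instInfinite
  set C := coxYt (K := K) B v hB hn hdim
  constructor
  · rintro ⟨hp, hp'⟩ b
    have h1 := C.mem_zero_of_mem_closure (x := ⟨p, hp⟩) (hom_X (CoxVar.x i b)) (fun _ hz => hz.1)
      (fun z hz => ?_) hp'
    · by_contra h2
      refine (C.hom_ne_of_lifts (x := ⟨p, hp⟩) (hom_X (k := k) (CoxVar.x i b))
        h.mem_regLocus h).1 ?_ h1
      rwa [MvPolynomial.aeval_X]
    · have hz1 := C.lifts_lift z
      have hz2 := (fst_eq_basePt_iff hB hv hz1 i).1 hz.2.1 b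
      have hz3 : C.lift z CoxVar.e ≠ 0 := fun h0 => hz.2.2 ((mem_Exc_iff hB hv hz1).2 h0).2
      change MvPolynomial.aeval _ _ = _
      rw [MvPolynomial.aeval_X]
      exact (mul_eq_zero.1 hz2).resolve_left hz3
  · intro h1
    refine ⟨mem_Yt_of_lifts hB h, mem_closure_of_deform (hom_thetaYt B v) {CoxVar.e} h
      fun ε hε p' hp' => ⟨mem_Yt_of_lifts hB hp', ?_, fun h2 => ?_⟩⟩
    · refine (fst_eq_basePt_iff hB hv hp' i).2 fun b => ?_
      rw [deform_of_notMem (s := CoxVar.x i b) _ _ (by simp), h1, mul_zero]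
    · exact deform_ne (T := {CoxVar.e}) hε q rfl
        ((mem_Exc_iff hB hv hp').1 ⟨mem_Yt_of_lifts hB hp', h2⟩)

end Source

/-! ### Strata of the blowup of the bundle. -/

section Target

variable {k K : Type*} [Field k] [Field K] [Algebra k K] {r : ℕ} {n : Fin r → ℕ}

lemma sPt_eq_zero_iff {q : CoxVar n → K} {p : MPt k K (ypSpace n)} (h : Lifts (thetaYp k n) q p)
    (a : PlusIdx n) : (sPt p).rep a = 0 ↔ sVal q a = 0 := by
  obtain ⟨s, hs, hs'⟩ := exists_sPt h
  rw [hs']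
  simp [hs]

lemma fst_mem_Sec_iff {q : CoxVar n → K} {p : MPt k K (ypSpace n)} (h : Lifts (thetaYp k n) q p)
    (j : Lines n) (b : Fin (n j.1)) : fst p ∈ Sec k K n j ↔ q (CoxVar.x j.1 b) = 0 := by
  have h1 : fst p ∈ Sec k K n j ↔ ∀ a : PlusIdx n, j.1 ∈ a.supp → sVal q a = 0 := by
    refine Iff.trans (and_iff_right (mem_Yh_of_lifts h)) ?_
    exact forall_congr' fun a => imp_congr_right fun _ => sPt_eq_zero_iff h a
  rw [h1]
  constructor
  · intro h2
    obtain ⟨a, ha, ha'⟩ := (mem_regLocus_thetaYp_iff.1 h.mem_regLocus).2.2 j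
    have := h2 a ha
    rw [sVal_eq_of_line j ha b] at this
    exact (mul_eq_zero.1 this).resolve_right ha'
  · intro h2 a ha
    rw [sVal_eq_of_line j ha b, h2, zero_mul]

lemma mem_ExcP_iff [Infinite K] (hn : ∀ i, 1 ≤ n i) {q : CoxVar n → K} {p : MPt k K (ypSpace n)}
    (h : Lifts (thetaYp k n) q p) (j : Lines n) (b : Fin (n j.1)) :
    p ∈ ExcP k K n j ↔ q (CoxVar.x j.1 b) = 0 :=
  (and_iff_right (mem_Yp_of_lifts hn h)).trans (fst_mem_Sec_iff h j b)

lemma card_supp_iff (a : PlusIdx n) : a.supp.card + 1 = r ↔ a.supp ≠ Finset.univ := by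
  constructor
  · intro h h1
    rw [h1, Finset.card_univ, Fintype.card_fin] at h
    omega
  · intro h
    rcases a.supp_cases with h1 | ⟨i, h1⟩
    · exact absurd h1 h
    · rw [h1, Finset.card_erase_of_mem (Finset.mem_univ i), Finset.card_univ, Fintype.card_fin]
      have := i.2
      omega

lemma fst_mem_PE_iff {q : CoxVar n → K} {p : MPt k K (ypSpace n)} (h : Lifts (thetaYp k n) q p)
    (J : Finset (Fin r)) : fst p ∈ PE k K n J ↔
      ∀ a : PlusIdx n, (J ⊆ a.supp → a.supp = Finset.univ) → sVal q a = 0 := by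
  refine (and_iff_right (mem_Yh_of_lifts h)).trans (forall_congr' fun a => ?_)
  rw [card_supp_iff, not_and, not_not]
  exact imp_congr_right fun _ => sPt_eq_zero_iff h a

/-- At a point outside the exceptional divisors. -/
lemma exists_x_ne (hn : ∀ i, 1 ≤ n i) {q : CoxVar n → K} (hq : q ∈ regLocus K (thetaYp k n))
    (hx : ∀ (j : Lines n) b, q (CoxVar.x j.1 b) ≠ 0) :
    ∃ b : ∀ l, Fin (n l), ∀ l, q (CoxVar.x l (b l)) ≠ 0 := by
  rcases regLocus_thetaYp_cases hn hq with ⟨b, hb, -⟩ | ⟨j, hj, -⟩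
  · exact ⟨b, hb⟩
  · exact absurd (hj ⟨0, hn _⟩) (hx j _)

lemma fst_mem_PE_empty_iff (hn : ∀ i, 1 ≤ n i) {q : CoxVar n → K} {p : MPt k K (ypSpace n)}
    (h : Lifts (thetaYp k n) q p) (hx : ∀ (j : Lines n) b, q (CoxVar.x j.1 b) ≠ 0) :
    fst p ∈ PE k K n ∅ ↔ q CoxVar.e = 0 := by
  rw [fst_mem_PE_iff h]
  obtain ⟨b, hb⟩ := exists_x_ne hn h.mem_regLocus hx
  constructor
  · intro h1
    have := h1 (bIdx b none) fun _ => supp_bIdx_eq_univ_iff.2 rfl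
    rw [sVal_bIdx_none] at this
    exact (mul_eq_zero.1 this).resolve_right (Finset.prod_ne_zero_iff.2 fun l _ => hb l)
  · intro h1 a ha
    rw [sVal, facE, if_pos (ha (Finset.empty_subset _)), h1, zero_mul]

lemma fst_mem_PE_singleton_iff (hn : ∀ i, 1 ≤ n i) {q : CoxVar n → K} {p : MPt k K (ypSpace n)}
    (h : Lifts (thetaYp k n) q p) (hx : ∀ (j : Lines n) b, q (CoxVar.x j.1 b) ≠ 0) (i : Fin r) :
    fst p ∈ PE k K n {i} ↔ q CoxVar.e = 0 ∧ q (CoxVar.t i) = 0 := by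
  rw [fst_mem_PE_iff h]
  obtain ⟨b, hb⟩ := exists_x_ne hn h.mem_regLocus hx
  constructor
  · intro h1
    have h2 := h1 (bIdx b none) fun _ => supp_bIdx_eq_univ_iff.2 rfl
    have h3 := h1 (bIdx b (some i)) fun h => absurd rfl (mem_supp_bIdx.1 (Finset.singleton_subset_iff.1 h))
    rw [sVal_bIdx_none] at h2
    rw [sVal_bIdx_some] at h3
    exact ⟨(mul_eq_zero.1 h2).resolve_right (Finset.prod_ne_zero_iff.2 fun l _ => hb l),
      (mul_eq_zero.1 h3).resolve_right (Finset.prod_ne_zero_iff.2 fun l _ => hb l)⟩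
  · rintro ⟨h1, h2⟩ a ha
    by_cases hi : i ∈ a.supp
    · rw [sVal, facE, if_pos (ha (Finset.singleton_subset_iff.2 hi)), h1, zero_mul]
    · rw [sVal_eq q i, fac_of_eq_none (PlusIdx.notMem_supp.1 hi), h2, zero_mul]

lemma deform_lineVars_ne {q : CoxVar n → K} {ε : K} (hε : ε ≠ 0) (j : Lines n)
    (b : Fin (n j.1)) : deform (lineVars n) ε q (CoxVar.x j.1 b) ≠ 0 :=
  deform_ne hε q ⟨j, b, rfl⟩

variable [IsAlgClosed K]

/-- Off the exceptional divisors every `x l` is nonzero, and ℙ(ℰ̄_∅) is given by `e = 0`. The strict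
transform is compared with this by closedness in one direction and by deforming the `x j` with `n j
= 1` in the other. -/
lemma mem_YpJ_empty_iff (hn : ∀ i, 1 ≤ n i) (hdim : 2 ≤ ∑ i, n i) {q : CoxVar n → K}
    {p : MPt k K (ypSpace n)} (h : Lifts (thetaYp k n) q p) :
    p ∈ YpJ k K n ∅ ↔ q CoxVar.e = 0 := by
  have : Infinite K := IsAlgClosed.instInfinite
  set C := coxYp (K := K) k hn hdim
  constructor
  · rintro ⟨hp, hp'⟩
    have h1 := C.mem_zero_of_mem_closure (x := ⟨p, hp⟩) (hom_X CoxVar.e) (fun _ hz => hz.1)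
      (fun z hz => ?_) hp'
    · by_contra h2
      refine (C.hom_ne_of_lifts (x := ⟨p, hp⟩) (hom_X (k := k) CoxVar.e) h.mem_regLocus h).1 ?_ h1
      rwa [MvPolynomial.aeval_X]
    · have hz1 := C.lifts_lift z
      change MvPolynomial.aeval _ _ = _
      rw [MvPolynomial.aeval_X]
      refine (fst_mem_PE_empty_iff hn hz1 fun j b h0 => hz.2.2 ?_).1 hz.2.1
      exact Set.mem_iUnion.2 ⟨j, (fst_mem_Sec_iff hz1 j b).2 h0⟩
  · intro h1
    refine ⟨mem_Yp_of_lifts hn h, mem_closure_of_deform hom_thetaYp (lineVars n) h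
      fun ε hε p' hp' => ⟨mem_Yp_of_lifts hn hp', ?_, fun h2 => ?_⟩⟩
    · refine (fst_mem_PE_empty_iff hn hp' (deform_lineVars_ne hε)).2 ?_
      rw [deform_of_notMem _ _ (by rintro ⟨j, b, hjb⟩; simp at hjb), h1]
    · obtain ⟨j, hj⟩ := Set.mem_iUnion.1 h2
      exact deform_lineVars_ne hε j ⟨0, hn _⟩ ((fst_mem_Sec_iff hp' j _).1 hj)

lemma mem_YpJ_singleton_iff (hn : ∀ i, 1 ≤ n i) (hdim : 2 ≤ ∑ i, n i) {q : CoxVar n → K}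
    {p : MPt k K (ypSpace n)} (h : Lifts (thetaYp k n) q p) (i : Fin r) :
    p ∈ YpJ k K n {i} ↔ q CoxVar.e = 0 ∧ q (CoxVar.t i) = 0 := by
  have : Infinite K := IsAlgClosed.instInfinite
  set C := coxYp (K := K) k hn hdim
  constructor
  · rintro ⟨hp, hp'⟩
    have key : ∀ s : CoxVar n, (s = CoxVar.e ∨ s = CoxVar.t i) → q s = 0 := by
      intro s hs
      have h1 := C.mem_zero_of_mem_closure (x := ⟨p, hp⟩) (hom_X s) (fun _ hz => hz.1)
        (fun z hz => ?_) hp'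
      · by_contra h2
        refine (C.hom_ne_of_lifts (x := ⟨p, hp⟩) (hom_X (k := k) s) h.mem_regLocus h).1 ?_ h1
        rwa [MvPolynomial.aeval_X]
      · have hz1 := C.lifts_lift z
        change MvPolynomial.aeval _ _ = _
        rw [MvPolynomial.aeval_X]
        have := (fst_mem_PE_singleton_iff hn hz1 (fun j b h0 => hz.2.2
          (Set.mem_iUnion.2 ⟨j, (fst_mem_Sec_iff hz1 j b).2 h0⟩)) i).1 hz.2.1
        rcases hs with rfl | rfl
        · exact this.1
        · exact this.2
    exact ⟨key _ (Or.inl rfl), key _ (Or.inr rfl)⟩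
  · intro h1
    refine ⟨mem_Yp_of_lifts hn h, mem_closure_of_deform hom_thetaYp (lineVars n) h
      fun ε hε p' hp' => ⟨mem_Yp_of_lifts hn hp', ?_, fun h2 => ?_⟩⟩
    · refine (fst_mem_PE_singleton_iff hn hp' (deform_lineVars_ne hε) i).2 ?_
      rw [deform_of_notMem _ _ (by rintro ⟨j, b, hjb⟩; simp at hjb),
        deform_of_notMem _ _ (by rintro ⟨j, b, hjb⟩; simp at hjb)]
      exact h1
    · obtain ⟨j, hj⟩ := Set.mem_iUnion.1 h2
      exact deform_lineVars_ne hε j ⟨0, hn _⟩ ((fst_mem_Sec_iff hp' j _).1 hj)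

end Target

/-! #### The orbits of codimension at most one -/

section Strata

variable {k : Type*} (K : Type*) [Field k] [Field K] [Algebra k K] {r : ℕ} (n : Fin r → ℕ)

/-- The open stratum. -/
def openStratum : Set (CoxVar n → K) :=
  {q | q CoxVar.e ≠ 0 ∧ ∀ i, ∃ b, q (CoxVar.x i b) ≠ 0}

/-- The stratum of codimension one where `e` vanishes. -/
def excStratum : Set (CoxVar n → K) :=
  {q | q CoxVar.e = 0 ∧ (∀ i, q (CoxVar.t i) ≠ 0) ∧ ∀ i, ∃ b, q (CoxVar.x i b) ≠ 0}

/-- The stratum where the coordinate of the factor `j` vanishes. -/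
def lineStratum (j : Fin r) : Set (CoxVar n → K) :=
  {q | (∀ b, q (CoxVar.x j b) = 0) ∧ q CoxVar.e ≠ 0 ∧ q (CoxVar.t j) ≠ 0 ∧
    ∀ l, l ≠ j → ∃ b, q (CoxVar.x l b) ≠ 0}

/-- The union of the strata. -/
def bigStratum : Set (CoxVar n → K) :=
  ({q | q CoxVar.e ≠ 0} ∩ ⋂ i, ⋃ b, {q | q (CoxVar.x i b) ≠ 0}) ∪
    ((⋂ i, {q | q (CoxVar.t i) ≠ 0}) ∩ ⋂ i, ⋃ b, {q | q (CoxVar.x i b) ≠ 0}) ∪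
    ⋃ j : Lines n, ({q | q CoxVar.e ≠ 0} ∩ {q | q (CoxVar.t j.1) ≠ 0}) ∩
      ⋂ l : {l : Fin r // l ≠ j.1}, ⋃ b, {q | q (CoxVar.x l.1 b) ≠ 0}

/-- The definition shows that the union is open: the condition that a coordinate vanishes on a
stratum of codimension one is dropped, which only adds points of the open stratum. -/
lemma bigStratum_eq : bigStratum K n =
    openStratum K n ∪ excStratum K n ∪ ⋃ j : Lines n, lineStratum K n j := by
  ext q
  simp only [bigStratum, openStratum, excStratum, lineStratum, Set.mem_union, Set.mem_inter_iff,
    Set.mem_iInter, Set.mem_iUnion, Set.mem_ofPred_eq, Subtype.forall]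
  constructor
  · rintro ((h | ⟨h, h'⟩) | ⟨j, ⟨h1, h2⟩, h3⟩)
    · exact Or.inl (Or.inl h)
    · by_cases he : q CoxVar.e = 0
      · exact Or.inl (Or.inr ⟨he, h, h'⟩)
      · exact Or.inl (Or.inl ⟨he, h'⟩)
    · by_cases hj : ∀ b, q (CoxVar.x j.1 b) = 0
      · exact Or.inr ⟨j, hj, h1, h2, h3⟩
      · push Not at hj
        refine Or.inl (Or.inl ⟨h1, fun i => ?_⟩)
        by_cases hi : i = j.1
        · rw [hi]
          exact hj
        · exact h3 i hi
  · rintro ((h | ⟨h, h', h''⟩) | ⟨j, h1, h2, h3, h4⟩)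
    · exact Or.inl (Or.inl h)
    · exact Or.inl (Or.inr ⟨h', h''⟩)
    · exact Or.inr ⟨j, ⟨h2, h3⟩, h4⟩

variable (k) in
lemma homOpen_bigStratum : HomOpen k wt (bigStratum K n) := by
  have h : HomOpen k wt (⋂ i, ⋃ b, {q : CoxVar n → K | q (CoxVar.x i b) ≠ 0}) :=
    HomOpen.iInter fun i => HomOpen.iUnion fun b => homOpen_X_ne _
  refine (((homOpen_X_ne _).inter h).union ((HomOpen.iInter fun i => homOpen_X_ne _).inter h)).union
    (HomOpen.iUnion fun j => ((homOpen_X_ne _).inter (homOpen_X_ne _)).inter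
      (HomOpen.iInter fun l => HomOpen.iUnion fun b => homOpen_X_ne _))

lemma tact_eq_zero_iff {u : Option (Fin r) → Kˣ} {q : CoxVar n → K} (s : CoxVar n) :
    tact wt u q s = 0 ↔ q s = 0 := by
  simp [tact]

lemma torusInvariant_openStratum : TorusInvariant wt (openStratum K n) := by
  intro q hq u
  simpa [openStratum, tact_eq_zero_iff] using hq

lemma torusInvariant_excStratum : TorusInvariant wt (excStratum K n) := by
  intro q hq u
  simpa [excStratum, tact_eq_zero_iff] using hq

lemma torusInvariant_lineStratum (j : Fin r) : TorusInvariant wt (lineStratum K n j) := by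
  intro q hq u
  simpa [lineStratum, tact_eq_zero_iff] using hq

variable {K n}

lemma openStratum_subset : openStratum K n ⊆ bigStratum K n := by
  rw [bigStratum_eq]
  exact fun q h => Or.inl (Or.inl h)

lemma excStratum_subset : excStratum K n ⊆ bigStratum K n := by
  rw [bigStratum_eq]
  exact fun q h => Or.inl (Or.inr h)

lemma lineStratum_subset (j : Lines n) : lineStratum K n j ⊆ bigStratum K n := by
  rw [bigStratum_eq]
  exact fun q h => Or.inr (Set.mem_iUnion.2 ⟨j, h⟩)

lemma bigStratum_subset_Yt {B : Splitting k n} {v : ∀ i, Fin (n i + 1) → k}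
    (hB : ∀ i, B i (v i) = Pi.single none 1) (hdim : 2 ≤ ∑ i, n i) :
    bigStratum K n ⊆ regLocus K (thetaYt B v) := by
  have hr : Nonempty (Fin r) := by
    by_contra hr
    rw [not_nonempty_iff] at hr
    simp at hdim
  rw [bigStratum_eq]
  rintro q ((⟨h1, h2⟩ | ⟨h1, h2, h3⟩) | h)
  · exact (mem_regLocus_thetaYt hB).2 ⟨fun i => Or.inr ((h2 i).imp fun b hb => mul_ne_zero h1 hb),
      _, h2 hr.some⟩
  · exact (mem_regLocus_thetaYt hB).2 ⟨fun i => Or.inl (h2 i), _, h3 hr.some⟩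
  · obtain ⟨j, -, h1, h2, h3⟩ := Set.mem_iUnion.1 h
    obtain ⟨i, hi⟩ := exists_ne_of_line hdim j
    refine (mem_regLocus_thetaYt hB).2 ⟨fun l => ?_, _, h3 i hi⟩
    by_cases hl : l = j.1
    · exact Or.inl (hl ▸ h2)
    · exact Or.inr ((h3 l hl).imp fun b hb => mul_ne_zero h1 hb)

lemma bigStratum_subset_Yp (hn : ∀ i, 1 ≤ n i) (hdim : 2 ≤ ∑ i, n i) :
    bigStratum K n ⊆ regLocus K (thetaYp k n) := by
  have hr : Nonempty (Fin r) := by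
    by_contra hr
    rw [not_nonempty_iff] at hr
    simp at hdim
  rw [bigStratum_eq]
  rintro q ((⟨h1, h2⟩ | ⟨h1, h2, h3⟩) | h)
  · choose b hb using h2
    exact mem_regLocus_of_headNe (o := none) hb h1 fun j => ⟨none, by simp, h1⟩
  · choose b hb using h3
    refine mem_regLocus_of_headNe (o := some hr.some) hb (h2 _) fun j => ?_
    obtain ⟨i, hi⟩ := exists_ne_of_line hdim j
    exact ⟨some i, by simpa using hi, h2 i⟩
  · obtain ⟨j, -, h1, h2, h3⟩ := Set.mem_iUnion.1 h
    have : ∀ l, ∃ b, l ≠ j.1 → q (CoxVar.x l b) ≠ 0 := by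
      intro l
      by_cases hl : l = j.1
      · exact ⟨⟨0, hn l⟩, fun h => absurd hl h⟩
      · exact (h3 l hl).imp fun b hb _ => hb
    choose b hb using this
    exact mem_regLocus_of_line j hb h2 (o := none) (by simp) h1

end Strata

/-! ### Strata as images, and codimension two from two vanishing coordinates. -/

section General

variable {k K : Type*} [Field k] [Field K] [Algebra k K] {ι : Type} {m : ι → Type}
variable {τ ρ : Type} [Fintype ρ] {w : τ → ρ → ℤ} {X : Set (MPt k K m)}

namespace CoxPres

lemma eq_img (C : CoxPres w X) {V : Set (τ → K)} (hV : TorusInvariant w V) {O : Set (MPt k K m)}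
    (hOX : O ⊆ X) (hO : ∀ x : X, x.1 ∈ O ↔ C.lift x ∈ V) : O = C.img V := by
  ext p
  constructor
  · intro hp
    exact (mem_img_iff (C := C) (x := ⟨p, hOX hp⟩) hV).2 ((hO ⟨p, hOX hp⟩).1 hp)
  · intro hp
    exact (hO ⟨p, C.img_subset V hp⟩).2 ((mem_img_iff (C := C) hV).1 hp)

lemma img_union (C : CoxPres w X) (V V' : Set (τ → K)) : C.img (V ∪ V') = C.img V ∪ C.img V' := by
  ext p
  simp only [img, Set.mem_union, Set.mem_ofPred_eq, or_and_right, exists_or]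

lemma img_iUnion (C : CoxPres w X) {α : Type*} (V : α → Set (τ → K)) :
    C.img (⋃ a, V a) = ⋃ a, C.img (V a) := by
  ext p
  simp only [img, Set.mem_iUnion, Set.mem_ofPred_eq]
  constructor
  · rintro ⟨q, ⟨a, h⟩, h'⟩
    exact ⟨a, q, h, h'⟩
  · rintro ⟨a, q, h, h'⟩
    exact ⟨q, ⟨a, h⟩, h'⟩

lemma nonempty (C : CoxPres w X) [Nonempty τ] : Nonempty X :=
  ⟨(C.exists_mem_zero (hom_X (Classical.arbitrary τ)) (MvPolynomial.X_prime)).choose⟩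

lemma not_X_dvd_X {s s' : τ} (h : s ≠ s') :
    ¬ (MvPolynomial.X s : MvPolynomial τ k) ∣ MvPolynomial.X s' :=
  fun hd => h (eq_of_prime_dvd_X MvPolynomial.X_prime dvd_rfl hd)

variable [IsAlgClosed K] [Finite τ] [Nonempty τ]

/-- Finitely many coordinate subspaces given by two distinct variables cover the complement, and no
variable divides another. -/
lemma codimComplGeTwo_of_X (C : CoxPres w X) {U : Set (MPt k K m)}
    (hU : ∀ x : X, x.1 ∉ U → ∃ s s', s ≠ s' ∧ C.lift x s = 0 ∧ C.lift x s' = 0) :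
    CodimComplGeTwo X U := by
  have := C.nonempty
  refine C.codimComplGeTwo (α := {ss : τ × τ // ss.1 ≠ ss.2})
    (Z := fun a => MvPolynomial.X a.1.1) (Z' := fun a => MvPolynomial.X a.1.2)
    (fun a => hom_X a.1.1) (fun a => hom_X a.1.2) (fun a => MvPolynomial.X_prime)
    (fun a => not_X_dvd_X a.2) fun x hx => ?_
  obtain ⟨s, s', hne, h, h'⟩ := hU x hx
  refine ⟨⟨(s, s'), hne⟩, ?_, ?_⟩
  · change MvPolynomial.aeval _ _ = _
    rwa [MvPolynomial.aeval_X]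
  · change MvPolynomial.aeval _ _ = _
    rwa [MvPolynomial.aeval_X]

end CoxPres

end General

/-! ### Codimensions of the strata in both quotients. -/

section Strata

variable {k K : Type*} [Field k] [Field K] [Algebra k K] {r : ℕ} {n : Fin r → ℕ}

instance : Nonempty (CoxVar n) := ⟨CoxVar.e⟩

variable [IsAlgClosed K]

section Codim

variable {ι : Type} {m : ι → Type} {X : Set (MPt k K m)} (C : CoxPres (wt (n := n)) X)

lemma hasCodim_openStratum (hn : ∀ i, 1 ≤ n i) : HasCodim X (C.img (openStratum K n)) 0 := by
  have := C.nonempty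
  refine C.hasCodim_zero ((hom_X (k := k) CoxVar.e).mul (Hom.prod Finset.univ fun l _ =>
    hom_X (k := k) (CoxVar.x l ⟨0, hn l⟩))) ?_ fun x hx => ?_
  · exact mul_ne_zero (MvPolynomial.X_ne_zero _)
      (Finset.prod_ne_zero_iff.2 fun l _ => MvPolynomial.X_ne_zero _)
  · rw [CoxPres.mem_img_iff (torusInvariant_openStratum K n)]
    simp only [map_mul, map_prod, MvPolynomial.aeval_X, mul_ne_zero_iff,
      Finset.prod_ne_zero_iff] at hx
    exact ⟨hx.1, fun i => ⟨_, hx.2 i (Finset.mem_univ i)⟩⟩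

lemma hasCodim_excStratum (hn : ∀ i, 1 ≤ n i) : HasCodim X (C.img (excStratum K n)) 1 := by
  refine C.hasCodim_one (hom_X (k := k) CoxVar.e) MvPolynomial.X_prime
    ((Hom.prod Finset.univ fun l _ => hom_X (k := k) (CoxVar.t l)).mul
    (Hom.prod Finset.univ fun l _ => hom_X (k := k) (CoxVar.x l ⟨0, hn l⟩))) (fun hd => ?_)
    (fun x hx => ?_) fun x hx hx' => ?_
  · rcases MvPolynomial.X_prime.dvd_or_dvd hd with h | h
    · obtain ⟨l, -, h⟩ := (Prime.dvd_finsetProd_iff MvPolynomial.X_prime _).1 h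
      exact CoxPres.not_X_dvd_X (by simp) h
    · obtain ⟨l, -, h⟩ := (Prime.dvd_finsetProd_iff MvPolynomial.X_prime _).1 h
      exact CoxPres.not_X_dvd_X (by simp) h
  · rw [CoxPres.mem_img_iff (torusInvariant_excStratum K n)] at hx
    change MvPolynomial.aeval _ _ = _
    rw [MvPolynomial.aeval_X]
    exact hx.1
  · rw [CoxPres.mem_img_iff (torusInvariant_excStratum K n)]
    change MvPolynomial.aeval _ _ = _ at hx
    rw [MvPolynomial.aeval_X] at hx
    simp only [map_mul, map_prod, MvPolynomial.aeval_X, mul_ne_zero_iff,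
      Finset.prod_ne_zero_iff] at hx'
    exact ⟨hx, fun i => hx'.1 i (Finset.mem_univ i), fun i => ⟨_, hx'.2 i (Finset.mem_univ i)⟩⟩

lemma hasCodim_lineStratum (hn : ∀ i, 1 ≤ n i) (j : Lines n) :
    HasCodim X (C.img (lineStratum K n j.1)) 1 := by
  refine C.hasCodim_one (hom_X (k := k) (CoxVar.x j.1 ⟨0, hn j.1⟩)) MvPolynomial.X_prime
    (((hom_X (k := k) CoxVar.e).mul (hom_X (k := k) (CoxVar.t j.1))).mul
    (Hom.prod (Finset.univ.erase j.1) fun l _ => hom_X (k := k) (CoxVar.x l ⟨0, hn l⟩)))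
    (fun hd => ?_) (fun x hx => ?_) fun x hx hx' => ?_
  · rcases MvPolynomial.X_prime.dvd_or_dvd hd with h | h
    · rcases MvPolynomial.X_prime.dvd_or_dvd h with h | h
      · exact CoxPres.not_X_dvd_X (by simp) h
      · exact CoxPres.not_X_dvd_X (by simp) h
    · obtain ⟨l, hl, h⟩ := (Prime.dvd_finsetProd_iff MvPolynomial.X_prime _).1 h
      refine CoxPres.not_X_dvd_X (fun h' => ?_) h
      rw [CoxVar.x.injEq] at h'
      exact Finset.ne_of_mem_erase hl h'.1.symm
  · rw [CoxPres.mem_img_iff (torusInvariant_lineStratum K n _)] at hx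
    change MvPolynomial.aeval _ _ = _
    rw [MvPolynomial.aeval_X]
    exact hx.1 _
  · rw [CoxPres.mem_img_iff (torusInvariant_lineStratum K n _)]
    change MvPolynomial.aeval _ _ = _ at hx
    rw [MvPolynomial.aeval_X] at hx
    simp only [map_mul, map_prod, MvPolynomial.aeval_X, mul_ne_zero_iff,
      Finset.prod_ne_zero_iff] at hx'
    refine ⟨fun b => ?_, hx'.1.1, hx'.1.2, fun l hl =>
      ⟨_, hx'.2 l (Finset.mem_erase.2 ⟨hl, Finset.mem_univ l⟩)⟩⟩
    rw [fin_eq_of_line j.2 b ⟨0, hn j.1⟩]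
    exact hx

end Codim

section Source

variable {B : Splitting k n} {v : ∀ i, Fin (n i + 1) → k}
  (hB : ∀ i, B i (v i) = Pi.single none 1) (hv : ∀ i, v i ≠ 0)
  (hn : ∀ i, 1 ≤ n i) (hdim : 2 ≤ ∑ i, n i)

lemma YtOpen_eq : YtOpen K v hv = (coxYt (K := K) B v hB hn hdim).img (openStratum K n) := by
  have : Infinite K := IsAlgClosed.instInfinite
  refine CoxPres.eq_img _ (torusInvariant_openStratum K n) Set.sdiff_subset fun x => ?_
  have hx := (coxYt (K := K) B v hB hn hdim).lifts_lift x
  rw [YtOpen, Set.mem_sdiff, Set.mem_union, Set.mem_iUnion, not_or, not_exists,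
    mem_Exc_iff hB hv hx, and_iff_right x.2]
  refine and_congr_right fun _ => forall_congr' fun i => ?_
  rw [mem_Yti_iff hB hv hn hdim hx, not_forall]

lemma ExcOpen_eq : ExcOpen K v hv = (coxYt (K := K) B v hB hn hdim).img (excStratum K n) := by
  have : Infinite K := IsAlgClosed.instInfinite
  refine CoxPres.eq_img _ (torusInvariant_excStratum K n) (fun p hp => hp.1.1) fun x => ?_
  have hx := (coxYt (K := K) B v hB hn hdim).lifts_lift x
  have hQ := (mem_regLocus_thetaYt hB).1 hx.mem_regLocus
  rw [ExcOpen, Set.mem_sdiff, Set.mem_iUnion, not_exists, mem_Exc_iff hB hv hx]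
  refine and_congr_right fun he => ?_
  rw [and_iff_right fun i => (hQ.1 i).resolve_right (by rintro ⟨b, hb⟩; exact hb (by rw [he, zero_mul]))]
  refine forall_congr' fun i => ?_
  rw [mem_Yti_iff hB hv hn hdim hx, not_forall]

lemma YtiOpen_eq (j : Lines n) : YtiOpen K v hv j.1 =
    (coxYt (K := K) B v hB hn hdim).img (lineStratum K n j.1) := by
  have : Infinite K := IsAlgClosed.instInfinite
  refine CoxPres.eq_img _ (torusInvariant_lineStratum K n _) (fun p hp => hp.1.1) fun x => ?_
  have hx := (coxYt (K := K) B v hB hn hdim).lifts_lift x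
  have hQ := (mem_regLocus_thetaYt hB).1 hx.mem_regLocus
  rw [YtiOpen, Set.mem_sdiff, Set.mem_union, not_or, mem_Exc_iff hB hv hx,
    mem_Yti_iff hB hv hn hdim hx]
  refine and_congr_right fun hj => and_congr_right fun _ => ?_
  rw [and_iff_right ((hQ.1 j.1).resolve_right
    (by rintro ⟨b, hb⟩; exact hb (by rw [hj, mul_zero])))]
  simp only [Set.mem_iUnion, not_exists, Set.mem_ofPred_eq]
  refine forall_congr' fun l => forall_congr' fun _ => ?_
  rw [mem_Yti_iff hB hv hn hdim hx, not_forall]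

/-- If `e = 0`, regularity makes all `t i` nonzero, so outside the strata some whole `x i` vanishes
too. If `e ≠ 0`, some whole `x i` vanishes, which is at least two coordinates for `n i ≥ 2`. For `n
i = 1` regularity gives `t i ≠ 0`, so a second `x l` must vanish. -/
lemma codimComplGeTwo_Yt :
    CodimComplGeTwo (Yt K v) ((coxYt (K := K) B v hB hn hdim).img (bigStratum K n)) := by
  refine CoxPres.codimComplGeTwo_of_X (coxYt (K := K) B v hB hn hdim) fun x hx => ?_
  rw [CoxPres.mem_img_iff (homOpen_bigStratum k K n).torusInvariant, bigStratum_eq] at hx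
  obtain ⟨h1, h2⟩ := (mem_regLocus_thetaYt hB).1
    ((coxYt (K := K) B v hB hn hdim).lifts_lift x).mem_regLocus
  set q := (coxYt (K := K) B v hB hn hdim).lift x
  simp only [Set.mem_union, Set.mem_iUnion, not_or, not_exists] at hx
  obtain ⟨⟨h3, h4⟩, h5⟩ := hx
  by_cases he : q CoxVar.e = 0
  · by_contra! h
    refine h4 ⟨he, fun i => (h1 i).resolve_right (by simp [he]), fun i => ?_⟩
    exact ⟨⟨0, hn i⟩, h CoxVar.e _ (by simp) he⟩
  · have : ∃ i, ∀ b, q (CoxVar.x i b) = 0 := by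
      by_contra! h
      exact h3 ⟨he, h⟩
    obtain ⟨i, hi⟩ := this
    by_cases hi1 : n i = 1
    · have : ∃ l, l ≠ i ∧ ∀ b, q (CoxVar.x l b) = 0 := by
        by_contra! h
        exact h5 ⟨i, hi1⟩ ⟨hi, he, (h1 i).resolve_right (by simp [hi]), h⟩
      obtain ⟨l, hl, hl'⟩ := this
      refine ⟨CoxVar.x i ⟨0, hn i⟩, CoxVar.x l ⟨0, hn l⟩, fun h => ?_, hi _, hl' _⟩
      rw [CoxVar.x.injEq] at h
      exact hl h.1.symm
    · refine ⟨CoxVar.x i ⟨0, hn i⟩, CoxVar.x i ⟨1, lt_of_le_of_ne (hn i) (Ne.symm hi1)⟩,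
        fun h => ?_, hi _, hi _⟩
      rw [CoxVar.x.injEq, heq_eq_eq, Fin.ext_iff] at h
      simp at h

end Source

section Target

variable (k) (hn : ∀ i, 1 ≤ n i) (hdim : 2 ≤ ∑ i, n i)

lemma YpOpen_eq : YpOpen k K n = (coxYp (K := K) k hn hdim).img (openStratum K n) := by
  have : Infinite K := IsAlgClosed.instInfinite
  refine CoxPres.eq_img _ (torusInvariant_openStratum K n) Set.sdiff_subset fun x => ?_
  have hx := (coxYp (K := K) k hn hdim).lifts_lift x
  rw [YpOpen, Set.mem_sdiff, Set.mem_union, Set.mem_iUnion, not_or, not_exists,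
    mem_YpJ_empty_iff hn hdim hx, and_iff_right x.2]
  refine and_congr_right fun _ => ⟨fun h => ?_, fun h j => ?_⟩
  · obtain ⟨b, hb⟩ := exists_x_ne hn hx.mem_regLocus fun j b h0 =>
      h j ((mem_ExcP_iff hn hx j b).2 h0)
    exact fun i => ⟨b i, hb i⟩
  · obtain ⟨b, hb⟩ := h j.1
    rwa [mem_ExcP_iff hn hx j b]

lemma YpEmptyOpen_eq : YpEmptyOpen k K n = (coxYp (K := K) k hn hdim).img (excStratum K n) := by
  have : Infinite K := IsAlgClosed.instInfinite
  refine CoxPres.eq_img _ (torusInvariant_excStratum K n) (fun p hp => hp.1.1) fun x => ?_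
  have hx := (coxYp (K := K) k hn hdim).lifts_lift x
  rw [YpEmptyOpen, Set.mem_sdiff, Set.mem_union, Set.mem_iUnion, Set.mem_iUnion, not_or, not_exists,
    not_exists, mem_YpJ_empty_iff hn hdim hx]
  refine and_congr_right fun he => and_congr (forall_congr' fun i => ?_) ⟨fun h => ?_, fun h j => ?_⟩
  · rw [mem_YpJ_singleton_iff hn hdim hx, not_and]
    exact ⟨fun h => h he, fun h _ => h⟩
  · obtain ⟨b, hb⟩ := exists_x_ne hn hx.mem_regLocus fun j b h0 =>
      h j ((mem_ExcP_iff hn hx j b).2 h0)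
    exact fun i => ⟨b i, hb i⟩
  · obtain ⟨b, hb⟩ := h j.1
    rwa [mem_ExcP_iff hn hx j b]

lemma ExcPOpen_eq (j : Lines n) :
    ExcPOpen k K n j = (coxYp (K := K) k hn hdim).img (lineStratum K n j.1) := by
  have : Infinite K := IsAlgClosed.instInfinite
  refine CoxPres.eq_img _ (torusInvariant_lineStratum K n _) (fun p hp => hp.1.1) fun x => ?_
  have hx := (coxYp (K := K) k hn hdim).lifts_lift x
  rw [ExcPOpen, Set.mem_sdiff, mem_YpJ_empty_iff hn hdim hx, mem_ExcP_iff hn hx j ⟨0, hn _⟩]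
  constructor
  · rintro ⟨h1, h2⟩
    rcases regLocus_thetaYp_cases hn hx.mem_regLocus with ⟨b, hb, -⟩ | ⟨j', h3, ht, b, hb, -⟩
    · have := hb j.1
      rw [fin_eq_of_line j.2 (b j.1) ⟨0, hn _⟩] at this
      exact absurd h1 this
    · have hj : j' = j := by
        by_contra hne
        have := hb j.1 fun h => hne (Subtype.ext h.symm)
        rw [fin_eq_of_line j.2 (b j.1) ⟨0, hn _⟩] at this
        exact this h1
      subst hj
      exact ⟨h3, h2, ht, fun l hl => ⟨_, hb l hl⟩⟩
  · rintro ⟨h1, h2, -⟩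
    exact ⟨h1 _, h2⟩

/-- Outside the strata `e = 0` always; in addition some `t i` vanishes, or some `x j` with `n j =
1`, according to the kind of the regular point. -/
lemma codimComplGeTwo_Yp :
    CodimComplGeTwo (Yp k K n) ((coxYp (K := K) k hn hdim).img (bigStratum K n)) := by
  refine CoxPres.codimComplGeTwo_of_X (coxYp (K := K) k hn hdim) fun x hx => ?_
  rw [CoxPres.mem_img_iff (homOpen_bigStratum k K n).torusInvariant, bigStratum_eq] at hx
  have hQ := ((coxYp (K := K) k hn hdim).lifts_lift x).mem_regLocus
  set q := (coxYp (K := K) k hn hdim).lift x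
  simp only [Set.mem_union, Set.mem_iUnion, not_or, not_exists] at hx
  obtain ⟨⟨h3, h4⟩, h5⟩ := hx
  rcases regLocus_thetaYp_cases hn hQ with ⟨b, hb, -⟩ | ⟨j, hj, ht, b, hb, -⟩
  · have he : q CoxVar.e = 0 := by
      by_contra he
      exact h3 ⟨he, fun i => ⟨_, hb i⟩⟩
    by_contra! h
    exact h4 ⟨he, fun i => h CoxVar.e _ (by simp) he, fun i => ⟨_, hb i⟩⟩
  · have he : q CoxVar.e = 0 := by
      by_contra he
      exact h5 j ⟨hj, he, ht, fun l hl => ⟨_, hb l hl⟩⟩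
    exact ⟨CoxVar.e, CoxVar.x j.1 ⟨0, hn _⟩, by simp, he, hj _⟩

end Target

end Strata

/-! ## The group action in Cox coordinates -/

/-! ### Polynomial functions, determined where a coordinate does not vanish. -/

section PolyFun

variable {k K : Type*} [Field k] [Field K] [Algebra k K] {τ σ : Type}

/-- A polynomial function on the affine space. -/
def IsPolyFun (f : (τ → K) → K) : Prop :=
  ∃ F : MvPolynomial τ K, ∀ q, f q = MvPolynomial.eval q F

lemma isPolyFun_coord (s : τ) : IsPolyFun fun q : τ → K => q s :=
  ⟨MvPolynomial.X s, fun q => by simp⟩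

lemma isPolyFun_const (c : K) : IsPolyFun fun _ : τ → K => c :=
  ⟨MvPolynomial.C c, fun q => by simp⟩

lemma IsPolyFun.add {f g : (τ → K) → K} (hf : IsPolyFun f) (hg : IsPolyFun g) :
    IsPolyFun fun q => f q + g q := by
  obtain ⟨F, hF⟩ := hf
  obtain ⟨G, hG⟩ := hg
  exact ⟨F + G, fun q => by rw [map_add, ← hF, ← hG]⟩

lemma IsPolyFun.sub {f g : (τ → K) → K} (hf : IsPolyFun f) (hg : IsPolyFun g) :
    IsPolyFun fun q => f q - g q := by
  obtain ⟨F, hF⟩ := hf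
  obtain ⟨G, hG⟩ := hg
  exact ⟨F - G, fun q => by rw [map_sub, ← hF, ← hG]⟩

lemma IsPolyFun.mul {f g : (τ → K) → K} (hf : IsPolyFun f) (hg : IsPolyFun g) :
    IsPolyFun fun q => f q * g q := by
  obtain ⟨F, hF⟩ := hf
  obtain ⟨G, hG⟩ := hg
  exact ⟨F * G, fun q => by rw [map_mul, ← hF, ← hG]⟩

lemma IsPolyFun.sum {α : Type*} (t : Finset α) {f : α → (τ → K) → K}
    (hf : ∀ a, IsPolyFun (f a)) : IsPolyFun fun q => ∑ a ∈ t, f a q := by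
  choose F hF using hf
  exact ⟨∑ a ∈ t, F a, fun q => by rw [map_sum]; exact Finset.sum_congr rfl fun a _ => hF a q⟩

lemma isPolyFun_aeval (F : MvPolynomial τ k) :
    IsPolyFun fun q : τ → K => MvPolynomial.aeval q F :=
  ⟨MvPolynomial.map (algebraMap k K) F, fun q => by
    rw [MvPolynomial.eval_map]; exact MvPolynomial.aeval_def ..⟩

lemma IsPolyFun.comp {f : (τ → K) → K} (hf : IsPolyFun f) {g : (σ → K) → τ → K}
    (hg : ∀ s, IsPolyFun fun q => g q s) : IsPolyFun fun q => f (g q) := by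
  obtain ⟨F, hF⟩ := hf
  choose G hG using hg
  refine ⟨MvPolynomial.bind₁ G F, fun q => ?_⟩
  refine (hF (g q)).trans ?_
  rw [← MvPolynomial.coe_aeval_eq_eval, ← MvPolynomial.coe_aeval_eq_eval, RingHom.coe_coe,
    RingHom.coe_coe, MvPolynomial.aeval_bind₁]
  congr 1
  congr 1
  funext s
  refine (hG s q).trans ?_
  rw [← MvPolynomial.coe_aeval_eq_eval, RingHom.coe_coe]

/-- Two polynomial functions that agree where a coordinate does not vanish are equal. -/
lemma IsPolyFun.eq_of_ne [Infinite K] {f g : (τ → K) → K} (hf : IsPolyFun f)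
    (hg : IsPolyFun g) (s : τ) (h : ∀ q, q s ≠ 0 → f q = g q) (q : τ → K) : f q = g q := by
  obtain ⟨F, hF⟩ := hf.sub hg
  have h0 : MvPolynomial.X s * F = 0 := by
    refine MvPolynomial.funext fun q => ?_
    rw [map_mul, MvPolynomial.eval_X, map_zero, ← hF]
    by_cases hs : q s = 0
    · rw [hs, zero_mul]
    · dsimp only
      rw [h q hs, sub_self, mul_zero]
  have h1 : F = 0 := (mul_eq_zero.1 h0).resolve_left (MvPolynomial.X_ne_zero s)
  have h2 := hF q
  rw [h1, map_zero] at h2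
  exact sub_eq_zero.1 h2

end PolyFun

/-! ### Linear maps acting on projective spaces. -/

section PMap

variable {K : Type*} [Field K] {c : Type}

lemma represents_pmap {A : (c → K) →ₗ[K] (c → K)} {w : c → K} {p : Projectivization K (c → K)}
    (h : Represents w p) (hA : A w ≠ 0) : Represents (A w) (pmap A p) := by
  obtain ⟨t, ht, rfl⟩ := h
  rw [map_smul] at hA ⊢
  have h1 : A p.rep ≠ 0 := fun h0 => hA (by rw [h0, smul_zero])
  rw [pmap, dif_pos h1]
  exact (represents_mk h1).smul ht

lemma represents_smul [Fintype c] [DecidableEq c] {w : c → K} {p : Projectivization K (c → K)}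
    (h : Represents w p) (g : PGL(c, K)) : Represents ((lift g).mulVec w) (g • p) := by
  have hg : Matrix.ProjGenLinGroup.mk
      (Function.surjInv Matrix.ProjGenLinGroup.mk_surjective g : GL c K) = g :=
    Function.surjInv_eq _ g
  obtain ⟨hw, rfl⟩ := represents_iff.1 h
  conv => arg 2; rw [← hg]
  rw [Projectivization.PGL.mk_smul_mk]
  exact represents_mk _

lemma isUnit_lift [Fintype c] [DecidableEq c] (g : PGL(c, K)) : IsUnit (lift g) :=
  Units.isUnit _

lemma exists_lift_mk [Fintype c] [DecidableEq c] (g : GL c K) :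
    ∃ s : K, s ≠ 0 ∧ lift (Matrix.ProjGenLinGroup.mk g) = s • (g : Matrix c c K) := by
  have hg : Matrix.ProjGenLinGroup.mk (Function.surjInv Matrix.ProjGenLinGroup.mk_surjective
      (Matrix.ProjGenLinGroup.mk g) : GL c K) = Matrix.ProjGenLinGroup.mk g :=
    Function.surjInv_eq _ _
  obtain ⟨u, hu⟩ := Matrix.ProjGenLinGroup.mk_eq_mk_iff.1 hg.symm
  refine ⟨u, u.ne_zero, ?_⟩
  rw [lift, ← hu, Units.val_mul, Matrix.GeneralLinearGroup.coe_scalar, Matrix.scalar_apply,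
    ← Matrix.smul_one_eq_diagonal, mul_smul_comm, mul_one]

/-- The linear group acts transitively on nonzero vectors. -/
lemma exists_mulVec_eq [Fintype c] [DecidableEq c] {x y : c → K} (hx : x ≠ 0) (hy : y ≠ 0) :
    ∃ A : Matrix c c K, IsUnit A ∧ A.mulVec x = y := by
  -- The special linear group is transitive on lines; the remaining scalar `u` is absorbed into the
  -- matrix.
  have := MulAction.isPretransitive_of_is_two_pretransitive
    (G := Matrix.SpecialLinearGroup c K) (α := Projectivization K (c → K))
  obtain ⟨A, hA⟩ := MulAction.exists_smul_eq (Matrix.SpecialLinearGroup c K)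
    (Projectivization.mk K x hx) (Projectivization.mk K y hy)
  rw [Projectivization.smul_mk, Projectivization.mk_eq_mk_iff] at hA
  obtain ⟨u, hu⟩ := hA
  refine ⟨(u⁻¹ : Kˣ) • A.1, ?_, ?_⟩
  · rw [Matrix.isUnit_iff_isUnit_det, Units.smul_def, Matrix.det_smul, A.2, mul_one]
    exact (u⁻¹).isUnit.pow _
  · rw [Matrix.smul_mulVec]
    have : A.1.mulVec x = u • y := hu.symm
    rw [this, inv_smul_smul]

end PMap

/-! ### Adapted matrices acting on Cox coordinates. -/

section CoxAct

variable {k K : Type*} [Field k] [Field K] [Algebra k K] {r : ℕ} {n : Fin r → ℕ}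

/-- The action of matrices on Cox coordinates. -/
def coxAct (M : ∀ i, Matrix (Option (Fin (n i))) (Option (Fin (n i))) K) (q : CoxVar n → K) :
    CoxVar n → K
  | CoxVar.e => q CoxVar.e
  | CoxVar.t i => M i none none * q (CoxVar.t i) +
      q CoxVar.e * ∑ b, M i none (some b) * q (CoxVar.x i b)
  | CoxVar.x i b => ∑ b', M i (some b) (some b') * q (CoxVar.x i b')

/-- Invertible matrices that preserve the line spanned by the first basis vector. -/
def IsAdapted (M : ∀ i, Matrix (Option (Fin (n i))) (Option (Fin (n i))) K) : Prop :=
  ∀ i, IsUnit (M i) ∧ ∀ b, M i (some b) none = 0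

variable {M N : ∀ i, Matrix (Option (Fin (n i))) (Option (Fin (n i))) K}

lemma IsAdapted.inv_mul (hM : IsAdapted M) (i : Fin r) : (M i)⁻¹ * M i = 1 :=
  Matrix.nonsing_inv_mul _ ((Matrix.isUnit_iff_isUnit_det _).1 (hM i).1)

lemma IsAdapted.inv_mul_none (hM : IsAdapted M) (i : Fin r) :
    (M i)⁻¹ none none * M i none none = 1 := by
  have := congrFun (congrFun (hM.inv_mul i) none) none
  rw [Matrix.mul_apply, Fintype.sum_option] at this
  simpa [(hM i).2] using this

lemma IsAdapted.none_ne (hM : IsAdapted M) (i : Fin r) : M i none none ≠ 0 :=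
  right_ne_zero_of_mul_eq_one (hM.inv_mul_none i)

lemma IsAdapted.inv (hM : IsAdapted M) : IsAdapted fun i => (M i)⁻¹ := by
  intro i
  refine ⟨(Matrix.isUnit_nonsing_inv_iff).2 (hM i).1, fun b => ?_⟩
  have := congrFun (congrFun (hM.inv_mul i) (some b)) none
  rw [Matrix.mul_apply, Fintype.sum_option] at this
  simpa [(hM i).2, hM.none_ne i] using this

lemma IsAdapted.inv_mul_some (hM : IsAdapted M) (i : Fin r) (b b' : Fin (n i)) :
    ∑ c, (M i)⁻¹ (some b) (some c) * M i (some c) (some b') = if b = b' then 1 else 0 := by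
  have := congrFun (congrFun (hM.inv_mul i) (some b)) (some b')
  rw [Matrix.mul_apply, Fintype.sum_option] at this
  simpa [(hM.inv i).2, Matrix.one_apply] using this

/-- This explains the formula for `coxAct`: as `M i` preserves the line of `v i`, the coordinates of
`u i` in V̄ i remain divisible by `e`, and `e` itself can be kept fixed. -/
lemma uVec_coxAct (hM : IsAdapted M) (q : CoxVar n → K) (i : Fin r) :
    uVec (coxAct M q) i = (M i).mulVec (uVec q i) := by
  funext o
  rw [Matrix.mulVec, dotProduct, Fintype.sum_option]
  rcases o with _ | b
  · simp only [uVec, Option.elim_none, Option.elim_some, coxAct, Finset.mul_sum]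
    congr 1
    exact Finset.sum_congr rfl fun b _ => by ring
  · simp only [uVec, Option.elim_none, Option.elim_some, coxAct, Finset.mul_sum, (hM i).2, zero_mul,
      zero_add]
    exact Finset.sum_congr rfl fun b _ => by ring

lemma coxAct_x_inv (hM : IsAdapted M) (q : CoxVar n → K) (i : Fin r) (b : Fin (n i)) :
    ∑ c, (M i)⁻¹ (some b) (some c) * coxAct M q (CoxVar.x i c) = q (CoxVar.x i b) := by
  simp only [coxAct, Finset.mul_sum]
  rw [Finset.sum_comm]
  simp only [← mul_assoc, ← Finset.sum_mul, hM.inv_mul_some]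
  simp

lemma coxAct_inv_coxAct (hM : IsAdapted M) (q : CoxVar n → K) :
    coxAct (fun i => (M i)⁻¹) (coxAct M q) = q := by
  funext s
  rcases s with _ | i | ⟨i, b⟩
  · rfl
  · have h := congrFun (congrArg (fun A => A.mulVec (uVec q i)) (hM.inv_mul i)) none
    rw [Matrix.one_mulVec, ← Matrix.mulVec_mulVec, ← uVec_coxAct hM,
      ← congrFun (uVec_coxAct hM.inv _ i) none] at h
    exact h
  · exact coxAct_x_inv hM q i b

lemma coxAct_x_eq_zero_iff (hM : IsAdapted M) (q : CoxVar n → K) (i : Fin r) :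
    (∀ b, coxAct M q (CoxVar.x i b) = 0) ↔ ∀ b, q (CoxVar.x i b) = 0 := by
  constructor
  · intro h b
    rw [← coxAct_x_inv hM q i b]
    exact Finset.sum_eq_zero fun c _ => by rw [h, mul_zero]
  · intro h b
    exact Finset.sum_eq_zero fun c _ => by rw [h, mul_zero]

lemma coxAct_x_ne_iff (hM : IsAdapted M) (q : CoxVar n → K) (i : Fin r) :
    (∃ b, coxAct M q (CoxVar.x i b) ≠ 0) ↔ ∃ b, q (CoxVar.x i b) ≠ 0 := by
  have := coxAct_x_eq_zero_iff hM q i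
  rw [← not_iff_not]
  push Not
  exact this

lemma isPolyFun_coxAct (M : ∀ i, Matrix (Option (Fin (n i))) (Option (Fin (n i))) K)
    (s : CoxVar n) : IsPolyFun fun q => coxAct M q s := by
  rcases s with _ | i | ⟨i, b⟩
  · exact isPolyFun_coord _
  · exact ((isPolyFun_const _).mul (isPolyFun_coord _)).add ((isPolyFun_coord _).mul
      (IsPolyFun.sum _ fun b => (isPolyFun_const _).mul (isPolyFun_coord _)))
  · exact IsPolyFun.sum _ fun b => (isPolyFun_const _).mul (isPolyFun_coord _)

/-! #### Invariance of the strata -/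

lemma coxAct_mem_openStratum (hM : IsAdapted M) {q : CoxVar n → K} (hq : q ∈ openStratum K n) :
    coxAct M q ∈ openStratum K n :=
  ⟨hq.1, fun i => (coxAct_x_ne_iff hM q i).2 (hq.2 i)⟩

lemma coxAct_mem_excStratum (hM : IsAdapted M) {q : CoxVar n → K} (hq : q ∈ excStratum K n) :
    coxAct M q ∈ excStratum K n := by
  refine ⟨hq.1, fun i => ?_, fun i => (coxAct_x_ne_iff hM q i).2 (hq.2.2 i)⟩
  change M i none none * q (CoxVar.t i) + q CoxVar.e * _ ≠ 0
  rw [hq.1, zero_mul, add_zero]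
  exact mul_ne_zero (hM.none_ne i) (hq.2.1 i)

lemma coxAct_mem_lineStratum (hM : IsAdapted M) {j : Fin r} {q : CoxVar n → K}
    (hq : q ∈ lineStratum K n j) : coxAct M q ∈ lineStratum K n j := by
  refine ⟨(coxAct_x_eq_zero_iff hM q j).2 hq.1, hq.2.1, ?_,
    fun l hl => (coxAct_x_ne_iff hM q l).2 (hq.2.2.2 l hl)⟩
  change M j none none * q (CoxVar.t j) + q CoxVar.e * _ ≠ 0
  rw [Finset.sum_eq_zero fun b _ => by rw [hq.1, mul_zero], mul_zero, add_zero]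
  exact mul_ne_zero (hM.none_ne j) hq.2.2.1

lemma coxAct_mem_bigStratum (hM : IsAdapted M) {q : CoxVar n → K} (hq : q ∈ bigStratum K n) :
    coxAct M q ∈ bigStratum K n := by
  rw [bigStratum_eq] at hq ⊢
  rcases hq with (h | h) | h
  · exact Or.inl (Or.inl (coxAct_mem_openStratum hM h))
  · exact Or.inl (Or.inr (coxAct_mem_excStratum hM h))
  · obtain ⟨j, hj⟩ := Set.mem_iUnion.1 h
    exact Or.inr (Set.mem_iUnion.2 ⟨j, coxAct_mem_lineStratum hM hj⟩)

/-! #### Transitivity on the strata -/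

/-- The matrix with the given first row and complementary block. -/
def adaptedOf {m : ℕ} (α : K) (ρ : Fin m → K) (A : Matrix (Fin m) (Fin m) K) :
    Matrix (Option (Fin m)) (Option (Fin m)) K :=
  Matrix.of fun o o' => o.elim (o'.elim α ρ) fun b => o'.elim 0 (A b)

lemma isUnit_adaptedOf {m : ℕ} {α : K} (hα : α ≠ 0) (ρ : Fin m → K)
    {A : Matrix (Fin m) (Fin m) K} (hA : IsUnit A) : IsUnit (adaptedOf α ρ A) := by
  refine Matrix.mulVec_injective_iff_isUnit.1 ?_
  rw [← Matrix.coe_mulVecLin, ← LinearMap.ker_eq_bot, LinearMap.ker_eq_bot']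
  intro f hf
  have h1 : A.mulVec (fun b => f (some b)) = 0 := by
    funext b
    have := congrFun hf (some b)
    rw [Matrix.mulVecLin_apply, Matrix.mulVec, dotProduct, Fintype.sum_option] at this
    simpa [adaptedOf, Matrix.mulVec, dotProduct] using this
  have h2 : (fun b => f (some b)) = 0 :=
    Matrix.mulVec_injective_iff_isUnit.2 hA (h1.trans (Matrix.mulVec_zero A).symm)
  have h3 : ∀ b, f (some b) = 0 := fun b => congrFun h2 b
  funext o
  rcases o with _ | b
  · have := congrFun hf none
    rw [Matrix.mulVecLin_apply, Matrix.mulVec, dotProduct, Fintype.sum_option] at this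
    simpa [adaptedOf, h3, hα] using this
  · exact h3 b

/-- The orbits in the Cox coordinates of one factor. -/
def SameType {m : ℕ} (e : K) (t t' : K) (x x' : Fin m → K) : Prop :=
  ((x ≠ 0 ∧ x' ≠ 0) ∧ (e ≠ 0 ∨ t ≠ 0 ∧ t' ≠ 0)) ∨ (x = 0 ∧ x' = 0 ∧ t ≠ 0 ∧ t' ≠ 0)

lemma exists_adaptedOf {m : ℕ} {e t t' : K} {x x' : Fin m → K} (h : SameType e t t' x x') :
    ∃ (α : K) (ρ : Fin m → K) (A : Matrix (Fin m) (Fin m) K), α ≠ 0 ∧ IsUnit A ∧ α * t + e * ∑ b, ρ b * x b = t' ∧ A.mulVec x = x' := by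
  rcases h with ⟨⟨hx, hx'⟩, he | ⟨ht, ht'⟩⟩ | ⟨rfl, rfl, ht, ht'⟩
  · obtain ⟨A, hA, hAx⟩ := exists_mulVec_eq hx hx'
    obtain ⟨b, hb⟩ := Function.ne_iff.1 hx
    have hb : x b ≠ 0 := hb
    -- With a first row supported at one `b` with `x b ≠ 0`, the entry solves `t + e * ρ b * x b =
    -- t'`.
    refine ⟨1, Pi.single b ((t' - t) / (e * x b)), A, one_ne_zero, hA, ?_, hAx⟩
    rw [Finset.sum_eq_single b (fun b' _ hb' => by rw [Pi.single_eq_of_ne hb', zero_mul])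
      (by simp), Pi.single_eq_same]
    field_simp
    ring
  · obtain ⟨A, hA, hAx⟩ := exists_mulVec_eq hx hx'
    refine ⟨t' / t, 0, A, div_ne_zero ht' ht, hA, ?_, hAx⟩
    simp [div_mul_cancel₀ _ ht]
  · refine ⟨t' / t, 0, 1, div_ne_zero ht' ht, isUnit_one, ?_, by simp⟩
    simp [div_mul_cancel₀ _ ht]

lemma exists_coxAct_eq {q q' : CoxVar n → K} (he : q' CoxVar.e = q CoxVar.e)
    (h : ∀ i, SameType (q CoxVar.e) (q (CoxVar.t i)) (q' (CoxVar.t i))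
      (fun b => q (CoxVar.x i b)) (fun b => q' (CoxVar.x i b))) :
    ∃ M, IsAdapted M ∧ coxAct M q = q' := by
  choose α ρ A hα hA h1 h2 using fun i => exists_adaptedOf (h i)
  refine ⟨fun i => adaptedOf (α i) (ρ i) (A i), fun i =>
    ⟨isUnit_adaptedOf (hα i) (ρ i) (hA i), fun b => rfl⟩, ?_⟩
  funext s
  rcases s with _ | i | ⟨i, b⟩
  · exact he.symm
  · exact h1 i
  · exact congrFun (h2 i) b

/-- A point with the same coordinate `e` in the torus orbit. -/
lemma exists_tact_e {q q' : CoxVar n → K} (h : q CoxVar.e ≠ 0) (h' : q' CoxVar.e ≠ 0) :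
    ∃ u : Option (Fin r) → Kˣ, tact wt u q' CoxVar.e = q CoxVar.e := by
  refine ⟨torusPt (Units.mk0 _ (div_ne_zero h h')) 1, ?_⟩
  rw [tact_e]
  exact div_mul_cancel₀ _ h'

/-- Up to the torus, the matrices act transitively. -/
def TransitiveOn (V : Set (CoxVar n → K)) : Prop :=
  ∀ q ∈ V, ∀ q' ∈ V, ∃ (M : ∀ i, Matrix (Option (Fin (n i))) (Option (Fin (n i))) K)
    (u : Option (Fin r) → Kˣ), IsAdapted M ∧ coxAct M q = tact wt u q'

lemma x_vec_ne {q : CoxVar n → K} {i : Fin r} (h : ∃ b, q (CoxVar.x i b) ≠ 0) :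
    (fun b => q (CoxVar.x i b)) ≠ 0 := Function.ne_iff.2 h

lemma transitiveOn_openStratum : TransitiveOn (openStratum K n) := by
  intro q hq q' hq'
  obtain ⟨u, hu⟩ := exists_tact_e hq.1 hq'.1
  have h := torusInvariant_openStratum K n q' hq' u
  obtain ⟨M, hM, h1⟩ := exists_coxAct_eq hu fun i =>
    Or.inl ⟨⟨x_vec_ne (hq.2 i), x_vec_ne (h.2 i)⟩, Or.inl hq.1⟩
  exact ⟨M, u, hM, h1⟩

lemma transitiveOn_excStratum : TransitiveOn (excStratum K n) := by
  intro q hq q' hq'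
  obtain ⟨M, hM, h1⟩ := exists_coxAct_eq (hq'.1.trans hq.1.symm) fun i =>
    Or.inl ⟨⟨x_vec_ne (hq.2.2 i), x_vec_ne (hq'.2.2 i)⟩, Or.inr ⟨hq.2.1 i, hq'.2.1 i⟩⟩
  exact ⟨M, 1, hM, by rw [tact_one, h1]⟩

lemma transitiveOn_lineStratum (j : Fin r) : TransitiveOn (lineStratum K n j) := by
  intro q hq q' hq'
  obtain ⟨u, hu⟩ := exists_tact_e hq.2.1 hq'.2.1
  have h := torusInvariant_lineStratum K n j q' hq' u
  obtain ⟨M, hM, h1⟩ := exists_coxAct_eq hu fun i => by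
    by_cases hi : i = j
    · subst hi
      exact Or.inr ⟨funext hq.1, funext h.1, hq.2.2.1, h.2.2.1⟩
    · exact Or.inl ⟨⟨x_vec_ne (hq.2.2.2 i hi), x_vec_ne (h.2.2.2 i hi)⟩, Or.inl hq.2.1⟩
  exact ⟨M, u, hM, h1⟩

/-- Scaling the matrices amounts to the action of the torus. -/
lemma coxAct_smul (c : Fin r → Kˣ) (q : CoxVar n → K) :
    coxAct (fun i => (c i : K) • M i) q = tact wt (torusPt 1 c) (coxAct M q) := by
  refine eq_tact ?_ (fun i => ?_) fun i b => ?_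
  · simp [coxAct, torusPt]
  · simp only [coxAct, torusPt, Option.elim_some, Option.elim_none, Units.val_one, mul_one,
      Matrix.smul_apply, smul_eq_mul, mul_add, Finset.mul_sum]
    congr 1
    · ring
    · exact Finset.sum_congr rfl fun b _ => by ring
  · simp only [coxAct, torusPt, Option.elim_some, Matrix.smul_apply, smul_eq_mul, Finset.mul_sum]
    exact Finset.sum_congr rfl fun b _ => by ring

end CoxAct

/-! ### Compatibility of the action with both presentations. -/

section Equivariance

variable {k K : Type*} [Field k] [Field K] [Algebra k K] {r : ℕ} {n : Fin r → ℕ}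
variable {B : Splitting k n} {v : ∀ i, Fin (n i + 1) → k}

lemma unsplit_eq_mulVec (i : Fin r) (f : Option (Fin (n i)) → K) :
    unsplit B i f = (splitInv K B i).mulVec f := rfl

lemma splitMat_mul_splitInv (i : Fin r) : splitMat K B i * splitInv K B i = 1 := by
  have := dirMat_mul_invMat B i
  rw [splitMat, splitInv, ← Matrix.map_mul]
  exact (congrArg (fun A => A.map (algebraMap k K)) this).trans (Matrix.map_one _ (map_zero _) (map_one _))

lemma splitInv_mul_splitMat (i : Fin r) : splitInv K B i * splitMat K B i = 1 := by
  have := invMat_mul_dirMat B i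
  rw [splitMat, splitInv, ← Matrix.map_mul]
  exact (congrArg (fun A => A.map (algebraMap k K)) this).trans (Matrix.map_one _ (map_zero _) (map_one _))

lemma lift_mulVec_unsplit (g : ∀ i, PGL(Fin (n i + 1), K)) (i : Fin r)
    (f : Option (Fin (n i)) → K) :
    (lift (g i)).mulVec (unsplit B i f) = unsplit B i ((adapted B g i).mulVec f) := by
  rw [unsplit_eq_mulVec, unsplit_eq_mulVec, Matrix.mulVec_mulVec, Matrix.mulVec_mulVec, adapted,
    ← Matrix.mul_assoc, ← Matrix.mul_assoc, splitInv_mul_splitMat, Matrix.one_mul]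

lemma isAdapted_adapted (hB : ∀ i, B i (v i) = Pi.single none 1) {hv : ∀ i, v i ≠ 0}
    {g : ∀ i, PGL(Fin (n i + 1), K)} (hg : g ∈ G K v hv) : IsAdapted (adapted B g) := by
  refine fun i => ⟨?_, fun b => ?_⟩
  · obtain ⟨u, hu⟩ := isUnit_lift (g i)
    refine (Matrix.isUnit_iff_isUnit_det _).2 <| Matrix.isUnit_det_of_left_inverse
      (B := splitMat K B i * (u⁻¹ : (Matrix _ _ K)ˣ).1 * splitInv K B i) ?_
    rw [adapted, ← hu]
    calc splitMat K B i * (u⁻¹ : (Matrix _ _ K)ˣ).1 * splitInv K B i *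
          (splitMat K B i * u.1 * splitInv K B i) =
        splitMat K B i * ((u⁻¹ : (Matrix _ _ K)ˣ).1 * (splitInv K B i * splitMat K B i) * u.1) *
          splitInv K B i := by simp only [Matrix.mul_assoc]
      _ = 1 := by rw [splitInv_mul_splitMat, Matrix.mul_one, Units.inv_mul, Matrix.mul_one,
        splitMat_mul_splitInv]
  · have h1 : g i • basePt K v hv i = basePt K v hv i := hg i (Set.mem_univ i)
    have h2 := represents_smul (represents_basePt (K := K) hv i) (g i)
    rw [h1] at h2
    obtain ⟨s, -, hs⟩ := (represents_basePt hv i).exists_smul h2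
    have h3 := unsplit_single (K := K) hB i 1
    simp only [one_mul] at h3
    rw [← h3, lift_mulVec_unsplit] at hs
    have h4 := congrArg (split B i) hs
    rw [split_unsplit, split_smul, split_unsplit] at h4
    simpa using congrFun h4 (some b)

/-- Every family of adapted matrices comes from the group, up to scalars. -/
lemma exists_mem_G (hB : ∀ i, B i (v i) = Pi.single none 1) (hv : ∀ i, v i ≠ 0)
    {M : ∀ i, Matrix (Option (Fin (n i))) (Option (Fin (n i))) K} (hM : IsAdapted M) :
    ∃ g ∈ G K v hv, ∃ c : Fin r → Kˣ, adapted B g = fun i => (c i : K) • M i := by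
  have h1 : ∀ i, ∃ g : GL (Fin (n i + 1)) K, g.1 = splitInv K B i * M i * splitMat K B i := by
    intro i
    obtain ⟨u, hu⟩ := (hM i).1
    have : IsUnit (splitInv K B i * M i * splitMat K B i) := by
      refine (Matrix.isUnit_iff_isUnit_det _).2 <| Matrix.isUnit_det_of_left_inverse
        (B := splitInv K B i * (u⁻¹ : (Matrix _ _ K)ˣ).1 * splitMat K B i) ?_
      rw [← hu]
      calc splitInv K B i * (u⁻¹ : (Matrix _ _ K)ˣ).1 * splitMat K B i *
            (splitInv K B i * u.1 * splitMat K B i) =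
          splitInv K B i * ((u⁻¹ : (Matrix _ _ K)ˣ).1 * (splitMat K B i * splitInv K B i) * u.1) *
            splitMat K B i := by simp only [Matrix.mul_assoc]
        _ = 1 := by rw [splitMat_mul_splitInv, Matrix.mul_one, Units.inv_mul, Matrix.mul_one,
          splitInv_mul_splitMat]
    exact ⟨this.unit, rfl⟩
  choose g hg using h1
  choose s hs hs' using fun i => exists_lift_mk (g i)
  have h2 : adapted B (fun i => Matrix.ProjGenLinGroup.mk (g i)) =
      fun i => (Units.mk0 (s i) (hs i) : K) • M i := by
    funext i
    rw [adapted, hs', hg, Units.val_mk0]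
    calc splitMat K B i * s i • (splitInv K B i * M i * splitMat K B i) * splitInv K B i =
        s i • ((splitMat K B i * splitInv K B i) * M i * (splitMat K B i * splitInv K B i)) := by
          simp only [Matrix.mul_smul, Matrix.smul_mul, Matrix.mul_assoc]
      _ = s i • M i := by rw [splitMat_mul_splitInv, Matrix.one_mul, Matrix.mul_one]
  refine ⟨_, ?_, _, h2⟩
  intro i _
  refine Represents.unique (w := (lift (Matrix.ProjGenLinGroup.mk (g i))).mulVec
    (fun a => algebraMap k K (v i a))) (represents_smul (represents_basePt hv i) _) ?_
  have h3 := unsplit_single (K := K) hB i 1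
  simp only [one_mul] at h3
  rw [← h3, lift_mulVec_unsplit (fun i => Matrix.ProjGenLinGroup.mk (g i)) i, h2]
  have h4 : ((Units.mk0 (s i) (hs i) : K) • M i).mulVec (Pi.single none 1) =
      (s i * M i none none) • Pi.single none 1 := by
    funext o
    rw [Matrix.mulVec_single_one]
    rcases o with _ | b
    · simp
    · simp [(hM i).2]
  rw [h4, unsplit_smul, h3]
  exact (represents_basePt hv i).smul (mul_ne_zero (hs i) (hM.none_ne i))

/-! #### The blowup of the product of projective spaces -/

lemma isPolyFun_wedgeVal (ab : TensIdx n × TensIdx n) :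
    IsPolyFun fun q : CoxVar n → K => wedgeVal B v q ab := by
  have := isPolyFun_aeval (K := K) (thetaYt B v (Sum.inr ()) ab)
  simpa only [aeval_thetaYt_inr] using this

lemma sum_mul_vTens (hB : ∀ i, B i (v i) = Pi.single none 1)
    {M : ∀ i, Matrix (Option (Fin (n i))) (Option (Fin (n i))) K} (hM : IsAdapted M)
    {L : ∀ i, Matrix (Fin (n i + 1)) (Fin (n i + 1)) K}
    (hL : ∀ i f, (L i).mulVec (unsplit B i f) = unsplit B i ((M i).mulVec f)) (a : TensIdx n) :
    ∑ c : TensIdx n, (∏ i, L i (a i) (c i)) * vTens v c = (∏ i, M i none none) * vTens v a := by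
  refine (sum_tensor_prod (fun i => L i) (fun i b => algebraMap k K (v i b)) a).trans ?_
  rw [vTens, ← Finset.prod_mul_distrib]
  refine Finset.prod_congr rfl fun i _ => ?_
  have h3 := unsplit_single (K := K) hB i 1
  simp only [one_mul] at h3
  have h4 : (M i).mulVec (Pi.single none 1) = Pi.single none (M i none none) := by
    funext o
    rw [Matrix.mulVec_single_one]
    rcases o with _ | b
    · simp
    · simp [(hM i).2]
  have h5 := hL i (Pi.single none 1)
  rw [h3, h4, unsplit_single hB] at h5
  exact congrFun h5 (a i)

lemma sum_mul_prod_unsplit {M : ∀ i, Matrix (Option (Fin (n i))) (Option (Fin (n i))) K}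
    (hM : IsAdapted M) {L : ∀ i, Matrix (Fin (n i + 1)) (Fin (n i + 1)) K}
    (hL : ∀ i f, (L i).mulVec (unsplit B i f) = unsplit B i ((M i).mulVec f))
    (q : CoxVar n → K) (a : TensIdx n) :
    ∑ c : TensIdx n, (∏ i, L i (a i) (c i)) * ∏ i, unsplit B i (uVec q i) (c i) =
      ∏ i, unsplit B i (uVec (coxAct M q) i) (a i) := by
  rw [sum_tensor_prod (fun i => L i) (fun i => unsplit B i (uVec q i)) a]
  refine Finset.prod_congr rfl fun i _ => ?_
  rw [uVec_coxAct hM, ← hL]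
  rfl

lemma sum_mul_sub_mul {α : Type*} [Fintype α] (f g : α → K) (x y : α → K) :
    ∑ cd : α × α, (f cd.1 * g cd.2) * (x cd.2 * y cd.1 - x cd.1 * y cd.2) =
      (∑ d, g d * x d) * (∑ c, f c * y c) - (∑ c, f c * x c) * ∑ d, g d * y d := by
  rw [mul_comm (∑ d, g d * x d), Finset.sum_mul_sum, Finset.sum_mul_sum, ← Finset.sum_sub_distrib,
    Fintype.sum_prod_type]
  refine Finset.sum_congr rfl fun c _ => ?_
  rw [← Finset.sum_sub_distrib]
  refine Finset.sum_congr rfl fun d _ => ?_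
  ring

/-- Both sides are polynomial in `q`, so it suffices to treat `e ≠ 0`. There `e` times the wedge is
formed from ⊗ u i and ⊗ v i, which transform factor by factor. -/
lemma sum_mul_wedgeVal [Infinite K] (hB : ∀ i, B i (v i) = Pi.single none 1)
    {M : ∀ i, Matrix (Option (Fin (n i))) (Option (Fin (n i))) K} (hM : IsAdapted M)
    {L : ∀ i, Matrix (Fin (n i + 1)) (Fin (n i + 1)) K}
    (hL : ∀ i f, (L i).mulVec (unsplit B i f) = unsplit B i ((M i).mulVec f))
    (q : CoxVar n → K) (ab : TensIdx n × TensIdx n) :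
    ∑ cd : TensIdx n × TensIdx n, ((∏ i, L i (ab.1 i) (cd.1 i)) * ∏ i, L i (ab.2 i) (cd.2 i)) *
      wedgeVal B v q cd = (∏ i, M i none none) * wedgeVal B v (coxAct M q) ab := by
  have h1 : IsPolyFun fun q : CoxVar n → K => ∑ cd : TensIdx n × TensIdx n,
      ((∏ i, L i (ab.1 i) (cd.1 i)) * ∏ i, L i (ab.2 i) (cd.2 i)) * wedgeVal B v q cd :=
    IsPolyFun.sum _ fun cd => (isPolyFun_const _).mul (isPolyFun_wedgeVal cd)
  have h2 : IsPolyFun fun q : CoxVar n → K =>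
      (∏ i, M i none none) * wedgeVal B v (coxAct M q) ab :=
    (isPolyFun_const _).mul ((isPolyFun_wedgeVal ab).comp (isPolyFun_coxAct M))
  refine h1.eq_of_ne h2 CoxVar.e (fun q he => mul_left_cancel₀ he ?_) q
  have hE : q CoxVar.e * wedgeVal B v (coxAct M q) ab =
      vTens v ab.2 * (∏ i, unsplit B i (uVec (coxAct M q) i) (ab.1 i)) -
        vTens v ab.1 * ∏ i, unsplit B i (uVec (coxAct M q) i) (ab.2 i) :=
    mul_wedgeVal hB (coxAct M q) ab
  have hS := sum_mul_sub_mul (fun c : TensIdx n => ∏ i, L i (ab.1 i) (c i))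
    (fun d : TensIdx n => ∏ i, L i (ab.2 i) (d i)) (vTens v)
    (fun a => ∏ i, unsplit B i (uVec q i) (a i))
  rw [sum_mul_vTens hB hM hL, sum_mul_vTens hB hM hL, sum_mul_prod_unsplit hM hL,
    sum_mul_prod_unsplit hM hL] at hS
  rw [mul_left_comm, hE, mul_sub, ← mul_assoc, ← mul_assoc, ← hS, Finset.mul_sum]
  refine Finset.sum_congr rfl fun cd _ => ?_
  rw [mul_left_comm, mul_wedgeVal hB]

lemma coxAct_mem_regLocus_Yt (hB : ∀ i, B i (v i) = Pi.single none 1)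
    {M : ∀ i, Matrix (Option (Fin (n i))) (Option (Fin (n i))) K} (hM : IsAdapted M)
    {q : CoxVar n → K} (hq : q ∈ regLocus K (thetaYt B v)) :
    coxAct M q ∈ regLocus K (thetaYt B v) := by
  have h1 := (mem_regLocus_thetaYt_iff.1 hq).1
  rw [mem_regLocus_thetaYt hB] at hq ⊢
  refine ⟨fun i => ?_, ?_⟩
  · rw [← uVec_ne_zero_iff, uVec_coxAct hM]
    intro h
    exact h1 i (Matrix.mulVec_injective_iff_isUnit.2 (hM i).1 (h.trans (Matrix.mulVec_zero _).symm))
  · obtain ⟨i, h⟩ := hq.2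
    exact ⟨i, (coxAct_x_ne_iff hM q i).2 h⟩

lemma lifts_actYt [Infinite K] (hB : ∀ i, B i (v i) = Pi.single none 1) {hv : ∀ i, v i ≠ 0}
    {g : ∀ i, PGL(Fin (n i + 1), K)} (hg : g ∈ G K v hv) {q : CoxVar n → K}
    {p : MPt k K (ytSpace n)} (h : Lifts (thetaYt B v) q p) :
    Lifts (thetaYt B v) (coxAct (adapted B g) q) (actYt g p) := by
  have hM := isAdapted_adapted hB hg
  have hq := mem_regLocus_thetaYt_iff.1 (coxAct_mem_regLocus_Yt hB hM h.mem_regLocus)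
  obtain ⟨h1, h2⟩ := lifts_thetaYt_iff.1 h
  refine lifts_thetaYt_iff.2 ⟨fun i => ?_, ?_⟩
  · have := represents_smul (h1 i) (g i)
    rw [lift_mulVec_unsplit, ← uVec_coxAct hM] at this
    exact this
  · have hc : (∏ i, adapted B g i none none) ≠ 0 :=
      Finset.prod_ne_zero_iff.2 fun i _ => hM.none_ne i
    have key : Matrix.mulVecLin (Matrix.of fun a b : TensIdx n × TensIdx n =>
        (∏ i, lift (g i) (a.1 i) (b.1 i)) * ∏ i, lift (g i) (a.2 i) (b.2 i)) (wedgeVal B v q) =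
        (∏ i, adapted B g i none none) • wedgeVal B v (coxAct (adapted B g) q) := by
      funext ab
      exact sum_mul_wedgeVal hB hM (L := fun i => lift (g i)) (fun i f => lift_mulVec_unsplit g i f)
        q ab
    have := represents_pmap h2 (by rw [key]; exact smul_ne_zero hc hq.2)
    rw [key] at this
    have h3 := this.smul (inv_ne_zero hc)
    rw [inv_smul_smul₀ hc] at h3
    exact h3

/-! #### The blowup of the projective bundle -/

lemma isPolyFun_sVal (a : PlusIdx n) : IsPolyFun fun q : CoxVar n → K => sVal q a := by
  simpa only [aeval_sVal] using isPolyFun_aeval (K := K) (sVal (genericPt K n) a)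

lemma isPolyFun_zVal (j : Fin r) (a : PlusIdx n) :
    IsPolyFun fun q : CoxVar n → K => zVal q j a := by
  simpa only [aeval_zVal] using isPolyFun_aeval (K := K) (zVal (genericPt K n) j a)

lemma prod_uVec (q : CoxVar n → K) (a : PlusIdx n) :
    ∏ i, uVec q i (a.1 i) = q CoxVar.e ^ a.supp.card * ∏ i, fac q a i := by
  have h : ∀ i, uVec q i (a.1 i) = (if i ∈ a.supp then q CoxVar.e else 1) * fac q a i := by
    intro i
    by_cases hi : i ∈ a.supp
    · obtain ⟨b, hb⟩ := PlusIdx.mem_supp.1 hi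
      rw [if_pos hi, fac_of_eq_some hb, hb]
      rfl
    · have hb := PlusIdx.notMem_supp.1 hi
      rw [if_neg hi, fac_of_eq_none hb, hb, one_mul]
      rfl
  simp only [h]
  rw [Finset.prod_mul_distrib, Finset.prod_ite_mem, Finset.univ_inter, Finset.prod_const]

/-- The component of ⊗ u i in V̄_I carries the power `|I|` of `e`, whereas `sVal` carries only `e`
or no `e`. The relation transfers the action on ⊗ u i to `sVal`. -/
lemma pow_mul_sVal (q : CoxVar n → K) (a : PlusIdx n) :
    q CoxVar.e ^ r * sVal q a = q CoxVar.e * ∏ i, uVec q i (a.1 i) := by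
  rw [prod_uVec, sVal, facE]
  split_ifs with h
  · rw [h, Finset.card_univ, Fintype.card_fin]
    ring
  · have := (card_supp_iff a).2 h
    have hp : q CoxVar.e ^ r = q CoxVar.e ^ a.supp.card * q CoxVar.e := by rw [← pow_succ, this]
    rw [hp]
    ring

lemma isSome_of_prod_ne {M : ∀ i, Matrix (Option (Fin (n i))) (Option (Fin (n i))) K}
    (hM : IsAdapted M) {a b : ∀ i, Option (Fin (n i))} (h : (∏ i, M i (a i) (b i)) ≠ 0) (i : Fin r)
    (hi : (a i).isSome) : (b i).isSome := by
  rw [Option.isSome_iff_ne_none]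
  intro hb
  obtain ⟨c, hc⟩ := Option.isSome_iff_exists.1 hi
  have := Finset.prod_ne_zero_iff.1 h i (Finset.mem_univ i)
  rw [hb, hc, (hM i).2] at this
  exact this rfl

/-- An adapted matrix has a nonzero entry between `a` and `b` only if the support of `a` is
contained in that of `b`. This is the invariance of the sum of the V̄_I with |I| ≤ r - 2, so
truncated sums lose nothing. -/
lemma sum_plusIdx {M : ∀ i, Matrix (Option (Fin (n i))) (Option (Fin (n i))) K}
    (hM : IsAdapted M) (a : PlusIdx n) (f : (∀ i, Option (Fin (n i))) → K) :
    ∑ b : PlusIdx n, (∏ i, M i (a.1 i) (b.1 i)) * f b.1 =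
      ∑ b : ∀ i, Option (Fin (n i)), (∏ i, M i (a.1 i) (b i)) * f b := by
  rw [← Finset.sum_filter_of_ne (p := fun b : ∀ i, Option (Fin (n i)) =>
    r ≤ (Finset.univ.filter fun i => (b i).isSome).card + 1)]
  · exact (Finset.sum_subtype _ (fun b => by rw [Finset.mem_filter, and_iff_right (Finset.mem_univ _)])
      fun b => (∏ i, M i (a.1 i) (b i)) * f b).symm
  · intro b _ hb
    refine a.2.trans (Nat.add_le_add_right (Finset.card_le_card fun i hi => ?_) 1)
    rw [Finset.mem_filter] at hi ⊢
    exact ⟨hi.1, isSome_of_prod_ne hM (left_ne_zero_of_mul hb) i hi.2⟩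

lemma sum_plusIdx_mem {M : ∀ i, Matrix (Option (Fin (n i))) (Option (Fin (n i))) K}
    (hM : IsAdapted M) {a : PlusIdx n} {j : Fin r} (ha : j ∈ a.supp) (f : PlusIdx n → K) :
    ∑ b : {b : PlusIdx n // j ∈ b.supp}, (∏ i, M i (a.1 i) (b.1.1 i)) * f b.1 =
      ∑ b : PlusIdx n, (∏ i, M i (a.1 i) (b.1 i)) * f b := by
  rw [← Finset.sum_filter_of_ne (p := fun b : PlusIdx n => j ∈ b.supp)]
  · exact (Finset.sum_subtype _ (fun b => by rw [Finset.mem_filter, and_iff_right (Finset.mem_univ _)])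
      fun b : PlusIdx n => (∏ i, M i (a.1 i) (b.1 i)) * f b).symm
  · intro b _ hb
    have h1 : (a.1 j).isSome := (Finset.mem_filter.1 ha).2
    exact Finset.mem_filter.2 ⟨Finset.mem_univ j,
      isSome_of_prod_ne hM (left_ne_zero_of_mul hb) j h1⟩

lemma sum_mul_sVal [Infinite K] {M : ∀ i, Matrix (Option (Fin (n i))) (Option (Fin (n i))) K}
    (hM : IsAdapted M) (q : CoxVar n → K) (a : PlusIdx n) :
    ∑ b : PlusIdx n, (∏ i, M i (a.1 i) (b.1 i)) * sVal q b = sVal (coxAct M q) a := by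
  refine IsPolyFun.eq_of_ne (IsPolyFun.sum _ fun b => (isPolyFun_const _).mul (isPolyFun_sVal b))
    ((isPolyFun_sVal a).comp (isPolyFun_coxAct M)) CoxVar.e (fun q he => ?_) q
  refine mul_left_cancel₀ (pow_ne_zero r he) ?_
  have h1 : q CoxVar.e ^ r * sVal (coxAct M q) a =
      q CoxVar.e * ∏ i, uVec (coxAct M q) i (a.1 i) := pow_mul_sVal (coxAct M q) a
  rw [h1, Finset.mul_sum]
  simp only [mul_left_comm (q CoxVar.e ^ r), pow_mul_sVal]
  simp only [mul_left_comm _ (q CoxVar.e)]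
  rw [← Finset.mul_sum, sum_plusIdx hM a fun b => ∏ i, uVec q i (b i),
    sum_tensor_prod (fun i => M i) (fun i => uVec q i) a.1]
  congr 1
  refine Finset.prod_congr rfl fun i _ => ?_
  rw [uVec_coxAct hM]
  rfl

/-- Where `x j ≠ 0` the identity is `sum_mul_sVal` divided by `x j`, which is scaled by the diagonal
entry of the matrix; polynomiality gives the rest. -/
lemma sum_mul_zVal [Infinite K] {M : ∀ i, Matrix (Option (Fin (n i))) (Option (Fin (n i))) K}
    (hM : IsAdapted M) (q : CoxVar n → K) (j : Lines n) (b₀ : Fin (n j.1))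
    {a : PlusIdx n} (ha : j.1 ∈ a.supp) :
    ∑ b : {b : PlusIdx n // j.1 ∈ b.supp}, (∏ i, M i (a.1 i) (b.1.1 i)) * zVal q j.1 b.1 =
      M j.1 (some b₀) (some b₀) * zVal (coxAct M q) j.1 a := by
  have hp : IsPolyFun fun q : CoxVar n → K => ∑ b : {b : PlusIdx n // j.1 ∈ b.supp},
      (∏ i, M i (a.1 i) (b.1.1 i)) * zVal q j.1 b.1 :=
    IsPolyFun.sum _ fun b => (isPolyFun_const _).mul (isPolyFun_zVal j.1 b.1)
  have hp' : IsPolyFun fun q : CoxVar n → K =>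
      M j.1 (some b₀) (some b₀) * zVal (coxAct M q) j.1 a :=
    (isPolyFun_const _).mul ((isPolyFun_zVal j.1 a).comp (isPolyFun_coxAct M))
  refine hp.eq_of_ne hp' (CoxVar.x j.1 b₀) (fun q hx => mul_left_cancel₀ hx ?_) q
  have h1 : coxAct M q (CoxVar.x j.1 b₀) =
      M j.1 (some b₀) (some b₀) * q (CoxVar.x j.1 b₀) := by
    refine Finset.sum_eq_single b₀ (fun b _ hb => absurd (fin_eq_of_line j.2 b b₀) hb) (by simp)
  calc q (CoxVar.x j.1 b₀) * ∑ b : {b : PlusIdx n // j.1 ∈ b.supp},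
        (∏ i, M i (a.1 i) (b.1.1 i)) * zVal q j.1 b.1 =
      ∑ b : {b : PlusIdx n // j.1 ∈ b.supp}, (∏ i, M i (a.1 i) (b.1.1 i)) * sVal q b.1 := by
        rw [Finset.mul_sum]
        refine Finset.sum_congr rfl fun b _ => ?_
        rw [sVal_eq_of_line j b.2 b₀]
        ring
    _ = sVal (coxAct M q) a := by
        rw [sum_plusIdx_mem hM ha fun b => sVal q b, sum_mul_sVal hM]
    _ = _ := by
        rw [sVal_eq_of_line j ha b₀, h1]
        ring

lemma some_some_ne {M : ∀ i, Matrix (Option (Fin (n i))) (Option (Fin (n i))) K}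
    (hM : IsAdapted M) {i : Fin r} (hi : n i = 1) (b : Fin (n i)) : M i (some b) (some b) ≠ 0 := by
  have := hM.inv_mul_some i b b
  rw [if_pos rfl, Finset.sum_eq_single b (fun c _ hc => absurd (fin_eq_of_line hi c b) hc)
    (by simp)] at this
  exact right_ne_zero_of_mul_eq_one this

lemma mulVec_yVal {M : ∀ i, Matrix (Option (Fin (n i))) (Option (Fin (n i))) K}
    (hM : IsAdapted M) (hn : ∀ i, 1 ≤ n i) (q : CoxVar n → K) (i : Fin r) :
    ∃ s : K, s ≠ 0 ∧
      ((M i).submatrix some some).mulVec (yVal q i) = s • yVal (coxAct M q) i := by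
  by_cases hi : n i = 1
  · refine ⟨_, some_some_ne hM hi ⟨0, hn i⟩, funext fun b => ?_⟩
    rw [Matrix.mulVec, dotProduct, Finset.sum_eq_single ⟨0, hn i⟩
      (fun c _ hc => absurd (fin_eq_of_line hi c _) hc) (by simp),
      fin_eq_of_line hi b ⟨0, hn i⟩]
    simp [yVal, hi]
  · refine ⟨1, one_ne_zero, funext fun b => ?_⟩
    rw [Matrix.mulVec, dotProduct, one_smul]
    simp [yVal, hi, coxAct]

/-- If a vector of coordinates vanished at `coxAct M q`, applying the inverse matrices would make it
vanish at `q`. -/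
lemma coxAct_mem_regLocus_Yp [Infinite K] {M : ∀ i, Matrix (Option (Fin (n i))) (Option (Fin (n i))) K}
    (hM : IsAdapted M) (hn : ∀ i, 1 ≤ n i) {q : CoxVar n → K}
    (hq : q ∈ regLocus K (thetaYp k n)) : coxAct M q ∈ regLocus K (thetaYp k n) := by
  rw [mem_regLocus_thetaYp_iff] at hq ⊢
  obtain ⟨h1, ⟨a, ha⟩, h3⟩ := hq
  have hN := hM.inv
  refine ⟨fun i => ?_, ?_, fun j => ?_⟩
  · by_contra! h
    obtain ⟨s, hs, h4⟩ := mulVec_yVal hN hn (coxAct M q) i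
    rw [coxAct_inv_coxAct hM, funext h] at h4
    obtain ⟨b, hb⟩ := h1 i
    have h5 := congrFun h4 b
    rw [show (fun _ => 0 : Fin (n i) → K) = 0 from rfl, Matrix.mulVec_zero] at h5
    exact mul_ne_zero hs hb h5.symm
  · by_contra! h
    refine ha ?_
    rw [← coxAct_inv_coxAct hM q, ← sum_mul_sVal hN]
    exact Finset.sum_eq_zero fun b _ => by rw [h, mul_zero]
  · by_contra! h
    obtain ⟨a, ha, ha'⟩ := h3 j
    have h4 := sum_mul_zVal hN (coxAct M q) j ⟨0, hn _⟩ ha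
    rw [coxAct_inv_coxAct hM, Finset.sum_eq_zero fun b _ => by rw [h b.1 b.2, mul_zero]] at h4
    exact mul_ne_zero (some_some_ne hN j.2 _) ha' h4.symm

lemma lifts_actYp [Infinite K] (hn : ∀ i, 1 ≤ n i) {g : ∀ i, PGL(Fin (n i + 1), K)}
    (hM : IsAdapted (adapted B g)) {q : CoxVar n → K}
    {p : MPt k K (ypSpace n)} (h : Lifts (thetaYp k n) q p) :
    Lifts (thetaYp k n) (coxAct (adapted B g) q) (actYp B g p) := by
  obtain ⟨hq1, ⟨a₀, hq2⟩, hq3⟩ := mem_regLocus_thetaYp_iff.1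
    (coxAct_mem_regLocus_Yp hM hn h.mem_regLocus)
  obtain ⟨h1, h2, h3⟩ := lifts_thetaYp_iff.1 h
  have main : ∀ {c : Type} {A : (c → K) →ₗ[K] (c → K)} {w w' : c → K}
      {p : Projectivization K (c → K)} {s : K}, Represents w p → s ≠ 0 → w' ≠ 0 → A w = s • w' →
      Represents w' (pmap A p) := by
    intro c A w w' p s hw hs hw' hA
    have := (represents_pmap hw (A := A) (by rw [hA]; exact smul_ne_zero hs hw')).smul
      (inv_ne_zero hs)
    rwa [hA, inv_smul_smul₀ hs] at this
  refine lifts_thetaYp_iff.2 ⟨fun i => ?_, ?_, fun j => ?_⟩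
  · obtain ⟨s, hs, h4⟩ := mulVec_yVal hM hn q i
    exact main (h1 i) hs (Function.ne_iff.2 (hq1 i)) h4
  · refine main h2 one_ne_zero (Function.ne_iff.2 ⟨a₀, hq2⟩) (funext fun a => ?_)
    rw [one_smul]
    exact sum_mul_sVal hM q a
  · obtain ⟨a, ha, ha'⟩ := hq3 j
    exact main (h3 j) (some_some_ne hM j.2 ⟨0, hn _⟩) (Function.ne_iff.2 ⟨⟨a, ha⟩, ha'⟩)
      (funext fun a => sum_mul_zVal hM q j ⟨0, hn _⟩ a.2)

end Equivariance

/-! ### The strata are orbits. -/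

section Orbits

variable {k K : Type*} [Field k] [Field K] [Algebra k K] {r : ℕ} {n : Fin r → ℕ}
variable {B : Splitting k n} {v : ∀ i, Fin (n i + 1) → k}

/-- In a Cox presentation on which the group acts through adapted matrices, the strata are
orbits. -/
lemma isOrbit_img {ι : Type} {m : ι → Type} {X : Set (MPt k K m)} (C : CoxPres (wt (n := n)) X)
    (hB : ∀ i, B i (v i) = Pi.single none 1) (hv : ∀ i, v i ≠ 0)
    {act : (∀ i, PGL(Fin (n i + 1), K)) → MPt k K m → MPt k K m}
    (hact : ∀ g ∈ G K v hv, ∀ q p, Lifts C.Θ q p → Lifts C.Θ (coxAct (adapted B g) q) (act g p))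
    {V : Set (CoxVar n → K)} (hV : V ⊆ C.Q) (hne : V.Nonempty)
    (hinv : ∀ M, IsAdapted M → ∀ q ∈ V, coxAct M q ∈ V) (htrans : TransitiveOn V) :
    IsOrbit (G K v hv) act (C.img V) := by
  obtain ⟨q₀, hq₀⟩ := hne
  obtain ⟨p₀, -, hp₀⟩ := C.exists_point q₀ (hV hq₀)
  refine ⟨p₀, Set.ext fun p => ⟨?_, ?_⟩⟩
  · rintro ⟨q, hqV, hq, h⟩
    obtain ⟨M, u, hM, hu⟩ := htrans q₀ hq₀ q hqV
    obtain ⟨g, hg, c, hc⟩ := exists_mem_G hB hv hM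
    have h1 := hact g hg q₀ p₀ hp₀
    rw [hc, coxAct_smul, hu] at h1
    exact ⟨g, hg, (C.lifts_tact (C.lifts_tact h u) _).unique h1⟩
  · rintro ⟨g, hg, rfl⟩
    have h1 := hinv _ (isAdapted_adapted hB hg) q₀ hq₀
    exact ⟨_, h1, hV h1, hact g hg q₀ p₀ hp₀⟩

lemma openStratum_nonempty (hn : ∀ i, 1 ≤ n i) : (openStratum K n).Nonempty :=
  ⟨fun _ => 1, one_ne_zero, fun i => ⟨⟨0, hn i⟩, one_ne_zero⟩⟩

open Classical in
lemma excStratum_nonempty (hn : ∀ i, 1 ≤ n i) : (excStratum K n).Nonempty :=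
  ⟨fun s => if s = CoxVar.e then 0 else 1, by simp,
    by simp, fun i => ⟨⟨0, hn i⟩, by simp⟩⟩

open Classical in
lemma lineStratum_nonempty (hn : ∀ i, 1 ≤ n i) (j : Fin r) : (lineStratum K n j).Nonempty := by
  refine ⟨fun s => if ∃ b, s = CoxVar.x j b then 0 else 1, fun b => ?_, ?_, ?_, fun l hl =>
    ⟨⟨0, hn l⟩, ?_⟩⟩
  · simp
  · simp
  · simp
  · have : ¬ ∃ b, CoxVar.x l ⟨0, hn l⟩ = CoxVar.x j b := by
      rintro ⟨b, hb⟩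
      rw [CoxVar.x.injEq] at hb
      exact hl hb.1
    dsimp only
    rw [if_neg this]
    exact one_ne_zero

/-- All components of ψ̂₀ share the factor `e ^ (r - 1)`, which disappears in the projective bundle.
-/
lemma prod_uVec_eq (hr : 1 ≤ r) (q : CoxVar n → K) (a : PlusIdx n) :
    ∏ i, uVec q i (a.1 i) = q CoxVar.e ^ (r - 1) * sVal q a := by
  rw [prod_uVec, sVal, facE]
  split_ifs with h
  · have hp : q CoxVar.e ^ r = q CoxVar.e ^ (r - 1) * q CoxVar.e := by
      rw [← pow_succ, Nat.sub_add_cancel hr]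
    rw [h, Finset.card_univ, Fintype.card_fin, hp]
    ring
  · have := (card_supp_iff a).2 h
    rw [one_mul, show a.supp.card = r - 1 by omega]

end Orbits

/-! ### Identities between degrees. -/

section Relations

variable {r : ℕ} {n : Fin r → ℕ}

lemma sum_degX_split (hn : ∀ i, 1 ≤ n i) : ∑ l : Fin r, degX l =
    ∑ i ∈ Finset.univ.filter (fun i => 2 ≤ n i), degX i + ∑ j : Lines n, degX j.1 := by
  rw [← Finset.sum_filter_add_sum_filter_not Finset.univ (fun i => 2 ≤ n i)]
  congr 1
  refine Finset.sum_subtype _ (fun i => ?_) degX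
  have := hn i
  rw [Finset.mem_filter, and_iff_right (Finset.mem_univ i)]
  omega

lemma degYp_y {i : Fin r} (hi : 2 ≤ n i) : degYp (n := n) (Sum.inl (Sum.inl i)) = degX i :=
  if_neg (by omega)

variable {A : Type*} [AddCommGroup A] (f : (Option (Fin r) → ℤ) ≃+ A)

lemma map_eq_map_add_sub (d e : Option (Fin r) → ℤ) : f d = f (d + e) - f e := by
  rw [map_add, add_sub_cancel_right]

lemma map_hyperplane_eq : f (degE r + ∑ l : Fin r, degX l) =
    ∑ i : Fin r, f (degX i + degE r) - ((r : ℤ) - 1) • f (degE r) := by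
  rw [← map_sum, ← map_zsmul, ← map_sub, Finset.sum_add_distrib, Finset.sum_const,
    Finset.card_univ, Fintype.card_fin, sub_smul, one_smul, natCast_zsmul]
  congr 1
  abel

lemma map_degE_eq (hn : ∀ i, 1 ≤ n i) : f (degE r) = f (degE r + ∑ l : Fin r, degX l) -
    ∑ i ∈ Finset.univ.filter (fun i => 2 ≤ n i), f (degX i) - ∑ j : Lines n, f (degX j.1) := by
  rw [← map_sum, ← map_sum, ← map_sub, ← map_sub, sum_degX_split hn]
  congr 1
  abel

end Relations

/-! ### Commutation with the projections. -/

section Diagram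

variable {k K : Type*} [Field k] [Field K] [Algebra k K] {r : ℕ} {n : Fin r → ℕ}
variable {B : Splitting k n} {v : ∀ i, Fin (n i + 1) → k}

lemma represents_psi0 {q : CoxVar n → K} {p : MPt k K (ytSpace n)} {p' : MPt k K (ypSpace n)}
    (h : Lifts (thetaYt B v) q p) (h' : Lifts (thetaYp k n) q p') {i : Fin r}
    (h0 : psi0 B (fst p) i ≠ 0) : Represents (psi0 B (fst p) i) (yPt p' i) := by
  obtain ⟨s, -, hs⟩ := exists_splitCoord h
  obtain ⟨b₀, -⟩ := Function.ne_iff.1 h0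
  -- For `n i = 1` the coordinate `yVal` is the constant `1`, so the value of `x i` is moved into
  -- the scalar.
  have h1 : psi0 B (fst p) i =
      (s i * (q CoxVar.e * if n i = 1 then q (CoxVar.x i b₀) else 1)) • yVal q i := by
    funext b
    refine (hs i (some b)).trans ?_
    change s i * (q CoxVar.e * q (CoxVar.x i b)) = _ * yVal q i b
    rw [yVal]
    split_ifs with hi
    · rw [fin_eq_of_line hi b b₀, mul_one]
    · rw [mul_one, mul_assoc]
  rw [h1] at h0 ⊢
  exact ((lifts_thetaYp_iff.1 h').1 i).smul fun hc => h0 (by rw [hc, zero_smul])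

lemma represents_psiHat0 (hr : 1 ≤ r) {q : CoxVar n → K} {p : MPt k K (ytSpace n)}
    {p' : MPt k K (ypSpace n)} (h : Lifts (thetaYt B v) q p) (h' : Lifts (thetaYp k n) q p')
    (h0 : psiHat0 B (fst p) ≠ 0) : Represents (psiHat0 B (fst p)) (sPt p') := by
  obtain ⟨s, -, hs⟩ := exists_splitCoord h
  have h1 : psiHat0 B (fst p) = ((∏ i, s i) * q CoxVar.e ^ (r - 1)) • sVal q := by
    funext a
    rw [psiHat0, Finset.prod_congr rfl fun i _ => hs i (a.1 i), Finset.prod_mul_distrib,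
      prod_uVec_eq hr, Pi.smul_apply, smul_eq_mul, mul_assoc]
  rw [h1] at h0 ⊢
  exact (lifts_thetaYp_iff.1 h').2.1.smul fun hc => h0 (by rw [hc, zero_smul])

end Diagram

end ToricLink

end

/-! ### Assembly of the theorem. -/

open ToricLink in
theorem theorem3p1 {k K : Type*} [Field k] [CharZero k] [Field K] [Algebra k K]
    [IsAlgClosure k K] (r : ℕ) (n : Fin r → ℕ) (hn : ∀ i, 1 ≤ n i) (hdim : 2 ≤ ∑ i, n i)
    (v : ∀ i, Fin (n i + 1) → k) (hv : ∀ i, v i ≠ 0)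
    (B : ToricLink.Splitting k n) (hB : ∀ i, B i (v i) = Pi.single none 1) :
    -- the small birational map, defined on the union of the orbits of codimension at most one
    ∃ ψ : ToricLink.SmallBirIso (ToricLink.Yt K v) (ToricLink.Yp k K n),
      ψ.dom = ToricLink.YtOpen K v hv ∪ ToricLink.ExcOpen K v hv ∪
        ⋃ i : ToricLink.Lines n, ToricLink.YtiOpen K v hv i ∧
      ψ.cod = ToricLink.YpOpen k K n ∪ ToricLink.YpEmptyOpen k K n ∪
        ⋃ i : ToricLink.Lines n, ToricLink.ExcPOpen k K n i ∧
      -- equivariance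
      ψ.IsEquivariant (ToricLink.G K v hv) ToricLink.actYt (ToricLink.actYp B) ∧
      -- the diagram commutes
      (∀ x : ψ.dom,
        (∀ i, ToricLink.psi0 B (ToricLink.fst x.1) i ≠ 0 →
          ToricLink.Represents (ToricLink.psi0 B (ToricLink.fst x.1) i)
            ((ψ.iso.toEquiv x).1 (Sum.inl (Sum.inl i)))) ∧
        (ToricLink.psiHat0 B (ToricLink.fst x.1) ≠ 0 →
          ToricLink.Represents (ToricLink.psiHat0 B (ToricLink.fst x.1))
            ((ψ.iso.toEquiv x).1 (Sum.inl (Sum.inr ()))))) ∧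
      -- isomorphisms of the orbits of codimension zero and one
      ψ.InducesIso (ToricLink.YtOpen K v hv) (ToricLink.YpOpen k K n) ∧
      ψ.InducesIso (ToricLink.ExcOpen K v hv) (ToricLink.YpEmptyOpen k K n) ∧
      (∀ i : ToricLink.Lines n,
        ψ.InducesIso (ToricLink.YtiOpen K v hv i) (ToricLink.ExcPOpen k K n i)) ∧
      (ToricLink.IsOrbit (ToricLink.G K v hv) ToricLink.actYt (ToricLink.YtOpen K v hv) ∧
        ToricLink.HasCodim (ToricLink.Yt K v) (ToricLink.YtOpen K v hv) 0) ∧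
      (ToricLink.IsOrbit (ToricLink.G K v hv) ToricLink.actYt (ToricLink.ExcOpen K v hv) ∧
        ToricLink.HasCodim (ToricLink.Yt K v) (ToricLink.ExcOpen K v hv) 1) ∧
      (∀ i : ToricLink.Lines n,
        ToricLink.IsOrbit (ToricLink.G K v hv) ToricLink.actYt (ToricLink.YtiOpen K v hv i) ∧
        ToricLink.HasCodim (ToricLink.Yt K v) (ToricLink.YtiOpen K v hv i) 1) ∧
      (ToricLink.IsOrbit (ToricLink.G K v hv) (ToricLink.actYp B) (ToricLink.YpOpen k K n) ∧
        ToricLink.HasCodim (ToricLink.Yp k K n) (ToricLink.YpOpen k K n) 0) ∧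
      (ToricLink.IsOrbit (ToricLink.G K v hv) (ToricLink.actYp B) (ToricLink.YpEmptyOpen k K n) ∧
        ToricLink.HasCodim (ToricLink.Yp k K n) (ToricLink.YpEmptyOpen k K n) 1) ∧
      (∀ i : ToricLink.Lines n,
        ToricLink.IsOrbit (ToricLink.G K v hv) (ToricLink.actYp B) (ToricLink.ExcPOpen k K n i) ∧
        ToricLink.HasCodim (ToricLink.Yp k K n) (ToricLink.ExcPOpen k K n i) 1) ∧
      -- the identification of the Picard groups, and the relations between the classes
      ∃ Φ : ToricLink.Pic (ToricLink.Yp k K n) ≃+ ToricLink.Pic (ToricLink.Yt K v),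
        (∀ c, ψ.PicCompat (Φ c) c) ∧
        ∃ (E : ToricLink.Pic (ToricLink.Yt K v))
          (e : ToricLink.Lines n → ToricLink.Pic (ToricLink.Yp k K n)),
          ToricLink.IsDivisorClass (ToricLink.Yt K v) (ToricLink.Exc K v hv) E ∧
          (∀ i, ToricLink.IsDivisorClass (ToricLink.Yp k K n) (ToricLink.ExcP k K n i) (e i)) ∧
          let H : Fin r → ToricLink.Pic (ToricLink.Yt K v) := fun i =>
            ToricLink.hyperplaneClass (ToricLink.Yt K v) (Sum.inl i)
          let h : ToricLink.Pic (ToricLink.Yp k K n) :=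
            ToricLink.hyperplaneClass (ToricLink.Yp k K n) (Sum.inl (Sum.inr ()))
          let h' : Fin r → ToricLink.Pic (ToricLink.Yp k K n) := fun i =>
            ToricLink.hyperplaneClass (ToricLink.Yp k K n) (Sum.inl (Sum.inl i))
          (∀ i, 2 ≤ n i → Φ (h' i) = H i - E) ∧
          (∀ i : ToricLink.Lines n, Φ (e i) = H i - E) ∧
          Φ h = ∑ i, H i - ((r : ℤ) - 1) • E ∧
          E = Φ h - ∑ i ∈ Finset.univ.filter (fun i => 2 ≤ n i), Φ (h' i) - ∑ i, Φ (e i) ∧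
          (∀ i, 2 ≤ n i → H i = Φ (h' i) + E) ∧
          (∀ i : ToricLink.Lines n, H i = Φ (e i) + E) := by
  have : IsAlgClosed K := IsAlgClosure.isAlgClosed k
  have : Infinite K := IsAlgClosed.instInfinite
  have hr : 1 ≤ r := by
    by_contra h
    obtain rfl : r = 0 := by omega
    simp at hdim
  set C := coxYt (K := K) B v hB hn hdim
  set C' := coxYp (K := K) k hn hdim
  have : ∀ j, Finite (ytSpace n j) := by
    rintro (i | u)
    · exact inferInstanceAs (Finite (Fin _))
    · exact inferInstanceAs (Finite (TensIdx n × TensIdx n))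
  have : ∀ j, Finite (ypSpace n j) := by
    rintro ((i | u) | j)
    · exact inferInstanceAs (Finite (Fin _))
    · exact inferInstanceAs (Finite (PlusIdx n))
    · exact inferInstanceAs (Finite {a : PlusIdx n // j.1 ∈ a.supp})
  have : Nonempty (CoxVar n) := ⟨CoxVar.e⟩
  have : Nonempty (Yt K v) := C.nonempty
  have : Nonempty (Yp k K n) := C'.nonempty
  have hVo := homOpen_bigStratum k K n
  have hQ : bigStratum K n ⊆ C.Q := bigStratum_subset_Yt hB hdim
  have hQ' : bigStratum K n ⊆ C'.Q := bigStratum_subset_Yp hn hdim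
  have hc := codimComplGeTwo_Yt (K := K) hB hn hdim
  have hc' := codimComplGeTwo_Yp k (K := K) hn hdim
  set ψ := C.smallBirIso C' hVo hQ hQ' hc hc'
  have hact : ∀ g ∈ G K v hv, ∀ q p, Lifts C.Θ q p →
      Lifts C.Θ (coxAct (adapted B g) q) (actYt g p) := fun g hg q p h => lifts_actYt hB hg h
  have hact' : ∀ g ∈ G K v hv, ∀ q p, Lifts C'.Θ q p →
      Lifts C'.Θ (coxAct (adapted B g) q) (actYp B g p) :=
    fun g hg q p h => lifts_actYp hn (isAdapted_adapted hB hg) h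
  -- From here on all strata are images of torus-invariant subsets of the common affine space.
  rw [YtOpen_eq hB hv hn hdim, ExcOpen_eq hB hv hn hdim, YpOpen_eq k hn hdim,
    YpEmptyOpen_eq k hn hdim]
  simp only [YtiOpen_eq hB hv hn hdim, ExcPOpen_eq k hn hdim]
  refine ⟨ψ, ?_, ?_, ?_, fun x => ⟨fun i h0 => ?_, fun h0 => ?_⟩,
    C.smallBirIso_inducesIso C' hVo hQ hQ' hc hc' (torusInvariant_openStratum K n)
      openStratum_subset,
    C.smallBirIso_inducesIso C' hVo hQ hQ' hc hc' (torusInvariant_excStratum K n)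
      excStratum_subset,
    fun j => C.smallBirIso_inducesIso C' hVo hQ hQ' hc hc' (torusInvariant_lineStratum K n j)
      (lineStratum_subset j),
    ⟨isOrbit_img C hB hv hact (openStratum_subset.trans hQ) (openStratum_nonempty hn)
      (fun M hM q hq => coxAct_mem_openStratum hM hq) transitiveOn_openStratum,
      hasCodim_openStratum C hn⟩,
    ⟨isOrbit_img C hB hv hact (excStratum_subset.trans hQ) (excStratum_nonempty hn)
      (fun M hM q hq => coxAct_mem_excStratum hM hq) transitiveOn_excStratum,
      hasCodim_excStratum C hn⟩,
    fun j => ⟨isOrbit_img C hB hv hact ((lineStratum_subset j).trans hQ)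
      (lineStratum_nonempty hn j) (fun M hM q hq => coxAct_mem_lineStratum hM hq)
      (transitiveOn_lineStratum j.1), hasCodim_lineStratum C hn j⟩,
    ⟨isOrbit_img C' hB hv hact' (openStratum_subset.trans hQ') (openStratum_nonempty hn)
      (fun M hM q hq => coxAct_mem_openStratum hM hq) transitiveOn_openStratum,
      hasCodim_openStratum C' hn⟩,
    ⟨isOrbit_img C' hB hv hact' (excStratum_subset.trans hQ') (excStratum_nonempty hn)
      (fun M hM q hq => coxAct_mem_excStratum hM hq) transitiveOn_excStratum,
      hasCodim_excStratum C' hn⟩,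
    fun j => ⟨isOrbit_img C' hB hv hact' ((lineStratum_subset j).trans hQ')
      (lineStratum_nonempty hn j) (fun M hM q hq => coxAct_mem_lineStratum hM hq)
      (transitiveOn_lineStratum j.1), hasCodim_lineStratum C' hn j⟩,
    -- Both Picard groups are the group of degrees, and `Φ` is the identity on degrees. The class E
    -- is the degree of `e`, and the class of the exceptional divisor over s_j is the degree of `x
    -- j`.
    C'.picEquiv.symm.trans C.picEquiv, fun c => ?_, C.picEquiv (degE r),
    fun j => C'.picEquiv (degX j.1), ?_, fun j => ?_, ?_⟩
  · change C.img (bigStratum K n) = _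
    rw [bigStratum_eq, C.img_union, C.img_union, C.img_iUnion]
  · change C'.img (bigStratum K n) = _
    rw [bigStratum_eq, C'.img_union, C'.img_union, C'.img_iUnion]
  -- The same Cox coordinates represent a point and its image, and the same matrices move them on
  -- both sides.
  · intro g hg x
    obtain ⟨q, hqV, hq, h⟩ := x.2
    have h1 := coxAct_mem_bigStratum (isAdapted_adapted hB hg) hqV
    have h2 := hact g hg q x.1 h
    have h3 : actYt g x.1 ∈ ψ.dom := ⟨_, h1, hQ h1, h2⟩
    exact ⟨h3, (C.lifts_smallBirIso C' hVo hQ hQ' hc hc' ⟨_, h3⟩ h1 h2).unique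
      (hact' g hg q _ (C.lifts_smallBirIso C' hVo hQ hQ' hc hc' x hqV h))⟩
  · obtain ⟨q, hqV, hq, h⟩ := x.2
    exact represents_psi0 h (C.lifts_smallBirIso C' hVo hQ hQ' hc hc' x hqV h) h0
  · obtain ⟨q, hqV, hq, h⟩ := x.2
    exact represents_psiHat0 hr h (C.lifts_smallBirIso C' hVo hQ hQ' hc hc' x hqV h) h0
  · obtain ⟨d, rfl⟩ := C'.picEquiv.surjective c
    rw [AddEquiv.trans_apply, AddEquiv.symm_apply_apply, CoxPres.picEquiv_apply,
      CoxPres.picEquiv_apply]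
    exact C.picCompat_bundle C' hVo hQ hQ' hc hc' d
  · rw [CoxPres.picEquiv_apply]
    refine CoxPres.isDivisorClass_bundle (hom_X (w := wt) CoxVar.e)
      (MvPolynomial.X_prime) fun x => ?_
    rw [MvPolynomial.aeval_X]
    exact mem_Exc_iff hB hv (C.lifts_lift x)
  · dsimp only
    rw [CoxPres.picEquiv_apply]
    refine CoxPres.isDivisorClass_bundle (hom_X (w := wt) (CoxVar.x j.1 ⟨0, hn _⟩))
      (MvPolynomial.X_prime) fun x => ?_
    rw [MvPolynomial.aeval_X]
    exact mem_ExcP_iff hn (C'.lifts_lift x) j _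
  · have hH : ∀ i, hyperplaneClass (Yt K v) (Sum.inl i) = C.picEquiv (degX i + degE r) :=
      fun i => CoxPres.hyperplaneClass_eq (C := C) (Sum.inl i)
    have hh : hyperplaneClass (Yp k K n) (Sum.inl (Sum.inr ())) =
        C'.picEquiv (degE r + ∑ l : Fin r, degX l) :=
      CoxPres.hyperplaneClass_eq (C := C') (Sum.inl (Sum.inr ()))
    have hy : ∀ i, 2 ≤ n i → hyperplaneClass (Yp k K n) (Sum.inl (Sum.inl i)) =
        C'.picEquiv (degX i) := fun i hi =>
      (CoxPres.hyperplaneClass_eq (C := C') (Sum.inl (Sum.inl i))).trans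
        (congrArg C'.picEquiv (degYp_y hi))
    have hΦ : ∀ d, (C'.picEquiv.symm.trans C.picEquiv) (C'.picEquiv d) = C.picEquiv d :=
      fun d => by rw [AddEquiv.trans_apply, AddEquiv.symm_apply_apply]
    have hy' : ∑ i ∈ Finset.univ.filter (fun i => 2 ≤ n i),
        (C'.picEquiv.symm.trans C.picEquiv) (hyperplaneClass (Yp k K n) (Sum.inl (Sum.inl i))) =
        ∑ i ∈ Finset.univ.filter (fun i => 2 ≤ n i), C.picEquiv (degX i) :=
      Finset.sum_congr rfl fun i hi => by rw [hy i (Finset.mem_filter.1 hi).2, hΦ]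
    refine ⟨fun i hi => ?_, fun j => ?_, ?_, ?_, fun i hi => ?_, fun j => ?_⟩
    · rw [hy i hi, hH, hΦ]
      exact map_eq_map_add_sub (A := Pic (Yt K v)) C.picEquiv _ _
    · rw [hH, hΦ]
      exact map_eq_map_add_sub (A := Pic (Yt K v)) C.picEquiv _ _
    · simp only [hH, hh, hΦ]
      exact map_hyperplane_eq (A := Pic (Yt K v)) C.picEquiv
    · rw [hy']
      simp only [hh, hΦ]
      exact map_degE_eq (A := Pic (Yt K v)) C.picEquiv hn
    · rw [hy i hi, hH, hΦ, map_add]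
    · rw [hH, hΦ, map_add]
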